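/- **Setting.** Let $(\Sigma,g)$ be a connected, geodesically complete smooth Riemannian manifold without boundary (Hausdorff, second countable) of dimension $n\ge 1$, $S\Sigma$ its unit tangent bundle and $\varphi^g$ its geodesic flow. Let $\Omega\subset\Sigma$ be a closed subset that is an $n$-dimensional submanifold with boundary, and let $n_x$ be the unit normal at $x\in\partial\Omega$ pointing towards $\Omega$. Put $\mathring M=\{(x,v)\in S\Sigma: x\notin\Omega\}$, $\partial_{\mathrm{in}}M=\{(x,v)\in S\Sigma: x\in\partial\Omega,\ g_x(v,n_x)>0\}$, $\partial_{\mathrm{out}}M=\{(x,v)\in S\Sigma: x\in\partial\Omega,\ g_x(v,n_x)<0\}$, and let $$M\setminus\partial_gM:=\mathring M\sqcup\partial_{\mathrm{in}}M\sqcup\partial_{\mathrm{out}}M ,$$ a submanifold with boundary of $S\Sigma$. The reflection $R(x,v)=(x,v')$, $v'=v-2g_x(v,n_x)n_x$, interchanges $\partial_{\mathrm{in}}M$ and $\partial_{\mathrm{out}}M$. *Billiard flow.* The non-grazing billiard trajectory of $z\in M\setminus\partial_gM$ follows the geodesic flow until it hits $\Omega$; it ceases to exist if it hits $\partial\Omega$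 tangentially, and otherwise it continues from the reflected vector. In detail, forward trajectories are finite concatenations of geodesic arcs which meet $\Omega$ at most in their end points, where an arc that is to start at a point $z\in\partial_{\mathrm{in}}M$ is started at $R(z)$ instead; at the time of hitting $\Omega$ the trajectory is at the (unreflected) end point of the arc. Backward trajectories are defined in the same way with $\partial_{\mathrm{in}}M$ and $\partial_{\mathrm{out}}M$ interchanged. This defines $\varphi:D\to M\setminus\partial_gM$, $(t,z)\mapsto\varphi_t(z)$, on a set $D\subset\mathbb R\times(M\setminus\partial_gM)$, with $\varphi_0=\mathrm{id}$. Let $C^\infty_{\mathrm{Bill}}(M\setminus\partial_gM)$ be the set of smooth $f:M\setminus\partial_gM\to\mathbb C$ for which $f\circ\varphi$ is smooth on $D$, and for such $f$ put $(\mathbf Pf)(z)=\frac{d}{dt}\big|_{t=0}f(\varphi_t(z))$. *Smooth model.* Let $(\mathcal M,\pi,\phi)$ be a smooth model of $\varphi$: a smooth manifold $\mathcal M$ of dimension $2n-1$, a smooth surjection $\pi:M\setminus\partial_gM\to\mathcal M$ such that $\mathcal D:=(\mathrm{id}_{\mathbb R}\times\pi)(D)$ is open in $\mathbb R\times\mathcal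 M$ and such that $\pi|_{\mathring M}$ is a diffeomorphism onto an open subset of $\mathcal M$, and a smooth flow $\phi:\mathcal D\to\mathcal M$ with $\phi_t(\pi(z))=\pi(\varphi_t(z))$ for all $(t,z)\in D$. *Bundle data.* Let $\widetilde{\mathcal E}\to M\setminus\partial_gM$ be a smooth complex vector bundle of rank $r$; let $\widetilde{\mathbb X}$ be a differential operator of order at most one acting on its smooth sections with $$\widetilde{\mathbb X}(f\sigma)=(\mathbf Pf)\,\sigma+f\,\widetilde{\mathbb X}\sigma\qquad\text{for all } f\in C^\infty_{\mathrm{Bill}}(M\setminus\partial_gM)\text{ and all smooth sections }\sigma ;$$ and let $\kappa:\widetilde{\mathcal E}|_{\partial_{\mathrm{in}}M}\to\widetilde{\mathcal E}|_{\partial_{\mathrm{out}}M}$ be a smooth vector bundle isomorphism covering $R$. *Parallel transport.* Let $\mathbb Y$ be a linear operator on the smooth sections of a bundle and $u$ a continuous curve in the total space over a curve $c$ in the base. Call $u$ parallel for $\mathbb Y$ if, for every time $s$ in the interior of its domain and every smooth section $\sigma$ with $\sigma(c(s))=u(s)$, one has $(\mathbb Y\sigma)(c(s))=\frac{d}{ds'}\big|_{s'=s}\big(\sigma(c(s'))-u(s')\big)$,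 the derivative being taken in a local trivialization. The billiard parallel transport $\widetilde\alpha_{z,t}:\widetilde{\mathcal E}_z\to\widetilde{\mathcal E}_{\varphi_t(z)}$, $(t,z)\in D$, is the composition of the parallel transports for $\widetilde{\mathbb X}$ along the geodesic arcs that form the trajectory from $z$ to $\varphi_t(z)$, where each reflection before an arc contributes the factor $\kappa$ if $t>0$ and $\kappa^{-1}$ if $t<0$. For a section $\sigma$ and $(-t,z)\in D$ put $$(\mathcal L_t\sigma)(z):=\big(\widetilde\alpha_{z,-t}\big)^{-1}\big(\sigma(\varphi_{-t}(z))\big)\in\widetilde{\mathcal E}_z .$$ A smooth section $\sigma$ is a *smooth billiard section* if $(t,z)\mapsto(\mathcal L_t\sigma)(z)$ is smooth on $\{(t,z):(-t,z)\in D\}$. These sections form a complex vector space $C^\infty_{\mathrm{Bill}}(M\setminus\partial_gM,\widetilde{\mathcal E})$. **Theorem.** For every $(t,z)\in D$ the billiard parallel transport $\widetilde\alpha_{z,t}$ is a well-defined linear isomorphism. There exist a smooth complex vector bundle $\mathcal E\to\mathcal M$ of rank $r$ and a smooth surjection $\Pi:\widetilde{\mathcal E}\to\mathcal E$ covering $\pi$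 that is a linear isomorphism on each fiber, as well as a linear isomorphism $$\Sigma_{\mathcal E}:C^\infty_{\mathrm{Bill}}(M\setminus\partial_gM,\widetilde{\mathcal E})\to C^\infty(\mathcal M,\mathcal E)$$ uniquely characterized by $\Sigma_{\mathcal E}(\sigma)\circ\pi=\Pi\circ\sigma$ for all smooth billiard sections $\sigma$. The operator $\widetilde{\mathbb X}$ preserves the space of smooth billiard sections, and $\mathbb X:=\Sigma_{\mathcal E}\circ\widetilde{\mathbb X}\circ\Sigma_{\mathcal E}^{-1}$ is a differential operator of order at most one on $C^\infty(\mathcal M,\mathcal E)$ with $\mathbb X(f\sigma)(p)=\frac{d}{dt}\big|_{t=0}f(\phi_t(p))\,\sigma(p)+f(p)\,(\mathbb X\sigma)(p)$ for all smooth $f:\mathcal M\to\mathbb C$. For every $(t,p)\in\mathcal D$ the parallel transport $\alpha_{p,t}:\mathcal E_p\to\mathcal E_{\phi_t(p)}$ for $\mathbb X$ along $s\mapsto\phi_s(p)$ is a well-defined linear isomorphism. If $(t,p)\in\mathcal D$ and $\phi_t(p)=p$, then there is $z\in M\setminus\partial_gM$ with $\pi(z)=p$, $(t,z)\in D$ and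 $\varphi_t(z)=z$, and for every such $z$ $$\operatorname{tr}\alpha_{p,t}=\operatorname{tr}\widetilde\alpha_{z,t} .$$ -/

import Mathlib

open scoped Manifold ContDiff Topology Bundle
open Bundle

noncomputable section

universe v

namespace Billiard

/-! ## Smooth maps on subsets of manifolds and smooth complex vector bundles -/

section Smooth

variable {EN HN N : Type*} [NormedAddCommGroup EN] [NormedSpace ℝ EN] [TopologicalSpace HN]
  [TopologicalSpace N] [ChartedSpace HN N]
  {EX HX X : Type*} [NormedAddCommGroup EX] [NormedSpace ℝ EX] [TopologicalSpace HX]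
  [TopologicalSpace X] [ChartedSpace HX X]

/-- Let `ι : B → N` be an injection of a set `B` into a smooth manifold `N`. The map `f : B → X` into
a manifold is smooth on `s ⊆ B` if, near each point of `s`, it is the restriction of a smooth map
defined on an open subset of `N`. This is the usual notion of smoothness when `ι` identifies `B` with
an embedded submanifold of `N`, possibly with boundary; for `B = N` and `ι = id` and `s` open it is
ordinary smoothness. -/
def SmoothOn (I : ModelWithCorners ℝ EN HN) (J : ModelWithCorners ℝ EX HX) {B : Type*}
    (ι : B → N) (f : B → X) (s : Set B) : Prop :=
  ∀ b ∈ s, ∃ U : Set N, IsOpen U ∧ ι b ∈ U ∧ ∃ G : N → X, ContMDiffOn I J ∞ G U ∧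
    ∀ b' ∈ s, ι b' ∈ U → G (ι b') = f b'

/-- Smooth complex valued functions. -/
def SmoothFun (I : ModelWithCorners ℝ EN HN) {B : Type*} (ι : B → N) : Type _ :=
  {f : B → ℂ // SmoothOn I 𝓘(ℝ, ℂ) ι f Set.univ}

/-- A smooth complex vector bundle of rank `r` over `B`, where `B` carries the smooth structure
of its image under `ι : B → N`: a topological complex vector bundle in which the coordinate changes
of the trivializations in the atlas are smooth. -/
structure SmoothBundle (I : ModelWithCorners ℝ EN HN) {B : Type*} [TopologicalSpace B]
    (ι : B → N) (r : ℕ) where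
  /-- The fibers. -/
  Fiber : B → Type v
  [addCommGroup : ∀ b, AddCommGroup (Fiber b)]
  [module : ∀ b, Module ℂ (Fiber b)]
  [topTotal : TopologicalSpace (TotalSpace (Fin r → ℂ) Fiber)]
  [topFiber : ∀ b, TopologicalSpace (Fiber b)]
  [fiberBundle : FiberBundle (Fin r → ℂ) Fiber]
  [vectorBundle : VectorBundle ℂ (Fin r → ℂ) Fiber]
  smooth_coordChange : ∀ (e e' : Trivialization (Fin r → ℂ) (π (Fin r → ℂ) Fiber))
    [MemTrivializationAtlas e] [MemTrivializationAtlas e'],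
    SmoothOn I 𝓘(ℝ, (Fin r → ℂ) →L[ℂ] (Fin r → ℂ)) ι
      (fun b => (e.coordChangeL ℂ e' b : (Fin r → ℂ) →L[ℂ] (Fin r → ℂ)))
      (e.baseSet ∩ e'.baseSet)

attribute [instance] SmoothBundle.addCommGroup SmoothBundle.module SmoothBundle.topTotal
  SmoothBundle.topFiber SmoothBundle.fiberBundle SmoothBundle.vectorBundle

variable {I : ModelWithCorners ℝ EN HN} {B : Type*} [TopologicalSpace B] {ι : B → N} {r : ℕ}

section Closure

variable {V : Type*} [NormedAddCommGroup V] [NormedSpace ℝ V] {A : Type*} {j : A → N} {s : Set A}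

lemma SmoothOn.zero : SmoothOn I 𝓘(ℝ, V) j (fun _ : A => (0 : V)) s := fun _ _ =>
  ⟨Set.univ, isOpen_univ, Set.mem_univ _, fun _ => 0, contMDiffOn_const, fun _ _ _ => rfl⟩

lemma SmoothOn.congr {f f' : A → V} (hf : SmoothOn I 𝓘(ℝ, V) j f s)
    (h : ∀ a ∈ s, f' a = f a) : SmoothOn I 𝓘(ℝ, V) j f' s := fun a ha => by
  obtain ⟨U, hU, haU, G, hG, hGf⟩ := hf a ha
  exact ⟨U, hU, haU, G, hG, fun b hb hbU => (hGf b hb hbU).trans (h b hb).symm⟩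

lemma SmoothOn.add {f f' : A → V} (hf : SmoothOn I 𝓘(ℝ, V) j f s)
    (hf' : SmoothOn I 𝓘(ℝ, V) j f' s) :
    SmoothOn I 𝓘(ℝ, V) j (fun a => f a + f' a) s := fun a ha => by
  obtain ⟨U, hU, haU, G, hG, hGf⟩ := hf a ha
  obtain ⟨U', hU', haU', G', hG', hGf'⟩ := hf' a ha
  refine ⟨U ∩ U', hU.inter hU', ⟨haU, haU'⟩, fun x => G x + G' x,
    (hG.mono Set.inter_subset_left).add (hG'.mono Set.inter_subset_right), fun b hb hbU => ?_⟩
  simp only [hGf b hb hbU.1, hGf' b hb hbU.2]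

lemma SmoothOn.smul [NormedSpace ℂ V] [IsScalarTower ℝ ℂ V] {f : A → ℂ} {f' : A → V}
    (hf : SmoothOn I 𝓘(ℝ, ℂ) j f s) (hf' : SmoothOn I 𝓘(ℝ, V) j f' s) :
    SmoothOn I 𝓘(ℝ, V) j (fun a => f a • f' a) s := fun a ha => by
  obtain ⟨U, hU, haU, G, hG, hGf⟩ := hf a ha
  obtain ⟨U', hU', haU', G', hG', hGf'⟩ := hf' a ha
  refine ⟨U ∩ U', hU.inter hU', ⟨haU, haU'⟩, fun x => G x • G' x, ?_, fun b hb hbU => ?_⟩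
  · have h : ContDiff ℝ ∞ (fun q : ℂ × V => q.1 • q.2) := contDiff_fst.smul contDiff_snd
    exact h.contMDiff.comp_contMDiffOn
      ((hG.mono Set.inter_subset_left).prodMk_space (hG'.mono Set.inter_subset_right))
  · simp only [hGf b hb hbU.1, hGf' b hb hbU.2]

lemma SmoothOn.const (c : V) : SmoothOn I 𝓘(ℝ, V) j (fun _ : A => c) s := fun _ _ =>
  ⟨Set.univ, isOpen_univ, Set.mem_univ _, fun _ => c, contMDiffOn_const, fun _ _ _ => rfl⟩

lemma SmoothOn.mono {f : A → V} {s' : Set A} (hf : SmoothOn I 𝓘(ℝ, V) j f s) (h : s' ⊆ s) :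
    SmoothOn I 𝓘(ℝ, V) j f s' := fun a ha => by
  obtain ⟨U, hU, haU, G, hG, hGf⟩ := hf a (h ha)
  exact ⟨U, hU, haU, G, hG, fun b hb hbU => hGf b (h hb) hbU⟩

end Closure

namespace SmoothBundle

variable (𝓔 : SmoothBundle I ι r)

/-- The typical fiber is `ℂ ^ r`; this is the total space of the bundle. -/
abbrev Total : Type _ := TotalSpace (Fin r → ℂ) 𝓔.Fiber

/-- Smoothness of a family `a ↦ τ a ∈ 𝓔_{f a}` of vectors, parametrized by a set `s` of parameters
`a`, along a base map `f`: in every trivialization the components are smooth. -/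
def SmoothFamily {EP HP P A : Type*} [NormedAddCommGroup EP] [NormedSpace ℝ EP]
    [TopologicalSpace HP] [TopologicalSpace P] [ChartedSpace HP P]
    (IP : ModelWithCorners ℝ EP HP) (j : A → P) (f : A → B) (τ : ∀ a, 𝓔.Fiber (f a))
    (s : Set A) : Prop :=
  ∀ (e : Trivialization (Fin r → ℂ) (π (Fin r → ℂ) 𝓔.Fiber)) [MemTrivializationAtlas e],
    SmoothOn IP 𝓘(ℝ, Fin r → ℂ) j (fun a => (e ⟨f a, τ a⟩).2) {a ∈ s | f a ∈ e.baseSet}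

lemma SmoothFamily.zero {EP HP P A : Type*} [NormedAddCommGroup EP] [NormedSpace ℝ EP]
    [TopologicalSpace HP] [TopologicalSpace P] [ChartedSpace HP P]
    {IP : ModelWithCorners ℝ EP HP} {j : A → P} {f : A → B} {s : Set A} :
    𝓔.SmoothFamily IP j f (fun _ => 0) s := fun e _ =>
  SmoothOn.zero.congr fun _ ha => (e.linear ℂ ha.2).map_zero

lemma SmoothFamily.add {EP HP P A : Type*} [NormedAddCommGroup EP] [NormedSpace ℝ EP]
    [TopologicalSpace HP] [TopologicalSpace P] [ChartedSpace HP P]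
    {IP : ModelWithCorners ℝ EP HP} {j : A → P} {f : A → B} {s : Set A}
    {τ τ' : ∀ a, 𝓔.Fiber (f a)} (h : 𝓔.SmoothFamily IP j f τ s)
    (h' : 𝓔.SmoothFamily IP j f τ' s) : 𝓔.SmoothFamily IP j f (fun a => τ a + τ' a) s :=
  fun e _ => ((h e).add (h' e)).congr fun _ ha => (e.linear ℂ ha.2).map_add _ _

lemma SmoothFamily.smul {EP HP P A : Type*} [NormedAddCommGroup EP] [NormedSpace ℝ EP]
    [TopologicalSpace HP] [TopologicalSpace P] [ChartedSpace HP P]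
    {IP : ModelWithCorners ℝ EP HP} {j : A → P} {f : A → B} {s : Set A} {h : A → ℂ}
    {τ : ∀ a, 𝓔.Fiber (f a)} (hh : SmoothOn IP 𝓘(ℝ, ℂ) j h s)
    (hτ : 𝓔.SmoothFamily IP j f τ s) : 𝓔.SmoothFamily IP j f (fun a => h a • τ a) s :=
  fun e _ => ((hh.mono fun _ ha => ha.1).smul (hτ e)).congr
    fun _ ha => (e.linear ℂ ha.2).map_smul _ _

/-- The complex vector space of smooth sections. -/
def sections : Submodule ℂ (∀ b, 𝓔.Fiber b) where
  carrier := {σ | 𝓔.SmoothFamily I ι (fun b => b) σ Set.univ}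
  zero_mem' := SmoothFamily.zero 𝓔
  add_mem' h h' := SmoothFamily.add 𝓔 h h'
  smul_mem' c _ h := SmoothFamily.smul 𝓔 (SmoothOn.const c) h

/-- Multiplication of smooth sections by smooth functions. -/
def fmul (f : SmoothFun I ι) (σ : 𝓔.sections) : 𝓔.sections :=
  ⟨fun b => f.1 b • σ.1 b, SmoothFamily.smul 𝓔 f.2 σ.2⟩

/-- A linear operator on smooth sections is a differential operator of order at most one if its
double commutators with multiplication operators vanish. -/
def IsFirstOrder (D : 𝓔.sections →ₗ[ℂ] 𝓔.sections) : Prop :=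
  ∀ (f h : SmoothFun I ι) (σ : 𝓔.sections),
    D (𝓔.fmul f (𝓔.fmul h σ)) - 𝓔.fmul f (D (𝓔.fmul h σ)) - 𝓔.fmul h (D (𝓔.fmul f σ))
      + 𝓔.fmul h (𝓔.fmul f (D σ)) = 0

/-- Smoothness of a family of linear isomorphisms `T a : 𝓔_{i a} → 𝓔'_{f a}`, as a map of total
spaces: the parameter `a` runs through a set with the smooth structure induced by `j`. -/
def IsSmoothBundleMap {EB' HB' N' B' : Type*} [NormedAddCommGroup EB'] [NormedSpace ℝ EB']
    [TopologicalSpace HB'] [TopologicalSpace N'] [ChartedSpace HB' N'] [TopologicalSpace B']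
    {I' : ModelWithCorners ℝ EB' HB'} {ι' : B' → N'} (𝓔' : SmoothBundle I' ι' r)
    {EP HP P A : Type*} [NormedAddCommGroup EP] [NormedSpace ℝ EP]
    [TopologicalSpace HP] [TopologicalSpace P] [ChartedSpace HP P]
    (IP : ModelWithCorners ℝ EP HP) (j : A → P) (i : A → B) (f : A → B')
    (T : ∀ a, 𝓔.Fiber (i a) ≃ₗ[ℂ] 𝓔'.Fiber (f a)) : Prop :=
  ∀ (e : Trivialization (Fin r → ℂ) (π (Fin r → ℂ) 𝓔.Fiber)) [MemTrivializationAtlas e],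
    𝓔'.SmoothFamily (IP.prod 𝓘(ℝ, Fin r → ℂ)) (Prod.map j (id : (Fin r → ℂ) → (Fin r → ℂ)))
      (fun x => f x.1) (fun x => T x.1 (e.symm (i x.1) x.2)) {x | i x.1 ∈ e.baseSet}

/-- `IsParallel D u t`: the curve `u` in the total space, considered for times between `0` and `t`,
is parallel with respect to `D`, i.e. it is continuous and for each time `s` strictly between `0` and
`t` and each smooth section `σ` with `σ = u s` at the base point `c s` of `u s`, the derivative
at time `s` of the difference `σ (c ·) - u`, which vanishes at time `s`, equals `(D σ) (c s)`. -/
def IsParallel (D : 𝓔.sections →ₗ[ℂ] 𝓔.sections) (u : ℝ → 𝓔.Total) (t : ℝ) : Prop :=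
  ContinuousOn u (Set.uIcc 0 t) ∧
  ∀ s ∈ Set.uIoo 0 t, ∀ σ : 𝓔.sections, σ.1 (u s).proj = (u s).snd →
    HasDerivAt
      (fun s' => (trivializationAt (Fin r → ℂ) 𝓔.Fiber (u s).proj
          ⟨(u s').proj, σ.1 (u s').proj⟩).2
        - (trivializationAt (Fin r → ℂ) 𝓔.Fiber (u s).proj (u s')).2)
      (trivializationAt (Fin r → ℂ) 𝓔.Fiber (u s).proj ⟨(u s).proj, (D σ).1 (u s).proj⟩).2 s

/-- `A` is the parallel transport along the curve `c` from `b` at time `0` to `b'` at time `t`. -/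
def IsParallelTransport (D : 𝓔.sections →ₗ[ℂ] 𝓔.sections) (c : ℝ → N) (t : ℝ) (b b' : B)
    (A : 𝓔.Fiber b ≃ₗ[ℂ] 𝓔.Fiber b') : Prop :=
  ∀ v, ∃ u : ℝ → 𝓔.Total, 𝓔.IsParallel D u t ∧ (∀ s ∈ Set.uIcc 0 t, ι (u s).proj = c s) ∧
    u 0 = ⟨b, v⟩ ∧ u t = ⟨b', A v⟩

end SmoothBundle

end Smooth

/-! ## The geodesic flow -/

section Geodesic

variable {n : ℕ} {Q : Type*} [TopologicalSpace Q] [ChartedSpace (EuclideanSpace ℝ (Fin n)) Q]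
  [IsManifold (𝓡 n) ∞ Q]

variable (Q) in
/-- Smooth Riemannian metrics on `Q`. -/
abbrev Metric : Type _ :=
  Bundle.ContMDiffRiemannianMetric (𝓡 n) ∞ (EuclideanSpace ℝ (Fin n))
    (fun x : Q => TangentSpace (𝓡 n) x)

variable (g : Metric (n := n) Q)

/-- The matrix of the metric, as a bilinear form depending on the coordinates `y`, in the preferred
chart around `x`. -/
def metricInChart (x : Q) (y : EuclideanSpace ℝ (Fin n)) :
    EuclideanSpace ℝ (Fin n) →L[ℝ] EuclideanSpace ℝ (Fin n) →L[ℝ] ℝ :=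
  let z := (extChartAt (𝓡 n) x).symm y
  let L : EuclideanSpace ℝ (Fin n) →L[ℝ] EuclideanSpace ℝ (Fin n) :=
    (trivializationAt (EuclideanSpace ℝ (Fin n)) (TangentSpace (𝓡 n)) x).symmL ℝ z
  let G : EuclideanSpace ℝ (Fin n) →L[ℝ] EuclideanSpace ℝ (Fin n) →L[ℝ] ℝ := g.inner z
  G.bilinearComp L L

lemma metricInChart_apply (x : Q) (y u w : EuclideanSpace ℝ (Fin n)) :
    metricInChart g x y u w = g.inner ((extChartAt (𝓡 n) x).symm y)
      ((trivializationAt (EuclideanSpace ℝ (Fin n)) (TangentSpace (𝓡 n)) x).symmL ℝ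
        ((extChartAt (𝓡 n) x).symm y) u)
      ((trivializationAt (EuclideanSpace ℝ (Fin n)) (TangentSpace (𝓡 n)) x).symmL ℝ
        ((extChartAt (𝓡 n) x).symm y) w) := rfl

/-- The geodesic equation `g (a, w) + (∂_v g)(v, w) - (∂_w g)(v, v) / 2 = 0` for all `w` in
the preferred chart around the base point: `a` is the second derivative in this chart of the geodesic
with initial velocity `p = (x, v)`. -/
def IsGeodesicAcceleration (p : TangentBundle (𝓡 n) Q) (a : EuclideanSpace ℝ (Fin n)) : Prop :=
  let v : EuclideanSpace ℝ (Fin n) := p.snd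
  let dg := fderiv ℝ (metricInChart g p.proj) (extChartAt (𝓡 n) p.proj p.proj)
  ∀ w : EuclideanSpace ℝ (Fin n),
    metricInChart g p.proj (extChartAt (𝓡 n) p.proj p.proj) a w + dg v v w - dg w v v / 2 = 0

/-- The geodesic vector field on the tangent bundle. The tangent space of the tangent bundle at
`p = (x, v)` is `E × E` through the preferred chart of the base around `x`. -/
def geodesicField (p : TangentBundle (𝓡 n) Q) : TangentSpace (𝓡 n).tangent p :=
  ((p.snd, Classical.epsilon (IsGeodesicAcceleration g p)) :
    EuclideanSpace ℝ (Fin n) × EuclideanSpace ℝ (Fin n))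

/-- Geodesic completeness: every geodesic is defined for all times. -/
def IsGeodesicallyComplete : Prop :=
  ∀ p : TangentBundle (𝓡 n) Q, ∃ c : ℝ → TangentBundle (𝓡 n) Q,
    c 0 = p ∧ IsMIntegralCurve (I := (𝓡 n).tangent) c (geodesicField g)

open Classical in
/-- The geodesic flow on the tangent bundle. -/
def geodesicFlow (t : ℝ) (p : TangentBundle (𝓡 n) Q) : TangentBundle (𝓡 n) Q :=
  if h : ∃ c : ℝ → TangentBundle (𝓡 n) Q,
    c 0 = p ∧ IsMIntegralCurve (I := (𝓡 n).tangent) c (geodesicField g)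
  then h.choose t else p

/-! ## Obstacles and the phase space -/

/-- `ρ` is a local defining function of the obstacle set `Ω` at its boundary point `x`. -/
def IsBoundaryDefiningAt (n : ℕ) {Q : Type*} [TopologicalSpace Q]
    [ChartedSpace (EuclideanSpace ℝ (Fin n)) Q] (Ω : Set Q) (x : Q) (ρ : Q → ℝ) : Prop :=
  ρ x = 0 ∧ mfderiv (𝓡 n) 𝓘(ℝ, ℝ) ρ x ≠ 0 ∧
  ∃ U : Set Q, IsOpen U ∧ x ∈ U ∧ ContMDiffOn (𝓡 n) 𝓘(ℝ, ℝ) ∞ ρ U ∧ ∀ y ∈ U, y ∈ Ω ↔ 0 ≤ ρ y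

/-- `Ω` is a closed subset which is a submanifold with boundary of full dimension. Its manifold
boundary and manifold interior are then its topological frontier and interior. -/
def IsObstacle (n : ℕ) {Q : Type*} [TopologicalSpace Q]
    [ChartedSpace (EuclideanSpace ℝ (Fin n)) Q] (Ω : Set Q) : Prop :=
  IsClosed Ω ∧ ∀ x ∈ frontier Ω, ∃ ρ : Q → ℝ, IsBoundaryDefiningAt n Ω x ρ

variable (Ω : Set Q)

/-- `ν` is the unit normal vector of the boundary of `Ω` at `x` pointing towards `Ω`. -/
def IsInwardNormal (x : Q) (ν : TangentSpace (𝓡 n) x) : Prop :=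
  g.inner x ν ν = 1 ∧ ∃ ρ : Q → ℝ, IsBoundaryDefiningAt n Ω x ρ ∧
    ∃ c : ℝ, 0 < c ∧ ∀ w : TangentSpace (𝓡 n) x,
      (mfderiv (𝓡 n) 𝓘(ℝ, ℝ) ρ x w : ℝ) = c * g.inner x ν w

open Classical in
/-- The inward unit normal vector; it is `0` by convention away from the boundary of `Ω`. -/
def inwardNormal (x : Q) : TangentSpace (𝓡 n) x :=
  if h : ∃ ν, IsInwardNormal g Ω x ν then h.choose else 0

/-- The normal component of a tangent vector. -/
def normalPart (p : TangentBundle (𝓡 n) Q) : ℝ :=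
  g.inner p.proj p.snd (inwardNormal g Ω p.proj)

/-- The non-grazing part of the phase space: unit tangent vectors that are based
either in the complement of `Ω` or on the boundary of `Ω` and, in the latter case, are not tangent
to the boundary. -/
def PhaseSpace : Type _ :=
  {p : TangentBundle (𝓡 n) Q // g.inner p.proj p.snd p.snd = 1 ∧
    (p.proj ∉ Ω ∨ (p.proj ∈ frontier Ω ∧ normalPart g Ω p ≠ 0))}

instance : TopologicalSpace (PhaseSpace g Ω) :=
  inferInstanceAs (TopologicalSpace (Subtype _))

/-- The inclusion of the non-grazing phase space into the tangent bundle. Smoothness on the phase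
space, a submanifold with boundary of the unit tangent bundle, is always understood with respect
to it. -/
def incl (z : PhaseSpace g Ω) : TangentBundle (𝓡 n) Q := z.1

/-- The interior of the phase space. -/
def interiorPart : Set (PhaseSpace g Ω) := {z | (incl g Ω z).proj ∉ Ω}

/-- The inward boundary. -/
def inwardBoundary : Set (PhaseSpace g Ω) :=
  {z | (incl g Ω z).proj ∈ frontier Ω ∧ 0 < normalPart g Ω (incl g Ω z)}

/-- The outward boundary. -/
def outwardBoundary : Set (PhaseSpace g Ω) :=
  {z | (incl g Ω z).proj ∈ frontier Ω ∧ normalPart g Ω (incl g Ω z) < 0}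

/-- The reflection `v' = v - 2 g (v, ν) ν` at the boundary of `Ω`. -/
def reflectVector (p : TangentBundle (𝓡 n) Q) : TangentBundle (𝓡 n) Q :=
  ⟨p.proj, p.snd - (2 * normalPart g Ω p) • inwardNormal g Ω p.proj⟩

lemma inwardNormal_eq_zero_or (x : Q) :
    inwardNormal g Ω x = 0 ∨ g.inner x (inwardNormal g Ω x) (inwardNormal g Ω x) = 1 := by
  unfold inwardNormal
  split_ifs with h
  · exact Or.inr h.choose_spec.1
  · exact Or.inl rfl

lemma normalPart_reflectVector (p : TangentBundle (𝓡 n) Q) :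
    normalPart g Ω (reflectVector g Ω p) = - normalPart g Ω p := by
  have key : ∀ v ν : TangentSpace (𝓡 n) p.proj, (ν = 0 ∨ g.inner p.proj ν ν = 1) →
      g.inner p.proj (v - (2 * g.inner p.proj v ν) • ν) ν = - g.inner p.proj v ν := by
    rintro v ν (rfl | h)
    · simp
    · rw [map_sub, map_smul, sub_apply, smul_apply, h, smul_eq_mul]
      ring
  exact key _ _ (inwardNormal_eq_zero_or g Ω p.proj)

lemma inner_reflectVector (p : TangentBundle (𝓡 n) Q) :
    g.inner (reflectVector g Ω p).proj (reflectVector g Ω p).snd (reflectVector g Ω p).snd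
      = g.inner p.proj p.snd p.snd := by
  have key : ∀ v ν : TangentSpace (𝓡 n) p.proj, (ν = 0 ∨ g.inner p.proj ν ν = 1) →
      g.inner p.proj (v - (2 * g.inner p.proj v ν) • ν) (v - (2 * g.inner p.proj v ν) • ν)
        = g.inner p.proj v v := by
    rintro v ν (rfl | h)
    · simp
    · have hl : ∀ (c : ℝ) (w : TangentSpace (𝓡 n) p.proj), g.inner p.proj (v - c • ν) w
          = g.inner p.proj v w - c * g.inner p.proj ν w := fun c w => by
        rw [map_sub, map_smul, sub_apply, smul_apply, smul_eq_mul]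
      rw [hl, map_sub, map_smul, map_sub, map_smul, h, g.symm p.proj ν v]
      simp only [smul_eq_mul]
      ring
  exact key _ _ (inwardNormal_eq_zero_or g Ω p.proj)

/-- The reflection on the non-grazing phase space: it interchanges the inward and
the outward boundary and is the identity on the interior. -/
def reflection (z : PhaseSpace g Ω) : PhaseSpace g Ω :=
  ⟨reflectVector g Ω z.1, by
    rw [inner_reflectVector]
    exact ⟨z.2.1, z.2.2.imp id fun h =>
      ⟨h.1, by rw [normalPart_reflectVector]; exact neg_ne_zero.2 h.2⟩⟩⟩

/-! ## The non-grazing billiard flow -/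

open Classical in
/-- The phase space point from which the trajectory through `z` is continued by the geodesic flow,
forward in time for `0 < s` and backward in time for `s < 0`. -/
def launch (s : ℝ) (z : PhaseSpace g Ω) : PhaseSpace g Ω :=
  if (0 < s ∧ z ∈ inwardBoundary g Ω) ∨ (s < 0 ∧ z ∈ outwardBoundary g Ω)
  then reflection g Ω z else z

/-- The geodesic with initial velocity `z` arrives at `w` at time `s ≠ 0` and does not meet `Ω` at
any time strictly between `0` and `s`. -/
def IsArc (s : ℝ) (z w : PhaseSpace g Ω) : Prop :=
  s ≠ 0 ∧ geodesicFlow g s (incl g Ω z) = incl g Ω w ∧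
    ∀ r ∈ Set.uIoo 0 s, (geodesicFlow g r (incl g Ω z)).proj ∉ Ω

/-- `FlowsTo g Ω t z w`: the non-grazing billiard trajectory of `z` exists up to time `t` and is at
`w` at time `t`. It is a finite concatenation of geodesic arcs, all run through in the direction of
the sign of `t`, which do not meet `Ω` except at their end points, with a reflection at `Ω` where
an arc ends at `Ω` and the trajectory is continued; an arc never ends at a grazing vector. -/
inductive FlowsTo : ℝ → PhaseSpace g Ω → PhaseSpace g Ω → Prop
  | refl (z : PhaseSpace g Ω) : FlowsTo 0 z z
  | step {t s : ℝ} {z w w' : PhaseSpace g Ω} (h : FlowsTo t z w) (hs : 0 ≤ t * s)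
      (harc : IsArc g Ω s (launch g Ω s w) w') : FlowsTo (t + s) z w'

/-- The domain of the non-grazing billiard flow. -/
def flowDomain : Set (ℝ × PhaseSpace g Ω) := {x | ∃ w, FlowsTo g Ω x.1 x.2 w}

open Classical in
/-- The non-grazing billiard flow (with a junk value outside of its domain). -/
def flow (t : ℝ) (z : PhaseSpace g Ω) : PhaseSpace g Ω :=
  if h : ∃ w, FlowsTo g Ω t z w then h.choose else z

/-- Smooth billiard functions on the non-grazing phase space. -/
def IsBilliardFun (f : SmoothFun (𝓡 n).tangent (incl g Ω)) : Prop :=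
  SmoothOn (𝓘(ℝ, ℝ).prod (𝓡 n).tangent) 𝓘(ℝ, ℂ) (Prod.map id (incl g Ω))
    (fun x : ℝ × PhaseSpace g Ω => f.1 (flow g Ω x.1 x.2)) (flowDomain g Ω)

/-- The billiard generator. -/
def generator (f : PhaseSpace g Ω → ℂ) (z : PhaseSpace g Ω) : ℂ :=
  deriv (fun t : ℝ => f (flow g Ω t z)) 0

/-! ## Smooth models of the billiard flow -/

/-- A smooth model of the non-grazing billiard flow: a smooth surjection `proj` of the non-grazing
phase space onto a manifold, restricting to a diffeomorphism from the interior onto an open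
subset, and a smooth flow on the image of the domain of the billiard flow, which is required to be
open, such that `proj` intertwines the two flows. -/
structure SmoothModel (𝓜 : Type*) [TopologicalSpace 𝓜]
    [ChartedSpace (EuclideanSpace ℝ (Fin (2 * n - 1))) 𝓜] where
  /-- The projection. -/
  proj : PhaseSpace g Ω → 𝓜
  /-- The model flow (only its values on the domain below matter). -/
  flow : ℝ → 𝓜 → 𝓜
  smooth_proj : SmoothOn (𝓡 n).tangent (𝓡 (2 * n - 1)) (incl g Ω) proj Set.univ
  surjective_proj : Function.Surjective proj
  isOpen_domain : IsOpen (Prod.map (id : ℝ → ℝ) proj '' flowDomain g Ω)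
  smooth_flow : ContMDiffOn (𝓘(ℝ, ℝ).prod (𝓡 (2 * n - 1))) (𝓡 (2 * n - 1)) ∞
    (fun x : ℝ × 𝓜 => flow x.1 x.2) (Prod.map (id : ℝ → ℝ) proj '' flowDomain g Ω)
  flow_zero : ∀ p, flow 0 p = p
  flow_add : ∀ t t' p, (t, p) ∈ Prod.map (id : ℝ → ℝ) proj '' flowDomain g Ω →
    (t', flow t p) ∈ Prod.map (id : ℝ → ℝ) proj '' flowDomain g Ω →
    (t + t', p) ∈ Prod.map (id : ℝ → ℝ) proj '' flowDomain g Ω →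
    flow t' (flow t p) = flow (t + t') p
  isOpen_interior : IsOpen (proj '' interiorPart g Ω)
  diffeo_interior : ∃ inv : 𝓜 → TangentBundle (𝓡 n) Q,
    ContMDiffOn (𝓡 (2 * n - 1)) (𝓡 n).tangent ∞ inv (proj '' interiorPart g Ω) ∧
    ∀ z ∈ interiorPart g Ω, inv (proj z) = incl g Ω z
  intertwines : ∀ x ∈ flowDomain g Ω,
    flow x.1 (proj x.2) = proj (Billiard.flow g Ω x.1 x.2)

/-- The domain of the model flow. -/
def SmoothModel.domain {g : Metric (n := n) Q} {Ω : Set Q} {𝓜 : Type*} [TopologicalSpace 𝓜]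
    [ChartedSpace (EuclideanSpace ℝ (Fin (2 * n - 1))) 𝓜] (mod : SmoothModel g Ω 𝓜) :
    Set (ℝ × 𝓜) :=
  Prod.map id mod.proj '' flowDomain g Ω

/-! ## Bundles over the non-grazing phase space -/

/-- Smooth complex vector bundles over the non-grazing phase space. -/
abbrev PhaseBundle (r : ℕ) : Type _ := SmoothBundle (𝓡 n).tangent (incl g Ω) r

variable {g Ω} {r : ℕ} (𝓔 : PhaseBundle g Ω r)

/-- The Leibniz rule with respect to the billiard generator. -/
def SatisfiesBilliardLeibniz (D : 𝓔.sections →ₗ[ℂ] 𝓔.sections) : Prop :=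
  ∀ f : SmoothFun (𝓡 n).tangent (incl g Ω), IsBilliardFun g Ω f →
    ∀ (σ : 𝓔.sections) (z : PhaseSpace g Ω),
      (D (𝓔.fmul f σ)).1 z = generator g Ω f.1 z • σ.1 z + f.1 z • (D σ).1 z

/-- A smooth isomorphism, covering the reflection, from the restriction of the bundle to the inward
boundary onto its restriction to the outward boundary. -/
structure Gluing where
  /-- The isomorphisms between fibers. -/
  map : ∀ z : inwardBoundary g Ω, 𝓔.Fiber z.1 ≃ₗ[ℂ] 𝓔.Fiber (reflection g Ω z.1)
  smooth : 𝓔.IsSmoothBundleMap 𝓔 (𝓡 n).tangent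
    (fun z : inwardBoundary g Ω => incl g Ω z.1) (fun z => z.1) (fun z => reflection g Ω z.1) map

variable {𝓔} (D : 𝓔.sections →ₗ[ℂ] 𝓔.sections) (κ : Gluing 𝓔)

/-- The isomorphism between fibers accompanying the passage from `w` to `launch g Ω s w`. -/
inductive IsLaunch (s : ℝ) :
    (w w' : PhaseSpace g Ω) → (𝓔.Fiber w ≃ₗ[ℂ] 𝓔.Fiber w') → Prop
  | stay (w : PhaseSpace g Ω) (h : 0 < s → w ∉ inwardBoundary g Ω)
      (h' : s < 0 → w ∉ outwardBoundary g Ω) : IsLaunch s w w (LinearEquiv.refl ℂ _)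
  | forward (w : inwardBoundary g Ω) (h : 0 < s) :
      IsLaunch s w.1 (reflection g Ω w.1) (κ.map w)
  | backward (w : inwardBoundary g Ω) (h : s < 0) :
      IsLaunch s (reflection g Ω w.1) w.1 (κ.map w).symm

/-- `BilliardTransport D κ t z w A`: `A` is the billiard parallel transport along the billiard
trajectory from `z` to `w` over the time `t`, namely the composition of the parallel transports
with respect to `D` along the geodesic arcs of the trajectory and of the gluing isomorphisms at
the reflections. -/
inductive BilliardTransport :
    ℝ → (z w : PhaseSpace g Ω) → (𝓔.Fiber z ≃ₗ[ℂ] 𝓔.Fiber w) → Prop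
  | refl (z : PhaseSpace g Ω) : BilliardTransport 0 z z (LinearEquiv.refl ℂ _)
  | step {t s : ℝ} {z w w₀ w' : PhaseSpace g Ω} {A : 𝓔.Fiber z ≃ₗ[ℂ] 𝓔.Fiber w}
      {K : 𝓔.Fiber w ≃ₗ[ℂ] 𝓔.Fiber w₀} {T : 𝓔.Fiber w₀ ≃ₗ[ℂ] 𝓔.Fiber w'}
      (h : BilliardTransport t z w A) (hs : 0 ≤ t * s) (hK : IsLaunch κ s w w₀ K)
      (harc : IsArc g Ω s w₀ w')
      (hT : 𝓔.IsParallelTransport D (fun r => geodesicFlow g r (incl g Ω w₀)) s w₀ w' T) :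
      BilliardTransport (t + s) z w' (A.trans (K.trans T))

open Classical in
/-- The billiard transfer operator `(L_t σ) (z) ∈ 𝓔_z`, for `(-t, z)` in the flow domain: the vector
which the billiard parallel transport along the trajectory of `z` carries to the value of `σ` at the
billiard flow `φ_{-t}(z)` of `z`. -/
def transferOperator (t : ℝ) (σ : ∀ z, 𝓔.Fiber z) (z : PhaseSpace g Ω) : 𝓔.Fiber z :=
  if h : ∃ A, BilliardTransport D κ (-t) z (flow g Ω (-t) z) A
  then h.choose.symm (σ (flow g Ω (-t) z)) else 0

lemma transferOperator_add (t : ℝ) (σ τ : ∀ z, 𝓔.Fiber z) (z : PhaseSpace g Ω) :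
    transferOperator D κ t (σ + τ) z = transferOperator D κ t σ z + transferOperator D κ t τ z := by
  unfold transferOperator
  split_ifs <;> simp

lemma transferOperator_smul (t : ℝ) (c : ℂ) (σ : ∀ z, 𝓔.Fiber z) (z : PhaseSpace g Ω) :
    transferOperator D κ t (c • σ) z = c • transferOperator D κ t σ z := by
  unfold transferOperator
  split_ifs <;> simp

/-- The space of smooth billiard sections: the smooth sections `σ` for which `(L_t σ) (z)` depends
smoothly on all `(t, z)` for which it is defined. -/
def billiardSections : Submodule ℂ 𝓔.sections where
  carrier := {σ | 𝓔.SmoothFamily (𝓘(ℝ, ℝ).prod (𝓡 n).tangent) (Prod.map (id : ℝ → ℝ) (incl g Ω))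
    Prod.snd (fun x => transferOperator D κ x.1 σ.1 x.2) {x | (-x.1, x.2) ∈ flowDomain g Ω}}
  zero_mem' := by
    have h : ∀ x : ℝ × PhaseSpace g Ω,
        transferOperator D κ x.1 (0 : 𝓔.sections).1 x.2 = 0 := fun x => by
      simpa using transferOperator_smul D κ x.1 0 (0 : 𝓔.sections).1 x.2
    simp only [Set.mem_ofPred_eq, h]
    exact SmoothBundle.SmoothFamily.zero 𝓔
  add_mem' {σ τ} hσ hτ := by
    have h : ∀ x : ℝ × PhaseSpace g Ω, transferOperator D κ x.1 (σ + τ).1 x.2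
        = transferOperator D κ x.1 σ.1 x.2 + transferOperator D κ x.1 τ.1 x.2 := fun x =>
      transferOperator_add D κ x.1 σ.1 τ.1 x.2
    simp only [Set.mem_ofPred_eq, h]
    exact SmoothBundle.SmoothFamily.add 𝓔 hσ hτ
  smul_mem' c σ hσ := by
    have h : ∀ x : ℝ × PhaseSpace g Ω, transferOperator D κ x.1 (c • σ).1 x.2
        = c • transferOperator D κ x.1 σ.1 x.2 := fun x =>
      transferOperator_smul D κ x.1 c σ.1 x.2
    simp only [Set.mem_ofPred_eq, h]
    exact SmoothBundle.SmoothFamily.smul 𝓔 (SmoothOn.const c) hσ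

/-- The operator `S ∘ D ∘ S⁻¹` induced on the sections of a bundle by an identification `S` of
the space of smooth billiard sections with the space of smooth sections of this bundle. -/
def inducedOperator {D : 𝓔.sections →ₗ[ℂ] 𝓔.sections} {κ : Gluing 𝓔}
    {𝓜 : Type*} [TopologicalSpace 𝓜] [ChartedSpace (EuclideanSpace ℝ (Fin (2 * n - 1))) 𝓜]
    {𝓕 : SmoothBundle (𝓡 (2 * n - 1)) (id : 𝓜 → 𝓜) r}
    (S : billiardSections D κ ≃ₗ[ℂ] 𝓕.sections)
    (hD : ∀ σ ∈ billiardSections D κ, D σ ∈ billiardSections D κ) :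
    𝓕.sections →ₗ[ℂ] 𝓕.sections :=
  S.toLinearMap ∘ₗ D.restrict hD ∘ₗ S.symm.toLinearMap

end Geodesic

end Billiard

end

open scoped Manifold ContDiff Topology Bundle
open Bundle

noncomputable section

namespace Billiard

-- The mechanism is a supply of local frames of `𝓔` that are parallel for `D` along geodesics and
-- compatible with the gluing `κ`. They are defined over the full preimages of small open subsets of
-- `𝓜`. Everything about the bundle on `𝓜` is then read off in these frames.
--
-- Local form of the operator. The Leibniz rule is assumed for billiard functions only. Pullbacks of
-- smooth functions on `𝓜` are billiard functions, and over the interior the projection is a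
-- diffeomorphism. Cutoffs therefore give the rule at interior points for every smooth function, and
-- continuity along short trajectories extends it to the boundary (`leibniz`). Consequently `D` is
-- local and in a trivialization is the derivative along geodesics plus a smooth matrix `C`
-- (`exists_connectionForm`). Solving `T' = T C` along the geodesic flow, with prescribed invertible
-- values on a transversal hypersurface, gives parallel frames near any point (`exists_localFrame`).
-- Smoothness of the geodesic flow and of linear equations with parameters is the input here.
--
-- Frames across a reflection. The fibers of the projection are the orbits of the reflection
-- (`proj_reflection`, `eq_or_eq_reflection`), and points over a small neighbourhood of the image of
-- `z` lie near `z` or near its reflection (`exists_isOpen_preimage_subset`). The boundary is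
-- transversal to the geodesic flow at non-grazing vectors, so frames may be prescribed on it. Near
-- the outward vector the boundary value is the identity, near the inward vector it is the matrix of
-- `κ`. The two pieces form a frame that respects the gluing (`exists_frame`).
--
-- The bundle. The change between two frames is invariant under reflection and constant along
-- geodesics. It therefore descends to a function on `𝓜` that is constant along the model flow, and
-- a short flow into the interior, where the projection is a diffeomorphism, shows that it is smooth
-- (`contMDiffOn_change`). These functions are the transition functions of the new bundle.
--
-- Parallel transport. In frames, parallel means having locally constant components, both for `D`
-- along arcs and for the induced operator along the model flow. Compatibility with `κ` makes
-- reflections invisible in the model. Both transports thus lift one and the same notion of flat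
-- curve (`trans_of_billiardTransport`, `trans_eq`), and over a closed orbit the fiber isomorphism
-- conjugates one into the other, so that the traces agree.
--
-- Sections. For `t ≠ 0` the transferred section has the same image in the model at `z` and at its
-- reflection; letting `t` tend to 0, a billiard section descends. Its smoothness at `q` is seen by
-- evaluating the transferred section at the interior point to which a short flow takes `q`
-- (`modelSection_mem_sections`). Conversely, sections on `𝓜` pull back to billiard sections, since
-- transport is locally a smooth matrix (`exists_trans_matrix`). In frames `D` acts on billiard
-- sections as the derivative along the model flow (`map_operator`). This gives invariance under
-- `D`, the Leibniz rule and order at most one.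

attribute [local instance] instTopologicalSpaceTangentBundle

/-! ### Smooth dependence of solutions of ordinary differential equations on initial data -/

section SmoothODE

universe u

/-- Near a point with invertible derivative a smooth map has a smooth local inverse. -/
lemma exists_smooth_localInverse {E F : Type*} [NormedAddCommGroup E] [NormedSpace ℝ E]
    [CompleteSpace E] [NormedAddCommGroup F] [NormedSpace ℝ F] {G : E → F} {U : Set E} {a : E}
    (hU : IsOpen U) (ha : a ∈ U) (hG : ContDiffOn ℝ ∞ G U) (L : E ≃L[ℝ] F)
    (hL : HasFDerivAt G (L : E →L[ℝ] F) a) :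
    ∃ (V : Set F) (U' : Set E) (H : F → E), IsOpen V ∧ G a ∈ V ∧ IsOpen U' ∧ a ∈ U' ∧ U' ⊆ U ∧
      ContDiffOn ℝ ∞ H V ∧ (∀ x ∈ U', G x ∈ V ∧ H (G x) = x) ∧ ∀ y ∈ V, H y ∈ U' ∧ G (H y) = y := by
  have hGa : ContDiffAt ℝ ∞ G a := hG.contDiffAt (hU.mem_nhds ha)
  have h0 : (∞ : WithTop ℕ∞) ≠ 0 := by simp
  let Φ := hGa.toOpenPartialHomeomorph G hL h0
  have hΦ : ∀ x : E, Φ x = G x := fun x => rfl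
  have haΦ : a ∈ Φ.source := hGa.mem_toOpenPartialHomeomorph_source hL h0
  have hcont : ContinuousOn (fderiv ℝ G) U := hG.continuousOn_fderiv_of_isOpen hU (by simp)
  -- The inverse is smooth at an image point if the derivative is invertible at its preimage. This
  -- is an open condition, so the source is shrunk to where it holds.
  let S : Set E := U ∩ fderiv ℝ G ⁻¹' Set.range ((↑) : (E ≃L[ℝ] F) → E →L[ℝ] F)
  have hS : IsOpen S := hcont.isOpen_inter_preimage hU (ContinuousLinearEquiv.isOpen (𝕜 := ℝ))
  have haS : a ∈ S := ⟨ha, L, hL.fderiv.symm⟩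
  have hU' : IsOpen (Φ.source ∩ S) := Φ.open_source.inter hS
  refine ⟨Φ.target ∩ Φ.symm ⁻¹' (Φ.source ∩ S), Φ.source ∩ S, Φ.symm,
    Φ.symm.isOpen_inter_preimage hU', ?_, hU', ⟨haΦ, haS⟩, fun x hx => hx.2.1, ?_, ?_, ?_⟩
  · exact ⟨Φ.map_source haΦ, by
      rw [Set.mem_preimage, ← hΦ, Φ.left_inv haΦ]; exact ⟨haΦ, haS⟩⟩
  · intro y hy
    obtain ⟨L', hL'⟩ := hy.2.2.2
    have hd : ContDiffAt ℝ ∞ G (Φ.symm y) := hG.contDiffAt (hU.mem_nhds hy.2.2.1)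
    have hd' : HasFDerivAt Φ (L' : E →L[ℝ] F) (Φ.symm y) := by
      rw [hL']
      exact (hd.differentiableAt (by simp)).hasFDerivAt
    exact (Φ.contDiffAt_symm hy.1 hd' hd).contDiffWithinAt
  · intro x hx
    refine ⟨⟨Φ.map_source hx.1, ?_⟩, Φ.left_inv hx.1⟩
    rwa [Set.mem_preimage, ← hΦ, Φ.left_inv hx.1]
  · intro y hy
    exact ⟨hy.2, Φ.right_inv hy.1⟩

section Nemytskii

variable {K : Type} [TopologicalSpace K] [CompactSpace K]

set_option synthInstance.maxHeartbeats 200000 in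
/-- Pointwise application of a continuous family of continuous linear maps. -/
def pointwiseApply (K : Type) [TopologicalSpace K] [CompactSpace K] (E F : Type*)
    [NormedAddCommGroup E] [NormedSpace ℝ E] [NormedAddCommGroup F] [NormedSpace ℝ F] :
    C(K, E →L[ℝ] F) →L[ℝ] C(K, E) →L[ℝ] C(K, F) :=
  LinearMap.mkContinuous₂
    (LinearMap.mk₂ ℝ (fun (A : C(K, E →L[ℝ] F)) (h : C(K, E)) =>
        (⟨fun s => A s (h s), A.continuous.clm_apply h.continuous⟩ : C(K, F)))
      (fun _ _ _ => by ext; simp) (fun _ _ _ => by ext; simp)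
      (fun _ _ _ => by ext; simp) (fun _ _ _ => by ext; simp)) 1 (fun A h => by
    rw [one_mul]
    refine (ContinuousMap.norm_le _ (by positivity)).2 fun s => ?_
    exact ((A s).le_opNorm _).trans
      (mul_le_mul (A.norm_coe_le_norm s) (h.norm_coe_le_norm s) (by positivity) (by positivity)))

set_option synthInstance.maxHeartbeats 200000 in
-- The mean value inequality at each parameter bounds the remainder by the oscillation of `f'`.
-- Compactness of the range of `γ` makes this oscillation uniformly small, which is what the sup
-- norm needs.
lemma hasFDerivAt_comp_continuousMap {E F : Type*}
    [NormedAddCommGroup E] [NormedSpace ℝ E] [NormedAddCommGroup F] [NormedSpace ℝ F]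
    (f : C(E, F)) (f' : C(E, E →L[ℝ] F)) (hf : ∀ x, HasFDerivAt f (f' x) x) (γ : C(K, E)) :
    HasFDerivAt (fun γ : C(K, E) => f.comp γ) (pointwiseApply K E F (f'.comp γ)) γ := by
  rw [hasFDerivAt_iff_isLittleO_nhds_zero, Asymptotics.isLittleO_iff]
  intro ε hε
  have hK : IsCompact (Set.range γ) := isCompact_range γ.continuous
  have hu := hK.uniformContinuousAt_of_continuousAt f' (fun a _ => f'.continuous.continuousAt)
    (Metric.dist_mem_uniformity hε)
  obtain ⟨δ, hδ, hδ'⟩ := Metric.mem_uniformity_dist.1 hu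
  filter_upwards [Metric.ball_mem_nhds (0 : C(K, E)) hδ] with h hh
  rw [mem_ball_zero_iff] at hh
  refine (ContinuousMap.norm_le _ (by positivity)).2 fun s => ?_
  have hs : ‖h s‖ < δ := (h.norm_coe_le_norm s).trans_lt hh
  have key := (convex_ball (γ s) δ).norm_image_sub_le_of_norm_hasFDerivWithin_le'
    (f := f) (f' := f') (φ := f' (γ s)) (C := ε) (x := γ s) (y := γ s + h s)
    (fun x _ => (hf x).hasFDerivWithinAt)
    (fun x hx => by
      have := hδ' (a := γ s) (b := x) (by rwa [dist_comm]) ⟨s, rfl⟩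
      rw [Set.mem_ofPred_eq, dist_comm, dist_eq_norm] at this
      exact this.le)
    (Metric.mem_ball_self hδ) (by simpa [Metric.mem_ball, dist_eq_norm] using hs)
  rw [add_sub_cancel_left] at key
  refine le_trans ?_ (key.trans (mul_le_mul_of_nonneg_left (h.norm_coe_le_norm s) hε.le))
  exact le_of_eq rfl

set_option synthInstance.maxHeartbeats 200000 in
-- Induction on the order: the derivative at `γ` is a fixed continuous linear map applied to `f' ∘
-- γ`, and this is again a superposition operator, with values in a larger target. Hence the target
-- space varies in the induction.
lemma contDiff_comp_continuousMap {E : Type u} [NormedAddCommGroup E] [NormedSpace ℝ E] (n : ℕ) :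
    ∀ {F : Type u} [NormedAddCommGroup F] [NormedSpace ℝ F] (f : C(E, F)), ContDiff ℝ n f →
      ContDiff ℝ n (fun γ : C(K, E) => f.comp γ) := by
  induction n with
  | zero =>
    intro F _ _ f _
    exact contDiff_zero.2 f.continuous_postcomp
  | succ n ih =>
    intro F _ _ f hf
    rw [Nat.cast_succ, contDiff_succ_iff_hasFDerivAt] at hf ⊢
    obtain ⟨f', hf', hff'⟩ := hf
    refine ⟨fun γ => pointwiseApply K E F ((⟨f', hf'.continuous⟩ : C(E, E →L[ℝ] F)).comp γ), ?_, ?_⟩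
    · exact (pointwiseApply K E F).contDiff.comp (ih ⟨f', hf'.continuous⟩ hf')
    · exact fun γ => hasFDerivAt_comp_continuousMap f ⟨f', hf'.continuous⟩ hff' γ

end Nemytskii

section Flow

variable {E : Type u} [NormedAddCommGroup E] [NormedSpace ℝ E]

/-- Integration from `0` of continuous curves parametrized by the unit interval. -/
def integrate [CompleteSpace E] : C(unitInterval, E) →L[ℝ] C(unitInterval, E) :=
  LinearMap.mkContinuous
    { toFun := fun γ => ⟨fun s => ∫ r in (0 : ℝ)..s, γ (Set.projIcc 0 1 zero_le_one r), by
        have : Continuous fun x : ℝ => ∫ r in (0 : ℝ)..x, γ (Set.projIcc 0 1 zero_le_one r) :=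
          intervalIntegral.continuous_primitive (fun a b =>
            (γ.continuous.comp continuous_projIcc).intervalIntegrable _ _) 0
        exact this.comp continuous_subtype_val⟩
      map_add' := fun γ γ' => by
        ext s
        simp only [ContinuousMap.add_apply, ContinuousMap.coe_mk]
        exact intervalIntegral.integral_add
          ((γ.continuous.comp continuous_projIcc).intervalIntegrable _ _)
          ((γ'.continuous.comp continuous_projIcc).intervalIntegrable _ _)
      map_smul' := fun c γ => by
        ext s
        simp }
    1 (fun γ => by
      rw [one_mul]
      refine (ContinuousMap.norm_le _ (by positivity)).2 fun s => ?_
      refine (intervalIntegral.norm_integral_le_of_norm_le_const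
        (fun r _ => γ.norm_coe_le_norm _)).trans ?_
      rw [sub_zero, abs_of_nonneg s.2.1]
      exact mul_le_of_le_one_right (norm_nonneg _) s.2.2)

lemma integrate_apply [CompleteSpace E] (γ : C(unitInterval, E)) (s : unitInterval) :
    integrate γ s = ∫ r in (0 : ℝ)..s, γ (Set.projIcc 0 1 zero_le_one r) := rfl

/-- The shear `(a, b, c) ↦ (a, b, c - A b - a z)`. -/
def shear {Z : Type*} [NormedAddCommGroup Z] [NormedSpace ℝ Z] (A : E →L[ℝ] Z) (z : Z) :
    (ℝ × E × Z) ≃L[ℝ] (ℝ × E × Z) :=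
  let P₁ : (ℝ × E × Z) →L[ℝ] ℝ := ContinuousLinearMap.fst ℝ _ _
  let P₂ : (ℝ × E × Z) →L[ℝ] E :=
    (ContinuousLinearMap.fst ℝ _ _).comp (ContinuousLinearMap.snd ℝ _ _)
  let P₃ : (ℝ × E × Z) →L[ℝ] Z :=
    (ContinuousLinearMap.snd ℝ _ _).comp (ContinuousLinearMap.snd ℝ _ _)
  ContinuousLinearEquiv.equivOfInverse
    (P₁.prod (P₂.prod (P₃ - A.comp P₂ - P₁.smulRight z)))
    (P₁.prod (P₂.prod (P₃ + A.comp P₂ + P₁.smulRight z)))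
    (fun q => Prod.ext rfl (Prod.ext rfl (by
      change q.2.2 - A q.2.1 - q.1 • z + A q.2.1 + q.1 • z = q.2.2; abel)))
    (fun q => Prod.ext rfl (Prod.ext rfl (by
      change q.2.2 + A q.2.1 + q.1 • z - A q.2.1 - q.1 • z = q.2.2; abel)))

/-- The local flow of a globally Lipschitz smooth vector field depends smoothly on all variables:
solutions are the values at `1` of the fixed points `γ = x + t ∫ f (γ)`, which depend smoothly on
`(t, x)` by the inverse function theorem. -/
lemma exists_smooth_evaluation [CompleteSpace E] {f : E → E} (hf : ContDiff ℝ ∞ f) {K : NNReal}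
    (hK : LipschitzWith K f) (x₀ : E) :
    ∃ (W : Set (ℝ × E)) (S : ℝ × E → E), IsOpen W ∧ ((0 : ℝ), x₀) ∈ W ∧ ContDiffOn ℝ ∞ S W ∧
      ∀ (t : ℝ) (x : E) (c : ℝ → E), (t, x) ∈ W → c 0 = x →
        (∀ r ∈ Set.Icc (0 : ℝ) 1, HasDerivAt c (f (c (r * t))) (r * t)) → c t = S (t, x) := by
  let N : C(unitInterval, E) → C(unitInterval, E) := fun γ => (⟨f, hf.continuous⟩ : C(E, E)).comp γ
  have hN : ContDiff ℝ ∞ N := contDiff_infty.2 fun n =>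
    contDiff_comp_continuousMap n _ (hf.of_le (by exact_mod_cast le_top))
  let cst : E →L[ℝ] C(unitInterval, E) := ContinuousLinearMap.const ℝ unitInterval
  let X := ℝ × E × C(unitInterval, E)
  -- Time and initial value are carried along, so that local invertibility of `G` solves the fixed
  -- point equation with parameters. At time 0 the integral enters the derivative only through the
  -- variation of time, and the derivative is a shear.
  let G : X → X := fun q => (q.1, q.2.1, q.2.2 - cst q.2.1 - q.1 • integrate (N q.2.2))
  have hG : ContDiff ℝ ∞ G := by
    refine contDiff_fst.prodMk ((contDiff_fst.comp contDiff_snd).prodMk ?_)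
    refine ((contDiff_snd.comp contDiff_snd).sub
      (cst.contDiff.comp (contDiff_fst.comp contDiff_snd))).sub ?_
    exact contDiff_fst.smul (integrate.contDiff.comp (hN.comp (contDiff_snd.comp contDiff_snd)))
  let q₀ : X := (0, x₀, cst x₀)
  let I₀ := integrate (N (cst x₀))
  have hL : HasFDerivAt G (shear cst I₀ : X →L[ℝ] X) q₀ := by
    have h1 : HasFDerivAt (fun q : X => q.1) (ContinuousLinearMap.fst ℝ _ _) q₀ := hasFDerivAt_fst
    have h2 : HasFDerivAt (fun q : X => q.2.1) ((ContinuousLinearMap.fst ℝ E _).comp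
      (ContinuousLinearMap.snd ℝ ℝ (E × C(unitInterval, E)))) q₀ :=
      ContinuousLinearMap.hasFDerivAt (𝕜 := ℝ) ((ContinuousLinearMap.fst ℝ E _).comp
        (ContinuousLinearMap.snd ℝ ℝ (E × C(unitInterval, E))))
    have h3 : HasFDerivAt (fun q : X => q.2.2) ((ContinuousLinearMap.snd ℝ E _).comp
      (ContinuousLinearMap.snd ℝ ℝ (E × C(unitInterval, E)))) q₀ :=
      ContinuousLinearMap.hasFDerivAt (𝕜 := ℝ) ((ContinuousLinearMap.snd ℝ E _).comp
        (ContinuousLinearMap.snd ℝ ℝ (E × C(unitInterval, E))))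
    have hNd : HasFDerivAt N (fderiv ℝ N q₀.2.2) q₀.2.2 :=
      ((hN.differentiable (by simp)) _).hasFDerivAt
    have h4 := HasFDerivAt.comp (g := integrate (E := E)) q₀
      (integrate (E := E)).hasFDerivAt (hNd.comp q₀ h3)
    have h6 := h1.prodMk (h2.prodMk ((h3.sub (cst.hasFDerivAt.comp q₀ h2)).sub (h1.smul h4)))
    refine h6.congr_fderiv (ContinuousLinearMap.ext fun q => ?_)
    refine Prod.ext rfl (Prod.ext rfl ?_)
    change q.2.2 - cst q.2.1 - ((0 : ℝ) • _ + q.1 • I₀) = q.2.2 - cst q.2.1 - q.1 • I₀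
    rw [zero_smul, zero_add]
  obtain ⟨V, U', H, hV, hqV, hU', hqU', -, hH, hH1, hH2⟩ :=
    exists_smooth_localInverse isOpen_univ (Set.mem_univ q₀) hG.contDiffOn (shear cst I₀) hL
  have hj : Continuous fun p : ℝ × E => ((p.1, p.2, 0) : X) := by fun_prop
  have hjs : ContDiff ℝ ∞ fun p : ℝ × E => ((p.1, p.2, 0) : X) :=
    contDiff_fst.prodMk (contDiff_snd.prodMk contDiff_const)
  have hGq : G q₀ = ((0 : ℝ), x₀, 0) := by simp [G, q₀]
  let ev : C(unitInterval, E) →L[ℝ] E := ContinuousMap.evalCLM ℝ 1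
  refine ⟨(fun p : ℝ × E => ((p.1, p.2, 0) : X)) ⁻¹' V, fun p => ev (H (p.1, p.2, 0)).2.2,
    hV.preimage hj, by simpa [hGq] using hqV, ?_, ?_⟩
  · refine ev.contDiff.comp_contDiffOn ((contDiff_snd.comp contDiff_snd).comp_contDiffOn ?_)
    exact hH.comp hjs.contDiffOn fun p hp => hp
  · intro t x c hW hc0 hc
    have hGH := (hH2 _ hW).2
    set q := H (t, x, 0) with hq
    have e1 : q.1 = t := congrArg (fun y : X => y.1) hGH
    have e2 : q.2.1 = x := congrArg (fun y : X => y.2.1) hGH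
    have e3 : q.2.2 - cst q.2.1 - q.1 • integrate (N q.2.2) = 0 :=
      congrArg (fun y : X => y.2.2) hGH
    rw [e1, e2, sub_sub, sub_eq_zero] at e3
    set γ := q.2.2 with hγ
    -- The fixed point lives on the unit interval only; its right hand side extends it to the real
    -- line, where two-sided derivatives make sense at the end points as well.
    let β : ℝ → E := fun r => x + t • ∫ s in (0 : ℝ)..r, f (γ (Set.projIcc 0 1 zero_le_one s))
    have hβγ : ∀ r (hr : r ∈ Set.Icc (0 : ℝ) 1), β r = γ ⟨r, hr⟩ := fun r hr => by
      have := congrArg (fun F : C(unitInterval, E) => F ⟨r, hr⟩) e3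
      simp only [ContinuousMap.add_apply, ContinuousMap.smul_apply, integrate_apply] at this
      rw [this]
      rfl
    have hcontI : Continuous fun s : ℝ => f (γ (Set.projIcc 0 1 zero_le_one s)) :=
      hf.continuous.comp (γ.continuous.comp continuous_projIcc)
    have hβ : ∀ r ∈ Set.Icc (0 : ℝ) 1, HasDerivAt β (t • f (β r)) r := fun r hr => by
      rw [hβγ r hr]
      have h := ((hcontI.integral_hasStrictDerivAt 0 r).hasDerivAt.const_smul t).const_add x
      rw [Set.projIcc_of_mem zero_le_one hr] at h
      exact h
    have hα : ∀ r ∈ Set.Icc (0 : ℝ) 1, HasDerivAt (fun r => c (r * t)) (t • f (c (r * t))) r :=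
      fun r hr => (hc r hr).scomp r (by simpa using (hasDerivAt_id r).mul_const t)
    -- Both curves solve the rescaled equation `y' = t • f y` on the unit interval with the same
    -- initial value.
    have heq := ODE_solution_unique (v := fun _ y => t • f y) (K := ‖t‖₊ * K)
      (f := fun r => c (r * t)) (g := β) (a := 0) (b := 1)
      (fun r => (lipschitzWith_smul t).comp hK)
      (fun r hr => (hα r hr).continuousAt.continuousWithinAt)
      (fun r hr => (hα r (Set.Ico_subset_Icc_self hr)).hasDerivWithinAt)
      (fun r hr => (hβ r hr).continuousAt.continuousWithinAt)
      (fun r hr => (hβ r (Set.Ico_subset_Icc_self hr)).hasDerivWithinAt)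
      (by simp [β, hc0])
    have h1 := heq (Set.right_mem_Icc.2 zero_le_one)
    simp only [one_mul] at h1
    rw [h1, hβγ 1 (Set.right_mem_Icc.2 zero_le_one)]
    rfl

/-- A smooth vector field on an open subset of a finite dimensional space has a smooth local flow. -/
theorem exists_smooth_localFlow [FiniteDimensional ℝ E] {f : E → E} {U : Set E} {x₀ : E}
    (hU : IsOpen U) (hx₀ : x₀ ∈ U) (hf : ContDiffOn ℝ ∞ f U) :
    ∃ (ε : ℝ) (V : Set E) (S : ℝ × E → E), 0 < ε ∧ IsOpen V ∧ x₀ ∈ V ∧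
      ContDiffOn ℝ ∞ S (Set.Ioo (-ε) ε ×ˢ V) ∧
      ∀ x ∈ V, S (0, x) = x ∧ ∀ t ∈ Set.Ioo (-ε) ε, S (t, x) ∈ U ∧
        HasDerivAt (fun s => S (s, x)) (f (S (t, x))) t := by
  have : CompleteSpace E := FiniteDimensional.complete ℝ E
  obtain ⟨R, hR, hRU⟩ := Metric.isOpen_iff.1 hU x₀ hx₀
  -- Cutting the field off makes it smooth with compact support, hence globally Lipschitz. It stays
  -- unchanged on the ball of radius `R / 4`, to which solutions are confined below.
  let χ : ContDiffBump x₀ := ⟨R / 4, R / 2, by positivity, by linarith⟩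
  have hχU : tsupport χ ⊆ U := by
    rw [χ.tsupport_eq]
    exact (Metric.closedBall_subset_ball (by simp only [χ]; linarith)).trans hRU
  let F : E → E := fun x => χ x • f x
  have hF : ContDiff ℝ ∞ F := by
    rw [contDiff_iff_contDiffAt]
    intro x
    by_cases hx : x ∈ U
    · exact χ.contDiffAt.smul (hf.contDiffAt (hU.mem_nhds hx))
    · have h0 : F =ᶠ[𝓝 x] fun _ => 0 := by
        filter_upwards [(isClosed_tsupport χ).isOpen_compl.mem_nhds fun h => hx (hχU h)] with y hy
        simp only [F, image_eq_zero_of_notMem_tsupport hy, zero_smul]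
      exact contDiffAt_const.congr_of_eventuallyEq h0
  have hFc : HasCompactSupport F := χ.hasCompactSupport.smul_right
  obtain ⟨K, hK⟩ := hF.lipschitzWith_of_hasCompactSupport hFc (by simp)
  obtain ⟨W, S, hW, hxW, hS, hSW⟩ := exists_smooth_evaluation hF hK x₀
  -- Existence, for a time uniform over a ball of initial values, comes from Picard–Lindelöf; `S`
  -- only identifies these solutions and supplies smoothness.
  obtain ⟨r, hr, ε, hε, hα⟩ :=
    (hF.contDiffAt.of_le (by simp)).exists_forall_mem_closedBall_exists_eq_forall_mem_Ioo_hasDerivAt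
      (x₀ := x₀) 0
  simp only [zero_sub, zero_add] at hα
  have hSα : ∀ x ∈ Metric.closedBall x₀ r, ∀ α : ℝ → E, α 0 = x →
      (∀ t ∈ Set.Ioo (-ε) ε, HasDerivAt α (F (α t)) t) → ∀ t ∈ Set.Ioo (-ε) ε, (t, x) ∈ W →
      α t = S (t, x) := fun x _ α h0 hd t ht hW => by
    refine hSW t x α hW h0 fun r hr => hd _ ?_
    have : |r * t| ≤ |t| := by
      rw [abs_mul, abs_of_nonneg hr.1]
      exact mul_le_of_le_one_left (abs_nonneg _) hr.2
    exact abs_lt.1 (this.trans_lt (abs_lt.2 ht))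
  have hS0 : S (0, x₀) = x₀ := by
    obtain ⟨α, h0, hd⟩ := hα x₀ (Metric.mem_closedBall_self hr.le)
    rw [← hSα x₀ (Metric.mem_closedBall_self hr.le) α h0 hd 0 ⟨by linarith, hε⟩ hxW, h0]
  have hpre : W ∩ S ⁻¹' Metric.ball x₀ (R / 4) ∈ 𝓝 ((0 : ℝ), x₀) :=
    (hS.continuousOn.isOpen_inter_preimage hW Metric.isOpen_ball).mem_nhds
      ⟨hxW, by rw [Set.mem_preimage, hS0]; exact Metric.mem_ball_self (by linarith)⟩
  obtain ⟨A, hA, B, hB, hAB⟩ := mem_nhds_prod_iff.1 hpre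
  obtain ⟨δ, hδ, hδA⟩ := Metric.mem_nhds_iff.1 hA
  rw [Real.ball_eq_Ioo, zero_sub, zero_add] at hδA
  have hsub : Set.Ioo (-min δ ε) (min δ ε) ×ˢ (interior B ∩ Metric.ball x₀ r) ⊆
      W ∩ S ⁻¹' Metric.ball x₀ (R / 4) := fun q hq =>
    hAB ⟨hδA ⟨by linarith [hq.1.1, min_le_left δ ε], hq.1.2.trans_le (min_le_left _ _)⟩,
      interior_subset hq.2.1⟩
  refine ⟨min δ ε, interior B ∩ Metric.ball x₀ r, S, lt_min hδ hε,
    isOpen_interior.inter Metric.isOpen_ball,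
    ⟨mem_interior_iff_mem_nhds.2 hB, Metric.mem_ball_self hr⟩,
    hS.mono (hsub.trans Set.inter_subset_left), fun x hx => ?_⟩
  have hxr := Metric.ball_subset_closedBall hx.2
  obtain ⟨α, h0, hd⟩ := hα x hxr
  have heq : ∀ t ∈ Set.Ioo (-min δ ε) (min δ ε), α t = S (t, x) := fun t ht =>
    hSα x hxr α h0 hd t ⟨by linarith [ht.1, min_le_right δ ε], ht.2.trans_le (min_le_right _ _)⟩
      (hsub ⟨ht, hx⟩).1
  have hm : 0 < min δ ε := lt_min hδ hε
  refine ⟨by rw [← heq 0 ⟨by linarith, hm⟩, h0], fun t ht => ?_⟩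
  have hball : S (t, x) ∈ Metric.ball x₀ (R / 4) := (hsub ⟨ht, hx⟩).2
  refine ⟨hRU (Metric.ball_subset_ball (by linarith) hball), ?_⟩
  have h1 : F (S (t, x)) = f (S (t, x)) := by
    have : χ (S (t, x)) = 1 := χ.one_of_mem_closedBall (Metric.ball_subset_closedBall hball)
    simp only [F, this, one_smul]
  have h2 := hd t ⟨by linarith [ht.1, min_le_right δ ε], ht.2.trans_le (min_le_right _ _)⟩
  rw [heq t ht, h1] at h2
  refine h2.congr_of_eventuallyEq ?_
  filter_upwards [isOpen_Ioo.mem_nhds ht] with s hs using (heq s hs).symm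

/-- Linear differential equations with smooth coefficients have smooth fundamental solutions. -/
theorem exists_smooth_linearFlow [FiniteDimensional ℝ E] {A : Type*} [NormedRing A]
    [NormedAlgebra ℝ A] [FiniteDimensional ℝ A] {b : ℝ × E → A} {U : Set (ℝ × E)} {y₀ : E}
    (hU : IsOpen U) (hy₀ : ((0 : ℝ), y₀) ∈ U) (hb : ContDiffOn ℝ ∞ b U) :
    ∃ (ε : ℝ) (V : Set E) (a : ℝ × E → A), 0 < ε ∧ IsOpen V ∧ y₀ ∈ V ∧
      Set.Ioo (-ε) ε ×ˢ V ⊆ U ∧ ContDiffOn ℝ ∞ a (Set.Ioo (-ε) ε ×ˢ V) ∧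
      ∀ y ∈ V, a (0, y) = 1 ∧ ∀ t ∈ Set.Ioo (-ε) ε,
        HasDerivAt (fun s => a (s, y)) (a (t, y) * b (t, y)) t := by
  let p : ℝ × E × A → ℝ × E := fun q => (q.1, q.2.1)
  have hp : ContDiff ℝ ∞ p := contDiff_fst.prodMk (contDiff_fst.comp contDiff_snd)
  -- The linear equation becomes autonomous on triples of time, parameter and solution: time moves
  -- at unit speed and the parameter is at rest.
  have hf : ContDiffOn ℝ ∞ (fun q : ℝ × E × A => ((1 : ℝ), (0 : E), q.2.2 * b (q.1, q.2.1)))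
      (p ⁻¹' U) :=
    contDiffOn_const.prodMk (contDiffOn_const.prodMk
      ((contDiff_snd.comp contDiff_snd).contDiffOn.mul (hb.comp hp.contDiffOn fun q hq => hq)))
  obtain ⟨ε, V, S, hε, hV, hyV, hS, hSd⟩ := exists_smooth_localFlow (x₀ := ((0 : ℝ), y₀, (1 : A)))
    (hU.preimage hp.continuous) hy₀ hf
  let j : E → ℝ × E × A := fun y => (0, y, 1)
  have hj : ContDiff ℝ ∞ j := contDiff_const.prodMk (contDiff_id.prodMk contDiff_const)
  have h0 : (0 : ℝ) ∈ Set.Ioo (-ε) ε := ⟨by linarith, hε⟩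
  have hS12 : ∀ y ∈ j ⁻¹' V, ∀ t ∈ Set.Ioo (-ε) ε, (S (t, j y)).1 = t ∧ (S (t, j y)).2.1 = y := by
    intro y hy t ht
    obtain ⟨hi, hd⟩ := hSd _ hy
    have hd1 : ∀ t ∈ Set.Ioo (-ε) ε, HasDerivAt (fun s => (S (s, j y)).1) 1 t := fun t ht =>
      ((ContinuousLinearMap.fst ℝ ℝ (E × A)).hasFDerivAt).comp_hasDerivAt t (hd t ht).2
    have hd2 : ∀ t ∈ Set.Ioo (-ε) ε, HasDerivAt (fun s => (S (s, j y)).2.1) 0 t := fun t ht =>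
      (((ContinuousLinearMap.fst ℝ E A).comp
        (ContinuousLinearMap.snd ℝ ℝ (E × A))).hasFDerivAt).comp_hasDerivAt t (hd t ht).2
    constructor
    · exact isOpen_Ioo.eqOn_of_deriv_eq (𝕜 := ℝ) isPreconnected_Ioo
        (fun t ht => (hd1 t ht).differentiableAt.differentiableWithinAt)
        differentiableOn_id (fun t ht => by rw [(hd1 t ht).deriv, deriv_id]) h0
        (by simp [hi, j]) ht
    · exact isOpen_Ioo.eqOn_of_deriv_eq (𝕜 := ℝ) (g := fun _ => y) isPreconnected_Ioo
        (fun t ht => (hd2 t ht).differentiableAt.differentiableWithinAt)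
        (differentiableOn_const _) (fun t ht => by rw [(hd2 t ht).deriv, deriv_const]) h0
        (by simp [hi, j]) ht
  refine ⟨ε, j ⁻¹' V, fun q => (S (q.1, j q.2)).2.2, hε, hV.preimage hj.continuous, hyV, ?_, ?_, ?_⟩
  · rintro ⟨t, y⟩ ⟨ht, hy⟩
    have h1 := ((hSd _ hy).2 t ht).1
    obtain ⟨h2, h3⟩ := hS12 y hy t ht
    have h4 : p (S (t, j y)) ∈ U := h1
    simp only [p, h2, h3] at h4
    exact h4
  · refine (contDiff_snd.comp contDiff_snd).comp_contDiffOn (hS.comp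
      (contDiff_fst.prodMk (hj.comp contDiff_snd)).contDiffOn fun q hq => ⟨hq.1, hq.2⟩)
  · intro y hy
    refine ⟨by simp [(hSd _ hy).1, j], fun t ht => ?_⟩
    obtain ⟨h2, h3⟩ := hS12 y hy t ht
    have h4 := (((ContinuousLinearMap.snd ℝ E A).comp
        (ContinuousLinearMap.snd ℝ ℝ (E × A))).hasFDerivAt).comp_hasDerivAt t
          ((hSd _ hy).2 t ht).2
    simp only [ContinuousLinearMap.comp_apply, ContinuousLinearMap.coe_snd', h2, h3] at h4
    exact h4

end Flow
end SmoothODE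

/-! ### The geodesic equation in coordinates -/

section GeodesicEquation

set_option synthInstance.maxHeartbeats 100000
set_option maxHeartbeats 400000

variable {E : Type*} [NormedAddCommGroup E] [NormedSpace ℝ E]

/-- The geodesic expression of a metric `G` in coordinates. -/
def geodesicExpr (G : E → E →L[ℝ] E →L[ℝ] ℝ) (y v a w : E) : ℝ :=
  G y a w + fderiv ℝ G y v v w - fderiv ℝ G y w v v / 2

lemma hasFDerivAt_comp_fderiv {F : Type*} [NormedAddCommGroup F] [NormedSpace ℝ F] {G : E → F}
    {ψ : E → E} {y : E} (hG : DifferentiableAt ℝ G (ψ y)) (hψ : DifferentiableAt ℝ ψ y) :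
    HasFDerivAt (fun z => G (ψ z)) ((fderiv ℝ G (ψ y)).comp (fderiv ℝ ψ y)) y :=
  hG.hasFDerivAt.comp y hψ.hasFDerivAt

lemma contDiffOn_fderiv_apply {F : Type*} [NormedAddCommGroup F] [NormedSpace ℝ F] {G : E → F}
    {U : Set E} (hU : IsOpen U) (hG : ContDiffOn ℝ ∞ G U) {E' : Type*} [NormedAddCommGroup E']
    [NormedSpace ℝ E'] {s : Set E'} {p w : E' → E} (hp : ContDiffOn ℝ ∞ p s)
    (hw : ContDiffOn ℝ ∞ w s) (hs : Set.MapsTo p s U) :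
    ContDiffOn ℝ ∞ (fun q => fderiv ℝ G (p q) (w q)) s :=
  ((hG.fderiv_of_isOpen hU (by simp)).comp hp hs).clm_apply hw

/-- The geodesic expression is invariant under coordinate changes. -/
lemma geodesicExpr_coordChange {G G' : E → E →L[ℝ] E →L[ℝ] ℝ}
    {ψ : E → E} {y : E} (hGd : DifferentiableAt ℝ G y) (hψ : ContDiffAt ℝ 2 ψ y)
    (hG' : DifferentiableAt ℝ G' (ψ y)) (hsymm : ∀ u w, G' (ψ y) u w = G' (ψ y) w u)
    (hG : ∀ᶠ z in 𝓝 y, ∀ u w, G z u w = G' (ψ z) (fderiv ℝ ψ z u) (fderiv ℝ ψ z w)) (v a w : E) :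
    geodesicExpr G y v a w = geodesicExpr G' (ψ y) (fderiv ℝ ψ y v)
      (fderiv ℝ (fderiv ℝ ψ) y v v + fderiv ℝ ψ y a) (fderiv ℝ ψ y w) := by
  have hd : DifferentiableAt ℝ (fderiv ℝ ψ) y :=
    (hψ.fderiv_right (m := 1) (by norm_num)).differentiableAt (by norm_num)
  have hs : ∀ u w, fderiv ℝ (fderiv ℝ ψ) y u w = fderiv ℝ (fderiv ℝ ψ) y w u := fun u w =>
    (hψ.isSymmSndFDerivAt (by simp)).eq u w
  have hψd : HasFDerivAt ψ (fderiv ℝ ψ y) y := (hψ.differentiableAt (by norm_num)).hasFDerivAt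
  have h0 : ∀ u w, HasFDerivAt (fun z => G z u w)
      ((G' (ψ y) (fderiv ℝ ψ y u)).comp ((fderiv ℝ (fderiv ℝ ψ) y).flip w) +
        (((fderiv ℝ G' (ψ y)).comp (fderiv ℝ ψ y)).flip (fderiv ℝ ψ y u) +
          (G' (ψ y)).comp ((fderiv ℝ (fderiv ℝ ψ) y).flip u)).flip (fderiv ℝ ψ y w)) y := by
    intro u w
    have h1 := hasFDerivAt_comp_fderiv (F := E →L[ℝ] E →L[ℝ] ℝ) hG'
      (hψ.differentiableAt (by norm_num))
    have h2 : ∀ u, HasFDerivAt (fun z => fderiv ℝ ψ z u) ((fderiv ℝ (fderiv ℝ ψ) y).flip u) y :=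
      fun u => by
        have := hd.hasFDerivAt.clm_apply (hasFDerivAt_const u y)
        simpa using this
    have h3 := (h1.clm_apply (h2 u)).clm_apply (h2 w)
    refine (h3.congr_of_eventuallyEq (hG.mono fun z hz => hz u w)).congr_fderiv ?_
    ext h
    simp [add_comm]
  have h5 : ∀ h u w, fderiv ℝ G y h u w = G' (ψ y) (fderiv ℝ ψ y u) (fderiv ℝ (fderiv ℝ ψ) y h w)
      + (fderiv ℝ G' (ψ y) (fderiv ℝ ψ y h) (fderiv ℝ ψ y u) (fderiv ℝ ψ y w)
        + G' (ψ y) (fderiv ℝ (fderiv ℝ ψ) y h u) (fderiv ℝ ψ y w)) := by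
    intro h u w
    have h6 := (hGd.hasFDerivAt.clm_apply (hasFDerivAt_const u y)).clm_apply (hasFDerivAt_const w y)
    have h7 := congrArg (fun L => L h) (h6.unique (h0 u w))
    simpa using h7
  -- Of the three terms with a second derivative of `ψ`, two cancel by the symmetry of the second
  -- derivative and of the metric. The third is the inhomogeneous term in the transformed
  -- acceleration.
  unfold geodesicExpr
  rw [h5, h5, hG.self_of_nhds, map_add, add_apply, hs w v,
    hsymm (fderiv ℝ ψ y v)]
  ring

/-- The solution of the geodesic equation for the acceleration. -/
def geodesicAccel (G : E → E →L[ℝ] E →L[ℝ] ℝ) (q : E × E) : E :=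
  (G q.1).inverse ((1 / 2 : ℝ) • ((fderiv ℝ G q.1).flip q.2).flip q.2 - fderiv ℝ G q.1 q.2 q.2)

/-- The expression is affine in the acceleration, with linear part the metric; testing with `a - a'`
contradicts positivity unless the two agree. -/
lemma eq_of_geodesicExpr_eq_zero {G : E → E →L[ℝ] E →L[ℝ] ℝ} {y v a a' : E}
    (hB : ∀ u, u ≠ 0 → 0 < G y u u) (h : ∀ w, geodesicExpr G y v a w = 0)
    (h' : ∀ w, geodesicExpr G y v a' w = 0) : a = a' := by
  by_contra hne
  have h1 := hB (a - a') (sub_ne_zero.2 hne)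
  have h2 := h (a - a')
  have h3 := h' (a - a')
  unfold geodesicExpr at h2 h3
  have h4 : G y (a - a') = G y a - G y a' := map_sub _ _ _
  rw [h4, sub_apply] at h1
  linarith

variable [FiniteDimensional ℝ E]

/-- Positivity makes the map into the dual space injective, and the dimensions agree. -/
lemma exists_equiv_of_pos {B : E →L[ℝ] E →L[ℝ] ℝ} (hB : ∀ u, u ≠ 0 → 0 < B u u) :
    ∃ e : E ≃L[ℝ] (E →L[ℝ] ℝ), (e : E →L[ℝ] E →L[ℝ] ℝ) = B := by
  have hinj : Function.Injective B.toLinearMap := by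
    rw [← LinearMap.ker_eq_bot, LinearMap.ker_eq_bot']
    intro u hu
    by_contra h
    have := hB u h
    have h2 : B u = 0 := hu
    simp [h2] at this
  have hfr : Module.finrank ℝ E = Module.finrank ℝ (E →L[ℝ] ℝ) := by
    rw [← (LinearMap.toContinuousLinearMap (𝕜 := ℝ) (E := E) (F' := ℝ)).finrank_eq]
    exact (Subspace.dual_finrank_eq (K := ℝ) (V := E)).symm
  refine ⟨(LinearEquiv.ofInjectiveOfFinrankEq B.toLinearMap hinj hfr).toContinuousLinearEquiv, ?_⟩
  ext u w
  rfl

lemma geodesicExpr_geodesicAccel {G : E → E →L[ℝ] E →L[ℝ] ℝ} {y : E}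
    (hB : ∀ u, u ≠ 0 → 0 < G y u u) (v w : E) :
    geodesicExpr G y v (geodesicAccel G (y, v)) w = 0 := by
  obtain ⟨e, he⟩ := exists_equiv_of_pos hB
  unfold geodesicExpr geodesicAccel
  simp only
  rw [← he, ContinuousLinearMap.inverse_equiv]
  simp only [ContinuousLinearEquiv.coe_coe, ContinuousLinearEquiv.apply_symm_apply]
  simp
  ring

lemma contDiffOn_geodesicAccel {G : E → E →L[ℝ] E →L[ℝ] ℝ} {U : Set E} (hU : IsOpen U)
    (hG : ContDiffOn ℝ ∞ G U) (hB : ∀ y ∈ U, ∀ u, u ≠ 0 → 0 < G y u u) :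
    ContDiffOn ℝ ∞ (geodesicAccel G) (U ×ˢ Set.univ) := by
  have : CompleteSpace E := FiniteDimensional.complete ℝ E
  have hm : Set.MapsTo (Prod.fst : E × E → E) (U ×ˢ Set.univ) U := fun q hq => hq.1
  have h1 : ContDiffOn ℝ ∞ (fun q : E × E => (G q.1).inverse) (U ×ˢ Set.univ) := by
    intro q hq
    obtain ⟨e, he⟩ := exists_equiv_of_pos (hB q.1 hq.1)
    have := contDiffAt_map_inverse (𝕜 := ℝ) (n := ∞) e
    rw [he] at this
    exact this.comp_contDiffWithinAt q ((hG.comp contDiffOn_fst hm) q hq)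
  have h2 : ContDiffOn ℝ ∞ (fun q : E × E => (1 / 2 : ℝ) • ((fderiv ℝ G q.1).flip q.2).flip q.2 -
      fderiv ℝ G q.1 q.2 q.2) (U ×ˢ Set.univ) := by
    rw [contDiffOn_clm_apply]
    intro w
    have h3 : ContDiffOn ℝ ∞ (fun q : E × E => fderiv ℝ G q.1 w) (U ×ˢ Set.univ) :=
      contDiffOn_fderiv_apply hU hG contDiffOn_fst contDiffOn_const hm
    have h4 : ContDiffOn ℝ ∞ (fun q : E × E => fderiv ℝ G q.1 q.2) (U ×ˢ Set.univ) :=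
      contDiffOn_fderiv_apply hU hG contDiffOn_fst contDiffOn_snd hm
    have h5 := ((h3.clm_apply contDiffOn_snd).clm_apply contDiffOn_snd).const_smul (1 / 2 : ℝ)
    exact h5.sub ((h4.clm_apply contDiffOn_snd).clm_apply contDiffOn_const)
  exact h1.clm_apply h2

end GeodesicEquation

/-- The derivative of the tangent map is the transformation law for second-order vectors. For `u =
v` its second component is the transformed acceleration of `geodesicExpr_coordChange`. -/
lemma fderiv_prodMk_fderiv_apply {E F : Type*} [NormedAddCommGroup E] [NormedSpace ℝ E]
    [NormedAddCommGroup F] [NormedSpace ℝ F] {ψ : E → F} {y : E} (hψ : ContDiffAt ℝ 2 ψ y)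
    (v u a : E) :
    fderiv ℝ (fun q : E × E => (ψ q.1, fderiv ℝ ψ q.1 q.2)) (y, v) (u, a) =
      (fderiv ℝ ψ y u, fderiv ℝ (fderiv ℝ ψ) y u v + fderiv ℝ ψ y a) := by
  have h1 : HasFDerivAt (fun q : E × E => ψ q.1) ((fderiv ℝ ψ y).comp
      (ContinuousLinearMap.fst ℝ E E)) (y, v) :=
    HasFDerivAt.comp (y, v) ((hψ.differentiableAt (by simp)).hasFDerivAt) hasFDerivAt_fst
  have h0 : DifferentiableAt ℝ (fderiv ℝ ψ) y :=
    (hψ.fderiv_right (m := 1) (by norm_num)).differentiableAt (by norm_num)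
  have h2 : HasFDerivAt (fun q : E × E => fderiv ℝ ψ q.1) ((fderiv ℝ (fderiv ℝ ψ) y).comp
      (ContinuousLinearMap.fst ℝ E E)) (y, v) :=
    HasFDerivAt.comp (y, v) h0.hasFDerivAt hasFDerivAt_fst
  have h3 := h2.clm_apply (hasFDerivAt_snd (𝕜 := ℝ) (p := (y, v)))
  rw [(h1.prodMk h3).fderiv]
  simp [add_comm]

/-! ### The metric and the tangent bundle in charts -/

section MetricInChart

variable {n : ℕ} {Q : Type*} [TopologicalSpace Q] [ChartedSpace (EuclideanSpace ℝ (Fin n)) Q]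
  [IsManifold (𝓡 n) ∞ Q] (g : Metric (n := n) Q)

local notation "E" => EuclideanSpace ℝ (Fin n)

lemma tangentCoordChange_injective {x z : Q} (hx : z ∈ (extChartAt (𝓡 n) x).source) {u : E}
    (h : tangentCoordChange (𝓡 n) x z z u = 0) : u = 0 := by
  have h1 := tangentCoordChange_comp (I := 𝓡 n) (w := x) (x := z) (y := x) (z := z) (v := u)
    ⟨⟨hx, mem_extChartAt_source z⟩, hx⟩
  rw [h, map_zero, tangentCoordChange_self hx] at h1
  exact h1.symm

lemma metricInChart_extChartAt {x z : Q} (hx : z ∈ (extChartAt (𝓡 n) x).source) (u w : E) :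
    metricInChart g x (extChartAt (𝓡 n) x z) u w = g.inner z
      (tangentCoordChange (𝓡 n) x z z u : E) (tangentCoordChange (𝓡 n) x z z w : E) := by
  rw [metricInChart_apply, (extChartAt (𝓡 n) x).left_inv hx]
  have hb : z ∈ (chartAt E x).source := by rwa [extChartAt_source] at hx
  rw [TangentBundle.symmL_trivializationAt_eq_core hb]
  rfl

lemma metricInChart_coordChange {x x' z : Q} (hx : z ∈ (extChartAt (𝓡 n) x).source)
    (hx' : z ∈ (extChartAt (𝓡 n) x').source) (u w : E) :
    metricInChart g x (extChartAt (𝓡 n) x z) u w =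
      metricInChart g x' (extChartAt (𝓡 n) x' z) (tangentCoordChange (𝓡 n) x x' z u)
        (tangentCoordChange (𝓡 n) x x' z w) := by
  rw [metricInChart_extChartAt g hx, metricInChart_extChartAt g hx',
    tangentCoordChange_comp ⟨⟨hx, hx'⟩, mem_extChartAt_source z⟩,
    tangentCoordChange_comp ⟨⟨hx, hx'⟩, mem_extChartAt_source z⟩]

lemma metricInChart_symm (x : Q) (y u w : E) :
    metricInChart g x y u w = metricInChart g x y w u := by
  rw [metricInChart_apply, metricInChart_apply, g.symm]

lemma metricInChart_pos {x : Q} {y : E} (hy : y ∈ (extChartAt (𝓡 n) x).target) (u : E)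
    (hu : u ≠ 0) : 0 < metricInChart g x y u u := by
  have hz := (extChartAt (𝓡 n) x).map_target hy
  have h := metricInChart_extChartAt g hz u u
  rw [(extChartAt (𝓡 n) x).right_inv hy] at h
  rw [h]
  exact g.pos _ _ fun h0 => hu (tangentCoordChange_injective hz h0)

/-- Sections that are constant in the trivialization are smooth, and so is the smooth metric
evaluated on two of them. -/
lemma contDiffOn_metricInChart (x : Q) :
    ContDiffOn ℝ ∞ (metricInChart g x) (extChartAt (𝓡 n) x).target := by
  rw [contDiffOn_clm_apply]
  intro u
  rw [contDiffOn_clm_apply]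
  intro w
  rw [← contMDiffOn_iff_contDiffOn]
  let e := trivializationAt E (TangentSpace (𝓡 n) : Q → Type _) x
  have hsec : ∀ u : E, ContMDiffOn (𝓡 n) (𝓡 n).tangent ∞
      (fun b => (⟨b, e.symmL ℝ b u⟩ : TangentBundle (𝓡 n) Q)) e.baseSet := fun u => by
    rw [e.contMDiffOn_section_iff e.open_baseSet subset_rfl]
    refine (contMDiffOn_const (c := u)).congr fun b hb => ?_
    have := e.continuousLinearMapAt_symmL (R := ℝ) hb u
    rw [e.continuousLinearMapAt_apply_of_mem (R := ℝ) hb] at this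
    exact this
  have h := (g.contMDiff.contMDiffOn (s := e.baseSet)).clm_bundle_apply₂ (E₃ := Bundle.Trivial Q ℝ) (hsec u) (hsec w)
  have h2 : ContMDiffOn (𝓡 n) 𝓘(ℝ, ℝ) ∞ (fun b => (g.inner b (e.symmL ℝ b u) (e.symmL ℝ b w) : ℝ)) e.baseSet := by
    intro b hb
    have := h b hb
    rw [contMDiffWithinAt_totalSpace] at this
    exact this.2
  refine (h2.comp (contMDiffOn_extChartAt_symm x) fun y hy => ?_).congr fun y hy => ?_
  · have := (extChartAt (𝓡 n) x).map_target hy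
    rwa [extChartAt_source] at this
  · rw [metricInChart_apply]; rfl

lemma tangent_extChartAt_apply (p₀ p : TangentBundle (𝓡 n) Q) :
    extChartAt (𝓡 n).tangent p₀ p = (extChartAt (𝓡 n) p₀.proj p.proj,
      (tangentCoordChange (𝓡 n) p.proj p₀.proj p.proj p.snd : E)) := rfl

lemma tangent_extChartAt_source (p₀ p : TangentBundle (𝓡 n) Q) :
    p ∈ (extChartAt (𝓡 n).tangent p₀).source ↔ p.proj ∈ (extChartAt (𝓡 n) p₀.proj).source := by
  rw [extChartAt_source, extChartAt_source]
  exact TangentBundle.mem_chart_source_iff p p₀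

lemma tangent_extChartAt_target (p₀ : TangentBundle (𝓡 n) Q) (q : E × E) :
    q ∈ (extChartAt (𝓡 n).tangent p₀).target ↔ q.1 ∈ (extChartAt (𝓡 n) p₀.proj).target := by
  rw [FiberBundle.extChartAt_target]
  refine ⟨fun h => h.1.1, fun h => ⟨⟨h, ?_⟩, Set.mem_univ _⟩⟩
  have := (extChartAt (𝓡 n) p₀.proj).map_target h
  rwa [extChartAt_source] at this

lemma tangent_extChartAt_symm_proj (p₀ : TangentBundle (𝓡 n) Q) (q : E × E) :
    ((extChartAt (𝓡 n).tangent p₀).symm q).proj = (extChartAt (𝓡 n) p₀.proj).symm q.1 := rfl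

/-- The coordinate change of the base from the preferred chart around `x` to that around `x'`. -/
def transition (x x' : Q) : E → E := extChartAt (𝓡 n) x' ∘ (extChartAt (𝓡 n) x).symm

lemma fderiv_transition (x x' z : Q) :
    fderiv ℝ (transition x x') (extChartAt (𝓡 n) x z) = tangentCoordChange (𝓡 n) x x' z := by
  rw [tangentCoordChange_def, ModelWithCorners.range_eq_univ, fderivWithin_univ]
  rfl

lemma contDiffAt_transition {x x' z : Q} (hx : z ∈ (extChartAt (𝓡 n) x).source)
    (hx' : z ∈ (extChartAt (𝓡 n) x').source) :
    ContDiffAt ℝ ∞ (transition x x') (extChartAt (𝓡 n) x z) := by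
  have h := contDiffWithinAt_ext_coord_change (I := 𝓡 n) (n := ∞) x' x
    (y := extChartAt (𝓡 n) x z) (by
      rw [PartialEquiv.trans_source'', PartialEquiv.symm_symm, PartialEquiv.symm_target]
      exact Set.mem_image_of_mem _ ⟨hx, hx'⟩)
  rw [ModelWithCorners.range_eq_univ, contDiffWithinAt_univ] at h
  exact h

omit [IsManifold (𝓡 n) ∞ Q] in
lemma eventually_mem_source {x x' z : Q} (hx : z ∈ (extChartAt (𝓡 n) x).source)
    (hx' : z ∈ (extChartAt (𝓡 n) x').source) :
    ∀ᶠ y in 𝓝 (extChartAt (𝓡 n) x z), y ∈ (extChartAt (𝓡 n) x).target ∧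
      (extChartAt (𝓡 n) x).symm y ∈ (extChartAt (𝓡 n) x').source := by
  have h1 : (extChartAt (𝓡 n) x).target ∈ 𝓝 (extChartAt (𝓡 n) x z) :=
    (isOpen_extChartAt_target x).mem_nhds ((extChartAt (𝓡 n) x).map_source hx)
  have h2 := (continuousOn_extChartAt_symm (I := 𝓡 n) x).continuousAt h1
  rw [ContinuousAt, (extChartAt (𝓡 n) x).left_inv hx] at h2
  exact (Filter.eventually_of_mem h1 fun y hy => hy).and
    (h2.eventually_mem ((isOpen_extChartAt_source x').mem_nhds hx'))


/-- The fiber coordinate of a tangent bundle chart is transformed by `tangentCoordChange`, which is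
the derivative of the base transition. Charts therefore change by the tangent map of the base
transition. -/
lemma tangent_transition_eventuallyEq {p p₀ : TangentBundle (𝓡 n) Q}
    (hp : p.proj ∈ (extChartAt (𝓡 n) p₀.proj).source) (v : E) :
    extChartAt (𝓡 n).tangent p₀ ∘ (extChartAt (𝓡 n).tangent p).symm =ᶠ[
      𝓝 ((extChartAt (𝓡 n) p.proj p.proj, v) : E × E)] fun q : E × E =>
        ((transition p.proj p₀.proj q.1, fderiv ℝ (transition p.proj p₀.proj) q.1 q.2) : E × E) := by
  have hxx : p.proj ∈ (extChartAt (𝓡 n) p.proj).source := mem_extChartAt_source _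
  have h1 := ((continuous_fst (X := E) (Y := E)).tendsto
    ((extChartAt (𝓡 n) p.proj p.proj, v) : E × E)).eventually (eventually_mem_source hxx hp)
  filter_upwards [h1] with q hq
  have hq' : q ∈ (extChartAt (𝓡 n).tangent p).target := (tangent_extChartAt_target p q).2 hq.1
  have hr := (extChartAt (𝓡 n).tangent p).right_inv hq'
  rw [tangent_extChartAt_apply, tangent_extChartAt_symm_proj] at hr
  rw [Function.comp_apply, tangent_extChartAt_apply, tangent_extChartAt_symm_proj]
  have hz := (extChartAt (𝓡 n) p.proj).map_target hq.1
  refine Prod.ext rfl ?_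
  have h2 : q.2 = (tangentCoordChange (𝓡 n) ((extChartAt (𝓡 n) p.proj).symm q.1) p.proj
    ((extChartAt (𝓡 n) p.proj).symm q.1) ((extChartAt (𝓡 n).tangent p).symm q).snd : E) :=
    (congrArg Prod.snd hr).symm
  have h3 := fderiv_transition (n := n) p.proj p₀.proj ((extChartAt (𝓡 n) p.proj).symm q.1)
  rw [(extChartAt (𝓡 n) p.proj).right_inv hq.1] at h3
  change _ = fderiv ℝ (transition p.proj p₀.proj) q.1 q.2
  rw [h2, h3]
  exact (tangentCoordChange_comp ⟨⟨mem_extChartAt_source _, hz⟩, hq.2⟩).symm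

/-- The tangential coordinate change in the tangent bundle from the preferred chart around `p` to
the one around `p₀`. -/
lemma tangentCoordChange_tangent {p p₀ : TangentBundle (𝓡 n) Q}
    (hp : p.proj ∈ (extChartAt (𝓡 n) p₀.proj).source) (u a v : E) (hv : p.snd = v) :
    tangentCoordChange (𝓡 n).tangent p p₀ p ((u, a) : E × E) =
      ((tangentCoordChange (𝓡 n) p.proj p₀.proj p.proj u,
        fderiv ℝ (fderiv ℝ (transition p.proj p₀.proj)) (extChartAt (𝓡 n) p.proj p.proj) u v +
          tangentCoordChange (𝓡 n) p.proj p₀.proj p.proj a) : E × E) := by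
  have hxx : p.proj ∈ (extChartAt (𝓡 n) p.proj).source := mem_extChartAt_source _
  have hψ := contDiffAt_transition hxx hp
  have hpt : extChartAt (𝓡 n).tangent p p = ((extChartAt (𝓡 n) p.proj p.proj, v) : E × E) := by
    rw [tangent_extChartAt_apply]
    exact Prod.ext rfl ((tangentCoordChange_self hxx).trans hv)
  have heq := tangent_transition_eventuallyEq hp v
  rw [← fderiv_transition (n := n) p.proj p₀.proj p.proj]
  generalize transition (n := n) p.proj p₀.proj = ψ at *
  rw [tangentCoordChange_def, ModelWithCorners.range_eq_univ, fderivWithin_univ, hpt,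
    heq.fderiv_eq]
  exact fderiv_prodMk_fderiv_apply (hψ.of_le (WithTop.coe_le_coe.2 (le_top (a := (2 : ℕ∞))))) v u a

lemma isGeodesicAcceleration_iff (p : TangentBundle (𝓡 n) Q) (a v : E) (hv : p.snd = v) :
    IsGeodesicAcceleration g p a ↔ ∀ w, geodesicExpr (metricInChart g p.proj)
      (extChartAt (𝓡 n) p.proj p.proj) v a w = 0 := by
  subst hv; rfl

/-- The acceleration in the definition is chosen by `Classical.epsilon`; existence and uniqueness of
solutions of the geodesic equation pin it down. -/
lemma geodesicField_eq (p : TangentBundle (𝓡 n) Q) (v : E) (hv : p.snd = v) :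
    geodesicField g p = ((v, geodesicAccel (metricInChart g p.proj)
      ((extChartAt (𝓡 n) p.proj p.proj, v) : E × E)) : E × E) := by
  have hpos := fun u hu => metricInChart_pos g (mem_extChartAt_target (I := 𝓡 n) p.proj) u hu
  have h1 := fun w => geodesicExpr_geodesicAccel (G := metricInChart g p.proj)
    (y := extChartAt (𝓡 n) p.proj p.proj) hpos v w
  have h2 := Classical.epsilon_spec (p := IsGeodesicAcceleration g p)
    ⟨_, (isGeodesicAcceleration_iff g p _ v hv).2 h1⟩
  have h3 := eq_of_geodesicExpr_eq_zero hpos ((isGeodesicAcceleration_iff g p _ v hv).1 h2) h1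
  exact Prod.ext hv h3

end MetricInChart

/-! ### Derivatives of curves on manifolds in a fixed chart -/

section CurvesInCharts

variable {E : Type*} [NormedAddCommGroup E] [NormedSpace ℝ E] {H : Type*} [TopologicalSpace H]
  {I : ModelWithCorners ℝ E H} {M : Type*} [TopologicalSpace M] [ChartedSpace H M]
  [IsManifold I 1 M]

lemma hasDerivAt_extChartAt_comp {γ : ℝ → M} {x₀ : M} {t : ℝ} {X : E}
    (hγ : HasMFDerivAt 𝓘(ℝ, ℝ) I γ t ((1 : ℝ →L[ℝ] ℝ).smulRight X : ℝ →L[ℝ] E))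
    (hsrc : γ t ∈ (extChartAt I x₀).source) :
    HasDerivAt (extChartAt I x₀ ∘ γ) (tangentCoordChange I (γ t) x₀ (γ t) X) t := by
  rw [extChartAt_source] at hsrc
  have h := HasMFDerivAt.comp t (hasMFDerivAt_extChartAt (I := I) hsrc) hγ
  have h1 : HasFDerivAt (extChartAt I x₀ ∘ γ) ((tangentCoordChange I (γ t) x₀ (γ t)).comp
      ((1 : ℝ →L[ℝ] ℝ).smulRight X)) t := by
    rw [mfderiv_chartAt_eq_tangentCoordChange hsrc] at h
    exact hasMFDerivAt_iff_hasFDerivAt.1 h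
  have h2 := h1.hasDerivAt
  rwa [ContinuousLinearMap.comp_apply, ContinuousLinearMap.smulRight_apply, one_apply_eq_self,
    one_smul] at h2

/-- The derivative of a curve on the manifold is read in the preferred chart around its current
point, so the coordinate change from the fixed chart to that one has to be undone. -/
lemma hasMFDerivAt_extChartAt_symm_comp [I.Boundaryless] {f : ℝ → E} {x₀ : M} {t : ℝ}
    {X : E} (hf : f t ∈ (extChartAt I x₀).target)
    (h : HasDerivAt f (tangentCoordChange I ((extChartAt I x₀).symm (f t)) x₀
      ((extChartAt I x₀).symm (f t)) X) t) :
    HasMFDerivAt 𝓘(ℝ, ℝ) I ((extChartAt I x₀).symm ∘ f) t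
      ((1 : ℝ →L[ℝ] ℝ).smulRight X : ℝ →L[ℝ] E) := by
  let xₜ : M := (extChartAt I x₀).symm (f t)
  have hft1 : xₜ ∈ (extChartAt I x₀).source := (extChartAt I x₀).map_target hf
  have hft2 := mem_extChartAt_source (I := I) xₜ
  refine ⟨(continuousAt_extChartAt_symm'' hf).comp h.continuousAt,
    ?_⟩
  have key : HasDerivAt ((extChartAt I xₜ ∘ (extChartAt I x₀).symm) ∘ f) X t := ?_
  · have := key.hasFDerivAt.hasFDerivWithinAt (s := Set.range 𝓘(ℝ, ℝ))
    refine this.congr_fderiv ?_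
    ext; simp
  rw [← tangentCoordChange_self (I := I) (x := xₜ) (z := xₜ) (v := X) hft2,
    ← tangentCoordChange_comp (x := x₀) ⟨⟨hft2, hft1⟩, hft2⟩]
  refine HasFDerivAt.comp_hasDerivAt _ ?_ h
  refine HasFDerivWithinAt.hasFDerivAt (s := Set.range I) ?_ (Filter.mem_of_superset
    ((isOpen_extChartAt_target x₀).mem_nhds hf) (extChartAt_target_subset_range x₀))
  have := hasFDerivWithinAt_tangentCoordChange (I := I) ⟨hft1, hft2⟩
  rwa [(extChartAt I x₀).right_inv hf] at this

end CurvesInCharts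

/-! ### Smoothness of the geodesic vector field -/

section GeodesicField

variable {n : ℕ} {Q : Type*} [TopologicalSpace Q] [ChartedSpace (EuclideanSpace ℝ (Fin n)) Q]
  [IsManifold (𝓡 n) ∞ Q] (g : Metric (n := n) Q)

local notation "E" => EuclideanSpace ℝ (Fin n)

/-- The geodesic vector field in the preferred chart around `x`. -/
def geodesicFieldInChart (x : Q) (q : E × E) : E × E := (q.2, geodesicAccel (metricInChart g x) q)

lemma contDiffOn_geodesicFieldInChart (x : Q) :
    ContDiffOn ℝ ∞ (geodesicFieldInChart g x) ((extChartAt (𝓡 n) x).target ×ˢ Set.univ) :=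
  contDiffOn_snd.prodMk (contDiffOn_geodesicAccel (isOpen_extChartAt_target x)
    (contDiffOn_metricInChart g x) fun _ hy u hu => metricInChart_pos g hy u hu)

/-- The field is defined at each point through a chart depending on that point. By invariance of the
geodesic expression, the transformed acceleration solves the geodesic equation in the chart around
`p₀`; uniqueness identifies it there. Test vectors are exhausted because coordinate changes are
surjective. -/
lemma tangentCoordChange_geodesicField {p p₀ : TangentBundle (𝓡 n) Q}
    (hp : p.proj ∈ (extChartAt (𝓡 n) p₀.proj).source) :
    tangentCoordChange (𝓡 n).tangent p p₀ p (geodesicField g p) =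
      geodesicFieldInChart g p₀.proj (extChartAt (𝓡 n).tangent p₀ p) := by
  obtain ⟨v, hv⟩ : ∃ v : E, p.snd = v := ⟨_, rfl⟩
  have hxx : p.proj ∈ (extChartAt (𝓡 n) p.proj).source := mem_extChartAt_source _
  have hpos := fun u hu => metricInChart_pos g (mem_extChartAt_target (I := 𝓡 n) p.proj) u hu
  have hpos' := fun u hu => metricInChart_pos g ((extChartAt (𝓡 n) p₀.proj).map_source hp) u hu
  rw [geodesicField_eq g p v hv, tangentCoordChange_tangent hp _ _ v hv]
  have hch : extChartAt (𝓡 n).tangent p₀ p = ((extChartAt (𝓡 n) p₀.proj p.proj,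
      tangentCoordChange (𝓡 n) p.proj p₀.proj p.proj v) : E × E) := by
    rw [← hv]; rfl
  rw [hch]
  refine Prod.ext rfl ?_
  refine eq_of_geodesicExpr_eq_zero hpos' (v := tangentCoordChange (𝓡 n) p.proj p₀.proj p.proj v)
    (fun w => ?_) fun w => geodesicExpr_geodesicAccel hpos' _ w
  obtain ⟨w, rfl⟩ : ∃ w', tangentCoordChange (𝓡 n) p.proj p₀.proj p.proj w' = w :=
    ⟨tangentCoordChange (𝓡 n) p₀.proj p.proj p.proj w, by
      rw [tangentCoordChange_comp ⟨⟨hp, hxx⟩, hp⟩, tangentCoordChange_self hp]⟩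
  have hd : ∀ {x z : Q}, z ∈ (extChartAt (𝓡 n) x).source →
      DifferentiableAt ℝ (metricInChart g x) (extChartAt (𝓡 n) x z) := fun {x z} hz =>
    ((contDiffOn_metricInChart g x).contDiffAt ((isOpen_extChartAt_target x).mem_nhds
      ((extChartAt (𝓡 n) x).map_source hz))).differentiableAt (by simp)
  have htr : transition p.proj p₀.proj (extChartAt (𝓡 n) p.proj p.proj)
      = extChartAt (𝓡 n) p₀.proj p.proj := by
    rw [transition, Function.comp_apply, (extChartAt (𝓡 n) p.proj).left_inv hxx]
  have key := geodesicExpr_coordChange (G := metricInChart g p.proj)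
    (G' := metricInChart g p₀.proj) (ψ := transition p.proj p₀.proj)
    (y := extChartAt (𝓡 n) p.proj p.proj) (hd hxx)
    ((contDiffAt_transition hxx hp).of_le (WithTop.coe_le_coe.2 (le_top (a := (2 : ℕ∞))))) (by rw [htr]; exact hd hp)
    (fun u w => metricInChart_symm g _ _ u w) (by
      filter_upwards [eventually_mem_source hxx hp] with y hy u w
      have hz := (extChartAt (𝓡 n) p.proj).map_target hy.1
      have h1 := metricInChart_coordChange g hz hy.2 u w
      rw [← fderiv_transition, (extChartAt (𝓡 n) p.proj).right_inv hy.1] at h1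
      exact h1) v (geodesicAccel (metricInChart g p.proj) (extChartAt (𝓡 n) p.proj p.proj, v)) w
  rw [geodesicExpr_geodesicAccel hpos, htr, fderiv_transition] at key
  exact key.symm

lemma contMDiff_geodesicField :
    ContMDiff (𝓡 n).tangent (𝓡 n).tangent.tangent ∞ (fun p : TangentBundle (𝓡 n) Q =>
      (⟨p, geodesicField g p⟩ : TangentBundle (𝓡 n).tangent (TangentBundle (𝓡 n) Q))) := by
  intro p₀
  let e := trivializationAt (E × E)
    (TangentSpace (𝓡 n).tangent : TangentBundle (𝓡 n) Q → Type _) p₀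
  have hbase : e.baseSet = (extChartAt (𝓡 n).tangent p₀).source := by
    rw [extChartAt_source]; rfl
  have hopen := isOpen_extChartAt_source (I := (𝓡 n).tangent) p₀
  have key : ContMDiffOn (𝓡 n).tangent (𝓡 n).tangent.tangent ∞ (fun p : TangentBundle (𝓡 n) Q =>
      (⟨p, geodesicField g p⟩ : TangentBundle (𝓡 n).tangent (TangentBundle (𝓡 n) Q)))
      (extChartAt (𝓡 n).tangent p₀).source := by
    rw [← hbase]
    refine (e.contMDiffOn_section_baseSet_iff).2 ?_
    rw [hbase]
    have h1 : ContMDiffOn (𝓡 n).tangent 𝓘(ℝ, E × E) ∞ (fun p : TangentBundle (𝓡 n) Q =>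
        geodesicFieldInChart g p₀.proj (extChartAt (𝓡 n).tangent p₀ p))
        (extChartAt (𝓡 n).tangent p₀).source := by
      refine (contMDiffOn_iff_contDiffOn.2 (contDiffOn_geodesicFieldInChart g p₀.proj)).comp
        (t := (extChartAt (𝓡 n) p₀.proj).target ×ˢ Set.univ) ?_ ?_
      · have := contMDiffOn_extChartAt (I := (𝓡 n).tangent) (n := ∞) (x := p₀)
        rwa [← extChartAt_source (𝓡 n).tangent] at this
      · intro p hp
        exact ⟨(tangent_extChartAt_target p₀ _).1 ((extChartAt (𝓡 n).tangent p₀).map_source hp),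
          Set.mem_univ _⟩
    refine h1.congr fun p hp => ?_
    rw [← tangentCoordChange_geodesicField g ((tangent_extChartAt_source p₀ p).1 hp)]
    rfl
  exact (key p₀ (mem_extChartAt_source p₀)).contMDiffAt (hopen.mem_nhds (mem_extChartAt_source p₀))

/-- Points over different base points are separated in the base, points of one fiber in a single
chart. Uniqueness of integral curves in the tangent bundle relies on this. -/
instance tangentBundle_t2Space [T2Space Q] : T2Space (TangentBundle (𝓡 n) Q) := by
  refine ⟨fun p q hpq => ?_⟩
  by_cases h : p.proj = q.proj
  · have hp := mem_extChartAt_source (I := (𝓡 n).tangent) p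
    have hq : q ∈ (extChartAt (𝓡 n).tangent p).source := by
      rw [tangent_extChartAt_source, ← h]; exact mem_extChartAt_source _
    have hne : extChartAt (𝓡 n).tangent p p ≠ extChartAt (𝓡 n).tangent p q := fun h' =>
      hpq ((extChartAt (𝓡 n).tangent p).injOn hp hq h')
    obtain ⟨u, v, hu, hv, hpu, hqv, huv⟩ := t2_separation hne
    have hc := continuousOn_extChartAt (I := (𝓡 n).tangent) p
    have ho := isOpen_extChartAt_source (I := (𝓡 n).tangent) p
    exact ⟨_, _, hc.isOpen_inter_preimage ho hu, hc.isOpen_inter_preimage ho hv, ⟨hp, hpu⟩,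
      ⟨hq, hqv⟩, Set.disjoint_left.2 fun x hx hx' => Set.disjoint_left.1 huv hx.2 hx'.2⟩
  · obtain ⟨u, v, hu, hv, hpu, hqv, huv⟩ := t2_separation h
    have hc : Continuous (TotalSpace.proj : TangentBundle (𝓡 n) Q → Q) :=
      FiberBundle.continuous_proj E _
    exact ⟨_, _, hu.preimage hc, hv.preimage hc, hpu, hqv, huv.preimage _⟩

end GeodesicField

lemma hasDerivAt_comp_fderiv {E F : Type*} [NormedAddCommGroup E] [NormedSpace ℝ E]
    [NormedAddCommGroup F] [NormedSpace ℝ F] {G : E → F} {c : ℝ → E} {t : ℝ} {v : E}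
    (hG : DifferentiableAt ℝ G (c t)) (hc : HasDerivAt c v t) :
    HasDerivAt (fun s => G (c s)) (fderiv ℝ G (c t) v) t :=
  hG.hasFDerivAt.comp_hasDerivAt t hc

lemma hasMFDerivAt_of_hasDerivAt_extChartAt {E : Type*} [NormedAddCommGroup E] [NormedSpace ℝ E]
    {H : Type*} [TopologicalSpace H] {I : ModelWithCorners ℝ E H} {M : Type*} [TopologicalSpace M]
    [ChartedSpace H M] {γ : ℝ → M} {t : ℝ} {X : E} (hc : ContinuousAt γ t)
    (h : HasDerivAt (fun s => extChartAt I (γ t) (γ s)) X t) :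
    HasMFDerivAt 𝓘(ℝ, ℝ) I γ t ((1 : ℝ →L[ℝ] ℝ).smulRight X : ℝ →L[ℝ] E) := by
  refine ⟨hc, ?_⟩
  have h1 := h.hasFDerivAt.hasFDerivWithinAt (s := Set.range 𝓘(ℝ, ℝ))
  refine h1.congr_fderiv ?_
  ext; simp

lemma hasDerivAt_comp_of_hasMFDerivAt {E : Type*} [NormedAddCommGroup E] [NormedSpace ℝ E]
    {H : Type*} [TopologicalSpace H] {I : ModelWithCorners ℝ E H} {M : Type*} [TopologicalSpace M]
    [ChartedSpace H M] {F : Type*} [NormedAddCommGroup F] [NormedSpace ℝ F] {γ : ℝ → M}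
    {f : M → F} {t : ℝ} {X : E} {L : E →L[ℝ] F}
    (hγ : HasMFDerivAt 𝓘(ℝ, ℝ) I γ t ((1 : ℝ →L[ℝ] ℝ).smulRight X : ℝ →L[ℝ] E))
    (hf : HasMFDerivAt I 𝓘(ℝ, F) f (γ t) L) : HasDerivAt (fun s => f (γ s)) (L X) t := by
  have h1 : HasFDerivAt (f ∘ γ) (L.comp ((1 : ℝ →L[ℝ] ℝ).smulRight X)) t :=
    hasMFDerivAt_iff_hasFDerivAt.1 (HasMFDerivAt.comp t hf hγ)
  have h2 := h1.hasDerivAt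
  rwa [ContinuousLinearMap.comp_apply, ContinuousLinearMap.smulRight_apply, one_apply_eq_self,
    one_smul] at h2

set_option synthInstance.maxHeartbeats 200000 in
-- Twice the geodesic equation tested with the velocity itself is the derivative of the squared
-- speed.
lemma hasDerivAt_metric_of_geodesicExpr_eq_zero {E : Type*} [NormedAddCommGroup E]
    [NormedSpace ℝ E] {G : E → E →L[ℝ] E →L[ℝ] ℝ} {c : ℝ → E × E} {t : ℝ} {a : E}
    (hG : DifferentiableAt ℝ G (c t).1) (hsymm : ∀ u w, G (c t).1 u w = G (c t).1 w u)
    (hc : HasDerivAt c ((c t).2, a) t) (h : geodesicExpr G (c t).1 (c t).2 a (c t).2 = 0) :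
    HasDerivAt (fun s => G (c s).1 (c s).2 (c s).2) 0 t := by
  have h1 : HasDerivAt (fun s => (c s).1) (c t).2 t := hc.fst
  have h2 : HasDerivAt (fun s => (c s).2) a t := hc.snd
  have h0 := hasDerivAt_comp_fderiv (F := E →L[ℝ] E →L[ℝ] ℝ) hG h1
  have h3 := (h0.clm_apply h2).clm_apply h2
  refine h3.congr_deriv ?_
  unfold geodesicExpr at h
  simp only [add_apply]
  rw [hsymm (c t).2 a]
  linarith

/-! ### The geodesic flow: group law, conservation of speed, smoothness -/

section GeodesicFlow

variable {n : ℕ} {Q : Type*} [TopologicalSpace Q] [ChartedSpace (EuclideanSpace ℝ (Fin n)) Q]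
  [IsManifold (𝓡 n) ∞ Q] {g : Metric (n := n) Q}

local notation "E" => EuclideanSpace ℝ (Fin n)

lemma geodesicFlow_zero (hg : IsGeodesicallyComplete g) (p : TangentBundle (𝓡 n) Q) :
    geodesicFlow g 0 p = p := by
  unfold geodesicFlow
  rw [dif_pos (hg p)]
  exact (hg p).choose_spec.1

lemma isMIntegralCurve_geodesicFlow (hg : IsGeodesicallyComplete g) (p : TangentBundle (𝓡 n) Q) :
    IsMIntegralCurve (I := (𝓡 n).tangent) (fun t => geodesicFlow g t p) (geodesicField g) := by
  have h : (fun t => geodesicFlow g t p) = (hg p).choose := by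
    funext t
    unfold geodesicFlow
    rw [dif_pos (hg p)]
  rw [h]
  exact (hg p).choose_spec.2

lemma contMDiff_one_geodesicField :
    ContMDiff (𝓡 n).tangent (𝓡 n).tangent.tangent 1 (fun p : TangentBundle (𝓡 n) Q =>
      (⟨p, geodesicField g p⟩ : TangentBundle (𝓡 n).tangent (TangentBundle (𝓡 n) Q))) :=
  (contMDiff_geodesicField g).of_le (WithTop.coe_le_coe.2 (le_top (a := (1 : ℕ∞))))

lemma geodesicFlow_add [T2Space Q] (hg : IsGeodesicallyComplete g) (s t : ℝ)
    (p : TangentBundle (𝓡 n) Q) :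
    geodesicFlow g (s + t) p = geodesicFlow g s (geodesicFlow g t p) := by
  have h1 := (isMIntegralCurve_geodesicFlow hg p).comp_add t
  have h2 := isMIntegralCurve_geodesicFlow hg (geodesicFlow g t p)
  have h3 := isMIntegralCurve_Ioo_eq_of_contMDiff_boundaryless (t₀ := 0)
    contMDiff_one_geodesicField h1 h2 (by
      simp only [Function.comp_apply, zero_add]
      rw [geodesicFlow_zero hg])
  exact congrFun h3 s

lemma continuous_geodesicFlow_left (hg : IsGeodesicallyComplete g) (p : TangentBundle (𝓡 n) Q) :
    Continuous fun t => geodesicFlow g t p :=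
  continuous_iff_continuousAt.2 fun t => (isMIntegralCurve_geodesicFlow hg p t).1

lemma hasDerivAt_geodesicFlow_inChart (hg : IsGeodesicallyComplete g)
    {p p₀ : TangentBundle (𝓡 n) Q} {t : ℝ}
    (h : (geodesicFlow g t p).proj ∈ (extChartAt (𝓡 n) p₀.proj).source) :
    HasDerivAt (fun s => (extChartAt (𝓡 n).tangent p₀ (geodesicFlow g s p) : E × E))
      (geodesicFieldInChart g p₀.proj (extChartAt (𝓡 n).tangent p₀ (geodesicFlow g t p))) t := by
  have h1 := hasDerivAt_extChartAt_comp (I := (𝓡 n).tangent) (x₀ := p₀)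
    (isMIntegralCurve_geodesicFlow hg p t) ((tangent_extChartAt_source _ _).2 h)
  rw [tangentCoordChange_geodesicField g h] at h1
  exact h1

variable (g) in
lemma inner_eq_metricInChart {p₀ p : TangentBundle (𝓡 n) Q}
    (hp : p.proj ∈ (extChartAt (𝓡 n) p₀.proj).source) :
    g.inner p.proj p.snd p.snd = metricInChart g p₀.proj (extChartAt (𝓡 n).tangent p₀ p).1
      (extChartAt (𝓡 n).tangent p₀ p).2 (extChartAt (𝓡 n).tangent p₀ p).2 := by
  obtain ⟨v, hv⟩ : ∃ v : E, p.snd = v := ⟨_, rfl⟩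
  have h1 := metricInChart_extChartAt g hp (tangentCoordChange (𝓡 n) p.proj p₀.proj p.proj v)
    (tangentCoordChange (𝓡 n) p.proj p₀.proj p.proj v)
  have hxx : p.proj ∈ (extChartAt (𝓡 n) p.proj).source := mem_extChartAt_source _
  rw [tangentCoordChange_comp ⟨⟨hxx, hp⟩, hxx⟩, tangentCoordChange_self hxx] at h1
  rw [tangent_extChartAt_apply, hv]
  exact h1.symm

/-- Conservation of speed. It keeps geodesics from phase space points inside the unit tangent
bundle, hence in the phase space as long as they avoid `Ω`. -/
lemma inner_geodesicFlow (hg : IsGeodesicallyComplete g) (p : TangentBundle (𝓡 n) Q) (t : ℝ) :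
    g.inner (geodesicFlow g t p).proj (geodesicFlow g t p).snd (geodesicFlow g t p).snd
      = g.inner p.proj p.snd p.snd := by
  have key : ∀ t, HasDerivAt (fun s => (g.inner (geodesicFlow g s p).proj (geodesicFlow g s p).snd
      (geodesicFlow g s p).snd : ℝ)) 0 t := by
    intro t
    set p₀ := geodesicFlow g t p with hp₀
    have hsrc : p₀.proj ∈ (extChartAt (𝓡 n) p₀.proj).source := mem_extChartAt_source _
    have hcont := (FiberBundle.continuous_proj E (TangentSpace (𝓡 n) : Q → Type _)).comp
      (continuous_geodesicFlow_left hg p)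
    have hev : ∀ᶠ s in 𝓝 t, (geodesicFlow g s p).proj ∈ (extChartAt (𝓡 n) p₀.proj).source :=
      hcont.continuousAt.eventually_mem ((isOpen_extChartAt_source p₀.proj).mem_nhds hsrc)
    have heq : (fun s => (g.inner (geodesicFlow g s p).proj (geodesicFlow g s p).snd
        (geodesicFlow g s p).snd : ℝ)) =ᶠ[𝓝 t] fun s => metricInChart g p₀.proj
          (extChartAt (𝓡 n).tangent p₀ (geodesicFlow g s p)).1
          (extChartAt (𝓡 n).tangent p₀ (geodesicFlow g s p)).2
          (extChartAt (𝓡 n).tangent p₀ (geodesicFlow g s p)).2 := by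
      filter_upwards [hev] with s hs using inner_eq_metricInChart g hs
    refine HasDerivAt.congr_of_eventuallyEq ?_ heq
    have hc := hasDerivAt_geodesicFlow_inChart hg (p₀ := p₀) (p := p) (t := t) hsrc
    rw [← hp₀] at hc
    have hct : extChartAt (𝓡 n).tangent p₀ (geodesicFlow g t p)
      = extChartAt (𝓡 n).tangent p₀ p₀ := rfl
    generalize hcd : (fun s => (extChartAt (𝓡 n).tangent p₀ (geodesicFlow g s p) : E × E)) = c
      at hc
    have hctt : c t = extChartAt (𝓡 n).tangent p₀ p₀ := by rw [← hcd]
    have hgoal : (fun s => metricInChart g p₀.proj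
          (extChartAt (𝓡 n).tangent p₀ (geodesicFlow g s p)).1
          (extChartAt (𝓡 n).tangent p₀ (geodesicFlow g s p)).2
          (extChartAt (𝓡 n).tangent p₀ (geodesicFlow g s p)).2)
        = fun s => metricInChart g p₀.proj (c s).1 (c s).2 (c s).2 := by rw [← hcd]
    rw [hgoal]
    rw [← hctt] at hc
    have hy : (c t).1 ∈ (extChartAt (𝓡 n) p₀.proj).target := by
      rw [hctt]; exact mem_extChartAt_target p₀.proj
    have hG : DifferentiableAt ℝ (metricInChart g p₀.proj) (c t).1 :=
      ((contDiffOn_metricInChart g p₀.proj).contDiffAt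
        ((isOpen_extChartAt_target p₀.proj).mem_nhds hy)).differentiableAt (by simp)
    have hpos := fun u hu => metricInChart_pos g hy u hu
    have hacc := geodesicExpr_geodesicAccel hpos (c t).2 (c t).2
    exact hasDerivAt_metric_of_geodesicExpr_eq_zero hG (metricInChart_symm g _ _) hc hacc
  have h1 := is_const_of_deriv_eq_zero (fun t => (key t).differentiableAt)
    (fun t => (key t).deriv) t 0
  rw [h1, geodesicFlow_zero hg]

/-- The smooth local flow of the field in a chart, carried back to the tangent bundle, consists of
integral curves and agrees with the geodesic flow by uniqueness. -/
lemma exists_contMDiffOn_geodesicFlow [T2Space Q] (hg : IsGeodesicallyComplete g)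
    (p₀ : TangentBundle (𝓡 n) Q) :
    ∃ ε > 0, ∃ V : Set (TangentBundle (𝓡 n) Q), IsOpen V ∧ p₀ ∈ V ∧
      ContMDiffOn (𝓘(ℝ, ℝ).prod (𝓡 n).tangent) (𝓡 n).tangent ∞
        (fun x : ℝ × TangentBundle (𝓡 n) Q => geodesicFlow g x.1 x.2)
        (Set.Ioo (-ε) ε ×ˢ V) := by
  have hsrc := mem_extChartAt_source (I := (𝓡 n).tangent) p₀
  have htar : ∀ q : E × E, q ∈ (extChartAt (𝓡 n) p₀.proj).target ×ˢ (Set.univ : Set E) ↔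
      q ∈ (extChartAt (𝓡 n).tangent p₀).target := fun q => by
    rw [tangent_extChartAt_target]; simp
  obtain ⟨ε, V, S, hε, hV, hp₀V, hS, hflow⟩ := exists_smooth_localFlow
    ((isOpen_extChartAt_target p₀.proj).prod isOpen_univ)
    ((htar _).2 ((extChartAt (𝓡 n).tangent p₀).map_source hsrc))
    (contDiffOn_geodesicFieldInChart g p₀.proj)
  let V' := (extChartAt (𝓡 n).tangent p₀).source ∩ extChartAt (𝓡 n).tangent p₀ ⁻¹' V
  have hV' : IsOpen V' := (continuousOn_extChartAt p₀).isOpen_inter_preimage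
    (isOpen_extChartAt_source p₀) hV
  have hmem0 : (0 : ℝ) ∈ Set.Ioo (-ε) ε := ⟨by linarith, hε⟩
  refine ⟨ε, hε, V', hV', ⟨hsrc, hp₀V⟩, ?_⟩
  have heq : ∀ x ∈ Set.Ioo (-ε) ε ×ˢ V', geodesicFlow g x.1 x.2
      = (extChartAt (𝓡 n).tangent p₀).symm (S (x.1, extChartAt (𝓡 n).tangent p₀ x.2)) := by
    rintro ⟨t, p⟩ ⟨ht, hp⟩
    obtain ⟨h0, hf⟩ := hflow _ hp.2
    have h1 : IsMIntegralCurveOn (I := (𝓡 n).tangent) ((extChartAt (𝓡 n).tangent p₀).symm ∘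
        fun s => S (s, extChartAt (𝓡 n).tangent p₀ p)) (geodesicField g) (Set.Ioo (-ε) ε) := by
      intro s hs
      obtain ⟨hU, hd⟩ := hf s hs
      have hU' := (htar _).1 hU
      refine HasMFDerivAt.hasMFDerivWithinAt (hasMFDerivAt_extChartAt_symm_comp hU' ?_)
      have hps := (extChartAt (𝓡 n).tangent p₀).map_target hU'
      have key := tangentCoordChange_geodesicField g ((tangent_extChartAt_source _ _).1 hps)
      rw [(extChartAt (𝓡 n).tangent p₀).right_inv hU'] at key
      exact hd.congr_deriv key.symm
    have h2 : IsMIntegralCurveOn (I := (𝓡 n).tangent) (fun s => geodesicFlow g s p)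
        (geodesicField g) (Set.Ioo (-ε) ε) :=
      (isMIntegralCurve_geodesicFlow hg p).isMIntegralCurveOn _
    refine isMIntegralCurveOn_Ioo_eqOn_of_contMDiff_boundaryless hmem0
      contMDiff_one_geodesicField h2 h1 ?_ ht
    simp only [Function.comp_apply]
    rw [h0, geodesicFlow_zero hg, (extChartAt (𝓡 n).tangent p₀).left_inv hp.1]
  refine ContMDiffOn.congr ?_ heq
  refine (contMDiffOn_extChartAt_symm p₀).comp (t := (extChartAt (𝓡 n).tangent p₀).target)
    (f := fun x : ℝ × TangentBundle (𝓡 n) Q => S (x.1, extChartAt (𝓡 n).tangent p₀ x.2)) ?_ ?_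
  · have hch : ContMDiffOn (𝓡 n).tangent 𝓘(ℝ, E × E) ∞ (extChartAt (𝓡 n).tangent p₀) V' := by
      refine (contMDiffOn_extChartAt (I := (𝓡 n).tangent) (n := ∞) (x := p₀)).mono fun x hx => ?_
      rw [← extChartAt_source (𝓡 n).tangent]
      exact hx.1
    have hpair : ContMDiffOn (𝓘(ℝ, ℝ).prod (𝓡 n).tangent) 𝓘(ℝ, ℝ × (E × E)) ∞
        (fun x : ℝ × TangentBundle (𝓡 n) Q => (x.1, extChartAt (𝓡 n).tangent p₀ x.2))
        (Set.Ioo (-ε) ε ×ˢ V') :=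
      contMDiffOn_fst.prodMk_space (hch.comp contMDiffOn_snd fun x hx => hx.2)
    exact (contMDiffOn_iff_contDiffOn.2 hS).comp hpair fun x hx => ⟨hx.1, hx.2.2⟩
  · intro x hx
    exact (htar _).1 (((hflow _ hx.2.2).2 _ hx.1).1)

/-- The set of times at which the flow is smooth at `p` is open and closed. Near the point reached
at time `t`, short time flow is smooth, and the group law transfers smoothness between any two times
close to `t`. -/
lemma contMDiff_geodesicFlow [T2Space Q] (hg : IsGeodesicallyComplete g) :
    ContMDiff (𝓘(ℝ, ℝ).prod (𝓡 n).tangent) (𝓡 n).tangent ∞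
      (fun x : ℝ × TangentBundle (𝓡 n) Q => geodesicFlow g x.1 x.2) := by
  rintro ⟨t, p⟩
  let Z : Set ℝ := {t | ContMDiffAt (𝓘(ℝ, ℝ).prod (𝓡 n).tangent) (𝓡 n).tangent ∞
      (fun x : ℝ × TangentBundle (𝓡 n) Q => geodesicFlow g x.1 x.2) (t, p)}
  have step : ∀ t : ℝ, ∃ ε > 0, ∀ s s' : ℝ, |s - t| < ε → |s' - t| < ε → s ∈ Z → s' ∈ Z := by
    intro t
    obtain ⟨ε, hε, V, hV, hpV, hsm⟩ := exists_contMDiffOn_geodesicFlow hg (geodesicFlow g t p)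
    have hc := (continuous_geodesicFlow_left hg p).continuousAt.eventually_mem
      (hV.mem_nhds hpV)
    obtain ⟨δ, hδ, hδ'⟩ := Metric.eventually_nhds_iff.1 hc
    refine ⟨min δ (ε / 2), lt_min hδ (by linarith), fun s s' hs hs' hsZ => ?_⟩
    have hsV : geodesicFlow g s p ∈ V := hδ' (by
      rw [Real.dist_eq]; exact lt_of_lt_of_le hs (min_le_left _ _))
    have h1 := lt_of_lt_of_le hs (min_le_right _ _)
    have h2 := lt_of_lt_of_le hs' (min_le_right _ _)
    rw [abs_lt] at h1 h2
    have heq : (fun x : ℝ × TangentBundle (𝓡 n) Q => geodesicFlow g x.1 x.2)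
        = fun x => geodesicFlow g (x.1 - s) (geodesicFlow g s x.2) := by
      funext x
      rw [← geodesicFlow_add hg, sub_add_cancel]
    change ContMDiffAt _ _ _ _ _
    rw [heq]
    have h3 : ContMDiffAt (𝓘(ℝ, ℝ).prod (𝓡 n).tangent) (𝓡 n).tangent ∞
        (fun x : ℝ × TangentBundle (𝓡 n) Q => geodesicFlow g x.1 x.2)
        (s' - s, geodesicFlow g s p) :=
      hsm.contMDiffAt ((isOpen_Ioo.prod hV).mem_nhds ⟨⟨by simp only; linarith,
        by simp only; linarith⟩, hsV⟩)
    have h4 : ContMDiffAt (𝓘(ℝ, ℝ).prod (𝓡 n).tangent) (𝓡 n).tangent ∞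
        (fun x : ℝ × TangentBundle (𝓡 n) Q => geodesicFlow g s x.2) (s', p) :=
      ContMDiffAt.comp (s', p) (g := fun x : ℝ × TangentBundle (𝓡 n) Q => geodesicFlow g x.1 x.2)
        (f := fun x : ℝ × TangentBundle (𝓡 n) Q => (s, x.2)) hsZ
        (contMDiffAt_const.prodMk contMDiffAt_snd)
    have h5 : ContMDiffAt (𝓘(ℝ, ℝ).prod (𝓡 n).tangent) 𝓘(ℝ, ℝ) ∞
        (fun x : ℝ × TangentBundle (𝓡 n) Q => x.1 - s) (s', p) :=
      contMDiffAt_fst.sub contMDiffAt_const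
    exact ContMDiffAt.comp (s', p)
      (g := fun x : ℝ × TangentBundle (𝓡 n) Q => geodesicFlow g x.1 x.2)
      (f := fun x : ℝ × TangentBundle (𝓡 n) Q => (x.1 - s, geodesicFlow g s x.2)) h3
      (h5.prodMk h4)
  have h0 : (0 : ℝ) ∈ Z := by
    obtain ⟨ε, hε, V, hV, hpV, hsm⟩ := exists_contMDiffOn_geodesicFlow hg p
    exact hsm.contMDiffAt ((isOpen_Ioo.prod hV).mem_nhds ⟨⟨by simpa using hε, hε⟩, hpV⟩)
  have hopen : IsOpen Z := Metric.isOpen_iff.2 fun t ht => by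
    obtain ⟨ε, hε, h⟩ := step t
    exact ⟨ε, hε, fun s hs => h t s (by simpa using hε) (by simpa [Real.dist_eq] using hs) ht⟩
  have hclosed : IsClosed Z := isOpen_compl_iff.1 <| Metric.isOpen_iff.2 fun t ht => by
    obtain ⟨ε, hε, h⟩ := step t
    exact ⟨ε, hε, fun s hs hsZ => ht (h s t (by simpa [Real.dist_eq] using hs)
      (by simpa using hε) hsZ)⟩
  have huniv : Z = Set.univ := IsClopen.eq_univ ⟨hclosed, hopen⟩ ⟨0, h0⟩
  have : t ∈ Z := huniv ▸ Set.mem_univ t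
  exact this

/-- The derivative of a function along the base curve of a geodesic. -/
lemma hasDerivAt_comp_proj_geodesicFlow (hg : IsGeodesicallyComplete g)
    (p : TangentBundle (𝓡 n) Q) {ρ : Q → ℝ} {t : ℝ}
    (hρ : MDifferentiableAt (𝓡 n) 𝓘(ℝ, ℝ) ρ (geodesicFlow g t p).proj) :
    HasDerivAt (fun s => ρ (geodesicFlow g s p).proj)
      (mfderiv (𝓡 n) 𝓘(ℝ, ℝ) ρ (geodesicFlow g t p).proj (geodesicFlow g t p).snd : ℝ) t := by
  set p₀ := geodesicFlow g t p with hp₀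
  have hsrc : p₀.proj ∈ (extChartAt (𝓡 n) p₀.proj).source := mem_extChartAt_source _
  have hc := hasDerivAt_geodesicFlow_inChart hg (p₀ := p₀) (p := p) (t := t) hsrc
  rw [← hp₀] at hc
  have hc1 : HasDerivAt (fun s => extChartAt (𝓡 n) p₀.proj (geodesicFlow g s p).proj)
      (geodesicFieldInChart g p₀.proj (extChartAt (𝓡 n).tangent p₀ p₀)).1 t := hc.fst
  have hcd : HasDerivAt (fun s => extChartAt (𝓡 n) p₀.proj (geodesicFlow g s p).proj)
      (p₀.snd : E) t := hc1.congr_deriv (tangentCoordChange_self hsrc)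
  have hcont := (FiberBundle.continuous_proj E (TangentSpace (𝓡 n) : Q → Type _)).comp
    (continuous_geodesicFlow_left hg p)
  have h1 : HasMFDerivAt 𝓘(ℝ, ℝ) (𝓡 n) (fun s => (geodesicFlow g s p).proj) t
      ((1 : ℝ →L[ℝ] ℝ).smulRight p₀.snd : ℝ →L[ℝ] E) :=
    hasMFDerivAt_of_hasDerivAt_extChartAt hcont.continuousAt hcd
  exact hasDerivAt_comp_of_hasMFDerivAt h1 hρ.hasMFDerivAt

end GeodesicFlow

/-! ### Reflections, arcs and billiard trajectories -/

section Trajectories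

variable {n : ℕ} {Q : Type*} [TopologicalSpace Q] [ChartedSpace (EuclideanSpace ℝ (Fin n)) Q]
  [IsManifold (𝓡 n) ∞ Q] {g : Metric (n := n) Q} {Ω : Set Q}

lemma incl_injective : Function.Injective (incl g Ω) := Subtype.val_injective

lemma mem_interiorPart_or (z : PhaseSpace g Ω) :
    z ∈ interiorPart g Ω ∨ z ∈ inwardBoundary g Ω ∨ z ∈ outwardBoundary g Ω :=
  z.2.2.imp id fun h => (lt_or_gt_of_ne h.2).symm.imp (fun h' => ⟨h.1, h'⟩) fun h' => ⟨h.1, h'⟩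

/-- A defining function at `x` vanishes at `x`, which puts `x` into `Ω`; so away from `Ω` the
default value is taken. This makes the reflection the identity on the interior. -/
lemma inwardNormal_eq_zero_of_notMem {x : Q} (hx : x ∉ Ω) : inwardNormal g Ω x = 0 := by
  unfold inwardNormal
  split_ifs with h
  · obtain ⟨ν, -, ρ, ⟨h0, -, U, -, hxU, -, hU⟩, -⟩ := h
    exact absurd ((hU x hxU).2 h0.ge) hx
  · rfl

lemma reflectVector_reflectVector (p : TangentBundle (𝓡 n) Q) :
    reflectVector g Ω (reflectVector g Ω p) = p := by
  have h := normalPart_reflectVector g Ω p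
  obtain ⟨x, v⟩ := p
  unfold reflectVector at h ⊢
  simp only at h ⊢
  congr 1
  rw [h, sub_sub, ← add_smul]
  simp

lemma reflection_reflection (z : PhaseSpace g Ω) :
    reflection g Ω (reflection g Ω z) = z :=
  Subtype.ext (reflectVector_reflectVector z.1)

lemma incl_reflection (z : PhaseSpace g Ω) :
    incl g Ω (reflection g Ω z) = reflectVector g Ω (incl g Ω z) := rfl

lemma reflection_mem_outwardBoundary {z : PhaseSpace g Ω} (hz : z ∈ inwardBoundary g Ω) :
    reflection g Ω z ∈ outwardBoundary g Ω :=
  ⟨hz.1, by rw [incl_reflection, normalPart_reflectVector]; exact neg_neg_of_pos hz.2⟩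

lemma reflection_mem_inwardBoundary {z : PhaseSpace g Ω} (hz : z ∈ outwardBoundary g Ω) :
    reflection g Ω z ∈ inwardBoundary g Ω :=
  ⟨hz.1, by rw [incl_reflection, normalPart_reflectVector]; exact neg_pos_of_neg hz.2⟩

lemma reflection_of_mem_interiorPart {z : PhaseSpace g Ω} (hz : z ∈ interiorPart g Ω) :
    reflection g Ω z = z := by
  refine Subtype.ext ?_
  obtain ⟨⟨x, v⟩, hv⟩ := z
  change reflectVector g Ω ⟨x, v⟩ = ⟨x, v⟩
  unfold reflectVector
  simp only
  congr 1
  have hx : x ∉ Ω := hz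
  rw [inwardNormal_eq_zero_of_notMem hx, smul_zero, sub_zero]

lemma notMem_inwardBoundary_of_outward {z : PhaseSpace g Ω} (hz : z ∈ outwardBoundary g Ω) :
    z ∉ inwardBoundary g Ω := fun h => lt_asymm h.2 hz.2

omit [IsManifold (𝓡 n) ∞ Q] in
lemma notMem_frontier (hΩ : IsObstacle n Ω) {x : Q} (hx : x ∉ Ω) : x ∉ frontier Ω :=
  fun h => hx (hΩ.1.frontier_subset h)

lemma notMem_boundary_of_interior (hΩ : IsObstacle n Ω) {z : PhaseSpace g Ω}
    (hz : z ∈ interiorPart g Ω) : z ∉ inwardBoundary g Ω ∧ z ∉ outwardBoundary g Ω :=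
  ⟨fun h => notMem_frontier hΩ hz h.1, fun h => notMem_frontier hΩ hz h.1⟩

/-! ### The start of a trajectory -/

/-- Only the sign of the time matters. From here on `d = 1` or `d = -1` records the direction of
time, and forward and backward trajectories share their proofs. -/
lemma launch_congr {d s : ℝ} (h : 0 < d * s) (z : PhaseSpace g Ω) :
    launch g Ω s z = launch g Ω d z := by
  unfold launch
  have h1 : 0 < s ↔ 0 < d := ⟨fun hs => pos_of_mul_pos_left h hs.le, fun hd =>
    pos_of_mul_pos_right h hd.le⟩
  have h2 : s < 0 ↔ d < 0 := ⟨fun hs => by nlinarith, fun hd => by nlinarith⟩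
  have h3 : ((0 < s ∧ z ∈ inwardBoundary g Ω) ∨ (s < 0 ∧ z ∈ outwardBoundary g Ω)) ↔
      ((0 < d ∧ z ∈ inwardBoundary g Ω) ∨ (d < 0 ∧ z ∈ outwardBoundary g Ω)) := by rw [h1, h2]
  by_cases h4 : (0 < d ∧ z ∈ inwardBoundary g Ω) ∨ (d < 0 ∧ z ∈ outwardBoundary g Ω)
  · rw [if_pos (h3.2 h4), if_pos h4]
  · rw [if_neg (fun h => h4 (h3.1 h)), if_neg h4]

lemma launch_of_mem_interiorPart (hΩ : IsObstacle n Ω) {z : PhaseSpace g Ω}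
    (hz : z ∈ interiorPart g Ω) (s : ℝ) : launch g Ω s z = z := by
  have h := notMem_boundary_of_interior hΩ hz
  unfold launch
  rw [if_neg]
  rintro (h' | h')
  · exact h.1 h'.2
  · exact h.2 h'.2

lemma launch_of_inward {z : PhaseSpace g Ω} (hz : z ∈ inwardBoundary g Ω) {d : ℝ} (hd : 0 < d) :
    launch g Ω d z = reflection g Ω z := if_pos (Or.inl ⟨hd, hz⟩)

lemma launch_of_outward {z : PhaseSpace g Ω} (hz : z ∈ outwardBoundary g Ω) {d : ℝ} (hd : d < 0) :
    launch g Ω d z = reflection g Ω z := if_pos (Or.inr ⟨hd, hz⟩)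

lemma launch_of_inward_neg {z : PhaseSpace g Ω} (hz : z ∈ inwardBoundary g Ω) {d : ℝ}
    (hd : d < 0) : launch g Ω d z = z := if_neg (by
  rintro (h | h)
  · exact lt_asymm h.1 hd
  · exact notMem_inwardBoundary_of_outward h.2 hz)

lemma launch_of_outward_pos {z : PhaseSpace g Ω} (hz : z ∈ outwardBoundary g Ω) {d : ℝ}
    (hd : 0 < d) : launch g Ω d z = z := if_neg (by
  rintro (h | h)
  · exact notMem_inwardBoundary_of_outward hz h.2
  · exact lt_asymm h.1 hd)

lemma launch_eq_or (d : ℝ) (z : PhaseSpace g Ω) :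
    launch g Ω d z = z ∨ launch g Ω d z = reflection g Ω z := by
  unfold launch
  split_ifs
  · exact Or.inr rfl
  · exact Or.inl rfl

lemma launch_reflection {d : ℝ} (hd : d ≠ 0) (z : PhaseSpace g Ω) :
    launch g Ω d (reflection g Ω z) = launch g Ω d z := by
  rcases mem_interiorPart_or z with hz | hz | hz
  · rw [reflection_of_mem_interiorPart hz]
  · rcases lt_or_gt_of_ne hd with h | h
    · rw [launch_of_inward_neg hz h, launch_of_outward (reflection_mem_outwardBoundary hz) h,
        reflection_reflection]
    · rw [launch_of_inward hz h, launch_of_outward_pos (reflection_mem_outwardBoundary hz) h]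
  · rcases lt_or_gt_of_ne hd with h | h
    · rw [launch_of_outward hz h, launch_of_inward_neg (reflection_mem_inwardBoundary hz) h]
    · rw [launch_of_outward_pos hz h, launch_of_inward (reflection_mem_inwardBoundary hz) h,
        reflection_reflection]

lemma eq_or_eq_reflection_of_launch_eq {d : ℝ} {z w : PhaseSpace g Ω}
    (h : launch g Ω d w = launch g Ω d z) : w = z ∨ w = reflection g Ω z := by
  rcases launch_eq_or d w with hw | hw <;> rcases launch_eq_or d z with hz | hz <;>
    rw [hw, hz] at h
  · exact Or.inl h
  · exact Or.inr h
  · right; rw [← h, reflection_reflection]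
  · left; rw [← reflection_reflection w, h, reflection_reflection]

/-- The launched vector points away from the obstacle in the direction of time `d`; the choice
between a vector and its reflection serves this purpose. -/
lemma launch_interior_or_sign {d : ℝ} (hd : d ≠ 0) (z : PhaseSpace g Ω) :
    launch g Ω d z ∈ interiorPart g Ω ∨ ((incl g Ω (launch g Ω d z)).proj ∈ frontier Ω ∧
      d * normalPart g Ω (incl g Ω (launch g Ω d z)) < 0) := by
  rcases mem_interiorPart_or z with hz | hz | hz
  · rcases launch_eq_or d z with h | h <;> rw [h]
    · exact Or.inl hz
    · rw [reflection_of_mem_interiorPart hz]; exact Or.inl hz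
  · right
    rcases lt_or_gt_of_ne hd with h | h
    · rw [launch_of_inward_neg hz h]; exact ⟨hz.1, mul_neg_of_neg_of_pos h hz.2⟩
    · rw [launch_of_inward hz h]
      exact ⟨hz.1, mul_neg_of_pos_of_neg h (reflection_mem_outwardBoundary hz).2⟩
  · right
    rcases lt_or_gt_of_ne hd with h | h
    · rw [launch_of_outward hz h]
      exact ⟨hz.1, mul_neg_of_neg_of_pos h (reflection_mem_inwardBoundary hz).2⟩
    · rw [launch_of_outward_pos hz h]; exact ⟨hz.1, mul_neg_of_pos_of_neg h hz.2⟩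

/-! ### Geodesics at the boundary -/

lemma exists_isBoundaryDefiningAt_inwardNormal {x : Q} (h : inwardNormal g Ω x ≠ 0) :
    ∃ (ρ : Q → ℝ) (c : ℝ), 0 < c ∧ IsBoundaryDefiningAt n Ω x ρ ∧ ∀ w : TangentSpace (𝓡 n) x,
      (mfderiv (𝓡 n) 𝓘(ℝ, ℝ) ρ x w : ℝ) = c * g.inner x w (inwardNormal g Ω x) := by
  unfold inwardNormal at h ⊢
  split_ifs at h ⊢ with h1
  · obtain ⟨-, ρ, hρ, c, hc, hcρ⟩ := h1.choose_spec
    exact ⟨ρ, c, hc, hρ, fun w => by rw [hcρ, g.symm]⟩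
  · exact absurd rfl h

lemma inwardNormal_ne_zero {p : TangentBundle (𝓡 n) Q} (h : normalPart g Ω p ≠ 0) :
    inwardNormal g Ω p.proj ≠ 0 := fun h0 => h (by unfold normalPart; rw [h0, map_zero])

omit [IsManifold (𝓡 n) ∞ Q] in
lemma IsBoundaryDefiningAt.mdifferentiableAt {x : Q} {ρ : Q → ℝ}
    (h : IsBoundaryDefiningAt n Ω x ρ) : MDifferentiableAt (𝓡 n) 𝓘(ℝ, ℝ) ρ x := by
  obtain ⟨-, -, U, hU, hxU, hs, -⟩ := h
  exact (hs.contMDiffAt (hU.mem_nhds hxU)).mdifferentiableAt (by simp)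

lemma continuous_proj_geodesicFlow (hg : IsGeodesicallyComplete g) (p : TangentBundle (𝓡 n) Q) :
    Continuous fun t => (geodesicFlow g t p).proj :=
  (FiberBundle.continuous_proj (EuclideanSpace ℝ (Fin n)) (TangentSpace (𝓡 n) : Q → Type _)).comp
    (continuous_geodesicFlow_left hg p)

/-- Transversality: along the geodesic a defining function vanishes at time 0 and has derivative a
positive multiple of the normal part, which fixes its sign at small times. -/
lemma eventually_mem_obstacle_iff (hg : IsGeodesicallyComplete g) {p : TangentBundle (𝓡 n) Q}
    (h : normalPart g Ω p ≠ 0) :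
    ∀ᶠ s in 𝓝 (0 : ℝ), s ≠ 0 → ((geodesicFlow g s p).proj ∈ Ω ↔ 0 < s * normalPart g Ω p) := by
  obtain ⟨ρ, c, hc, hρ, hd⟩ := exists_isBoundaryDefiningAt_inwardNormal (inwardNormal_ne_zero h)
  have hdiff := hρ.mdifferentiableAt
  obtain ⟨h0, -, U, hU, hxU, hs, hΩ⟩ := hρ
  have hp0 := geodesicFlow_zero hg p
  have hder := hasDerivAt_comp_proj_geodesicFlow hg p (ρ := ρ) (t := 0) (by rwa [hp0])
  rw [hp0, hd] at hder
  change HasDerivAt _ (c * normalPart g Ω p) 0 at hder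
  have hU' : ∀ᶠ s in 𝓝 (0 : ℝ), (geodesicFlow g s p).proj ∈ U :=
    (continuous_proj_geodesicFlow hg p).continuousAt.eventually_mem
      (hU.mem_nhds (by rwa [hp0]))
  have hslope := hasDerivAt_iff_tendsto_slope.1 hder
  have hpos : ∀ᶠ s in 𝓝[≠] (0 : ℝ),
      0 < slope (fun s => ρ (geodesicFlow g s p).proj) 0 s * normalPart g Ω p := by
    refine (hslope.mul_const _).eventually (lt_mem_nhds ?_)
    rw [mul_assoc]
    exact mul_pos hc (mul_self_pos.2 h)
  filter_upwards [hU', eventually_nhdsWithin_iff.1 hpos] with s hsU hs' hs0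
  have h1 := hs' hs0
  rw [slope_def_field, hp0, h0] at h1
  simp only [sub_zero] at h1
  rw [hΩ _ hsU]
  set y := ρ (geodesicFlow g s p).proj
  have h2 : 0 < y * (s * normalPart g Ω p) := by
    have : y * (s * normalPart g Ω p) = (y / s * normalPart g Ω p) * (s * s) := by
      field_simp
    rw [this]
    exact mul_pos h1 (mul_self_pos.2 hs0)
  constructor
  · intro hy; exact pos_of_mul_pos_right h2 hy
  · intro hy; exact (pos_of_mul_pos_left h2 hy.le).le

/-! ### Arcs -/

lemma mem_uIoo_iff_of_mul_pos {d s : ℝ} (hd : d = 1 ∨ d = -1) (hs : 0 < d * s) (r : ℝ) :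
    r ∈ Set.uIoo 0 s ↔ 0 < d * r ∧ d * r < d * s := by
  rcases hd with rfl | rfl
  · rw [Set.uIoo_of_lt (by linarith), Set.mem_Ioo]; simp
  · rw [Set.uIoo_of_gt (by linarith), Set.mem_Ioo]
    constructor
    · rintro ⟨h1, h2⟩; exact ⟨by linarith, by linarith⟩
    · rintro ⟨h1, h2⟩; exact ⟨by linarith, by linarith⟩

lemma exists_direction {s : ℝ} (hs : s ≠ 0) : ∃ d : ℝ, (d = 1 ∨ d = -1) ∧ 0 < d * s := by
  rcases lt_or_gt_of_ne hs with h | h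
  · exact ⟨-1, Or.inr rfl, by linarith⟩
  · exact ⟨1, Or.inl rfl, by linarith⟩

lemma direction_ne_zero {d : ℝ} (hd : d = 1 ∨ d = -1) : d ≠ 0 := by
  rcases hd with rfl | rfl <;> norm_num

lemma direction_cancel {d s t : ℝ} (hd : d = 1 ∨ d = -1) (h : d * s = d * t) : s = t :=
  mul_left_cancel₀ (direction_ne_zero hd) h

lemma IsArc.eq {s : ℝ} {z w w' : PhaseSpace g Ω} (h : IsArc g Ω s z w) (h' : IsArc g Ω s z w') :
    w = w' := incl_injective (h.2.1.symm.trans h'.2.1)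

/-- The end of the shorter arc is passed by the longer one strictly inside its time interval, hence
outside `Ω`. -/
lemma IsArc.split [T2Space Q] (hg : IsGeodesicallyComplete g) {d s s' : ℝ}
    (hd : d = 1 ∨ d = -1) (hs : 0 < d * s) (hss : d * s < d * s') {z w w' : PhaseSpace g Ω}
    (h : IsArc g Ω s z w) (h' : IsArc g Ω s' z w') :
    w ∈ interiorPart g Ω ∧ IsArc g Ω (s' - s) w w' := by
  have hs' : 0 < d * s' := hs.trans hss
  have hsub : 0 < d * (s' - s) := by rw [mul_sub]; linarith
  refine ⟨?_, right_ne_zero_of_mul hsub.ne', ?_, fun r hr => ?_⟩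
  · have := h'.2.2 s ((mem_uIoo_iff_of_mul_pos hd hs' s).2 ⟨hs, hss⟩)
    rwa [h.2.1] at this
  · rw [← h.2.1, ← geodesicFlow_add hg, sub_add_cancel, h'.2.1]
  · rw [← h.2.1, ← geodesicFlow_add hg]
    rw [mem_uIoo_iff_of_mul_pos hd hsub] at hr
    refine h'.2.2 _ ((mem_uIoo_iff_of_mul_pos hd hs' _).2 ?_)
    rw [mul_add]
    rw [mul_sub] at hr
    exact ⟨by linarith, by linarith⟩

lemma exists_phasePoint (hg : IsGeodesicallyComplete g) (z : PhaseSpace g Ω) {r : ℝ}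
    (h : (geodesicFlow g r (incl g Ω z)).proj ∉ Ω) :
    ∃ w ∈ interiorPart g Ω, geodesicFlow g r (incl g Ω z) = incl g Ω w :=
  ⟨⟨geodesicFlow g r (incl g Ω z), by rw [inner_geodesicFlow hg]; exact z.2.1, Or.inl h⟩, h, rfl⟩

lemma IsArc.exists_prefix (hg : IsGeodesicallyComplete g) {d r s : ℝ} (hd : d = 1 ∨ d = -1)
    (hr : 0 < d * r) (hrs : d * r < d * s) {z w : PhaseSpace g Ω} (h : IsArc g Ω s z w) :
    ∃ w₀ ∈ interiorPart g Ω, IsArc g Ω r z w₀ := by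
  have hs := hr.trans hrs
  obtain ⟨w₀, hw₀, hw₀'⟩ := exists_phasePoint hg z
    (h.2.2 r ((mem_uIoo_iff_of_mul_pos hd hs r).2 ⟨hr, hrs⟩))
  refine ⟨w₀, hw₀, right_ne_zero_of_mul hr.ne', hw₀', fun r' hr' => ?_⟩
  rw [mem_uIoo_iff_of_mul_pos hd hr] at hr'
  exact h.2.2 r' ((mem_uIoo_iff_of_mul_pos hd hs r').2 ⟨hr'.1, hr'.2.trans hrs⟩)

/-- With the opposite sign the geodesic would be inside `Ω` just before its arrival, contradicting
that an arc avoids `Ω` at intermediate times. -/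
lemma IsArc.sign_of_mem [T2Space Q] (hg : IsGeodesicallyComplete g) {s : ℝ}
    {z w : PhaseSpace g Ω} (h : IsArc g Ω s z w) (hw : w ∉ interiorPart g Ω) :
    0 < s * normalPart g Ω (incl g Ω w) := by
  have hne : normalPart g Ω (incl g Ω w) ≠ 0 := by
    rcases mem_interiorPart_or w with h1 | h1 | h1
    · exact absurd h1 hw
    · exact h1.2.ne'
    · exact h1.2.ne
  by_contra hcon
  have hneg : s * normalPart g Ω (incl g Ω w) < 0 :=
    lt_of_le_of_ne (not_lt.1 hcon) (mul_ne_zero h.1 hne)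
  obtain ⟨ε, hε, hev⟩ := Metric.eventually_nhds_iff.1 (eventually_mem_obstacle_iff hg hne)
  obtain ⟨d, hd, hds⟩ := exists_direction h.1
  -- Small enough for the local description of `Ω` at the end point, and for going back by `τ` to
  -- remain strictly inside the arc.
  set τ := min (ε / 2) (d * s / 2) with hτ
  have hτ0 : 0 < τ := lt_min (by linarith) (by linarith)
  have hτε : τ < ε := lt_of_le_of_lt (min_le_left _ _) (by linarith)
  have hτs : τ < d * s := lt_of_le_of_lt (min_le_right _ _) (by linarith)
  have hdd : d * d = 1 := by rcases hd with rfl | rfl <;> norm_num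
  have h1 := hev (y := -d * τ) (by
    rw [Real.dist_eq, sub_zero, abs_mul, abs_neg]
    rcases hd with rfl | rfl <;> simp [abs_of_pos hτ0, hτε])
    (mul_ne_zero (neg_ne_zero.2 (direction_ne_zero hd)) hτ0.ne')
  have h2 : (geodesicFlow g (-d * τ) (incl g Ω w)).proj ∉ Ω := by
    rw [← h.2.1, ← geodesicFlow_add hg]
    refine h.2.2 _ ((mem_uIoo_iff_of_mul_pos hd hds _).2 ?_)
    have : d * (-d * τ + s) = d * s - τ := by linear_combination (-τ) * hdd
    rw [this]
    exact ⟨by linarith, by linarith⟩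
  refine h2 (h1.2 ?_)
  have h3 : (-d * τ) * normalPart g Ω (incl g Ω w) * (s * s)
      = τ * (d * s) * (-(s * normalPart g Ω (incl g Ω w))) := by ring
  have h4 : 0 < τ * (d * s) * (-(s * normalPart g Ω (incl g Ω w))) :=
    mul_pos (mul_pos hτ0 hds) (by linarith)
  rw [← h3] at h4
  exact pos_of_mul_pos_left h4 (mul_self_nonneg s)

lemma IsArc.end_mem_inwardBoundary [T2Space Q] (hg : IsGeodesicallyComplete g) {s : ℝ}
    (hs : 0 < s) {z w : PhaseSpace g Ω} (h : IsArc g Ω s z w) (hw : w ∉ interiorPart g Ω) :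
    w ∈ inwardBoundary g Ω := by
  have h1 := pos_of_mul_pos_right (h.sign_of_mem hg hw) hs.le
  rcases mem_interiorPart_or w with h2 | h2 | h2
  · exact absurd h2 hw
  · exact h2
  · exact absurd h1 (not_lt.2 h2.2.le)

/-- Short geodesic arcs exist in both directions. -/
lemma exists_short_arcs (hg : IsGeodesicallyComplete g) (hΩ : IsObstacle n Ω) {d : ℝ}
    (hd : d = 1 ∨ d = -1) (z : PhaseSpace g Ω) :
    ∃ ε > 0, ∀ s, 0 < d * s → d * s < ε →
      ∃ w ∈ interiorPart g Ω, IsArc g Ω s (launch g Ω d z) w := by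
  have key : ∀ᶠ s in 𝓝 (0 : ℝ), 0 < d * s →
      (geodesicFlow g s (incl g Ω (launch g Ω d z))).proj ∉ Ω := by
    rcases launch_interior_or_sign (direction_ne_zero hd) z with h | ⟨-, h⟩
    · have : ∀ᶠ s in 𝓝 (0 : ℝ),
          (geodesicFlow g s (incl g Ω (launch g Ω d z))).proj ∈ Ωᶜ :=
        (continuous_proj_geodesicFlow hg _).continuousAt.eventually_mem
          (hΩ.1.isOpen_compl.mem_nhds (by rw [geodesicFlow_zero hg]; exact h))
      exact this.mono fun s hs _ => hs
    · filter_upwards [eventually_mem_obstacle_iff hg (right_ne_zero_of_mul h.ne)] with s hs hds hmem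
      have h1 := (hs (right_ne_zero_of_mul hds.ne')).1 hmem
      have hdd : d * d = 1 := by rcases hd with rfl | rfl <;> norm_num
      have h2 : s * normalPart g Ω (incl g Ω (launch g Ω d z))
        = (d * s) * (d * normalPart g Ω (incl g Ω (launch g Ω d z))) := by
        linear_combination (-s * normalPart g Ω (incl g Ω (launch g Ω d z))) * hdd
      rw [h2] at h1
      exact absurd h1 (not_lt.2 (mul_neg_of_pos_of_neg hds h).le)
  obtain ⟨ε, hε, hev⟩ := Metric.eventually_nhds_iff.1 key
  have hev' : ∀ s, 0 < d * s → d * s < ε →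
      (geodesicFlow g s (incl g Ω (launch g Ω d z))).proj ∉ Ω := fun s h1 h2 => hev (by
    rw [Real.dist_eq, sub_zero]
    rcases hd with rfl | rfl
    · rw [abs_of_pos (by linarith)]; linarith
    · rw [abs_of_neg (by linarith)]; linarith) h1
  refine ⟨ε, hε, fun s h1 h2 => ?_⟩
  obtain ⟨w, hw, hw'⟩ := exists_phasePoint hg _ (hev' s h1 h2)
  refine ⟨w, hw, right_ne_zero_of_mul h1.ne', hw', fun r hr => ?_⟩
  rw [mem_uIoo_iff_of_mul_pos hd h1] at hr
  exact hev' r hr.1 (hr.2.trans h2)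

/-! ### Trajectories -/

/-- The condition `0 ≤ t * s` in a step forces both pieces to have the direction of the total time,
so that inductions on trajectories can fix a direction. -/
lemma direction_of_step {d t s : ℝ} (hd : d = 1 ∨ d = -1) (hts : 0 ≤ t * s) (hs : s ≠ 0)
    (h : 0 ≤ d * (t + s)) : 0 ≤ d * t ∧ 0 < d * s := by
  have h1 : 0 < d * s := by
    rcases lt_or_gt_of_ne hs with h' | h' <;> rcases hd with rfl | rfl <;> nlinarith
  have h2 : 0 ≤ d * t := by
    by_contra hcon
    have h3 : (d * t) * (d * s) < 0 := mul_neg_of_neg_of_pos (not_le.1 hcon) h1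
    have h4 : (d * t) * (d * s) = (d * d) * (t * s) := by ring
    rw [h4] at h3
    exact absurd (mul_nonneg (mul_self_nonneg d) hts) (not_le.2 h3)
  exact ⟨h2, h1⟩

lemma mul_nonneg_of_direction {d t s : ℝ} (hd : d = 1 ∨ d = -1) (ht : 0 ≤ d * t)
    (hs : 0 ≤ d * s) : 0 ≤ t * s := by
  have hdd : d * d = 1 := by rcases hd with rfl | rfl <;> norm_num
  have : t * s = (d * t) * (d * s) := by linear_combination (-t * s) * hdd
  rw [this]
  exact mul_nonneg ht hs

lemma FlowsTo.single {s : ℝ} {z w : PhaseSpace g Ω} (h : IsArc g Ω s (launch g Ω s z) w) :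
    FlowsTo g Ω s z w := by
  have := FlowsTo.step (FlowsTo.refl z) (by simp) h
  rwa [zero_add] at this

lemma FlowsTo.eq_of_zero {t : ℝ} {z w : PhaseSpace g Ω} (h : FlowsTo g Ω t z w) (ht : t = 0) :
    w = z := by
  cases h with
  | refl => rfl
  | step h hs harc =>
    have := (direction_of_step (Or.inl rfl : (1 : ℝ) = 1 ∨ (1 : ℝ) = -1) hs harc.1 (by rw [ht]; simp))
    have := mul_nonneg_of_direction (Or.inl rfl : (1 : ℝ) = 1 ∨ (1 : ℝ) = -1) this.1 this.2.le
    linarith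

/-- Comparison of a trajectory with a single arc starting at the same point. -/
lemma FlowsTo.compare_arc [T2Space Q] (hg : IsGeodesicallyComplete g) (hΩ : IsObstacle n Ω)
    {d : ℝ} (hd : d = 1 ∨ d = -1) {u s : ℝ} {z w w' : PhaseSpace g Ω} (h : FlowsTo g Ω u z w)
    (hu : 0 ≤ d * u) (hs : 0 < d * s) (h' : IsArc g Ω s (launch g Ω d z) w') :
    (d * u < d * s → IsArc g Ω (s - u) (launch g Ω d w) w') ∧
      (d * s ≤ d * u → FlowsTo g Ω (u - s) w' w) := by
  induction h with
  | refl =>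
    refine ⟨fun _ => by simpa using h', fun h0 => ?_⟩
    rw [mul_zero] at h0
    exact absurd hs (not_lt.2 h0)
  | @step u₁ s₁ z w₁ w h1 hs₁ harc ih =>
    obtain ⟨h2, h3⟩ := direction_of_step hd hs₁ harc.1 hu
    obtain ⟨ih1, ih2⟩ := ih h2 h'
    rw [launch_congr h3] at harc
    rw [mul_add]
    rcases lt_or_ge (d * u₁) (d * s) with hlt | hge
    · have harc' := ih1 hlt
      have hsub : 0 < d * (s - u₁) := by rw [mul_sub]; linarith
      refine ⟨fun h4 => ?_, fun h4 => ?_⟩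
      · obtain ⟨h5, h6⟩ := harc.split hg hd h3 (by rw [mul_sub]; linarith) harc'
        rw [launch_of_mem_interiorPart hΩ h5, ← sub_sub]
        exact h6
      · rcases h4.eq_or_lt with h5 | h5
        · have h6 : s - u₁ = s₁ := direction_cancel hd (by rw [mul_sub]; linarith)
          rw [h6] at harc'
          rw [harc.eq harc', show u₁ + s₁ - s = 0 by linarith]
          exact FlowsTo.refl _
        · obtain ⟨h6, h7⟩ := harc'.split hg hd hsub (by rw [mul_sub]; linarith) harc
          rw [show u₁ + s₁ - s = s₁ - (s - u₁) by ring]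
          refine FlowsTo.single ?_
          rwa [launch_of_mem_interiorPart hΩ h6]
    · refine ⟨fun h4 => absurd h4 (not_lt.2 (by linarith)), fun _ => ?_⟩
      rw [show u₁ + s₁ - s = u₁ - s + s₁ by ring]
      refine FlowsTo.step (ih2 hge) (mul_nonneg_of_direction hd (by rw [mul_sub]; linarith) h3.le) ?_
      rwa [launch_congr h3]

/-- Trajectories from one point in one direction are nested. Induction on the second trajectory:
each new arc of it is compared through `compare_arc` with what remains of the first. Equal times
give uniqueness of the billiard flow. -/
lemma FlowsTo.compare [T2Space Q] (hg : IsGeodesicallyComplete g) (hΩ : IsObstacle n Ω)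
    {d : ℝ} (hd : d = 1 ∨ d = -1) {t t' : ℝ} {z w w' : PhaseSpace g Ω} (h : FlowsTo g Ω t z w)
    (h' : FlowsTo g Ω t' z w') (ht : 0 ≤ d * t) (ht' : 0 ≤ d * t') :
    (d * t ≤ d * t' → FlowsTo g Ω (t' - t) w w') ∧
      (d * t' ≤ d * t → FlowsTo g Ω (t - t') w' w) := by
  induction h' with
  | refl =>
    refine ⟨fun h0 => ?_, fun _ => by simpa using h⟩
    have h1 : t = 0 := direction_cancel hd (by rw [mul_zero] at h0 ⊢; linarith)
    rw [h.eq_of_zero h1, h1, sub_zero]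
    exact FlowsTo.refl _
  | @step t₁ s z w₁ w' h1 hs harc ih =>
    obtain ⟨h2, h3⟩ := direction_of_step hd hs harc.1 ht'
    obtain ⟨ih1, ih2⟩ := ih h h2
    rw [mul_add]
    rcases le_or_gt (d * t) (d * t₁) with hle | hgt
    · refine ⟨fun _ => ?_, fun h4 => absurd h4 (not_le.2 (by linarith))⟩
      rw [show t₁ + s - t = t₁ - t + s by ring]
      exact FlowsTo.step (ih1 hle) (mul_nonneg_of_direction hd (by rw [mul_sub]; linarith) h3.le)
        harc
    · rw [launch_congr h3] at harc
      obtain ⟨h4, h5⟩ := (ih2 hgt.le).compare_arc hg hΩ hd (by rw [mul_sub]; linarith) h3 harc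
      rw [mul_sub] at h4 h5
      refine ⟨fun h6 => ?_, fun h6 => ?_⟩
      · rcases h6.eq_or_lt with h7 | h7
        · have h8 := h5 (by linarith)
          have h9 : t - t₁ - s = 0 := direction_cancel hd (by rw [mul_zero]; linarith)
          rw [h8.eq_of_zero h9, show t₁ + s - t = 0 by linarith]
          exact FlowsTo.refl _
        · have h8 := h4 (by linarith)
          rw [show t₁ + s - t = s - (t - t₁) by ring]
          refine FlowsTo.single ?_
          rwa [launch_congr (d := d) (by rw [mul_sub, mul_sub]; linarith)]
      · rw [show t - (t₁ + s) = t - t₁ - s by ring]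
        exact h5 (by linarith)

lemma exists_direction_nonneg (t : ℝ) : ∃ d : ℝ, (d = 1 ∨ d = -1) ∧ 0 ≤ d * t := by
  rcases le_total 0 t with h | h
  · exact ⟨1, Or.inl rfl, by linarith⟩
  · exact ⟨-1, Or.inr rfl, by linarith⟩

lemma FlowsTo.unique [T2Space Q] (hg : IsGeodesicallyComplete g) (hΩ : IsObstacle n Ω)
    {t : ℝ} {z w w' : PhaseSpace g Ω} (h : FlowsTo g Ω t z w) (h' : FlowsTo g Ω t z w') :
    w = w' := by
  obtain ⟨d, hd, hdt⟩ := exists_direction_nonneg t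
  exact (((h.compare hg hΩ hd h' hdt hdt).1 le_rfl).eq_of_zero (sub_self t)).symm

lemma flow_eq [T2Space Q] (hg : IsGeodesicallyComplete g) (hΩ : IsObstacle n Ω)
    {t : ℝ} {z w : PhaseSpace g Ω} (h : FlowsTo g Ω t z w) : flow g Ω t z = w := by
  unfold flow
  have h' : ∃ w, FlowsTo g Ω t z w := ⟨w, h⟩
  rw [dif_pos h']
  exact h'.choose_spec.unique hg hΩ h

lemma FlowsTo.exists_prefix (hg : IsGeodesicallyComplete g) {d : ℝ} (hd : d = 1 ∨ d = -1)
    {t s : ℝ} {z w : PhaseSpace g Ω} (h : FlowsTo g Ω t z w) (hs : 0 ≤ d * s)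
    (hst : d * s ≤ d * t) : ∃ w₀, FlowsTo g Ω s z w₀ := by
  induction h with
  | refl z =>
    have h1 : s = 0 := direction_cancel hd (by rw [mul_zero] at hst ⊢; linarith)
    exact ⟨z, h1 ▸ FlowsTo.refl z⟩
  | @step t₁ s₁ z w₁ w' h1 hs₁ harc ih =>
    obtain ⟨h2, h3⟩ := direction_of_step hd hs₁ harc.1 (hs.trans hst)
    rw [mul_add] at hst
    rcases le_or_gt (d * s) (d * t₁) with hle | hgt
    · exact ih hle
    · rcases hst.eq_or_lt with h4 | h4
      · have h5 : s = t₁ + s₁ := direction_cancel hd (by rw [mul_add]; exact h4)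
        exact ⟨w', h5 ▸ FlowsTo.step h1 hs₁ harc⟩
      · have h6 : 0 < d * (s - t₁) := by rw [mul_sub]; linarith
        obtain ⟨w₀, -, h5⟩ := harc.exists_prefix hg hd h6 (by rw [mul_sub]; linarith)
        refine ⟨w₀, ?_⟩
        rw [show s = t₁ + (s - t₁) by ring]
        refine FlowsTo.step h1 (mul_nonneg_of_direction hd h2 h6.le) ?_
        rwa [launch_congr h6, ← launch_congr h3]

/-- Trajectories from points with the same starting vector coincide. -/
lemma FlowsTo.of_launch_eq {d : ℝ} (hd : d = 1 ∨ d = -1) {t : ℝ} {z z' w : PhaseSpace g Ω}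
    (hz : launch g Ω d z = launch g Ω d z') (h : FlowsTo g Ω t z w) (ht : 0 < d * t) :
    FlowsTo g Ω t z' w := by
  induction h with
  | refl => simp at ht
  | @step t₁ s z w₁ w' h1 hs harc ih =>
    obtain ⟨h2, h3⟩ := direction_of_step hd hs harc.1 ht.le
    rcases h2.eq_or_lt with h4 | h4
    · have h5 : t₁ = 0 := direction_cancel hd (by rw [mul_zero]; exact h4.symm)
      have h6 := h1.eq_of_zero h5
      rw [h5, zero_add]
      refine FlowsTo.single ?_
      rwa [launch_congr h3, ← hz, ← launch_congr h3, ← h6]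
    · exact FlowsTo.step (ih hz h4) hs harc

/-- Launching erases the difference between `z` and its reflection. At time 0 nothing is launched,
hence the condition on `t`. -/
lemma FlowsTo.reflection {t : ℝ} {z w : PhaseSpace g Ω} (h : FlowsTo g Ω t z w) (ht : t ≠ 0) :
    FlowsTo g Ω t (reflection g Ω z) w := by
  obtain ⟨d, hd, hdt⟩ := exists_direction ht
  exact h.of_launch_eq hd (launch_reflection (direction_ne_zero hd) z).symm hdt

end Trajectories

/-! ### Comparison of linear forms and of differentials at a common zero -/

section LinearForms

variable {E : Type*} [NormedAddCommGroup E] [NormedSpace ℝ E]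

/-- Linear forms which are nonnegative where another one is positive. -/
lemma exists_eq_smul_of_pos_imp_nonneg {f f' : E →L[ℝ] ℝ} (hf : f ≠ 0) (hf' : f' ≠ 0)
    (h : ∀ w, 0 < f' w → 0 ≤ f w) : ∃ k : ℝ, 0 < k ∧ f = k • f' := by
  obtain ⟨e, he⟩ : ∃ e, 0 < f' e := by
    obtain ⟨e, he⟩ : ∃ e, f' e ≠ 0 := by
      by_contra hcon
      push Not at hcon
      exact hf' (ContinuousLinearMap.ext hcon)
    rcases lt_or_gt_of_ne he with h1 | h1
    · exact ⟨-e, by rw [map_neg]; linarith⟩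
    · exact ⟨e, h1⟩
  have hker' : ∀ w, f' w = 0 → 0 ≤ f w := by
    intro w hw
    by_contra hcon
    push Not at hcon
    have hfe := h e he
    -- The multiple of `e` is positive, so that `f'` becomes positive, but so small that `f` still
    -- is at most `f w / 2 < 0`. The summand 1 covers the case `f e = 0`.
    have h1 := h (w + (-(f w) / (2 * (f e + 1))) • e) (by
      rw [map_add, map_smul, hw, zero_add, smul_eq_mul]
      exact mul_pos (div_pos (by linarith) (by linarith)) he)
    rw [map_add, map_smul, smul_eq_mul] at h1
    have h2 : -(f w) / (2 * (f e + 1)) * f e ≤ -(f w) / 2 := by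
      rw [div_mul_eq_mul_div, div_le_div_iff₀ (by linarith) (by norm_num)]
      nlinarith
    linarith
  have hker : ∀ w, f' w = 0 → f w = 0 := fun w hw =>
    le_antisymm (by have := hker' (-w) (by rw [map_neg, hw, neg_zero]); rw [map_neg] at this; linarith)
      (hker' w hw)
  have heq : f = (f e / f' e) • f' := by
    ext w
    have h1 := hker (w - (f' w / f' e) • e) (by
      rw [map_sub, map_smul, smul_eq_mul, div_mul_cancel₀ _ he.ne', sub_self])
    rw [map_sub, map_smul, smul_eq_mul] at h1
    rw [smul_apply, smul_eq_mul]
    field_simp at h1 ⊢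
    linarith
  refine ⟨f e / f' e, lt_of_le_of_ne (div_nonneg (h e he) he.le) fun h0 => hf ?_, heq⟩
  rw [heq, ← h0, zero_smul]

/-- In a direction in which `ρ'` increases, `ρ'` is positive at small positive times. Hence `ρ` is
nonnegative there, and so are its difference quotients. -/
lemma fderiv_nonneg_of_pos {ρ ρ' : E → ℝ} {x : E} (hρ : DifferentiableAt ℝ ρ x)
    (hρ' : DifferentiableAt ℝ ρ' x) (h0 : ρ x = 0) (h0' : ρ' x = 0)
    (h : ∀ᶠ y in 𝓝 x, 0 ≤ ρ' y → 0 ≤ ρ y) (w : E) (hw : 0 < fderiv ℝ ρ' x w) :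
    0 ≤ fderiv ℝ ρ x w := by
  have hline : HasDerivAt (fun s : ℝ => x + s • w) w 0 := by
    simpa using ((hasDerivAt_id (0 : ℝ)).smul_const w).const_add x
  have hd : ∀ {f : E → ℝ}, DifferentiableAt ℝ f x →
      HasDerivAt (fun s : ℝ => f (x + s • w)) (fderiv ℝ f x w) 0 := fun {f} hf =>
    HasFDerivAt.comp_hasDerivAt (f := fun s : ℝ => x + s • w) (0 : ℝ)
      (by simpa using hf.hasFDerivAt) hline
  have h1 := (hasDerivAt_iff_tendsto_slope.1 (hd hρ)).mono_left (nhdsGT_le_nhdsNE 0)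
  have h2 := (hasDerivAt_iff_tendsto_slope.1 (hd hρ')).mono_left (nhdsGT_le_nhdsNE 0)
  have h3 : ∀ᶠ s in 𝓝[>] (0 : ℝ), 0 ≤ ρ' (x + s • w) → 0 ≤ ρ (x + s • w) := by
    have hc : Filter.Tendsto (fun s : ℝ => x + s • w) (𝓝 0) (𝓝 x) := by
      simpa using hline.continuousAt.tendsto
    exact (hc.eventually h).filter_mono nhdsWithin_le_nhds
  refine ge_of_tendsto h1 ?_
  filter_upwards [h2.eventually (lt_mem_nhds hw), h3, self_mem_nhdsWithin] with s hs hs' hs0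
  have hs0' : (0 : ℝ) < s := hs0
  rw [slope_def_field] at hs ⊢
  simp only [zero_smul, add_zero, sub_zero, h0, h0'] at hs ⊢
  exact div_nonneg (hs' ((div_pos_iff_of_pos_right hs0').1 hs).le) hs0'.le

end LinearForms

/-! ### Independence of the normal direction from the defining function -/

section Boundary

variable {n : ℕ} {Q : Type*} [TopologicalSpace Q] [ChartedSpace (EuclideanSpace ℝ (Fin n)) Q]
  {Ω : Set Q}

local notation "E" => EuclideanSpace ℝ (Fin n)

/-- The differential of a function, as a linear form on the model space. -/
def differential (ρ : Q → ℝ) (x : Q) : E →L[ℝ] ℝ := mfderiv (𝓡 n) 𝓘(ℝ, ℝ) ρ x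

lemma differential_eq_fderiv {ρ : Q → ℝ} {x : Q} (h : MDifferentiableAt (𝓡 n) 𝓘(ℝ, ℝ) ρ x) :
    differential ρ x =
      fderiv ℝ (fun y => ρ ((extChartAt (𝓡 n) x).symm y)) (extChartAt (𝓡 n) x x) := by
  unfold differential
  rw [h.mfderiv, ModelWithCorners.range_eq_univ, fderivWithin_univ]
  rfl

lemma differentiableAt_extChartAt {ρ : Q → ℝ} {x : Q}
    (h : MDifferentiableAt (𝓡 n) 𝓘(ℝ, ℝ) ρ x) :
    DifferentiableAt ℝ (fun y => ρ ((extChartAt (𝓡 n) x).symm y)) (extChartAt (𝓡 n) x x) := by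
  have := h.differentiableWithinAt_writtenInExtChartAt
  rw [ModelWithCorners.range_eq_univ, differentiableWithinAt_univ] at this
  exact this

/-- The differentials of two defining functions are positively proportional. -/
lemma differential_eq_smul_of_isBoundaryDefiningAt {x : Q} {ρ ρ' : Q → ℝ}
    (h : IsBoundaryDefiningAt n Ω x ρ) (h' : IsBoundaryDefiningAt n Ω x ρ') :
    ∃ k : ℝ, 0 < k ∧ (differential ρ x : E →L[ℝ] ℝ) = k • differential ρ' x := by
  have hd := h.mdifferentiableAt
  have hd' := h'.mdifferentiableAt
  obtain ⟨h0, hne, U, hU, hxU, -, hΩ⟩ := h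
  obtain ⟨h0', hne', U', hU', hxU', -, hΩ'⟩ := h'
  have hx : (extChartAt (𝓡 n) x).symm (extChartAt (𝓡 n) x x) = x := extChartAt_to_inv x
  refine exists_eq_smul_of_pos_imp_nonneg hne hne' ?_
  rw [differential_eq_fderiv hd, differential_eq_fderiv hd']
  refine fderiv_nonneg_of_pos (differentiableAt_extChartAt hd) (differentiableAt_extChartAt hd')
    (by rw [hx, h0]) (by rw [hx, h0']) ?_
  have hc := continuousAt_extChartAt_symm (I := 𝓡 n) x
  rw [ContinuousAt, hx] at hc
  filter_upwards [hc.eventually_mem (hU.mem_nhds hxU), hc.eventually_mem (hU'.mem_nhds hxU')]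
    with y hy hy' h1
  exact (hΩ _ hy).1 ((hΩ' _ hy').2 h1)

end Boundary

/-! ### Continuity of the reflection along the boundary -/

section Reflection

variable {n : ℕ} {Q : Type*} [TopologicalSpace Q] [ChartedSpace (EuclideanSpace ℝ (Fin n)) Q]
  [IsManifold (𝓡 n) ∞ Q] {g : Metric (n := n) Q} {Ω : Set Q}

local notation "E" => EuclideanSpace ℝ (Fin n)

lemma contDiffOn_inChart {ρ : Q → ℝ} (x₁ : Q) {U : Set Q}
    (hρ : ContMDiffOn (𝓡 n) 𝓘(ℝ, ℝ) ∞ ρ U) :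
    ContDiffOn ℝ ∞ (fun y => ρ ((extChartAt (𝓡 n) x₁).symm y))
      ((extChartAt (𝓡 n) x₁).target ∩ (extChartAt (𝓡 n) x₁).symm ⁻¹' U) := by
  rw [← contMDiffOn_iff_contDiffOn]
  exact hρ.comp ((contMDiffOn_extChartAt_symm x₁).mono Set.inter_subset_left) fun y hy => hy.2

omit [IsManifold (𝓡 n) ∞ Q] in
lemma isOpen_inChart (x₁ : Q) {U : Set Q} (hU : IsOpen U) :
    IsOpen ((extChartAt (𝓡 n) x₁).target ∩ (extChartAt (𝓡 n) x₁).symm ⁻¹' U) :=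
  (continuousOn_extChartAt_symm x₁).isOpen_inter_preimage (isOpen_extChartAt_target x₁) hU

lemma differential_eq_fderiv_inChart {ρ : Q → ℝ} {x x₁ : Q}
    (hx : x ∈ (extChartAt (𝓡 n) x₁).source) {U : Set Q} (hU : IsOpen U) (hxU : x ∈ U)
    (hρ : ContMDiffOn (𝓡 n) 𝓘(ℝ, ℝ) ∞ ρ U) (w : E) :
    differential ρ x w =
      fderiv ℝ (fun y => ρ ((extChartAt (𝓡 n) x₁).symm y)) (extChartAt (𝓡 n) x₁ x)
        (tangentCoordChange (𝓡 n) x x₁ x w) := by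
  have hxx : x ∈ (extChartAt (𝓡 n) x).source := mem_extChartAt_source x
  rw [differential_eq_fderiv ((hρ.contMDiffAt (hU.mem_nhds hxU)).mdifferentiableAt (by simp))]
  have heq : (fun y => ρ ((extChartAt (𝓡 n) x).symm y)) =ᶠ[𝓝 (extChartAt (𝓡 n) x x)]
      (fun y => ρ ((extChartAt (𝓡 n) x₁).symm y)) ∘ transition x x₁ := by
    filter_upwards [eventually_mem_source hxx hx] with y hy
    simp only [Function.comp_apply, transition]
    rw [(extChartAt (𝓡 n) x₁).left_inv hy.2]
  have htr : transition x x₁ (extChartAt (𝓡 n) x x) = extChartAt (𝓡 n) x₁ x := by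
    rw [transition, Function.comp_apply, (extChartAt (𝓡 n) x).left_inv hxx]
  have hd : DifferentiableAt ℝ (fun y => ρ ((extChartAt (𝓡 n) x₁).symm y))
      (transition x x₁ (extChartAt (𝓡 n) x x)) := by
    rw [htr]
    refine ((contDiffOn_inChart x₁ hρ).contDiffAt ((isOpen_inChart x₁ hU).mem_nhds
      ⟨(extChartAt (𝓡 n) x₁).map_source hx, ?_⟩)).differentiableAt (by simp)
    rw [Set.mem_preimage, (extChartAt (𝓡 n) x₁).left_inv hx]
    exact hxU
  rw [heq.fderiv_eq, fderiv_comp _ hd ((contDiffAt_transition hxx hx).differentiableAt (by simp)),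
    ContinuousLinearMap.comp_apply, htr, fderiv_transition]

omit [IsManifold (𝓡 n) ∞ Q] in
-- Where a function describing `Ω` is positive, the point is interior to `Ω`; so it vanishes at
-- frontier points. A defining function at one boundary point thereby serves at the neighbouring
-- ones.
lemma IsBoundaryDefiningAt.of_mem_frontier (hΩ : IsClosed Ω) {ρ : Q → ℝ} {x : Q} {U : Set Q}
    (hU : IsOpen U) (hxU : x ∈ U) (hρ : ContMDiffOn (𝓡 n) 𝓘(ℝ, ℝ) ∞ ρ U)
    (h : ∀ y ∈ U, y ∈ Ω ↔ 0 ≤ ρ y) (hx : x ∈ frontier Ω) (hd : (differential ρ x : E →L[ℝ] ℝ) ≠ 0) :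
    IsBoundaryDefiningAt n Ω x ρ := by
  refine ⟨le_antisymm ?_ ((h x hxU).1 (hΩ.frontier_subset hx)), hd, U, hU, hxU, hρ, h⟩
  by_contra hcon
  have h1 : ∀ᶠ y in 𝓝 x, y ∈ Ω := by
    have hc := (hρ.contMDiffAt (hU.mem_nhds hxU)).continuousAt
    filter_upwards [hc.eventually (lt_mem_nhds (not_le.1 hcon)), hU.mem_nhds hxU] with y hy hyU
    exact (h y hyU).2 hy.le
  exact hx.2 (mem_interior_iff_mem_nhds.2 h1)

/-- The reflection in the chart around `x₁`, expressed through a defining function. -/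
lemma reflectVector_inChart {ρ : Q → ℝ} {p p₁ : TangentBundle (𝓡 n) Q}
    (hp : p.proj ∈ (extChartAt (𝓡 n) p₁.proj).source) {U : Set Q} (hU : IsOpen U)
    (hpU : p.proj ∈ U) (hρ : ContMDiffOn (𝓡 n) 𝓘(ℝ, ℝ) ∞ ρ U)
    (hbd : IsBoundaryDefiningAt n Ω p.proj ρ) (hN : normalPart g Ω p ≠ 0) {y v a : E}
    {ℓ : E →L[ℝ] ℝ} (hyv : extChartAt (𝓡 n).tangent p₁ p = ((y, v) : E × E))
    (hℓ : ℓ = fderiv ℝ (fun y => ρ ((extChartAt (𝓡 n) p₁.proj).symm y)) y)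
    (ha : ∀ w, metricInChart g p₁.proj y a w = ℓ w) :
    extChartAt (𝓡 n).tangent p₁ (reflectVector g Ω p) = ((y, v - (2 * ℓ v / ℓ a) • a) : E × E) ∧
      0 < ℓ a ∧ ∃ K : ℝ, 0 < K ∧ ℓ v = K * normalPart g Ω p := by
  obtain ⟨ρ', c, hc, hρ', hcρ⟩ := exists_isBoundaryDefiningAt_inwardNormal (inwardNormal_ne_zero hN)
  obtain ⟨k, hk, hkρ⟩ := differential_eq_smul_of_isBoundaryDefiningAt hbd hρ'
  have hν1 : g.inner p.proj (inwardNormal g Ω p.proj) (inwardNormal g Ω p.proj) = 1 :=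
    (inwardNormal_eq_zero_or g Ω p.proj).resolve_left (inwardNormal_ne_zero hN)
  have hxx : p.proj ∈ (extChartAt (𝓡 n) p.proj).source := mem_extChartAt_source _
  obtain ⟨N, hNdef⟩ : ∃ N, normalPart g Ω p = N := ⟨_, rfl⟩
  obtain ⟨v', hv'⟩ : ∃ v' : E, p.snd = v' := ⟨_, rfl⟩
  obtain ⟨ν, hν⟩ : ∃ ν : E, inwardNormal g Ω p.proj = ν := ⟨_, rfl⟩
  rw [hν] at hν1
  let L : E →L[ℝ] E := tangentCoordChange (𝓡 n) p.proj p₁.proj p.proj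
  have hy : y = extChartAt (𝓡 n) p₁.proj p.proj := (congrArg Prod.fst hyv).symm
  have hv : v = L v' := by rw [← hv']; exact (congrArg Prod.snd hyv).symm
  have hyt : y ∈ (extChartAt (𝓡 n) p₁.proj).target := hy ▸ (extChartAt (𝓡 n) p₁.proj).map_source hp
  have hLG : ∀ u w : E, metricInChart g p₁.proj y (L u) (L w) = (g.inner p.proj : E →L[ℝ] E →L[ℝ] ℝ) u w := by
    intro u w
    have h1 := metricInChart_extChartAt g hp (L u) (L w)
    rw [tangentCoordChange_comp ⟨⟨hxx, hp⟩, hxx⟩, tangentCoordChange_self hxx,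
      tangentCoordChange_comp ⟨⟨hxx, hp⟩, hxx⟩, tangentCoordChange_self hxx] at h1
    rw [hy]
    exact h1
  have hℓL : ∀ w : E, ℓ (L w) = k * c * (g.inner p.proj : E →L[ℝ] E →L[ℝ] ℝ) w ν := by
    intro w
    rw [hℓ, hy, ← differential_eq_fderiv_inChart hp hU hpU hρ w, hkρ, smul_apply, smul_eq_mul,
      mul_assoc]
    congr 1
    rw [← hν]
    exact hcρ w
  have hsurj : ∀ w : E, ∃ w', L w' = w := fun w => ⟨tangentCoordChange (𝓡 n) p₁.proj p.proj p.proj w, by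
    change tangentCoordChange (𝓡 n) p.proj p₁.proj p.proj _ = _
    rw [tangentCoordChange_comp ⟨⟨hp, hxx⟩, hp⟩, tangentCoordChange_self hp]⟩
  -- The gradient of the defining function is a positive multiple of the normal. This removes the
  -- pointwise chosen normal from the formula for the reflection.
  have haν : a = (k * c) • L ν := by
    by_contra hne
    have hpos := metricInChart_pos g hyt (a - (k * c) • L ν) (sub_ne_zero.2 hne)
    obtain ⟨w, hw⟩ := hsurj (a - (k * c) • L ν)
    have h1 : metricInChart g p₁.proj y (a - (k * c) • L ν)
        = metricInChart g p₁.proj y a - (k * c) • metricInChart g p₁.proj y (L ν) := by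
      rw [map_sub, map_smul]
    rw [← hw, hw, h1, ← hw, sub_apply, smul_apply, ha, hℓL, metricInChart_symm, hLG, smul_eq_mul,
      sub_self] at hpos
    exact lt_irrefl _ hpos
  have hKpos : 0 < k * c := mul_pos hk hc
  have hℓa : ℓ a = (k * c) * (k * c) := by
    rw [haν, map_smul, hℓL, smul_eq_mul]
    have : (g.inner p.proj : E →L[ℝ] E →L[ℝ] ℝ) ν ν = 1 := hν1
    rw [this, mul_one]
  have hNv : (g.inner p.proj : E →L[ℝ] E →L[ℝ] ℝ) v' ν = N := by
    rw [← hNdef, ← hv', ← hν]; rfl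
  have hℓv : ℓ v = (k * c) * N := by rw [hv, hℓL, hNv]
  refine ⟨?_, ?_, k * c, hKpos, by rw [hNdef]; exact hℓv⟩
  · have h1 : extChartAt (𝓡 n).tangent p₁ (reflectVector g Ω p)
        = ((y, L (v' - (2 * N) • ν)) : E × E) := by
      rw [hy, ← hv', ← hν, ← hNdef]; rfl
    rw [h1, hℓv, hℓa, haν, map_sub, map_smul, ← hv, smul_smul]
    congr 3
    field_simp
  · rw [hℓa]; positivity

/-- Along the boundary of the obstacle the reflection is continuous, and the sign of the normal
part is locally constant. -/
lemma eventually_reflectVector_mem (hΩ : IsObstacle n Ω) {p₁ : TangentBundle (𝓡 n) Q}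
    (hN : normalPart g Ω p₁ ≠ 0) {W : Set (TangentBundle (𝓡 n) Q)}
    (hW : IsOpen W) (hpW : reflectVector g Ω p₁ ∈ W) :
    ∀ᶠ p in 𝓝 p₁, p.proj ∈ frontier Ω → normalPart g Ω p ≠ 0 →
      reflectVector g Ω p ∈ W ∧ 0 < normalPart g Ω p * normalPart g Ω p₁ := by
  obtain ⟨ρ, c, hc, hρ, -⟩ := exists_isBoundaryDefiningAt_inwardNormal (inwardNormal_ne_zero hN)
  have hbd := hρ
  obtain ⟨h0, hne, U, hU, hxU, hs, hΩU⟩ := hρ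
  have hsrc : p₁.proj ∈ (extChartAt (𝓡 n) p₁.proj).source := mem_extChartAt_source _
  obtain ⟨⟨y₁, v₁⟩, hyv⟩ : ∃ q : E × E, extChartAt (𝓡 n).tangent p₁ p₁ = q := ⟨_, rfl⟩
  have hy₁ : y₁ = extChartAt (𝓡 n) p₁.proj p₁.proj := (congrArg Prod.fst hyv).symm
  let ρ' : E → ℝ := fun y => ρ ((extChartAt (𝓡 n) p₁.proj).symm y)
  let ℓ : E → E →L[ℝ] ℝ := fderiv ℝ ρ'
  let G := metricInChart g p₁.proj
  let a : E → E := fun y => (G y).inverse (ℓ y)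
  have hopen := isOpen_inChart (n := n) p₁.proj hU
  have hsm := contDiffOn_inChart (n := n) p₁.proj hs
  have hyU : y₁ ∈ (extChartAt (𝓡 n) p₁.proj).target ∩ (extChartAt (𝓡 n) p₁.proj).symm ⁻¹' U := by
    rw [hy₁]
    refine ⟨(extChartAt (𝓡 n) p₁.proj).map_source hsrc, ?_⟩
    rw [Set.mem_preimage, (extChartAt (𝓡 n) p₁.proj).left_inv hsrc]
    exact hxU
  have hℓc : ContinuousAt ℓ y₁ :=
    ((hsm.fderiv_of_isOpen hopen (m := 0) (by simp)).continuousOn).continuousAt (hopen.mem_nhds hyU)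
  have ha : ∀ y ∈ (extChartAt (𝓡 n) p₁.proj).target, ∀ w, G y (a y) w = ℓ y w := by
    intro y hy w
    obtain ⟨e, he⟩ := exists_equiv_of_pos fun u hu => metricInChart_pos g hy u hu
    have : G y = e := he.symm
    simp only [a, this, ContinuousLinearMap.inverse_equiv]
    simp
  have hac : ContinuousAt a y₁ := by
    obtain ⟨e, he⟩ := exists_equiv_of_pos fun u hu => metricInChart_pos g hyU.1 u hu
    have h1 := (contDiffAt_map_inverse (𝕜 := ℝ) (n := 0) e).continuousAt
    rw [he] at h1
    have h2 : ContinuousAt G y₁ := ((contDiffOn_metricInChart g p₁.proj).continuousOn).continuousAt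
      ((isOpen_extChartAt_target p₁.proj).mem_nhds hyU.1)
    exact (ContinuousAt.comp (f := G) (x := y₁) h1 h2).clm_apply hℓc
  obtain ⟨hR₁, hpos₁, K₁, hK₁, hN₁⟩ := reflectVector_inChart hsrc hU hxU hs hbd hN hyv
    (ℓ := ℓ y₁) rfl (ha y₁ hyU.1)
  -- The reflection formula with the gradient of one fixed defining function. It is continuous at
  -- the centre on a full neighbourhood in the chart, whereas the chosen normal is meaningful at
  -- boundary points only.
  let F : E × E → E × E := fun q => (q.1, q.2 - (2 * ℓ q.1 q.2 / ℓ q.1 (a q.1)) • a q.1)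
  have hfst : ContinuousAt (Prod.fst : E × E → E) (y₁, v₁) := continuousAt_fst
  have hsnd : ContinuousAt (Prod.snd : E × E → E) (y₁, v₁) := continuousAt_snd
  have hℓ1 : ContinuousAt (fun q : E × E => ℓ q.1) (y₁, v₁) :=
    ContinuousAt.comp (f := Prod.fst) (x := (y₁, v₁)) hℓc hfst
  have ha1 : ContinuousAt (fun q : E × E => a q.1) (y₁, v₁) :=
    ContinuousAt.comp (f := Prod.fst) (x := (y₁, v₁)) hac hfst
  have hℓv : ContinuousAt (fun q : E × E => ℓ q.1 q.2) (y₁, v₁) := hℓ1.clm_apply hsnd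
  have hF : ContinuousAt F (y₁, v₁) :=
    hfst.prodMk (hsnd.sub (((continuousAt_const.mul hℓv).div (hℓ1.clm_apply ha1) hpos₁.ne').smul ha1))
  have hchart : ContinuousAt (extChartAt (𝓡 n).tangent p₁) p₁ := continuousAt_extChartAt p₁
  have hFc : ContinuousAt (fun p => (extChartAt (𝓡 n).tangent p₁).symm
      (F (extChartAt (𝓡 n).tangent p₁ p))) p₁ := by
    have h1 : ContinuousAt (extChartAt (𝓡 n).tangent p₁).symm (F (extChartAt (𝓡 n).tangent p₁ p₁)) := by
      refine (continuousOn_extChartAt_symm p₁).continuousAt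
        ((isOpen_extChartAt_target p₁).mem_nhds ?_)
      rw [hyv]
      exact (tangent_extChartAt_target p₁ (F (y₁, v₁))).2 hyU.1
    have h2 : ContinuousAt (fun p => F (extChartAt (𝓡 n).tangent p₁ p)) p₁ := by
      refine ContinuousAt.comp (g := F) ?_ hchart
      rw [hyv]; exact hF
    exact ContinuousAt.comp (f := fun p => F (extChartAt (𝓡 n).tangent p₁ p)) h1 h2
  have hsym : ∀ p : TangentBundle (𝓡 n) Q, p.proj ∈ (extChartAt (𝓡 n) p₁.proj).source →
      (extChartAt (𝓡 n).tangent p₁).symm (extChartAt (𝓡 n).tangent p₁ p) = p := fun p hp =>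
    (extChartAt (𝓡 n).tangent p₁).left_inv ((tangent_extChartAt_source p₁ p).2 hp)
  have hval : (extChartAt (𝓡 n).tangent p₁).symm (F (extChartAt (𝓡 n).tangent p₁ p₁)) ∈ W := by
    have : F (extChartAt (𝓡 n).tangent p₁ p₁)
        = extChartAt (𝓡 n).tangent p₁ (reflectVector g Ω p₁) := by rw [hR₁, hyv]
    rw [this, hsym (reflectVector g Ω p₁) hsrc]
    exact hpW
  have hproj : ContinuousAt (fun p : TangentBundle (𝓡 n) Q => p.proj) p₁ :=
    (FiberBundle.continuous_proj E (TangentSpace (𝓡 n) : Q → Type _)).continuousAt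
  have hℓe : ∀ᶠ p in 𝓝 p₁, 0 < ℓ (extChartAt (𝓡 n).tangent p₁ p).1 (extChartAt (𝓡 n).tangent p₁ p).2
      * normalPart g Ω p₁ := by
    have h1 : ContinuousAt (fun p => ℓ (extChartAt (𝓡 n).tangent p₁ p).1
        (extChartAt (𝓡 n).tangent p₁ p).2) p₁ := by
      refine ContinuousAt.comp (g := fun q : E × E => ℓ q.1 q.2) ?_ hchart
      rw [hyv]; exact hℓv
    refine (h1.mul continuousAt_const).eventually (lt_mem_nhds ?_)
    change 0 < ℓ (extChartAt (𝓡 n).tangent p₁ p₁).1 (extChartAt (𝓡 n).tangent p₁ p₁).2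
      * normalPart g Ω p₁
    rw [hyv]
    change 0 < ℓ y₁ v₁ * _
    rw [hN₁, mul_assoc]
    exact mul_pos hK₁ (mul_self_pos.2 hN)
  filter_upwards [hFc.eventually_mem (hW.mem_nhds hval), hℓe,
    hproj.eventually_mem (hU.mem_nhds hxU),
    hproj.eventually_mem ((isOpen_extChartAt_source p₁.proj).mem_nhds hsrc)]
    with p hpF hpℓ hpU hpsrc hfr hpN
  obtain ⟨⟨y, v⟩, hq⟩ : ∃ q : E × E, extChartAt (𝓡 n).tangent p₁ p = q := ⟨_, rfl⟩
  rw [hq] at hpF hpℓ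
  have hy : y = extChartAt (𝓡 n) p₁.proj p.proj := (congrArg Prod.fst hq).symm
  have hyt : y ∈ (extChartAt (𝓡 n) p₁.proj).target :=
    hy ▸ (extChartAt (𝓡 n) p₁.proj).map_source hpsrc
  -- Close to `p₁` the differential does not annihilate the velocity of `p`, since this quantity
  -- varies continuously and is nonzero at `p₁`.
  have hdne : (differential ρ p.proj : E →L[ℝ] ℝ) ≠ 0 := by
    intro h
    have h1 := differential_eq_fderiv_inChart hpsrc hU hpU hs p.snd
    rw [h] at h1
    have h2 : ℓ y v = 0 := by
      have h3 : v = tangentCoordChange (𝓡 n) p.proj p₁.proj p.proj p.snd :=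
        (congrArg Prod.snd hq).symm
      rw [h3, hy]
      exact h1.symm
    simp only [h2, zero_mul, lt_self_iff_false] at hpℓ
  have hbd' := IsBoundaryDefiningAt.of_mem_frontier hΩ.1 hU hpU hs hΩU hfr hdne
  obtain ⟨hR, hpos, K, hK, hNp⟩ := reflectVector_inChart hpsrc hU hpU hs hbd' hpN hq
    (ℓ := ℓ y) rfl (ha y hyt)
  refine ⟨?_, ?_⟩
  · have h1 : F (y, v) = extChartAt (𝓡 n).tangent p₁ (reflectVector g Ω p) := hR.symm
    rw [h1, hsym _ (by exact hpsrc)] at hpF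
    exact hpF
  · change 0 < ℓ y v * _ at hpℓ
    rw [hNp, mul_assoc] at hpℓ
    exact pos_of_mul_pos_right hpℓ hK.le

end Reflection

lemma SmoothOn.continuous {EN HN N : Type*} [NormedAddCommGroup EN] [NormedSpace ℝ EN]
    [TopologicalSpace HN] [TopologicalSpace N] [ChartedSpace HN N] {EX HX X : Type*}
    [NormedAddCommGroup EX] [NormedSpace ℝ EX] [TopologicalSpace HX] [TopologicalSpace X]
    [ChartedSpace HX X] {I : ModelWithCorners ℝ EN HN} {J : ModelWithCorners ℝ EX HX} {B : Type*}
    [TopologicalSpace B] {ι : B → N} (hι : Continuous ι) {f : B → X} {s : Set B}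
    (h : SmoothOn I J ι f s) : ContinuousOn f s := by
  intro b hb
  obtain ⟨U, hU, hbU, G, hG, hGf⟩ := h b hb
  have h1 : ContinuousAt (fun b => G (ι b)) b :=
    ((hG.continuousOn).continuousAt (hU.mem_nhds hbU)).comp hι.continuousAt
  refine h1.continuousWithinAt.congr_of_eventuallyEq ?_ (hGf b hb hbU).symm
  filter_upwards [self_mem_nhdsWithin,
    nhdsWithin_le_nhds ((hU.preimage hι).mem_nhds hbU)] with b' hb' hbU'
  exact (hGf b' hb' hbU').symm

/-! ### The projection to the smooth model: its fibers and their neighbourhoods -/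

section Model

variable {n : ℕ} {Q : Type*} [TopologicalSpace Q] [ChartedSpace (EuclideanSpace ℝ (Fin n)) Q]
  [IsManifold (𝓡 n) ∞ Q] {g : Metric (n := n) Q} {Ω : Set Q}

lemma continuous_incl : Continuous (incl g Ω) := continuous_subtype_val

lemma isOpen_interiorPart (hΩ : IsObstacle n Ω) : IsOpen (interiorPart g Ω) :=
  (hΩ.1.isOpen_compl).preimage ((FiberBundle.continuous_proj (EuclideanSpace ℝ (Fin n))
    (TangentSpace (𝓡 n) : Q → Type _)).comp continuous_incl)

lemma IsArc.concat [T2Space Q] (hg : IsGeodesicallyComplete g) {d s s' : ℝ}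
    (hd : d = 1 ∨ d = -1) (hs : 0 < d * s) (hs' : 0 < d * s') {z w w' : PhaseSpace g Ω}
    (h : IsArc g Ω s z w) (hw : w ∈ interiorPart g Ω) (h' : IsArc g Ω s' w w') :
    IsArc g Ω (s + s') z w' := by
  have hss : 0 < d * (s + s') := by rw [mul_add]; linarith
  refine ⟨right_ne_zero_of_mul hss.ne', ?_, fun r hr => ?_⟩
  · rw [add_comm, geodesicFlow_add hg, h.2.1, h'.2.1]
  · rw [mem_uIoo_iff_of_mul_pos hd hss] at hr
    rcases lt_trichotomy (d * r) (d * s) with h1 | h1 | h1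
    · exact h.2.2 r ((mem_uIoo_iff_of_mul_pos hd hs r).2 ⟨hr.1, h1⟩)
    · rw [direction_cancel hd h1, h.2.1]
      exact hw
    · have := h'.2.2 (r - s) ((mem_uIoo_iff_of_mul_pos hd hs' _).2
        ⟨by rw [mul_sub]; linarith, by rw [mul_sub]; rw [mul_add] at hr; linarith⟩)
      rwa [← h.2.1, ← geodesicFlow_add hg, sub_add_cancel] at this

/-- The first arc of a trajectory, up to the first reflection. -/
lemma FlowsTo.first_arc [T2Space Q] (hg : IsGeodesicallyComplete g) (hΩ : IsObstacle n Ω)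
    {d : ℝ} (hd : d = 1 ∨ d = -1) {t : ℝ} {z w : PhaseSpace g Ω} (h : FlowsTo g Ω t z w)
    (ht : 0 < d * t) :
    ∃ (s : ℝ) (w₁ : PhaseSpace g Ω), 0 < d * s ∧ d * s ≤ d * t ∧
      IsArc g Ω s (launch g Ω d z) w₁ ∧ FlowsTo g Ω (t - s) w₁ w ∧
      (w₁ ∉ interiorPart g Ω ∨ s = t) := by
  induction h with
  | refl => simp at ht
  | @step t₁ s₁ z w₂ w h1 hs harc ih =>
    obtain ⟨h2, h3⟩ := direction_of_step hd hs harc.1 ht.le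
    rcases h2.eq_or_lt with h4 | h4
    · have h5 : t₁ = 0 := direction_cancel hd (by rw [mul_zero]; exact h4.symm)
      have h6 := h1.eq_of_zero h5
      rw [h5, zero_add]
      refine ⟨s₁, w, h3, le_rfl, ?_, by rw [sub_self]; exact FlowsTo.refl _, Or.inr rfl⟩
      rwa [← launch_congr h3, ← h6]
    · obtain ⟨s, w₁, hs0, hst, hs1, hs2, hs3⟩ := ih h4
      by_cases hint : w₁ ∈ interiorPart g Ω
      · have hst' := hs3.resolve_left (fun h => h hint)
        subst hst'
        have h6 := hs2.eq_of_zero (sub_self s)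
        rw [h6, launch_of_mem_interiorPart hΩ hint] at harc
        refine ⟨s + s₁, w, ?_, le_rfl, hs1.concat hg hd hs0 h3 hint harc,
          by rw [sub_self]; exact FlowsTo.refl _, Or.inr rfl⟩
        rw [mul_add]; linarith
      · refine ⟨s, w₁, hs0, by rw [mul_add]; linarith, hs1, ?_, Or.inl hint⟩
        rw [show t₁ + s₁ - s = t₁ - s + s₁ by ring]
        exact FlowsTo.step hs2 (mul_nonneg_of_direction hd (by rw [mul_sub]; linarith) h3.le) harc

variable [T2Space Q] (hg : IsGeodesicallyComplete g) (hΩ : IsObstacle n Ω)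
  {𝓜 : Type*} [TopologicalSpace 𝓜] [ChartedSpace (EuclideanSpace ℝ (Fin (2 * n - 1))) 𝓜]
  (mod : SmoothModel g Ω 𝓜)

namespace SmoothModel

omit [T2Space Q] in
lemma continuous_proj : Continuous mod.proj :=
  continuousOn_univ.1 (mod.smooth_proj.continuous continuous_incl)

omit [T2Space Q] in
lemma mem_domain {t : ℝ} {z w : PhaseSpace g Ω} (h : FlowsTo g Ω t z w) :
    (t, mod.proj z) ∈ mod.domain := ⟨(t, z), ⟨w, h⟩, rfl⟩

omit [T2Space Q] in
lemma zero_mem_domain (p : 𝓜) : ((0 : ℝ), p) ∈ mod.domain := by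
  obtain ⟨z, rfl⟩ := mod.surjective_proj p
  exact mod.mem_domain (FlowsTo.refl z)

omit [T2Space Q] in
lemma isOpen_domain' : IsOpen mod.domain := mod.isOpen_domain

omit [T2Space Q] in
lemma continuousAt_flow {x : ℝ × 𝓜} (hx : x ∈ mod.domain) :
    ContinuousAt (fun x : ℝ × 𝓜 => mod.flow x.1 x.2) x :=
  mod.smooth_flow.continuousOn.continuousAt (mod.isOpen_domain'.mem_nhds hx)

include hg hΩ in
lemma flow_proj {t : ℝ} {z w : PhaseSpace g Ω} (h : FlowsTo g Ω t z w) :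
    mod.flow t (mod.proj z) = mod.proj w := by
  have h1 := mod.intertwines (t, z) ⟨w, h⟩
  rw [flow_eq hg hΩ h] at h1
  exact h1

omit [T2Space Q] in
lemma continuousAt_flow_left (p : 𝓜) : ContinuousAt (fun t => mod.flow t p) 0 :=
  ContinuousAt.comp (f := fun t : ℝ => (t, p)) (x := (0 : ℝ))
    (mod.continuousAt_flow (mod.zero_mem_domain p)) (by fun_prop)

omit [T2Space Q] in
lemma eq_of_proj_eq_interior {z w : PhaseSpace g Ω} (hz : z ∈ interiorPart g Ω)
    (hw : w ∈ interiorPart g Ω) (h : mod.proj z = mod.proj w) : z = w := by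
  obtain ⟨inv, -, hinv⟩ := mod.diffeo_interior
  exact incl_injective (by rw [← hinv z hz, h, hinv w hw])

include hg hΩ in
-- At small positive times both points are on the same trajectory, so the model flow takes both
-- images to the same point. Letting the time tend to 0 in a Hausdorff space identifies the images.
lemma proj_reflection [T2Space 𝓜] (z : PhaseSpace g Ω) :
    mod.proj (reflection g Ω z) = mod.proj z := by
  obtain ⟨ε, hε, harc⟩ := exists_short_arcs hg hΩ (Or.inl rfl : (1 : ℝ) = 1 ∨ (1 : ℝ) = -1) z
  have h1 : ∀ᶠ s in 𝓝[>] (0 : ℝ), mod.flow s (mod.proj z)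
      = mod.flow s (mod.proj (reflection g Ω z)) := by
    filter_upwards [Ioo_mem_nhdsGT hε] with s hs
    obtain ⟨w, -, hw⟩ := harc s (by linarith [hs.1]) (by linarith [hs.2])
    rw [← launch_congr (d := 1) (s := s) (by linarith [hs.1])] at hw
    have h2 := FlowsTo.single hw
    rw [mod.flow_proj hg hΩ h2, mod.flow_proj hg hΩ (h2.reflection hs.1.ne')]
  have hlim : ∀ p, Filter.Tendsto (fun s => mod.flow s p) (𝓝[>] (0 : ℝ)) (𝓝 p) := fun p => by
    have := (mod.continuousAt_flow_left p).tendsto.mono_left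
      (nhdsWithin_le_nhds (s := Set.Ioi (0 : ℝ)))
    rwa [mod.flow_zero] at this
  exact tendsto_nhds_unique ((hlim _).congr' (h1.mono fun s hs => hs.symm)) (hlim _)

include hg hΩ in
-- A short flow moves both points into the interior, where the projection is injective. Running the
-- geodesics backwards, the launched vectors agree.
lemma eq_or_eq_reflection {z w : PhaseSpace g Ω} (h : mod.proj z = mod.proj w) :
    w = z ∨ w = reflection g Ω z := by
  have h1 : (1 : ℝ) = 1 ∨ (1 : ℝ) = -1 := Or.inl rfl
  obtain ⟨ε, hε, harc⟩ := exists_short_arcs hg hΩ h1 z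
  obtain ⟨ε', hε', harc'⟩ := exists_short_arcs hg hΩ h1 w
  have hpos : 0 < min ε ε' := lt_min hε hε'
  set s := min ε ε' / 2
  have hs : 0 < 1 * s := by rw [one_mul]; exact half_pos hpos
  have hsε : 1 * s < min ε ε' := by rw [one_mul]; exact half_lt_self hpos
  obtain ⟨z', hz', hz⟩ := harc s hs (hsε.trans_le (min_le_left _ _))
  obtain ⟨w', hw', hw⟩ := harc' s hs (hsε.trans_le (min_le_right _ _))
  have h2 := mod.flow_proj hg hΩ (FlowsTo.single (by rwa [launch_congr hs]) : FlowsTo g Ω s z z')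
  have h3 := mod.flow_proj hg hΩ (FlowsTo.single (by rwa [launch_congr hs]) : FlowsTo g Ω s w w')
  rw [h, h3] at h2
  have h4 := mod.eq_of_proj_eq_interior hz' hw' h2.symm
  refine eq_or_eq_reflection_of_launch_eq (d := 1) (incl_injective ?_)
  have h5 : geodesicFlow g s (incl g Ω (launch g Ω 1 w))
      = geodesicFlow g s (incl g Ω (launch g Ω 1 z)) := by rw [hw.2.1, hz.2.1, h4]
  have h6 := congrArg (geodesicFlow g (-s)) h5
  rwa [← geodesicFlow_add hg, ← geodesicFlow_add hg, neg_add_cancel, geodesicFlow_zero hg,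
    geodesicFlow_zero hg] at h6

include hg hΩ in
-- Membership in the model domain is witnessed by some point over the given image. This is `z` or
-- its reflection, and both have the same trajectories at nonzero times.
lemma exists_flowsTo {t : ℝ} {z : PhaseSpace g Ω} (h : (t, mod.proj z) ∈ mod.domain) :
    ∃ w, FlowsTo g Ω t z w := by
  obtain ⟨⟨t', z'⟩, ⟨w, hw⟩, heq⟩ := h
  obtain ⟨rfl, h2⟩ : t' = t ∧ mod.proj z' = mod.proj z := ⟨congrArg Prod.fst heq, congrArg Prod.snd heq⟩
  rcases eq_or_ne t' 0 with rfl | ht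
  · exact ⟨z, FlowsTo.refl z⟩
  · rcases mod.eq_or_eq_reflection hg hΩ h2 with rfl | rfl
    · exact ⟨w, hw⟩
    · exact ⟨w, hw.reflection ht⟩

/-- Points of the phase space over a small neighbourhood of `π z` are close to `z` or to its
reflection. -/
lemma exists_isOpen_preimage_subset [T2Space 𝓜] (hg : IsGeodesicallyComplete g)
    (hΩ : IsObstacle n Ω) (z : PhaseSpace g Ω) {W : Set (TangentBundle (𝓡 n) Q)} (hW : IsOpen W)
    (hz : incl g Ω z ∈ W) (hz' : incl g Ω (reflection g Ω z) ∈ W) :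
    ∃ U : Set 𝓜, IsOpen U ∧ mod.proj z ∈ U ∧ ∀ w, mod.proj w ∈ U → incl g Ω w ∈ W := by
  obtain ⟨inv, hinvs, hinv⟩ := mod.diffeo_interior
  have hO := mod.isOpen_interior
  by_cases hint : z ∈ interiorPart g Ω
  · refine ⟨(mod.proj '' interiorPart g Ω) ∩ inv ⁻¹' W, hinvs.continuousOn.isOpen_inter_preimage hO hW,
      ⟨⟨z, hint, rfl⟩, by rw [Set.mem_preimage, hinv z hint]; exact hz⟩, ?_⟩
    rintro w ⟨⟨w', hw', hww⟩, hwW⟩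
    rcases mod.eq_or_eq_reflection hg hΩ hww with rfl | rfl
    · rwa [Set.mem_preimage, hinv _ hw'] at hwW
    · rw [← hww, Set.mem_preimage, hinv _ hw'] at hwW
      rwa [reflection_of_mem_interiorPart hw']
  -- The claim is symmetric under exchanging `z` with its reflection.
  wlog hout : z ∈ outwardBoundary g Ω generalizing z
  · have hin : z ∈ inwardBoundary g Ω := by
      rcases mem_interiorPart_or z with h | h | h
      · exact absurd h hint
      · exact h
      · exact absurd h hout
    have := this (reflection g Ω z) hz' (by rwa [reflection_reflection]) hint
      (reflection_mem_outwardBoundary hin)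
    rwa [mod.proj_reflection hg hΩ] at this
  set z₁ := reflection g Ω z with hz₁
  have hz₁in : z₁ ∈ inwardBoundary g Ω := reflection_mem_inwardBoundary hout
  have hdp : (1 : ℝ) = 1 ∨ (1 : ℝ) = -1 := Or.inl rfl
  have hdm : (-1 : ℝ) = 1 ∨ (-1 : ℝ) = -1 := Or.inr rfl
  -- near the outward vector
  have hsign := eventually_reflectVector_mem (g := g) hΩ (p₁ := incl g Ω z) hout.2.ne
    (W := Set.univ) isOpen_univ (Set.mem_univ _)
  obtain ⟨N₂, hN₂, hN₂o, hzN₂⟩ := eventually_nhds_iff.1 (hsign.and (hW.mem_nhds hz))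
  have hcont := (contMDiff_geodesicFlow hg).continuous
  have hc0 : ∀ᶠ x : ℝ × TangentBundle (𝓡 n) Q in 𝓝 ((0 : ℝ), incl g Ω z),
      geodesicFlow g x.1 x.2 ∈ N₂ :=
    hcont.continuousAt.eventually_mem (hN₂o.mem_nhds (by
      simp only; rwa [geodesicFlow_zero hg]))
  rw [nhds_prod_eq] at hc0
  obtain ⟨P, hP, R, hR, hPR⟩ := Filter.eventually_prod_iff.1 hc0
  obtain ⟨ε₀, hε₀, hP'⟩ := Metric.eventually_nhds_iff.1 hP
  obtain ⟨N₂', hN₂', hN₂'o, hzN₂'⟩ := eventually_nhds_iff.1 hR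
  -- near the inward vector
  have hrefl : reflectVector g Ω (incl g Ω z₁) ∈ N₂' := by
    rw [← incl_reflection, hz₁, reflection_reflection]; exact hzN₂'
  have hnear := eventually_reflectVector_mem (g := g) hΩ (p₁ := incl g Ω z₁) hz₁in.2.ne'
    hN₂'o hrefl
  have hnear' := eventually_reflectVector_mem (g := g) hΩ (p₁ := incl g Ω z₁) hz₁in.2.ne'
    hW (by rw [← incl_reflection, hz₁, reflection_reflection]; exact hz)
  obtain ⟨N₁, hN₁, hN₁o, hzN₁⟩ := eventually_nhds_iff.1 ((hnear.and hnear').and (hW.mem_nhds hz'))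
  have hc1 : ∀ᶠ s in 𝓝 (0 : ℝ), geodesicFlow g s (incl g Ω z₁) ∈ N₁ :=
    (continuous_geodesicFlow_left hg _).continuousAt.eventually_mem
      (hN₁o.mem_nhds (by rwa [geodesicFlow_zero hg]))
  obtain ⟨ε₁, hε₁, hN₁'⟩ := Metric.eventually_nhds_iff.1 hc1
  obtain ⟨ε₂, hε₂, harc⟩ := exists_short_arcs hg hΩ hdm z
  -- The time `t` respects three bounds: geodesics issuing near `z` stay in `N₂`, the geodesic
  -- through `z₁` stays in `N₁`, and the backward trajectory of `z` is a single arc.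
  obtain ⟨t, ht0, htε₀, htε₁, htε₂⟩ : ∃ t : ℝ, 0 < t ∧ t < ε₀ ∧ t < ε₁ ∧ t < ε₂ := by
    refine ⟨min ε₀ (min ε₁ ε₂) / 2, ?_, ?_, ?_, ?_⟩
    · have : 0 < min ε₀ (min ε₁ ε₂) := lt_min hε₀ (lt_min hε₁ hε₂)
      linarith
    all_goals
      have h1 : min ε₀ (min ε₁ ε₂) ≤ ε₀ := min_le_left _ _
      have h2 : min ε₀ (min ε₁ ε₂) ≤ ε₁ := (min_le_right _ _).trans (min_le_left _ _)
      have h3 : min ε₀ (min ε₁ ε₂) ≤ ε₂ := (min_le_right _ _).trans (min_le_right _ _)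
      have h4 : 0 < min ε₀ (min ε₁ ε₂) := lt_min hε₀ (lt_min hε₁ hε₂)
      linarith
  have hlaunch : launch g Ω (-1) z = z₁ := launch_of_outward hout (by norm_num)
  obtain ⟨y₀, hy₀, hy₀arc⟩ := harc (-t) (by linarith) (by linarith)
  rw [hlaunch] at hy₀arc
  have hback : FlowsTo g Ω (-t) z y₀ := FlowsTo.single (by
    rw [launch_congr (d := -1) (by linarith), hlaunch]; exact hy₀arc)
  have hψy₀ : geodesicFlow g t (incl g Ω y₀) = incl g Ω z₁ := by
    rw [← hy₀arc.2.1, ← geodesicFlow_add hg, add_neg_cancel, geodesicFlow_zero hg]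
  have hfwd : FlowsTo g Ω t y₀ z₁ := FlowsTo.single (by
    rw [launch_of_mem_interiorPart hΩ hy₀]
    refine ⟨ht0.ne', hψy₀, fun r hr => ?_⟩
    rw [Set.uIoo_of_lt ht0] at hr
    rw [← hy₀arc.2.1, ← geodesicFlow_add hg]
    refine hy₀arc.2.2 _ ?_
    rw [Set.uIoo_of_gt (by linarith)]
    exact ⟨by linarith [hr.1], by linarith [hr.2]⟩)
  -- Compactness of the time interval gives one neighbourhood of `y₀` that works for all
  -- intermediate times.
  have htube : ∀ᶠ y in 𝓝 (incl g Ω y₀), ∀ s ∈ Set.Icc 0 t, geodesicFlow g s y ∈ N₁ := by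
    have : ∀ s ∈ Set.Icc 0 t, ∀ᶠ x : TangentBundle (𝓡 n) Q × ℝ in 𝓝 (incl g Ω y₀, s),
        geodesicFlow g x.2 x.1 ∈ N₁ := by
      intro s hs
      have hcs : Continuous fun x : TangentBundle (𝓡 n) Q × ℝ => geodesicFlow g x.2 x.1 :=
        hcont.comp continuous_swap
      refine hcs.continuousAt.eventually_mem (hN₁o.mem_nhds ?_)
      simp only
      rw [← hy₀arc.2.1, ← geodesicFlow_add hg]
      refine hN₁' ?_
      rw [Real.dist_eq, sub_zero, abs_lt]
      exact ⟨by linarith [hs.1], by linarith [hs.2]⟩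
    exact isCompact_Icc.eventually_forall_of_forall_eventually this
  -- A trajectory of duration `t` from a point near `y₀` ends near `z₁`, or hits `Ω` near `z₁` and
  -- continues near `z`. A second hit is impossible: arcs run forward end at inward vectors, while
  -- boundary vectors in `N₂` are outward like `z`.
  have key : ∀ y u : PhaseSpace g Ω, y ∈ interiorPart g Ω →
      (∀ s ∈ Set.Icc 0 t, geodesicFlow g s (incl g Ω y) ∈ N₁) → FlowsTo g Ω t y u →
      incl g Ω u ∈ W ∧ incl g Ω (reflection g Ω u) ∈ W := by
    intro y u hy hyN hyu
    obtain ⟨s, w₁, hs0, hst, hs1, hs2, hs3⟩ := hyu.first_arc hg hΩ hdp (by linarith)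
    rw [launch_of_mem_interiorPart hΩ hy] at hs1
    rw [one_mul] at hs0
    rw [one_mul, one_mul] at hst
    have hw₁N : incl g Ω w₁ ∈ N₁ := by
      rw [← hs1.2.1]; exact hyN s ⟨hs0.le, hst⟩
    obtain ⟨⟨hw₁R, hw₁R'⟩, hw₁W⟩ := hN₁ _ hw₁N
    rcases hst.eq_or_lt with rfl | hlt
    · have hu := hs2.eq_of_zero (sub_self s)
      rw [hu]
      refine ⟨hw₁W, ?_⟩
      by_cases hwi : w₁ ∈ interiorPart g Ω
      · rwa [reflection_of_mem_interiorPart hwi]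
      · have hwin := hs1.end_mem_inwardBoundary hg hs0 hwi
        exact (hw₁R' hwin.1 hwin.2.ne').1
    · have hwi := hs3.resolve_right hlt.ne
      have hwin := hs1.end_mem_inwardBoundary hg hs0 hwi
      have hR₁ : incl g Ω (reflection g Ω w₁) ∈ N₂' := (hw₁R hwin.1 hwin.2.ne').1
      obtain ⟨s', w₂, hs0', hst', hs1', hs2', hs3'⟩ :=
        hs2.first_arc hg hΩ hdp (by linarith)
      rw [launch_of_inward hwin one_pos] at hs1'
      rw [one_mul] at hs0'
      rw [one_mul, one_mul] at hst'
      have hw₂N : incl g Ω w₂ ∈ N₂ := by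
        rw [← hs1'.2.1]
        refine hPR (hP' ?_) (hN₂' _ hR₁)
        rw [Real.dist_eq, sub_zero, abs_of_pos hs0']
        linarith
      obtain ⟨hw₂s, hw₂W⟩ := hN₂ _ hw₂N
      have hw₂i : w₂ ∈ interiorPart g Ω := by
        by_contra hcon
        have h1 := hs1'.end_mem_inwardBoundary hg hs0' hcon
        have h2 := (hw₂s h1.1 h1.2.ne').2
        exact absurd h2 (not_lt.2 (mul_neg_of_pos_of_neg h1.2 hout.2).le)
      have hs' : s' = t - s := hs3'.resolve_left fun h => h hw₂i
      have hu := hs2'.eq_of_zero (by rw [hs', sub_self])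
      rw [hu, reflection_of_mem_interiorPart hw₂i]
      exact ⟨hw₂W, hw₂W⟩
  have hmem : (-t, mod.proj z) ∈ mod.domain := mod.mem_domain hback
  have hφ : mod.flow (-t) (mod.proj z) = mod.proj y₀ := mod.flow_proj hg hΩ hback
  have hφc : ContinuousAt (fun q => mod.flow (-t) q) (mod.proj z) :=
    ContinuousAt.comp (f := fun q : 𝓜 => (-t, q)) (x := mod.proj z) (mod.continuousAt_flow hmem)
      (by fun_prop)
  have e1 : ∀ᶠ q in 𝓝 (mod.proj z), (-t, q) ∈ mod.domain :=
    (Continuous.prodMk_right (-t)).continuousAt.eventually_mem (mod.isOpen_domain'.mem_nhds hmem)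
  have e2 : ∀ᶠ q in 𝓝 (mod.proj z), (t, mod.flow (-t) q) ∈ mod.domain := by
    have : ContinuousAt (fun q => (t, mod.flow (-t) q)) (mod.proj z) :=
      continuousAt_const.prodMk hφc
    refine this.eventually_mem (mod.isOpen_domain'.mem_nhds ?_)
    rw [hφ]
    exact mod.mem_domain hfwd
  have e3 : ∀ᶠ q in 𝓝 (mod.proj z), mod.flow (-t) q ∈ mod.proj '' interiorPart g Ω :=
    hφc.eventually_mem (hO.mem_nhds (by rw [hφ]; exact ⟨y₀, hy₀, rfl⟩))
  have e4 : ∀ᶠ q in 𝓝 (mod.proj z), ∀ s ∈ Set.Icc 0 t,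
      geodesicFlow g s (inv (mod.flow (-t) q)) ∈ N₁ := by
    have h1 : ContinuousAt inv (mod.flow (-t) (mod.proj z)) :=
      hinvs.continuousOn.continuousAt (hO.mem_nhds (by rw [hφ]; exact ⟨y₀, hy₀, rfl⟩))
    have h2 : ContinuousAt (fun q => inv (mod.flow (-t) q)) (mod.proj z) :=
      ContinuousAt.comp (f := fun q => mod.flow (-t) q) h1 hφc
    have h3 : inv (mod.flow (-t) (mod.proj z)) = incl g Ω y₀ := by rw [hφ, hinv y₀ hy₀]
    rw [← h3] at htube
    exact h2.eventually htube
  obtain ⟨U, hU, hUo, hzU⟩ := eventually_nhds_iff.1 ((e1.and e2).and (e3.and e4))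
  refine ⟨U, hUo, hzU, fun w hw => ?_⟩
  obtain ⟨⟨h1, h2⟩, ⟨y, hy, hyq⟩, h4⟩ := hU _ hw
  rw [← hyq, hinv y hy] at h4
  -- Flowing the image of `w` back by `t` and forward again produces a point `u` with the same
  -- image. Hence `w` is `u` or its reflection, and `key` controls both.
  obtain ⟨u, hu⟩ := mod.exists_flowsTo hg hΩ (hyq ▸ h2 : (t, mod.proj y) ∈ mod.domain)
  have h5 := mod.flow_proj hg hΩ hu
  have h6 := mod.flow_add (-t) t (mod.proj w) h1 h2 (by
    rw [neg_add_cancel]; exact mod.zero_mem_domain _)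
  rw [neg_add_cancel, mod.flow_zero, ← hyq, h5] at h6
  obtain ⟨h7, h8⟩ := key y u hy h4 hu
  rcases mod.eq_or_eq_reflection hg hΩ h6 with rfl | rfl
  · exact h7
  · exact h8

end SmoothModel

end Model

/-! ### Closure properties of smoothness on subsets of manifolds -/

section SmoothOnAPI

variable {EN HN N : Type*} [NormedAddCommGroup EN] [NormedSpace ℝ EN] [TopologicalSpace HN]
  [TopologicalSpace N] [ChartedSpace HN N] {I : ModelWithCorners ℝ EN HN}
  {EX HX X : Type*} [NormedAddCommGroup EX] [NormedSpace ℝ EX] [TopologicalSpace HX]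
  [TopologicalSpace X] [ChartedSpace HX X] {J : ModelWithCorners ℝ EX HX}
  {EY HY Y : Type*} [NormedAddCommGroup EY] [NormedSpace ℝ EY] [TopologicalSpace HY]
  [TopologicalSpace Y] [ChartedSpace HY Y] {K : ModelWithCorners ℝ EY HY}
  {V V' V'' : Type*} [NormedAddCommGroup V] [NormedSpace ℝ V] [NormedAddCommGroup V']
  [NormedSpace ℝ V'] [NormedAddCommGroup V''] [NormedSpace ℝ V'']
  {A B : Type*} {ι : B → N} {s : Set B}

lemma SmoothOn.congr' {f f' : B → X} (hf : SmoothOn I J ι f s) (h : ∀ a ∈ s, f' a = f a) :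
    SmoothOn I J ι f' s := fun a ha => by
  obtain ⟨U, hU, haU, G, hG, hGf⟩ := hf a ha
  exact ⟨U, hU, haU, G, hG, fun b hb hbU => (hGf b hb hbU).trans (h b hb).symm⟩

lemma SmoothOn.mono' {f : B → X} {s' : Set B} (hf : SmoothOn I J ι f s) (h : s' ⊆ s) :
    SmoothOn I J ι f s' := fun a ha => by
  obtain ⟨U, hU, haU, G, hG, hGf⟩ := hf a (h ha)
  exact ⟨U, hU, haU, G, hG, fun b hb hbU => hGf b (h hb) hbU⟩

lemma SmoothOn.of_contMDiffOn {F : N → X} {W : Set N} (hW : IsOpen W)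
    (hF : ContMDiffOn I J ∞ F W) (hs : ∀ b ∈ s, ι b ∈ W) :
    SmoothOn I J ι (fun b => F (ι b)) s := fun b hb =>
  ⟨W, hW, hs b hb, F, hF, fun _ _ _ => rfl⟩

lemma SmoothOn.of_local {f : B → X}
    (h : ∀ b ∈ s, ∃ U : Set N, IsOpen U ∧ ι b ∈ U ∧ SmoothOn I J ι f (s ∩ ι ⁻¹' U)) :
    SmoothOn I J ι f s := fun b hb => by
  obtain ⟨U, hU, hbU, hf⟩ := h b hb
  obtain ⟨U', hU', hbU', G, hG, hGf⟩ := hf b ⟨hb, hbU⟩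
  exact ⟨U ∩ U', hU.inter hU', ⟨hbU, hbU'⟩, G, hG.mono Set.inter_subset_right,
    fun b' hb' hbU => hGf b' ⟨hb', hbU.1⟩ hbU.2⟩

lemma SmoothOn.comp_contMDiffOn {f : B → X} (hf : SmoothOn I J ι f s) {G : X → Y} {O : Set X}
    (hO : IsOpen O) (hG : ContMDiffOn J K ∞ G O) (hs : ∀ b ∈ s, f b ∈ O) :
    SmoothOn I K ι (fun b => G (f b)) s := fun b hb => by
  obtain ⟨U, hU, hbU, F, hF, hFf⟩ := hf b hb
  refine ⟨U ∩ F ⁻¹' O, hF.continuousOn.isOpen_inter_preimage hU hO,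
    ⟨hbU, by rw [Set.mem_preimage, hFf b hb hbU]; exact hs b hb⟩, fun x => G (F x),
    hG.comp (hF.mono Set.inter_subset_left) fun x hx => hx.2,
    fun b' hb' hbU' => by simp only [hFf b' hb' hbU'.1]⟩

lemma SmoothOn.comp_contDiff {f : B → V} (hf : SmoothOn I 𝓘(ℝ, V) ι f s) {G : V → V'}
    (hG : ContDiff ℝ ∞ G) : SmoothOn I 𝓘(ℝ, V') ι (fun b => G (f b)) s :=
  hf.comp_contMDiffOn isOpen_univ hG.contMDiff.contMDiffOn fun _ _ => Set.mem_univ _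

lemma SmoothOn.comp_contDiffAt {f : B → V} (hf : SmoothOn I 𝓘(ℝ, V) ι f s) {G : V → V'}
    {O : Set V} (hO : IsOpen O) (hG : ∀ x ∈ O, ContDiffAt ℝ ∞ G x) (hs : ∀ b ∈ s, f b ∈ O) :
    SmoothOn I 𝓘(ℝ, V') ι (fun b => G (f b)) s :=
  hf.comp_contMDiffOn hO (contMDiffOn_iff_contDiffOn.2 fun x hx => (hG x hx).contDiffWithinAt) hs

/-- Composition with a map `c` of parameter sets for which `ι ∘ c` is smooth. -/
lemma SmoothOn.comp_param {f : B → Y} (hf : SmoothOn I K ι f s) {j : A → X} {s' : Set A}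
    {c : A → B} (hc : SmoothOn J I j (fun a => ι (c a)) s') (hs : ∀ a ∈ s', c a ∈ s) :
    SmoothOn J K j (fun a => f (c a)) s' := fun a ha => by
  obtain ⟨U, hU, hbU, F, hF, hFf⟩ := hf (c a) (hs a ha)
  obtain ⟨U', hU', haU', C, hC, hCc⟩ := hc a ha
  refine ⟨U' ∩ C ⁻¹' U, hC.continuousOn.isOpen_inter_preimage hU' hU,
    ⟨haU', by rw [Set.mem_preimage, hCc a ha haU']; exact hbU⟩, fun x => F (C x),
    hF.comp (hC.mono Set.inter_subset_left) fun x hx => hx.2, fun a' ha' haU => ?_⟩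
  have h1 := hCc a' ha' haU.1
  have h2 := haU.2
  rw [Set.mem_preimage, h1] at h2
  simp only [h1]
  exact hFf _ (hs a' ha') h2

lemma SmoothOn.prodMk {f : B → X} {f' : B → Y} (hf : SmoothOn I J ι f s)
    (hf' : SmoothOn I K ι f' s) : SmoothOn I (J.prod K) ι (fun b => (f b, f' b)) s := fun b hb => by
  obtain ⟨U, hU, haU, G, hG, hGf⟩ := hf b hb
  obtain ⟨U', hU', haU', G', hG', hGf'⟩ := hf' b hb
  refine ⟨U ∩ U', hU.inter hU', ⟨haU, haU'⟩, fun x => (G x, G' x),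
    (hG.mono Set.inter_subset_left).prodMk (hG'.mono Set.inter_subset_right), fun b hb hbU => ?_⟩
  simp only [hGf b hb hbU.1, hGf' b hb hbU.2]

lemma SmoothOn.prodMk_space {f : B → V} {f' : B → V'} (hf : SmoothOn I 𝓘(ℝ, V) ι f s)
    (hf' : SmoothOn I 𝓘(ℝ, V') ι f' s) :
    SmoothOn I 𝓘(ℝ, V × V') ι (fun b => (f b, f' b)) s := fun b hb => by
  obtain ⟨U, hU, haU, G, hG, hGf⟩ := hf b hb
  obtain ⟨U', hU', haU', G', hG', hGf'⟩ := hf' b hb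
  refine ⟨U ∩ U', hU.inter hU', ⟨haU, haU'⟩, fun x => (G x, G' x),
    (hG.mono Set.inter_subset_left).prodMk_space (hG'.mono Set.inter_subset_right),
    fun b hb hbU => ?_⟩
  simp only [hGf b hb hbU.1, hGf' b hb hbU.2]

lemma SmoothOn.comp_contDiff₂ {f : B → V} {f' : B → V'} (hf : SmoothOn I 𝓘(ℝ, V) ι f s)
    (hf' : SmoothOn I 𝓘(ℝ, V') ι f' s) {G : V × V' → V''} (hG : ContDiff ℝ ∞ G) :
    SmoothOn I 𝓘(ℝ, V'') ι (fun b => G (f b, f' b)) s :=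
  (hf.prodMk_space hf').comp_contDiff hG

lemma SmoothOn.clm_apply {r : ℕ} {f : B → (Fin r → ℂ) →L[ℂ] (Fin r → ℂ)} {f' : B → Fin r → ℂ}
    (hf : SmoothOn I 𝓘(ℝ, (Fin r → ℂ) →L[ℂ] (Fin r → ℂ)) ι f s)
    (hf' : SmoothOn I 𝓘(ℝ, Fin r → ℂ) ι f' s) :
    SmoothOn I 𝓘(ℝ, Fin r → ℂ) ι (fun b => f b (f' b)) s :=
  hf.comp_contDiff₂ hf' (G := fun q => q.1 q.2)
    ((isBoundedBilinearMap_apply (𝕜 := ℂ) (E := Fin r → ℂ) (F := Fin r → ℂ)).contDiff.restrict_scalars ℝ)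

set_option synthInstance.maxHeartbeats 200000 in
lemma SmoothOn.clm_comp {r : ℕ} {f f' : B → (Fin r → ℂ) →L[ℂ] (Fin r → ℂ)}
    (hf : SmoothOn I 𝓘(ℝ, (Fin r → ℂ) →L[ℂ] (Fin r → ℂ)) ι f s)
    (hf' : SmoothOn I 𝓘(ℝ, (Fin r → ℂ) →L[ℂ] (Fin r → ℂ)) ι f' s) :
    SmoothOn I 𝓘(ℝ, (Fin r → ℂ) →L[ℂ] (Fin r → ℂ)) ι (fun b => (f b).comp (f' b)) s :=
  hf.comp_contDiff₂ hf' (G := fun q => q.1.comp q.2)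
    ((isBoundedBilinearMap_comp (𝕜 := ℂ)).contDiff.restrict_scalars ℝ)

/-- A linear map valued function is smooth if its values on all vectors are. -/
lemma SmoothOn.clm_of_apply {r : ℕ} {f : B → (Fin r → ℂ) →L[ℂ] (Fin r → ℂ)}
    (h : ∀ v, SmoothOn I 𝓘(ℝ, Fin r → ℂ) ι (fun b => f b v) s) :
    SmoothOn I 𝓘(ℝ, (Fin r → ℂ) →L[ℂ] (Fin r → ℂ)) ι f s := by
  have key : ∀ t : Finset (Fin r), SmoothOn I 𝓘(ℝ, (Fin r → ℂ) →L[ℂ] (Fin r → ℂ)) ι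
      (fun b => ∑ i ∈ t, (ContinuousLinearMap.proj (R := ℂ) (φ := fun _ : Fin r => ℂ) i).smulRight
        (f b (Pi.single i 1))) s := by
    intro t
    induction t using Finset.induction_on with
    | empty => simpa using SmoothOn.zero
    | insert i t hi ih =>
      simp only [Finset.sum_insert hi]
      refine SmoothOn.add ?_ ih
      refine (h (Pi.single i 1)).comp_contDiff (G := fun w =>
        (ContinuousLinearMap.proj (R := ℂ) (φ := fun _ : Fin r => ℂ) i).smulRight w) ?_
      exact (((ContinuousLinearMap.smulRightL ℂ (Fin r → ℂ) (Fin r → ℂ)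
        (ContinuousLinearMap.proj (R := ℂ) (φ := fun _ : Fin r => ℂ) i)).contDiff (n := ∞)).restrict_scalars ℝ)
  refine (key Finset.univ).congr fun b _ => ContinuousLinearMap.ext fun v => ?_
  simp only [_root_.sum_apply, ContinuousLinearMap.smulRight_apply,
    ContinuousLinearMap.proj_apply]
  conv_lhs => rw [pi_eq_sum_univ' v, map_sum]
  refine Finset.sum_congr rfl fun i _ => ?_
  rw [map_smul]

lemma SmoothOn.clm_inverse {r : ℕ} {f : B → (Fin r → ℂ) →L[ℂ] (Fin r → ℂ)}
    (hf : SmoothOn I 𝓘(ℝ, (Fin r → ℂ) →L[ℂ] (Fin r → ℂ)) ι f s)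
    (h : ∀ b ∈ s, IsUnit (f b)) :
    SmoothOn I 𝓘(ℝ, (Fin r → ℂ) →L[ℂ] (Fin r → ℂ)) ι (fun b => Ring.inverse (f b)) s :=
  hf.comp_contDiffAt Units.isOpen (fun x hx => by
    obtain ⟨u, rfl⟩ := hx
    exact (contDiffAt_ringInverse ℂ u).restrict_scalars ℝ) h

end SmoothOnAPI

/-! ### Cutoff functions on manifolds -/

section Cutoff

variable {E : Type*} [NormedAddCommGroup E] [NormedSpace ℝ E] [FiniteDimensional ℝ E]
  {H : Type*} [TopologicalSpace H] {I : ModelWithCorners ℝ E H} {M : Type*} [TopologicalSpace M]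
  [ChartedSpace H M] [IsManifold I ∞ M] [T2Space M]

lemma exists_cutoff (I : ModelWithCorners ℝ E H) [IsManifold I ∞ M] {x : M} {s : Set M} (hs : s ∈ 𝓝 x) :
    ∃ b : M → ℝ, ContMDiff I 𝓘(ℝ, ℝ) ∞ b ∧ tsupport b ⊆ s ∧ b =ᶠ[𝓝 x] 1 := by
  obtain ⟨f, -, hf⟩ := (SmoothBumpFunction.nhds_basis_tsupport (I := I) x).mem_iff.1 hs
  exact ⟨f, f.contMDiff, hf, f.eventuallyEq_one⟩

omit [FiniteDimensional ℝ E] [IsManifold I ∞ M] [T2Space M] in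
lemma contMDiff_cutoff_smul {V : Type*} [NormedAddCommGroup V] [NormedSpace ℝ V] {b : M → ℝ}
    (hb : ContMDiff I 𝓘(ℝ, ℝ) ∞ b) {s : Set M} (hs : IsOpen s) (hbs : tsupport b ⊆ s) {F : M → V}
    (hF : ContMDiffOn I 𝓘(ℝ, V) ∞ F s) : ContMDiff I 𝓘(ℝ, V) ∞ (fun x => b x • F x) := by
  refine contMDiff_of_tsupport fun x hx => ?_
  have hx' : x ∈ s := hbs (tsupport_smul_subset_left b F hx)
  exact (hb x).smul (hF.contMDiffAt (hs.mem_nhds hx'))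

end Cutoff

lemma hasDerivWithinAt_clm_apply {V V' : Type*} [NormedAddCommGroup V] [NormedSpace ℂ V]
    [NormedAddCommGroup V'] [NormedSpace ℂ V'] {A : ℝ → V →L[ℂ] V'} {A' : V →L[ℂ] V'}
    {u : ℝ → V} {u' : V} {J : Set ℝ} {s : ℝ} (hA : HasDerivWithinAt A A' J s)
    (hu : HasDerivWithinAt u u' J s) :
    HasDerivWithinAt (fun s => A s (u s)) (A' (u s) + A s u') J s := by
  have h1 : HasDerivWithinAt (fun s => (A s).restrictScalars ℝ) (A'.restrictScalars ℝ) J s :=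
    (ContinuousLinearMap.restrictScalarsL ℂ V V' ℝ ℝ).hasFDerivAt.comp_hasDerivWithinAt s hA
  exact h1.clm_apply hu

/-! ### Derivatives along geodesics inside the phase space, one-sided at its boundary -/

section ArcDeriv

variable {n : ℕ} {Q : Type*} [TopologicalSpace Q] [ChartedSpace (EuclideanSpace ℝ (Fin n)) Q]
  [IsManifold (𝓡 n) ∞ Q] {g : Metric (n := n) Q} {Ω : Set Q}
  {V V' : Type*} [NormedAddCommGroup V] [NormedSpace ℝ V]

/-- `y` is the derivative of `f` along the geodesic through `z`, as far as this geodesic stays in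
the phase space. -/
def HasArcDeriv (f : PhaseSpace g Ω → V) (z : PhaseSpace g Ω) (y : V) : Prop :=
  ∀ (J : Set ℝ) (w : ℝ → PhaseSpace g Ω), w 0 = z →
    (∀ s ∈ J, incl g Ω (w s) = geodesicFlow g s (incl g Ω z)) →
    HasDerivWithinAt (fun s => f (w s)) y J 0

lemma HasArcDeriv.const (c : V) (z : PhaseSpace g Ω) : HasArcDeriv (fun _ => c) z 0 :=
  fun _ _ _ _ => hasDerivWithinAt_const _ _ _

lemma HasArcDeriv.clm_apply {r : ℕ} {A : PhaseSpace g Ω → (Fin r → ℂ) →L[ℂ] (Fin r → ℂ)}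
    {A' : (Fin r → ℂ) →L[ℂ] (Fin r → ℂ)} {u : PhaseSpace g Ω → Fin r → ℂ} {u' : Fin r → ℂ}
    {z : PhaseSpace g Ω} (hA : HasArcDeriv A z A') (hu : HasArcDeriv u z u') :
    HasArcDeriv (fun w => A w (u w)) z (A' (u z) + A z u') := fun J w hw hJ => by
  have := hasDerivWithinAt_clm_apply (hA J w hw hJ) (hu J w hw hJ)
  rwa [hw] at this

lemma HasArcDeriv.comp_clm [NormedAddCommGroup V'] [NormedSpace ℝ V'] {f : PhaseSpace g Ω → V}
    {z : PhaseSpace g Ω} {y : V} (h : HasArcDeriv f z y) (L : V →L[ℝ] V') :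
    HasArcDeriv (fun w => L (f w)) z (L y) := fun J w hw hJ =>
  L.hasFDerivAt.comp_hasDerivWithinAt 0 (h J w hw hJ)

lemma HasArcDeriv.congr (hg : IsGeodesicallyComplete g) {f f' : PhaseSpace g Ω → V}
    {z : PhaseSpace g Ω} {y : V} (h : HasArcDeriv f z y) {W : Set (TangentBundle (𝓡 n) Q)}
    (hW : IsOpen W) (hz : incl g Ω z ∈ W) (heq : ∀ w, incl g Ω w ∈ W → f' w = f w) :
    HasArcDeriv f' z y := fun J w hw hJ => by
  refine (h J w hw hJ).congr_of_eventuallyEq ?_ (show f' (w 0) = f (w 0) by rw [hw]; exact heq z hz)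
  have h1 : ∀ᶠ s in 𝓝 (0 : ℝ), geodesicFlow g s (incl g Ω z) ∈ W :=
    (continuous_geodesicFlow_left hg _).continuousAt.eventually_mem
      (hW.mem_nhds (by rwa [geodesicFlow_zero hg]))
  filter_upwards [nhdsWithin_le_nhds h1, self_mem_nhdsWithin] with s hs hsJ
  exact heq _ (by rw [hJ s hsJ]; exact hs)

lemma HasArcDeriv.of_hasDerivAt (hg : IsGeodesicallyComplete g) {f : PhaseSpace g Ω → V}
    {F : TangentBundle (𝓡 n) Q → V} {z : PhaseSpace g Ω} {y : V}
    {W : Set (TangentBundle (𝓡 n) Q)} (hW : IsOpen W) (hz : incl g Ω z ∈ W)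
    (heq : ∀ w, incl g Ω w ∈ W → f w = F (incl g Ω w))
    (h : HasDerivAt (fun s => F (geodesicFlow g s (incl g Ω z))) y 0) : HasArcDeriv f z y := by
  have h1 : HasArcDeriv (fun w => F (incl g Ω w)) z y := fun J w hw hJ =>
    h.hasDerivWithinAt.congr_of_eventuallyEq
      (by filter_upwards [self_mem_nhdsWithin] with s hs using by rw [hJ s hs])
      (by rw [hw, geodesicFlow_zero hg])
  exact h1.congr hg hW hz heq


/-! ### Short pieces of trajectories -/

lemma launch_launch {d : ℝ} (z : PhaseSpace g Ω) :
    launch g Ω d (launch g Ω d z) = launch g Ω d z := by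
  rcases mem_interiorPart_or z with hz | hz | hz
  · rcases launch_eq_or d z with h | h
    · rw [h, h]
    · rw [reflection_of_mem_interiorPart hz] at h; rw [h, h]
  all_goals rcases lt_trichotomy d 0 with h | rfl | h
  · rw [launch_of_inward_neg hz h, launch_of_inward_neg hz h]
  · simp [launch]
  · rw [launch_of_inward hz h, launch_of_outward_pos (reflection_mem_outwardBoundary hz) h]
  · rw [launch_of_outward hz h, launch_of_inward_neg (reflection_mem_inwardBoundary hz) h]
  · simp [launch]
  · rw [launch_of_outward_pos hz h, launch_of_outward_pos hz h]

/-- At every point one of the two directions of time requires no reflection, and in it the geodesic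
itself is the trajectory for a short time. -/
lemma exists_direction_launch (hΩ : IsObstacle n Ω) (z : PhaseSpace g Ω) :
    ∃ d : ℝ, (d = 1 ∨ d = -1) ∧ launch g Ω d z = z := by
  rcases mem_interiorPart_or z with hz | hz | hz
  · exact ⟨1, Or.inl rfl, launch_of_mem_interiorPart hΩ hz 1⟩
  · exact ⟨-1, Or.inr rfl, launch_of_inward_neg hz (by norm_num)⟩
  · exact ⟨1, Or.inl rfl, launch_of_outward_pos hz one_pos⟩

/-- The short trajectory starting at `z` in a direction in which it is not reflected at `z`. -/
lemma exists_arc_family (hg : IsGeodesicallyComplete g) (hΩ : IsObstacle n Ω) {d : ℝ}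
    (hd : d = 1 ∨ d = -1) {z : PhaseSpace g Ω} (hz : launch g Ω d z = z) :
    ∃ ε > 0, ∃ w : ℝ → PhaseSpace g Ω, w 0 = z ∧ ∀ s, 0 ≤ d * s → d * s < ε →
      incl g Ω (w s) = geodesicFlow g s (incl g Ω z) ∧ FlowsTo g Ω s z (w s) ∧
        (s ≠ 0 → w s ∈ interiorPart g Ω) := by
  obtain ⟨ε, hε, harc⟩ := exists_short_arcs hg hΩ hd z
  rw [hz] at harc
  have : Nonempty (PhaseSpace g Ω) := ⟨z⟩
  choose! w hw hwarc using harc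
  classical
  refine ⟨ε, hε, fun s => if s = 0 then z else w s, if_pos rfl, fun s hs hsε => ?_⟩
  rcases eq_or_ne s 0 with rfl | h0
  · simp only [if_true]
    exact ⟨(geodesicFlow_zero hg _).symm, FlowsTo.refl z, fun h => absurd rfl h⟩
  · simp only [if_neg h0]
    have hs' : 0 < d * s := lt_of_le_of_ne hs (mul_ne_zero (direction_ne_zero hd) h0).symm
    refine ⟨(hwarc s hs' hsε).2.1.symm, FlowsTo.single ?_, fun _ => hw s hs' hsε⟩
    rw [launch_congr hs', hz]
    exact hwarc s hs' hsε

lemma halfInterval_mem_nhdsWithin {d ε : ℝ} (hε : 0 < ε) :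
    {s : ℝ | 0 ≤ d * s ∧ d * s < ε} ∈ 𝓝[{s : ℝ | 0 ≤ d * s}] (0 : ℝ) := by
  have h1 : ∀ᶠ s in 𝓝 (0 : ℝ), d * s < ε := by
    have : ContinuousAt (fun s : ℝ => d * s) 0 := by fun_prop
    exact this.eventually (gt_mem_nhds (by simpa using hε))
  filter_upwards [self_mem_nhdsWithin, nhdsWithin_le_nhds h1] with s hs hs'
  exact ⟨hs, hs'⟩

/-- The arc in the direction without reflection provides a half interval of times, on which
derivatives at 0 are unique. -/
lemma HasArcDeriv.unique (hg : IsGeodesicallyComplete g) (hΩ : IsObstacle n Ω)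
    {f : PhaseSpace g Ω → V} {z : PhaseSpace g Ω} {y y' : V} (h : HasArcDeriv f z y)
    (h' : HasArcDeriv f z y') : y = y' := by
  obtain ⟨d, hd, hz⟩ := exists_direction_launch hΩ z
  obtain ⟨ε, hε, w, hw0, hw⟩ := exists_arc_family hg hΩ hd hz
  have h1 := h {s | 0 ≤ d * s ∧ d * s < ε} w hw0 fun s hs => (hw s hs.1 hs.2).1
  have h2 := h' {s | 0 ≤ d * s ∧ d * s < ε} w hw0 fun s hs => (hw s hs.1 hs.2).1
  have h3 : UniqueDiffWithinAt ℝ {s : ℝ | 0 ≤ d * s ∧ d * s < ε} 0 := by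
    have hmem := halfInterval_mem_nhdsWithin (d := d) hε
    refine UniqueDiffWithinAt.mono_nhds (s := {s : ℝ | 0 ≤ d * s}) ?_ ?_
    · rcases hd with rfl | rfl
      · rw [show {s : ℝ | 0 ≤ 1 * s} = Set.Ici 0 by ext; simp]
        exact uniqueDiffWithinAt_Ici (0 : ℝ)
      · rw [show {s : ℝ | 0 ≤ -1 * s} = Set.Iic 0 by ext; simp]
        exact uniqueDiffWithinAt_Iic (0 : ℝ)
    · exact nhdsWithin_le_iff.2 hmem
  exact h3.eq_deriv _ h1 h2

lemma HasArcDeriv.hasDerivWithinAt_family {d ε : ℝ} {z : PhaseSpace g Ω} {w : ℝ → PhaseSpace g Ω}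
    (hε : 0 < ε) (hw0 : w 0 = z) (hw : ∀ s, 0 ≤ d * s → d * s < ε →
      incl g Ω (w s) = geodesicFlow g s (incl g Ω z)) {f : PhaseSpace g Ω → V} {y : V}
    (h : HasArcDeriv f z y) : HasDerivWithinAt (fun s => f (w s)) y {s | 0 ≤ d * s} 0 :=
  (h {s | 0 ≤ d * s ∧ d * s < ε} w hw0 fun s hs => hw s hs.1 hs.2).mono_of_mem_nhdsWithin
    (halfInterval_mem_nhdsWithin hε)

variable [T2Space Q] {𝓜 : Type*} [TopologicalSpace 𝓜]
  [ChartedSpace (EuclideanSpace ℝ (Fin (2 * n - 1))) 𝓜] (mod : SmoothModel g Ω 𝓜)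

/-- If a function on the model has the same derivative along geodesics at all points over `p`, then
this is its derivative along the model flow. -/
lemma SmoothModel.hasDerivAt_of_hasArcDeriv [T2Space 𝓜] (hg : IsGeodesicallyComplete g)
    (hΩ : IsObstacle n Ω) {F : 𝓜 → V} {p : 𝓜} {y : V}
    (h : ∀ z, mod.proj z = p → HasArcDeriv (fun w => F (mod.proj w)) z y) :
    HasDerivAt (fun t => F (mod.flow t p)) y 0 := by
  obtain ⟨z₀, rfl⟩ := mod.surjective_proj p
  -- In either direction the model flow follows the geodesic from the launched vector, which may be
  -- the other point over `p`. The hypothesis at all points over `p` gives equal one-sided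
  -- derivatives.
  have key : ∀ d : ℝ, (d = 1 ∨ d = -1) →
      HasDerivWithinAt (fun t => F (mod.flow t (mod.proj z₀))) y {s | 0 ≤ d * s} 0 := by
    intro d hd
    have hproj : mod.proj (launch g Ω d z₀) = mod.proj z₀ := by
      rcases launch_eq_or d z₀ with h1 | h1 <;> rw [h1]
      exact mod.proj_reflection hg hΩ z₀
    obtain ⟨ε, hε, w, hw0, hw⟩ := exists_arc_family hg hΩ hd (launch_launch (d := d) z₀)
    refine ((h _ hproj).hasDerivWithinAt_family hε hw0
      fun s h1 h2 => (hw s h1 h2).1).congr_of_eventuallyEq ?_ ?_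
    · filter_upwards [halfInterval_mem_nhdsWithin (d := d) hε] with s hs
      rw [← hproj, mod.flow_proj hg hΩ (hw s hs.1 hs.2).2.1]
    · rw [mod.flow_zero, hw0, hproj]
  have h1 := key 1 (Or.inl rfl)
  have h2 := key (-1) (Or.inr rfl)
  have h3 := h1.union h2
  have h4 : {s : ℝ | 0 ≤ 1 * s} ∪ {s : ℝ | 0 ≤ -1 * s} = Set.univ := by
    ext s
    simpa using le_total 0 s
  rwa [h4, hasDerivWithinAt_univ] at h3

/-- Smooth functions on the model as smooth functions on the phase space. -/
def SmoothModel.pullback (F : 𝓜 → ℂ)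
    (hF : ContMDiff (𝓡 (2 * n - 1)) 𝓘(ℝ, ℂ) ∞ F) : SmoothFun (𝓡 n).tangent (incl g Ω) :=
  ⟨fun z => F (mod.proj z), mod.smooth_proj.comp_contMDiffOn isOpen_univ hF.contMDiffOn
    fun _ _ => Set.mem_univ _⟩

omit [T2Space Q] in
lemma SmoothModel.smoothOn_proj_snd :
    SmoothOn (𝓘(ℝ, ℝ).prod (𝓡 n).tangent) (𝓘(ℝ, ℝ).prod (𝓡 (2 * n - 1)))
      (Prod.map (id : ℝ → ℝ) (incl g Ω))
      (fun x : ℝ × PhaseSpace g Ω => (x.1, mod.proj x.2)) Set.univ := by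
  refine SmoothOn.prodMk ?_ ?_
  · exact SmoothOn.of_contMDiffOn (F := fun x : ℝ × TangentBundle (𝓡 n) Q => x.1) isOpen_univ
      contMDiffOn_fst fun _ _ => Set.mem_univ _
  · refine mod.smooth_proj.comp_param (c := Prod.snd) ?_ fun _ _ => Set.mem_univ _
    exact SmoothOn.of_contMDiffOn (F := fun x : ℝ × TangentBundle (𝓡 n) Q => x.2) isOpen_univ
      contMDiffOn_snd fun _ _ => Set.mem_univ _

omit [T2Space Q] in
-- By intertwining, the function along the billiard flow is the composition of a function on `𝓜`
-- with the smooth model flow. Pullbacks are the billiard functions to which the Leibniz hypothesis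
-- gets applied.
lemma SmoothModel.isBilliardFun_pullback {F : 𝓜 → ℂ} (hF : ContMDiff (𝓡 (2 * n - 1)) 𝓘(ℝ, ℂ) ∞ F) :
    IsBilliardFun g Ω (mod.pullback F hF) := by
  have h1 := (mod.smoothOn_proj_snd.mono' (Set.subset_univ (flowDomain g Ω))).comp_contMDiffOn
    mod.isOpen_domain' (mod.smooth_flow) (fun x hx => ⟨x, hx, rfl⟩)
  have h2 := h1.comp_contMDiffOn isOpen_univ hF.contMDiffOn fun _ _ => Set.mem_univ _
  refine h2.congr' fun x hx => ?_
  simp only [mod.intertwines x hx]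
  rfl

lemma SmoothModel.generator_pullback (hg : IsGeodesicallyComplete g)
    (hΩ : IsObstacle n Ω) {F : 𝓜 → ℂ} (hF : ContMDiff (𝓡 (2 * n - 1)) 𝓘(ℝ, ℂ) ∞ F)
    (z : PhaseSpace g Ω) :
    generator g Ω (mod.pullback F hF).1 z = deriv (fun t => F (mod.flow t (mod.proj z))) 0 := by
  unfold generator
  refine Filter.EventuallyEq.deriv_eq ?_
  have h1 : ∀ᶠ t in 𝓝 (0 : ℝ), (t, mod.proj z) ∈ mod.domain :=
    (Continuous.prodMk_left (mod.proj z)).continuousAt.eventually_mem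
      (mod.isOpen_domain'.mem_nhds (mod.zero_mem_domain _))
  filter_upwards [h1] with t ht
  obtain ⟨w, hw⟩ := mod.exists_flowsTo hg hΩ ht
  rw [flow_eq hg hΩ hw, mod.flow_proj hg hΩ hw]
  rfl

end ArcDeriv

/-! ### Cutoffs for functions on subsets, and complex valued cutoffs -/

section Cutoff

variable {EN HN N : Type*} [NormedAddCommGroup EN] [NormedSpace ℝ EN] [TopologicalSpace HN]
  [TopologicalSpace N] [ChartedSpace HN N] {I : ModelWithCorners ℝ EN HN}
  {V : Type*} [NormedAddCommGroup V] [NormedSpace ℝ V] [NormedSpace ℂ V] [IsScalarTower ℝ ℂ V]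
  {B : Type*} {ι : B → N} {s : Set B}

lemma SmoothOn.cutoff {b : N → ℂ} (hb : ContMDiff I 𝓘(ℝ, ℂ) ∞ b) {W : Set N} (hW : IsOpen W)
    (hbW : tsupport b ⊆ W) {f : B → V} (hf : SmoothOn I 𝓘(ℝ, V) ι f (s ∩ ι ⁻¹' W)) :
    SmoothOn I 𝓘(ℝ, V) ι (fun x => b (ι x) • f x) s := by
  refine SmoothOn.of_local fun x hx => ?_
  by_cases hxW : ι x ∈ W
  · exact ⟨W, hW, hxW, SmoothOn.smul (SmoothOn.of_contMDiffOn isOpen_univ hb.contMDiffOn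
      fun _ _ => Set.mem_univ _) hf⟩
  · refine ⟨(tsupport b)ᶜ, (isClosed_tsupport b).isOpen_compl, fun h => hxW (hbW h), ?_⟩
    exact SmoothOn.zero.congr fun y hy => by
      rw [image_eq_zero_of_notMem_tsupport hy.2, zero_smul]

lemma exists_complex_cutoff [FiniteDimensional ℝ EN] [T2Space N] (I : ModelWithCorners ℝ EN HN)
    [IsManifold I ∞ N] {x : N} {s : Set N} (hs : s ∈ 𝓝 x) :
    ∃ b : N → ℂ, ContMDiff I 𝓘(ℝ, ℂ) ∞ b ∧ tsupport b ⊆ s ∧ b =ᶠ[𝓝 x] 1 := by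
  obtain ⟨b, hb, hbs, hb1⟩ := exists_cutoff I hs
  refine ⟨fun x => (b x : ℂ), ?_, ?_, ?_⟩
  · exact (Complex.ofRealCLM.contDiff (n := ∞)).contMDiff.comp hb
  · refine (closure_mono fun y hy => ?_ : tsupport (fun x => (b x : ℂ)) ⊆ tsupport b).trans hbs
    simpa using hy
  · filter_upwards [hb1] with y hy
    simp [hy]

end Cutoff

/-! ### Fibers in a trivialization -/

section FiberEquiv

variable {EN HN N : Type*} [NormedAddCommGroup EN] [NormedSpace ℝ EN] [TopologicalSpace HN]
  [TopologicalSpace N] [ChartedSpace HN N] {I : ModelWithCorners ℝ EN HN}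
  {B : Type*} [TopologicalSpace B] {ι : B → N} {r : ℕ} (𝓔 : SmoothBundle I ι r)

/-- The linear isomorphism of a fiber with the typical fiber given by a trivialization. -/
def SmoothBundle.fiberEquiv (e : Trivialization (Fin r → ℂ) (π (Fin r → ℂ) 𝓔.Fiber))
    [MemTrivializationAtlas e] {b : B} (hb : b ∈ e.baseSet) : 𝓔.Fiber b ≃ₗ[ℂ] (Fin r → ℂ) :=
  (e.continuousLinearEquivAt ℂ b hb).toLinearEquiv

variable (e e' : Trivialization (Fin r → ℂ) (π (Fin r → ℂ) 𝓔.Fiber)) [MemTrivializationAtlas e]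
  [MemTrivializationAtlas e']

lemma SmoothBundle.fiberEquiv_apply {b : B} (hb : b ∈ e.baseSet) (v : 𝓔.Fiber b) :
    𝓔.fiberEquiv e hb v = (e ⟨b, v⟩).2 := rfl

lemma SmoothBundle.fiberEquiv_symm_apply {b : B} (hb : b ∈ e.baseSet) (y : Fin r → ℂ) :
    (𝓔.fiberEquiv e hb).symm y = e.symm b y := rfl

lemma SmoothBundle.coordChangeL_eq {b : B} (hb : b ∈ e.baseSet) (hb' : b ∈ e'.baseSet)
    (y : Fin r → ℂ) : e.coordChangeL ℂ e' b y = 𝓔.fiberEquiv e' hb' ((𝓔.fiberEquiv e hb).symm y) :=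
  e.coordChangeL_apply e' ⟨hb, hb'⟩ y

end FiberEquiv

/-! ### The Leibniz rule for all smooth functions, and locality -/

section Leibniz

variable {n : ℕ} {Q : Type*} [TopologicalSpace Q] [ChartedSpace (EuclideanSpace ℝ (Fin n)) Q]
  [IsManifold (𝓡 n) ∞ Q] {g : Metric (n := n) Q} {Ω : Set Q} [T2Space Q]
  {𝓜 : Type*} [TopologicalSpace 𝓜] [T2Space 𝓜]
  [ChartedSpace (EuclideanSpace ℝ (Fin (2 * n - 1))) 𝓜] [IsManifold (𝓡 (2 * n - 1)) ∞ 𝓜]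
  {r : ℕ} {𝓔 : PhaseBundle g Ω r} {D : 𝓔.sections →ₗ[ℂ] 𝓔.sections}

omit [T2Space Q] in
lemma exists_isOpen_of_isOpen_phaseSpace {U : Set (PhaseSpace g Ω)} (hU : IsOpen U) :
    ∃ W : Set (TangentBundle (𝓡 n) Q), IsOpen W ∧ ∀ z, incl g Ω z ∈ W ↔ z ∈ U := by
  obtain ⟨W, hW, h⟩ := isOpen_induced_iff.1 hU
  exact ⟨W, hW, fun z => by rw [← h]; rfl⟩

/-- Near an interior point `f` agrees with the pullback of a cut-off function on `𝓜`, to which the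
hypothesis applies. A second cutoff `h`, supported where the two agree and equal to 1 near the
point, makes the sections `h f σ` and `h F σ` equal. Comparing the Leibniz rule for `h` on both
sides identifies `D (f σ)` and `D (F σ)` at the point, without locality being known beforehand. -/
lemma leibniz_interior (mod : SmoothModel g Ω 𝓜) (hg : IsGeodesicallyComplete g)
    (hΩ : IsObstacle n Ω) (hD₂ : SatisfiesBilliardLeibniz 𝓔 D)
    {f : SmoothFun (𝓡 n).tangent (incl g Ω)} {z : PhaseSpace g Ω} (hz : z ∈ interiorPart g Ω)
    {y : ℂ} (hy : HasArcDeriv f.1 z y) (σ : 𝓔.sections) :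
    (D (𝓔.fmul f σ)).1 z = y • σ.1 z + f.1 z • (D σ).1 z := by
  obtain ⟨inv, hinvs, hinv⟩ := mod.diffeo_interior
  have hO := mod.isOpen_interior
  obtain ⟨W, hW, hzW, G, hG, hGf⟩ := f.2 z (Set.mem_univ _)
  have honly : ∀ w, mod.proj w ∈ mod.proj '' interiorPart g Ω → inv (mod.proj w) = incl g Ω w := by
    rintro w ⟨w', hw', hww⟩
    rcases mod.eq_or_eq_reflection hg hΩ hww with h | h
    · rw [h, hinv _ hw']
    · rw [h, reflection_of_mem_interiorPart hw', hinv _ hw']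
  have hO' : IsOpen (mod.proj '' interiorPart g Ω ∩ inv ⁻¹' W) :=
    hinvs.continuousOn.isOpen_inter_preimage hO hW
  have hzO' : mod.proj z ∈ mod.proj '' interiorPart g Ω ∩ inv ⁻¹' W :=
    ⟨⟨z, hz, rfl⟩, by rw [Set.mem_preimage, hinv z hz]; exact hzW⟩
  obtain ⟨b, hb, hbs, hb1⟩ := exists_cutoff (𝓡 (2 * n - 1)) (hO'.mem_nhds hzO')
  obtain ⟨N, hN, hNo, hzN⟩ := eventually_nhds_iff.1 hb1
  obtain ⟨h, hh, hhs, hh1⟩ := exists_complex_cutoff (𝓡 (2 * n - 1)) (hNo.mem_nhds hzN)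
  have hF : ContMDiff (𝓡 (2 * n - 1)) 𝓘(ℝ, ℂ) ∞ (fun q => b q • G (inv q)) :=
    contMDiff_cutoff_smul hb hO' hbs (F := fun q => G (inv q))
      (hG.comp (hinvs.mono Set.inter_subset_left) fun q hq => hq.2)
  have hN' : ∀ w, mod.proj w ∈ N → b (mod.proj w) • G (inv (mod.proj w)) = f.1 w := by
    intro w hw
    have h1 : b (mod.proj w) = 1 := hN _ hw
    have h2 : mod.proj w ∈ tsupport b := subset_tsupport _ (by simp [h1])
    have h3 := hbs h2
    have h4 := honly w h3.1
    have h5 := h3.2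
    rw [Set.mem_preimage, h4] at h5
    rw [h1, one_smul, h4]
    exact hGf w (Set.mem_univ _) h5
  have hsec : 𝓔.fmul (mod.pullback h hh) (𝓔.fmul f σ)
      = 𝓔.fmul (mod.pullback h hh) (𝓔.fmul (mod.pullback _ hF) σ) := by
    refine Subtype.ext (funext fun w => ?_)
    change h (mod.proj w) • (f.1 w • σ.1 w)
      = h (mod.proj w) • ((b (mod.proj w) • G (inv (mod.proj w))) • σ.1 w)
    by_cases hw : mod.proj w ∈ N
    · rw [hN' w hw]
    · rw [image_eq_zero_of_notMem_tsupport (fun h => hw (hhs h)), zero_smul, zero_smul]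
  have e1 := hD₂ _ (mod.isBilliardFun_pullback hh) (𝓔.fmul f σ) z
  have e2 := hD₂ _ (mod.isBilliardFun_pullback hh) (𝓔.fmul (mod.pullback _ hF) σ) z
  have e3 := hD₂ _ (mod.isBilliardFun_pullback hF) σ z
  have hz1 : (mod.pullback h hh).1 z = 1 := hh1.self_of_nhds
  have hz2 : (mod.pullback _ hF).1 z = f.1 z := hN' z hzN
  have hz3 : (𝓔.fmul f σ).1 z = (𝓔.fmul (mod.pullback _ hF) σ).1 z := by
    change f.1 z • σ.1 z = (mod.pullback _ hF).1 z • σ.1 z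
    rw [hz2]
  rw [← hsec, e1, hz1, one_smul, one_smul, hz3] at e2
  have hder : HasDerivAt (fun t => b (mod.flow t (mod.proj z)) • G (inv (mod.flow t (mod.proj z))))
      y 0 := by
    refine mod.hasDerivAt_of_hasArcDeriv (F := fun q => b q • G (inv q)) hg hΩ fun w hw => ?_
    have hwz : w = z := by
      rcases mod.eq_or_eq_reflection hg hΩ hw.symm with h | h
      · exact h
      · rw [h, reflection_of_mem_interiorPart hz]
    subst hwz
    obtain ⟨W', hW', hWN⟩ :=
      exists_isOpen_of_isOpen_phaseSpace (hNo.preimage mod.continuous_proj)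
    exact hy.congr hg hW' ((hWN _).2 hzN) fun w' hw' => hN' w' ((hWN _).1 hw')
  rw [add_left_cancel e2, e3, hz2, mod.generator_pullback hg hΩ, hder.deriv]

/-- The Leibniz rule holds for all smooth functions. -/
lemma leibniz (mod : SmoothModel g Ω 𝓜) (hg : IsGeodesicallyComplete g)
    (hΩ : IsObstacle n Ω) (hD₂ : SatisfiesBilliardLeibniz 𝓔 D)
    {f : SmoothFun (𝓡 n).tangent (incl g Ω)} {z : PhaseSpace g Ω}
    {y : ℂ} (hy : HasArcDeriv f.1 z y) (σ : 𝓔.sections) :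
    (D (𝓔.fmul f σ)).1 z = y • σ.1 z + f.1 z • (D σ).1 z := by
  -- Every point is a limit of interior points along the short trajectory that leaves it without
  -- reflection. The derivative of `f` along this trajectory is continuous in time, so that the
  -- interior rule passes to the limit.
  obtain ⟨d, hd, hz⟩ := exists_direction_launch hΩ z
  obtain ⟨ε, hε, w, hw0, hw⟩ := exists_arc_family hg hΩ hd hz
  obtain ⟨W, hW, hzW, G, hG, hGf⟩ := f.2 z (Set.mem_univ _)
  have hcurve : ContMDiff 𝓘(ℝ, ℝ) (𝓡 n).tangent ∞ (fun s => geodesicFlow g s (incl g Ω z)) :=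
    (contMDiff_geodesicFlow hg).comp (contMDiff_id.prodMk contMDiff_const)
  set S := (fun s => geodesicFlow g s (incl g Ω z)) ⁻¹' W with hS
  have hSo : IsOpen S := hW.preimage hcurve.continuous
  have h0S : (0 : ℝ) ∈ S := by
    change geodesicFlow g 0 (incl g Ω z) ∈ W
    rwa [geodesicFlow_zero hg]
  set φ : ℝ → ℂ := fun s => G (geodesicFlow g s (incl g Ω z)) with hφ
  have hφs : ContDiffOn ℝ ∞ φ S :=
    contMDiffOn_iff_contDiffOn.1 (hG.comp hcurve.contMDiffOn fun s hs => hs)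
  have hφd : ∀ s ∈ S, HasDerivAt φ (deriv φ s) s := fun s hs =>
    ((hφs.differentiableOn (by simp)).differentiableAt (hSo.mem_nhds hs)).hasDerivAt
  have hφc : ContinuousAt (deriv φ) 0 :=
    (hφs.continuousOn_deriv_of_isOpen hSo (by simp)).continuousAt (hSo.mem_nhds h0S)
  have hfam : ∀ s ∈ S, 0 ≤ d * s → d * s < ε → HasArcDeriv f.1 (w s) (deriv φ s) := by
    intro s hs h1 h2
    have h3 := (hw s h1 h2).1
    refine HasArcDeriv.of_hasDerivAt hg (F := G) hW (by rw [h3]; exact hs)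
      (fun w' hw' => (hGf w' (Set.mem_univ _) hw').symm) ?_
    have h4 : (fun s' => G (geodesicFlow g s' (incl g Ω (w s)))) = fun s' => φ (s' + s) := by
      funext s'
      rw [h3, ← geodesicFlow_add hg]
    rw [h4]
    have h5 : HasDerivAt φ (deriv φ s) (0 + s) := by rw [zero_add]; exact hφd s hs
    exact h5.comp_add_const 0 s
  have hy0 : deriv φ 0 = y := by
    have := hfam 0 h0S (by simp) (by simpa using hε)
    rw [hw0] at this
    exact this.unique hg hΩ hy
  -- the limit along the short trajectory
  set e := trivializationAt (Fin r → ℂ) 𝓔.Fiber z with he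
  have hze : z ∈ e.baseSet := mem_baseSet_trivializationAt _ _ _
  set l : Filter ℝ := 𝓝[{s : ℝ | 0 ≤ d * s} \ {0}] (0 : ℝ) with hl
  have hl0 : l ≤ 𝓝 0 := nhdsWithin_le_nhds
  have hlne : l.NeBot := by
    rw [hl]
    rcases hd with rfl | rfl
    · rw [show {s : ℝ | 0 ≤ 1 * s} \ {0} = Set.Ioi 0 by
        ext s; simp [lt_iff_le_and_ne, eq_comm]]
      infer_instance
    · rw [show {s : ℝ | 0 ≤ -1 * s} \ {0} = Set.Iio 0 by
        ext s; simp [lt_iff_le_and_ne]]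
      infer_instance
  have hev : ∀ᶠ s in l, (0 ≤ d * s ∧ d * s < ε) ∧ s ≠ 0 := by
    have h1 : ∀ᶠ s in l, 0 ≤ d * s ∧ d * s < ε :=
      nhdsWithin_mono 0 (Set.sdiff_subset) (halfInterval_mem_nhdsWithin hε)
    filter_upwards [h1, self_mem_nhdsWithin] with s h1 h2
    exact ⟨h1, h2.2⟩
  have hwlim : Filter.Tendsto w l (𝓝 z) := by
    refine tendsto_subtype_rng.2 ?_
    have h1 : Filter.Tendsto (fun s => geodesicFlow g s (incl g Ω z)) l (𝓝 (incl g Ω z)) := by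
      have := (hcurve.continuous.tendsto 0).mono_left hl0
      rwa [geodesicFlow_zero hg] at this
    refine h1.congr' ?_
    filter_upwards [hev] with s hs
    exact (hw s hs.1.1 hs.1.2).1.symm
  have hlim : ∀ τ : 𝓔.sections,
      Filter.Tendsto (fun s => (e ⟨w s, τ.1 (w s)⟩).2) l (𝓝 (e ⟨z, τ.1 z⟩).2) := by
    intro τ
    have h1 : ContinuousOn (fun w' => (e ⟨w', τ.1 w'⟩).2) e.baseSet :=
      ((τ.2 e).mono fun w' hw' => ⟨Set.mem_univ _, hw'⟩).continuous continuous_incl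
    exact ((h1.continuousAt (e.open_baseSet.mem_nhds hze)).tendsto).comp hwlim
  have hflim : Filter.Tendsto (fun s => f.1 (w s)) l (𝓝 (f.1 z)) := by
    have h1 : ContinuousOn f.1 Set.univ := f.2.continuous continuous_incl
    exact ((h1.continuousAt Filter.univ_mem).tendsto).comp hwlim
  have hdlim : Filter.Tendsto (deriv φ) l (𝓝 y) := hy0 ▸ hφc.tendsto.mono_left hl0
  have h1 := hlim (D (𝓔.fmul f σ))
  have h2 := (hdlim.smul (hlim σ)).add (hflim.smul (hlim (D σ)))
  have h3 : (e ⟨z, (D (𝓔.fmul f σ)).1 z⟩).2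
      = y • (e ⟨z, σ.1 z⟩).2 + f.1 z • (e ⟨z, (D σ).1 z⟩).2 := by
    refine tendsto_nhds_unique h1 (h2.congr' ?_)
    filter_upwards [hev, hwlim.eventually_mem (e.open_baseSet.mem_nhds hze),
      hl0 (hSo.mem_nhds h0S)] with s hs hse hsS
    rw [leibniz_interior mod hg hΩ hD₂ ((hw s hs.1.1 hs.1.2).2.2 hs.2)
      (hfam s hsS hs.1.1 hs.1.2) σ, (e.linear ℂ hse).map_add, (e.linear ℂ hse).map_smul,
      (e.linear ℂ hse).map_smul]
  rw [← (e.linear ℂ hze).map_smul, ← (e.linear ℂ hze).map_smul, ← (e.linear ℂ hze).map_add] at h3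
  exact (𝓔.fiberEquiv e hze).injective h3

/-- The value of `D σ` at a point only depends on `σ` near this point. -/
lemma operator_congr (mod : SmoothModel g Ω 𝓜) (hg : IsGeodesicallyComplete g)
    (hΩ : IsObstacle n Ω) (hD₂ : SatisfiesBilliardLeibniz 𝓔 D) {z : PhaseSpace g Ω}
    {W : Set (TangentBundle (𝓡 n) Q)} (hW : IsOpen W) (hz : incl g Ω z ∈ W) {σ σ' : 𝓔.sections}
    (h : ∀ w, incl g Ω w ∈ W → σ.1 w = σ'.1 w) : (D σ).1 z = (D σ').1 z := by
  obtain ⟨b, hb, hbs, hb1⟩ := exists_complex_cutoff (𝓡 n).tangent (hW.mem_nhds hz)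
  obtain ⟨N, hN, hNo, hzN⟩ := eventually_nhds_iff.1 hb1
  let f : SmoothFun (𝓡 n).tangent (incl g Ω) := ⟨fun w => b (incl g Ω w),
    SmoothOn.of_contMDiffOn isOpen_univ hb.contMDiffOn fun _ _ => Set.mem_univ _⟩
  -- The cutoff is 1 near the point, so its derivative along geodesics vanishes there; the Leibniz
  -- rule applied to this zero product gives the claim.
  have hsec : 𝓔.fmul f (σ - σ') = 0 := by
    refine Subtype.ext (funext fun w => ?_)
    change b (incl g Ω w) • (σ.1 w - σ'.1 w) = 0
    by_cases hw : incl g Ω w ∈ W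
    · rw [h w hw, sub_self, smul_zero]
    · rw [image_eq_zero_of_notMem_tsupport (fun h => hw (hbs h)), zero_smul]
  have hf : HasArcDeriv f.1 z 0 :=
    (HasArcDeriv.const (1 : ℂ) z).congr hg hNo hzN fun w hw => hN _ hw
  have h1 := leibniz mod hg hΩ hD₂ hf (σ - σ')
  have h2 : f.1 z = 1 := hN _ hzN
  rw [hsec, map_zero, map_sub, h2, one_smul, zero_smul, zero_add] at h1
  exact (sub_eq_zero.1 h1.symm)

end Leibniz

/-! ### Extension of local sections -/

section Sections

variable {EN HN N : Type*} [NormedAddCommGroup EN] [NormedSpace ℝ EN] [TopologicalSpace HN]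
  [TopologicalSpace N] [ChartedSpace HN N] {I : ModelWithCorners ℝ EN HN}
  {B : Type*} [TopologicalSpace B] {ι : B → N} {r : ℕ} {𝓔 : SmoothBundle I ι r}

/-- Local sections can be extended after multiplication by a cutoff function. -/
lemma exists_section_cutoff (e : Trivialization (Fin r → ℂ) (π (Fin r → ℂ) 𝓔.Fiber))
    [MemTrivializationAtlas e] {b : N → ℂ} (hb : ContMDiff I 𝓘(ℝ, ℂ) ∞ b) {W : Set N}
    (hW : IsOpen W) (hWe : ∀ w, ι w ∈ W → w ∈ e.baseSet) (hbW : tsupport b ⊆ W)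
    {c : B → Fin r → ℂ} (hc : SmoothOn I 𝓘(ℝ, Fin r → ℂ) ι c e.baseSet) :
    ∃ s : 𝓔.sections, ∀ w ∈ e.baseSet, (e ⟨w, s.1 w⟩).2 = b (ι w) • c w := by
  refine ⟨⟨fun w => b (ι w) • e.symm w (c w), fun e' _ => ?_⟩, fun w hw => ?_⟩
  · have h1 : SmoothOn I 𝓘(ℝ, Fin r → ℂ) ι 
        (fun w => (e.coordChangeL ℂ e' w : (Fin r → ℂ) →L[ℂ] (Fin r → ℂ)) (c w))
        ({w | w ∈ Set.univ ∧ w ∈ e'.baseSet} ∩ ι ⁻¹' W) :=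
      SmoothOn.clm_apply ((𝓔.smooth_coordChange e e').mono' fun w hw => ⟨hWe w hw.2, hw.1.2⟩)
        (hc.mono fun w hw => hWe w hw.2)
    refine (SmoothOn.cutoff hb hW hbW h1).congr fun w hw => ?_
    by_cases hwW : ι w ∈ W
    · have hwe := hWe w hwW
      have h2 : (e.coordChangeL ℂ e' w : (Fin r → ℂ) →L[ℂ] (Fin r → ℂ)) (c w)
          = 𝓔.fiberEquiv e' hw.2 ((𝓔.fiberEquiv e hwe).symm (c w)) :=
        𝓔.coordChangeL_eq e e' hwe hw.2 (c w)
      rw [h2, ← map_smul]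
      rfl
    · have h0 : b (ι w) = 0 := image_eq_zero_of_notMem_tsupport fun h => hwW (hbW h)
      change 𝓔.fiberEquiv e' hw.2 (b (ι w) • e.symm w (c w)) = _
      rw [h0, zero_smul, zero_smul, map_zero]
  · change 𝓔.fiberEquiv e hw (b (ι w) • (𝓔.fiberEquiv e hw).symm (c w)) = _
    rw [map_smul, LinearEquiv.apply_symm_apply]

lemma smoothOn_section (e : Trivialization (Fin r → ℂ) (π (Fin r → ℂ) 𝓔.Fiber))
    [MemTrivializationAtlas e] (σ : 𝓔.sections) :
    SmoothOn I 𝓘(ℝ, Fin r → ℂ) ι (fun w => (e ⟨w, σ.1 w⟩).2) e.baseSet :=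
  (σ.2 e).mono fun _ hw => ⟨Set.mem_univ _, hw⟩

end Sections

/-! ### The operator in a trivialization -/

section ConnectionForm

variable {n : ℕ} {Q : Type*} [TopologicalSpace Q] [ChartedSpace (EuclideanSpace ℝ (Fin n)) Q]
  [IsManifold (𝓡 n) ∞ Q] {g : Metric (n := n) Q} {Ω : Set Q} [T2Space Q]
  {𝓜 : Type*} [TopologicalSpace 𝓜] [T2Space 𝓜]
  [ChartedSpace (EuclideanSpace ℝ (Fin (2 * n - 1))) 𝓜] [IsManifold (𝓡 (2 * n - 1)) ∞ 𝓜]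
  {r : ℕ} {𝓔 : PhaseBundle g Ω r} {D : 𝓔.sections →ₗ[ℂ] 𝓔.sections}

lemma SmoothOn.clm_of_columns {EN HN N : Type*} [NormedAddCommGroup EN] [NormedSpace ℝ EN]
    [TopologicalSpace HN] [TopologicalSpace N] [ChartedSpace HN N] {I : ModelWithCorners ℝ EN HN}
    {B : Type*} {ι : B → N} {s : Set B} {c : Fin r → B → Fin r → ℂ}
    (hc : ∀ i, SmoothOn I 𝓘(ℝ, Fin r → ℂ) ι (c i) s) :
    SmoothOn I 𝓘(ℝ, (Fin r → ℂ) →L[ℂ] (Fin r → ℂ)) ι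
      (fun w => ∑ i, (ContinuousLinearMap.proj (R := ℂ) (φ := fun _ : Fin r => ℂ) i).smulRight
        (c i w)) s := by
  refine SmoothOn.clm_of_apply fun v => ?_
  have key : ∀ t : Finset (Fin r), SmoothOn I 𝓘(ℝ, Fin r → ℂ) ι (fun w => ∑ i ∈ t, v i • c i w) s := by
    intro t
    induction t using Finset.induction_on with
    | empty => simpa using SmoothOn.zero
    | insert i t hi ih =>
      simp only [Finset.sum_insert hi]
      exact ((SmoothOn.const (v i)).smul (hc i)).add ih
  refine (key Finset.univ).congr fun w _ => ?_
  simp only [_root_.sum_apply, ContinuousLinearMap.smulRight_apply, ContinuousLinearMap.proj_apply]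

set_option maxHeartbeats 1000000 in
/-- In a trivialization, the operator is the derivative along geodesics plus a matrix. -/
lemma exists_connectionForm (mod : SmoothModel g Ω 𝓜) (hg : IsGeodesicallyComplete g)
    (hΩ : IsObstacle n Ω) (hD₂ : SatisfiesBilliardLeibniz 𝓔 D)
    (e : Trivialization (Fin r → ℂ) (π (Fin r → ℂ) 𝓔.Fiber)) [MemTrivializationAtlas e]
    {z : PhaseSpace g Ω} (hz : z ∈ e.baseSet) :
    ∃ (W : Set (TangentBundle (𝓡 n) Q))
      (C : TangentBundle (𝓡 n) Q → (Fin r → ℂ) →L[ℂ] (Fin r → ℂ)), IsOpen W ∧ incl g Ω z ∈ W ∧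
      ContMDiffOn (𝓡 n).tangent 𝓘(ℝ, (Fin r → ℂ) →L[ℂ] (Fin r → ℂ)) ∞ C W ∧
      (∀ w, incl g Ω w ∈ W → w ∈ e.baseSet) ∧
      ∀ w, incl g Ω w ∈ W → ∀ (σ : 𝓔.sections) (y : Fin r → ℂ),
        HasArcDeriv (fun w' => (e ⟨w', σ.1 w'⟩).2) w y →
        (e ⟨w, (D σ).1 w⟩).2 = y + C (incl g Ω w) (e ⟨w, σ.1 w⟩).2 := by
  obtain ⟨W₀, hW₀, hWe⟩ := exists_isOpen_of_isOpen_phaseSpace (g := g) (Ω := Ω) e.open_baseSet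
  obtain ⟨b, hb, hbs, hb1⟩ := exists_complex_cutoff (𝓡 n).tangent (hW₀.mem_nhds ((hWe z).2 hz))
  obtain ⟨W₁, hb₁, hW₁, hzW₁⟩ := eventually_nhds_iff.1 hb1
  have hW₁₀ : W₁ ⊆ W₀ := fun x hx => hbs (subset_tsupport _ (by
    have h1 : b x = 1 := hb₁ x hx
    simp [h1]))
  -- Global sections that agree near `z` with the standard frame of `e`. The columns of `C` will be
  -- the components of `D (s i)`.
  choose s hs using fun i : Fin r => exists_section_cutoff e hb hW₀ (fun w => (hWe w).1) hbs
    (SmoothOn.const (Pi.single i (1 : ℂ) : Fin r → ℂ))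
  obtain ⟨U, hU, hzU, C, hC, hCs⟩ := SmoothOn.clm_of_columns
    (fun i => smoothOn_section e (D (s i))) z hz
  refine ⟨U ∩ W₁, C, hU.inter hW₁, ⟨hzU, hzW₁⟩, hC.mono Set.inter_subset_left,
    fun w hw => (hWe w).1 (hW₁₀ hw.2), fun w hw σ y hy => ?_⟩
  have hwe : w ∈ e.baseSet := (hWe w).1 (hW₁₀ hw.2)
  let c : Fin r → SmoothFun (𝓡 n).tangent (incl g Ω) := fun i =>
    ⟨fun w => b (incl g Ω w) • (e ⟨w, σ.1 w⟩).2 i, SmoothOn.cutoff hb hW₀ hbs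
      (((smoothOn_section e σ).mono fun w hw => (hWe w).1 hw.2).comp_contDiff
        (G := fun v : Fin r → ℂ => v i) (contDiff_apply ℝ ℂ i))⟩
  have hder : ∀ i, HasArcDeriv (c i).1 w (y i) := fun i =>
    (hy.comp_clm (ContinuousLinearMap.proj (R := ℝ) (φ := fun _ : Fin r => ℂ) i)).congr hg hW₁ hw.2
      fun w' hw' => by
        change b (incl g Ω w') • (e ⟨w', σ.1 w'⟩).2 i = (e ⟨w', σ.1 w'⟩).2 i
        have h1 : b (incl g Ω w') = 1 := hb₁ _ hw'
        rw [h1, one_smul]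
  -- Near `w` the section is a combination of the frame sections with globally smooth coefficients;
  -- by locality the Leibniz rule can be applied to each term.
  have hsum : ∀ w', incl g Ω w' ∈ W₁ → σ.1 w' = (∑ i, 𝓔.fmul (c i) (s i)).1 w' := by
    intro w' hw'
    have hwe' : w' ∈ e.baseSet := (hWe w').1 (hW₁₀ hw')
    have h1 : b (incl g Ω w') = 1 := hb₁ _ hw'
    apply (𝓔.fiberEquiv e hwe').injective
    rw [AddSubmonoidClass.coe_finsetSum, Finset.sum_apply, map_sum]
    have h2 : ∀ i, 𝓔.fiberEquiv e hwe' ((𝓔.fmul (c i) (s i)).1 w')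
        = (e ⟨w', σ.1 w'⟩).2 i • (Pi.single i 1 : Fin r → ℂ) := fun i => by
      change 𝓔.fiberEquiv e hwe' ((b (incl g Ω w') • (e ⟨w', σ.1 w'⟩).2 i) • (s i).1 w') = _
      rw [map_smul, 𝓔.fiberEquiv_apply, hs i w' hwe', h1, one_smul, one_smul]
    simp only [h2]
    exact pi_eq_sum_univ' _
  have hval : ∀ i, 𝓔.fiberEquiv e hwe ((D (𝓔.fmul (c i) (s i))).1 w)
      = y i • (Pi.single i 1 : Fin r → ℂ)
        + (e ⟨w, σ.1 w⟩).2 i • (e ⟨w, (D (s i)).1 w⟩).2 := fun i => by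
    have h1 : b (incl g Ω w) = 1 := hb₁ _ hw.2
    have h2 : (c i).1 w = (e ⟨w, σ.1 w⟩).2 i := by
      change b (incl g Ω w) • (e ⟨w, σ.1 w⟩).2 i = _
      rw [h1, one_smul]
    rw [leibniz mod hg hΩ hD₂ (hder i), map_add, map_smul, map_smul, h2, 𝓔.fiberEquiv_apply,
      𝓔.fiberEquiv_apply, hs i w hwe, h1, one_smul]
  have hCw : C (incl g Ω w) (e ⟨w, σ.1 w⟩).2
      = ∑ i, (e ⟨w, σ.1 w⟩).2 i • (e ⟨w, (D (s i)).1 w⟩).2 := by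
    rw [hCs w hwe hw.1]
    simp only [_root_.sum_apply, ContinuousLinearMap.smulRight_apply,
      ContinuousLinearMap.proj_apply]
  rw [operator_congr mod hg hΩ hD₂ hW₁ hw.2 hsum, map_sum, hCw]
  change 𝓔.fiberEquiv e hwe ((∑ i, D (𝓔.fmul (c i) (s i))).1 w) = _
  rw [AddSubmonoidClass.coe_finsetSum, Finset.sum_apply, map_sum]
  simp only [hval]
  rw [Finset.sum_add_distrib]
  congr 1
  exact (pi_eq_sum_univ' y).symm

end ConnectionForm

/-! ### Linear equations along a flow with values prescribed on a transversal hypersurface -/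

section FlowBox

variable {X : Type*} [NormedAddCommGroup X] [NormedSpace ℝ X]

/-- The isomorphism `(s, v) ↦ (L (s, v), v)`. -/
def graphEquiv (L : ℝ × X →L[ℝ] ℝ) (hL : L (1, 0) ≠ 0) : (ℝ × X) ≃L[ℝ] (ℝ × X) :=
  let P₂ : ℝ × X →L[ℝ] X := ContinuousLinearMap.snd ℝ ℝ X
  let P₁ : ℝ × X →L[ℝ] ℝ := ContinuousLinearMap.fst ℝ ℝ X
  let α : X →L[ℝ] ℝ := L.comp (ContinuousLinearMap.inr ℝ ℝ X)
  have hLs : ∀ s v, L (s, v) = s * L (1, 0) + α v := fun s v => by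
    have h : ((s, v) : ℝ × X) = s • ((1 : ℝ), (0 : X)) + ((0 : ℝ), v) := by simp
    rw [h, map_add, map_smul, smul_eq_mul]
    rfl
  ContinuousLinearEquiv.equivOfInverse (L.prod P₂)
    (((L (1, 0))⁻¹ • (P₁ - α.comp P₂)).prod P₂)
    (fun q => Prod.ext (by
      change (L (1, 0))⁻¹ * (L (q.1, q.2) - α q.2) = q.1
      rw [hLs q.1 q.2]
      field_simp
      ring) rfl)
    (fun q => Prod.ext (by
      change L ((L (1, 0))⁻¹ * (q.1 - α q.2), q.2) = q.1
      rw [hLs]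
      field_simp
      ring) rfl)

lemma coe_graphEquiv (L : ℝ × X →L[ℝ] ℝ) (hL : L (1, 0) ≠ 0) :
    ((graphEquiv L hL : (ℝ × X) ≃L[ℝ] (ℝ × X)) : ℝ × X →L[ℝ] ℝ × X)
      = L.prod (ContinuousLinearMap.snd ℝ ℝ X) := rfl

variable [FiniteDimensional ℝ X] {A : Type*} [NormedRing A] [NormedAlgebra ℝ A]
  [FiniteDimensional ℝ A]

/-- Solutions of the linear equation `T' = T C` along a flow, with prescribed values `K` on a
transversal hypersurface `ρ = 0`. -/
theorem exists_flowBox_solution {Ψ : ℝ × X → X} {P : Set (ℝ × X)} {q₀ : X} (hP : IsOpen P)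
    (hqP : ((0 : ℝ), q₀) ∈ P) (hΨ : ContDiffOn ℝ ∞ Ψ P) (hΨ0 : ∀ q, ((0 : ℝ), q) ∈ P → Ψ (0, q) = q)
    (hadd : ∀ s s' q, (s, q) ∈ P → (s', Ψ (s, q)) ∈ P → (s + s', q) ∈ P →
      Ψ (s', Ψ (s, q)) = Ψ (s + s', q))
    {N : Set X} (hN : IsOpen N) (hqN : q₀ ∈ N) {ρ : X → ℝ} (hρ : ContDiffOn ℝ ∞ ρ N)
    (hρ0 : ρ q₀ = 0) {c : ℝ} (hc : c ≠ 0) (hρd : HasDerivAt (fun s => ρ (Ψ (s, q₀))) c 0)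
    {C K : X → A} (hC : ContDiffOn ℝ ∞ C N) (hK : ContDiffOn ℝ ∞ K N) (hKu : IsUnit (K q₀)) :
    ∃ (V : Set X) (T : X → A), IsOpen V ∧ q₀ ∈ V ∧ ContDiffOn ℝ ∞ T V ∧ ∀ q ∈ V, IsUnit (T q) ∧
      (ρ q = 0 → T q = K q) ∧ HasDerivAt (fun s => T (Ψ (s, q))) (T q * C q) 0 := by
  have : CompleteSpace X := FiniteDimensional.complete ℝ X
  have : CompleteSpace A := FiniteDimensional.complete ℝ A
  set P' : Set (ℝ × X) := P ∩ Ψ ⁻¹' N with hP'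
  have hP'o : IsOpen P' := hΨ.continuousOn.isOpen_inter_preimage hP hN
  have hqP' : ((0 : ℝ), q₀) ∈ P' := ⟨hqP, by rw [Set.mem_preimage, hΨ0 _ hqP]; exact hqN⟩
  have hΨ' : ContDiffOn ℝ ∞ Ψ P' := hΨ.mono Set.inter_subset_left
  have hf : ContDiffOn ℝ ∞ (fun x => ρ (Ψ x)) P' := hρ.comp hΨ' fun x hx => hx.2
  have hfd := ((hf.differentiableOn (by simp)).differentiableAt (hP'o.mem_nhds hqP')).hasFDerivAt
  set L := fderiv ℝ (fun x => ρ (Ψ x)) (0, q₀) with hLdef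
  have hL : L (1, 0) = c := by
    have h1 : HasDerivAt (fun s : ℝ => ((s, q₀) : ℝ × X)) ((1 : ℝ), (0 : X)) 0 :=
      (hasDerivAt_id 0).prodMk (hasDerivAt_const _ _)
    exact (HasFDerivAt.comp_hasDerivAt (0 : ℝ) (f := fun s : ℝ => ((s, q₀) : ℝ × X)) hfd h1).unique hρd
  -- The map `(s, q) ↦ (ρ (Ψ (s, q)), q)` is invertible near `(0, q₀)`, since `ρ` has the nonzero
  -- derivative `c` along the flow.
  obtain ⟨V₁, U₁, H, hV₁, hqV₁, hU₁, hqU₁, hU₁P, hH, hGH, hHG⟩ :=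
    exists_smooth_localInverse hP'o hqP' (hf.prodMk contDiffOn_snd)
      (graphEquiv L (hL ▸ hc)) (by rw [coe_graphEquiv]; exact hfd.prodMk hasFDerivAt_snd)
  have hG0 : ((ρ (Ψ (0, q₀)), q₀) : ℝ × X) = (0, q₀) := by rw [hΨ0 _ hqP, hρ0]
  have hqV₁' : ((0 : ℝ), q₀) ∈ V₁ := hG0 ▸ hqV₁
  obtain ⟨ε, V₂, a, hε, hV₂, hqV₂, hVP, ha, had⟩ := exists_smooth_linearFlow
    (b := fun x => C (Ψ x)) hP'o hqP' (hC.comp hΨ' fun x hx => hx.2)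
  -- `τ q` is the time after which the orbit of `q` hits the hypersurface, and `h q` is the point
  -- where it does.
  set τ : X → ℝ := fun q => (H (0, q)).1 with hτ
  set h : X → X := fun q => Ψ (τ q, q) with hh
  have hHsnd : ∀ q, ((0 : ℝ), q) ∈ V₁ → H (0, q) = (τ q, q) := fun q hq =>
    by
    have h1 : (H (0, q)).2 = q := congrArg Prod.snd (hHG _ hq).2
    exact Prod.ext rfl h1
  have hτ0 : ∀ q, ((0 : ℝ), q) ∈ U₁ → ρ q = 0 → τ q = 0 := by
    intro q hq hρq
    have h1 := (hGH _ hq).2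
    simp only [hΨ0 _ (hU₁P hq).1, hρq] at h1
    exact congrArg Prod.fst h1
  have hτq₀ : τ q₀ = 0 := hτ0 q₀ hqU₁ hρ0
  have hhq₀ : h q₀ = q₀ := by simp only [hh, hτq₀, hΨ0 _ hqP]
  have hτs : ∀ q, ((0 : ℝ), q) ∈ V₁ → ContDiffAt ℝ ∞ τ q := fun q hq =>
    contDiffAt_fst.comp q (ContDiffAt.comp q (f := fun q : X => ((0 : ℝ), q))
      (hH.contDiffAt (hV₁.mem_nhds hq)) (contDiffAt_const.prodMk contDiffAt_id))
  have hhs : ∀ q, ((0 : ℝ), q) ∈ V₁ → ContDiffAt ℝ ∞ h q := fun q hq =>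
    ContDiffAt.comp q (f := fun q : X => (τ q, q))
      (hΨ'.contDiffAt (hP'o.mem_nhds (hHsnd q hq ▸ hU₁P (hHG _ hq).1)))
      ((hτs q hq).prodMk contDiffAt_id)
  have hu : ∀ᶠ q in 𝓝 q₀, ((((0 : ℝ), q) ∈ V₁ ∧ ((0 : ℝ), q) ∈ U₁) ∧
      (h q ∈ N ∧ h q ∈ V₂ ∧ -τ q ∈ Set.Ioo (-ε) ε)) ∧
      IsUnit (K (h q)) ∧ IsUnit (a (-τ q, h q)) := by
    have hi : ContinuousAt (fun q : X => ((0 : ℝ), q)) q₀ := by fun_prop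
    have hhc : ContinuousAt h q₀ := (hhs q₀ hqV₁').continuousAt
    have hτc : ContinuousAt τ q₀ := (hτs q₀ hqV₁').continuousAt
    refine (((hi.eventually_mem (hV₁.mem_nhds hqV₁')).and
      (hi.eventually_mem (hU₁.mem_nhds hqU₁))).and
      ((hhc.eventually_mem (hN.mem_nhds (by rwa [hhq₀]))).and
      ((hhc.eventually_mem (hV₂.mem_nhds (by rwa [hhq₀]))).and
      (hτc.neg.eventually_mem (isOpen_Ioo.mem_nhds (by simp [hτq₀, hε])))))).and
      (ContinuousAt.eventually_mem (f := fun q => K (h q)) ?_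
        (Units.isOpen.mem_nhds (by simpa [hhq₀] using hKu)) |>.and
        (ContinuousAt.eventually_mem (f := fun q => a (-τ q, h q)) ?_
        (Units.isOpen.mem_nhds ?_)))
    · refine ContinuousAt.comp (f := h) ?_ hhc
      rw [hhq₀]
      exact hK.continuousOn.continuousAt (hN.mem_nhds hqN)
    · refine ContinuousAt.comp (f := fun q => (-τ q, h q)) ?_ (hτc.neg.prodMk hhc)
      refine ha.continuousOn.continuousAt ((isOpen_Ioo.prod hV₂).mem_nhds ⟨?_, ?_⟩)
      · simp [hτq₀, hε]
      · simpa only [hhq₀] using hqV₂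
    · simp only [hτq₀, hhq₀, neg_zero, (had q₀ hqV₂).1]
      exact isUnit_one
  obtain ⟨V, hV, hVo, hqV⟩ := eventually_nhds_iff.1 hu
  -- The prescribed value at the hitting point is transported to `q`, which is reached from there
  -- after time `-τ q`.
  refine ⟨V, fun q => K (h q) * a (-τ q, h q), hVo, hqV, fun q hq => ?_, fun q hq => ?_⟩
  · obtain ⟨⟨⟨h1, h2⟩, h3, h4, h5⟩, -⟩ := hV q hq
    refine ContDiffAt.contDiffWithinAt (ContDiffAt.mul ?_ ?_)
    · exact ContDiffAt.comp q (hK.contDiffAt (hN.mem_nhds h3)) (hhs q h1)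
    · exact ContDiffAt.comp q (f := fun q => (-τ q, h q))
        (ha.contDiffAt ((isOpen_Ioo.prod hV₂).mem_nhds ⟨h5, h4⟩)) ((hτs q h1).neg.prodMk (hhs q h1))
  obtain ⟨⟨⟨h1, h2⟩, h3, h4, h5⟩, h6, h7⟩ := hV q hq
  have hqP0 := (hU₁P h2).1
  refine ⟨h6.mul h7, fun hρq => ?_, ?_⟩
  · have e1 := hτ0 q h2 hρq
    have e2 : h q = q := by simp only [hh, e1, hΨ0 _ hqP0]
    simp only [e1, e2, neg_zero, (had q (e2 ▸ h4)).1, mul_one]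
  have hHq := hHsnd q h1
  have hτU : (τ q, q) ∈ U₁ := hHq ▸ (hHG _ h1).1
  have hρh : ρ (h q) = 0 := by
    have := congrArg Prod.fst (hHG _ h1).2
    simpa only [hHq] using this
  have hΨc : ContinuousAt (fun s : ℝ => Ψ (s, q)) 0 :=
    ContinuousAt.comp (f := fun s : ℝ => (s, q))
      (hΨ.continuousOn.continuousAt (hP.mem_nhds hqP0)) (by fun_prop)
  have ev1 : ∀ᶠ s in 𝓝 (0 : ℝ), (s, q) ∈ P :=
    ContinuousAt.eventually_mem (f := fun s : ℝ => (s, q)) (by fun_prop) (hP.mem_nhds hqP0)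
  have ev2 : ∀ᶠ s in 𝓝 (0 : ℝ), (τ q - s, Ψ (s, q)) ∈ U₁ := by
    refine ContinuousAt.eventually_mem (f := fun s : ℝ => (τ q - s, Ψ (s, q)))
      (ContinuousAt.prodMk (by fun_prop) hΨc) (hU₁.mem_nhds ?_)
    simpa only [sub_zero, hΨ0 _ hqP0] using hτU
  -- Along an orbit the hitting point does not change and the hitting time decreases at unit rate,
  -- so only the time argument of `a` varies.
  have hinv : ∀ᶠ s in 𝓝 (0 : ℝ), τ (Ψ (s, q)) = τ q - s ∧ h (Ψ (s, q)) = h q := by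
    filter_upwards [ev1, ev2] with s hs hs'
    have e1 : Ψ (τ q - s, Ψ (s, q)) = h q := by
      rw [hadd s (τ q - s) q hs (hU₁P hs').1 (by rw [add_sub_cancel]; exact (hU₁P hτU).1),
        add_sub_cancel]
    have e2 := (hGH _ hs').2
    simp only [e1, hρh] at e2
    have e3 : τ (Ψ (s, q)) = τ q - s := congrArg Prod.fst e2
    exact ⟨e3, by simp only [hh, e3] at e1 ⊢; exact e1⟩
  have hmem : (-τ q, h q) ∈ P' := hVP ⟨h5, h4⟩
  have hback : Ψ (-τ q, h q) = q := by
    have := hadd (τ q) (-τ q) q (hU₁P hτU).1 hmem.1 (by rw [add_neg_cancel]; exact hqP0)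
    rw [add_neg_cancel, hΨ0 _ hqP0] at this
    exact this
  have hd := (had _ h4).2 _ h5
  simp only [hback] at hd
  have hd' : HasDerivAt (fun s => K (h q) * a (s - τ q, h q))
      (K (h q) * (a (-τ q, h q) * C q)) 0 := by
    have h8 : HasDerivAt (fun s => a (s, h q)) (a (-τ q, h q) * C q) (0 - τ q) := by
      rwa [zero_sub]
    exact (h8.comp_sub_const 0 (τ q)).const_mul _
  rw [mul_assoc]
  refine hd'.congr_of_eventuallyEq ?_
  filter_upwards [hinv] with s hs
  rw [hs.1, hs.2, neg_sub]

end FlowBox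

/-! ### Frames parallel along geodesics -/

section LocalFrame

variable {n : ℕ} {Q : Type*} [TopologicalSpace Q] [ChartedSpace (EuclideanSpace ℝ (Fin n)) Q]
  [IsManifold (𝓡 n) ∞ Q] {g : Metric (n := n) Q} {Ω : Set Q}
  {r : ℕ} {𝓔 : PhaseBundle g Ω r} (D : 𝓔.sections →ₗ[ℂ] 𝓔.sections)

local notation "End" => (Fin r → ℂ) →L[ℂ] (Fin r → ℂ)

/-- A frame over an open subset of the phase space which is parallel along geodesics. -/
structure IsLocalFrame (W : Set (TangentBundle (𝓡 n) Q))
    (map : ∀ z, 𝓔.Fiber z ≃ₗ[ℂ] (Fin r → ℂ)) : Prop where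
  smooth : ∀ (e : Trivialization (Fin r → ℂ) (π (Fin r → ℂ) 𝓔.Fiber)) [MemTrivializationAtlas e]
    (y : Fin r → ℂ), SmoothOn (𝓡 n).tangent 𝓘(ℝ, Fin r → ℂ) (incl g Ω)
      (fun z => map z (e.symm z y)) {z | incl g Ω z ∈ W ∧ z ∈ e.baseSet}
  parallel : ∀ z, incl g Ω z ∈ W → ∀ σ : 𝓔.sections,
    HasArcDeriv (fun z' => map z' (σ.1 z')) z (map z ((D σ).1 z))

variable {D}

lemma IsLocalFrame.mono {W W' : Set (TangentBundle (𝓡 n) Q)}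
    {map : ∀ z, 𝓔.Fiber z ≃ₗ[ℂ] (Fin r → ℂ)} (h : IsLocalFrame D W map) (hW : W' ⊆ W) :
    IsLocalFrame D W' map :=
  ⟨fun e _ y => (h.smooth e y).mono fun _ hz => ⟨hW hz.1, hz.2⟩, fun z hz => h.parallel z (hW hz)⟩

open Classical in
-- Being a frame is a local condition, so disjoint open sets decouple. This combines a frame near a
-- boundary vector with one near its reflection.
lemma IsLocalFrame.piecewise (hg : IsGeodesicallyComplete g) {W₁ W₂ : Set (TangentBundle (𝓡 n) Q)}
    (hW₁ : IsOpen W₁) (hW₂ : IsOpen W₂) (hd : Disjoint W₁ W₂)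
    {map₁ map₂ : ∀ z, 𝓔.Fiber z ≃ₗ[ℂ] (Fin r → ℂ)} (h₁ : IsLocalFrame D W₁ map₁)
    (h₂ : IsLocalFrame D W₂ map₂) :
    IsLocalFrame D (W₁ ∪ W₂) (fun z => if incl g Ω z ∈ W₁ then map₁ z else map₂ z) := by
  have hn : ∀ {z}, incl g Ω z ∈ W₂ → incl g Ω z ∉ W₁ := fun h h' =>
    Set.disjoint_left.1 hd h' h
  refine ⟨fun e _ y => SmoothOn.of_local fun z hz => ?_, fun z hz σ => ?_⟩
  · rcases hz.1 with h | h
    · refine ⟨W₁, hW₁, h, ((h₁.smooth e y).mono fun z hz => ⟨hz.2, hz.1.2⟩).congr fun z hz => ?_⟩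
      simp only [if_pos (show incl g Ω z ∈ W₁ from hz.2)]
    · refine ⟨W₂, hW₂, h, ((h₂.smooth e y).mono fun z hz => ⟨hz.2, hz.1.2⟩).congr fun z hz => ?_⟩
      simp only [if_neg (hn (show incl g Ω z ∈ W₂ from hz.2))]
  · rcases hz with h | h
    · have := (h₁.parallel z h σ).congr (f' := fun z' =>
        (if incl g Ω z' ∈ W₁ then map₁ z' else map₂ z') (σ.1 z')) hg hW₁ h
        fun w hw => by simp only [if_pos hw]
      simpa only [if_pos h] using this
    · have := (h₂.parallel z h σ).congr (f' := fun z' =>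
        (if incl g Ω z' ∈ W₁ then map₁ z' else map₂ z') (σ.1 z')) hg hW₂ h
        fun w hw => by simp only [if_neg (hn hw)]
      simpa only [if_neg (hn h)] using this

lemma SmoothOn.exists_hasArcDeriv (hg : IsGeodesicallyComplete g) {V : Type*}
    [NormedAddCommGroup V] [NormedSpace ℝ V] {f : PhaseSpace g Ω → V} {s : Set (PhaseSpace g Ω)}
    (hf : SmoothOn (𝓡 n).tangent 𝓘(ℝ, V) (incl g Ω) f s) {W : Set (TangentBundle (𝓡 n) Q)}
    (hW : IsOpen W) (hWs : ∀ w, incl g Ω w ∈ W → w ∈ s) {z : PhaseSpace g Ω}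
    (hz : incl g Ω z ∈ W) [T2Space Q] : ∃ y, HasArcDeriv f z y := by
  obtain ⟨U, hU, hzU, G, hG, hGf⟩ := hf z (hWs z hz)
  have hcurve : ContMDiff 𝓘(ℝ, ℝ) (𝓡 n).tangent ∞ (fun s => geodesicFlow g s (incl g Ω z)) :=
    (contMDiff_geodesicFlow hg).comp (contMDiff_id.prodMk contMDiff_const)
  have h1 : ContMDiffOn 𝓘(ℝ, ℝ) 𝓘(ℝ, V) ∞ (fun s => G (geodesicFlow g s (incl g Ω z)))
      ((fun s => geodesicFlow g s (incl g Ω z)) ⁻¹' U) :=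
    hG.comp hcurve.contMDiffOn fun s hs => hs
  have h0 : (0 : ℝ) ∈ (fun s => geodesicFlow g s (incl g Ω z)) ⁻¹' U := by
    change geodesicFlow g 0 (incl g Ω z) ∈ U
    rwa [geodesicFlow_zero hg]
  have h2 := ((contMDiffOn_iff_contDiffOn.1 h1).differentiableOn (by simp)).differentiableAt
    ((hU.preimage hcurve.continuous).mem_nhds h0)
  exact ⟨_, HasArcDeriv.of_hasDerivAt hg (hU.inter hW) ⟨hzU, hz⟩
    (fun w hw => (hGf w (hWs w hw.2) hw.1).symm) h2.hasDerivAt⟩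

variable [T2Space Q] {𝓜 : Type*} [TopologicalSpace 𝓜] [T2Space 𝓜]
  [ChartedSpace (EuclideanSpace ℝ (Fin (2 * n - 1))) 𝓜] [IsManifold (𝓡 (2 * n - 1)) ∞ 𝓜]

local notation "X" => EuclideanSpace ℝ (Fin n) × EuclideanSpace ℝ (Fin n)

set_option maxHeartbeats 1000000 in
/-- The flow box solution on the tangent bundle. -/
lemma exists_flowBox_solution_geodesicFlow (hg : IsGeodesicallyComplete g)
    {p₀ : TangentBundle (𝓡 n) Q} {N : Set (TangentBundle (𝓡 n) Q)} (hN : IsOpen N) (hp₀ : p₀ ∈ N)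
    {ρ : TangentBundle (𝓡 n) Q → ℝ} (hρ : ContMDiffOn (𝓡 n).tangent 𝓘(ℝ, ℝ) ∞ ρ N) (hρ0 : ρ p₀ = 0)
    {c : ℝ} (hc : c ≠ 0) (hρd : HasDerivAt (fun s => ρ (geodesicFlow g s p₀)) c 0)
    {C K : TangentBundle (𝓡 n) Q → End} (hC : ContMDiffOn (𝓡 n).tangent 𝓘(ℝ, End) ∞ C N)
    (hK : ContMDiffOn (𝓡 n).tangent 𝓘(ℝ, End) ∞ K N) (hKu : IsUnit (K p₀)) :
    ∃ (W : Set (TangentBundle (𝓡 n) Q)) (T : TangentBundle (𝓡 n) Q → End), IsOpen W ∧ p₀ ∈ W ∧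
      ContMDiffOn (𝓡 n).tangent 𝓘(ℝ, End) ∞ T W ∧ ∀ p ∈ W, IsUnit (T p) ∧ (ρ p = 0 → T p = K p) ∧
        HasDerivAt (fun s => T (geodesicFlow g s p)) (T p * C p) 0 := by
  let χ := extChartAt (𝓡 n).tangent p₀
  have hsrc : IsOpen χ.source := isOpen_extChartAt_source (I := (𝓡 n).tangent) p₀
  have htgt : IsOpen χ.target := isOpen_extChartAt_target (I := (𝓡 n).tangent) p₀
  have hχ : ContMDiffOn (𝓡 n).tangent 𝓘(ℝ, X) ∞ χ χ.source := by
    rw [show χ.source = (chartAt (ModelProd (EuclideanSpace ℝ (Fin n)) (EuclideanSpace ℝ (Fin n))) p₀).source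
      from extChartAt_source _ _]
    exact contMDiffOn_extChartAt
  have hχs : ContMDiffOn 𝓘(ℝ, X) (𝓡 n).tangent ∞ χ.symm χ.target := contMDiffOn_extChartAt_symm p₀
  have hp₀s : p₀ ∈ χ.source := mem_extChartAt_source (I := (𝓡 n).tangent) p₀
  let Φ : ℝ × X → TangentBundle (𝓡 n) Q := fun x => geodesicFlow g x.1 (χ.symm x.2)
  have hΦ : ContMDiffOn 𝓘(ℝ, ℝ × X) (𝓡 n).tangent ∞ Φ (Set.univ ×ˢ χ.target) := by
    refine (contMDiff_geodesicFlow hg).comp_contMDiffOn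
      (f := fun x : ℝ × X => (x.1, χ.symm x.2)) (ContMDiffOn.prodMk ?_ ?_)
    · exact (contDiff_fst.contMDiff).contMDiffOn
    · exact hχs.comp (contDiff_snd.contMDiff).contMDiffOn fun x hx => hx.2
  have ho : IsOpen ((Set.univ : Set ℝ) ×ˢ χ.target) := isOpen_univ.prod htgt
  set P : Set (ℝ × X) := (Set.univ ×ˢ χ.target) ∩ Φ ⁻¹' χ.source with hP
  have hPo : IsOpen P := hΦ.continuousOn.isOpen_inter_preimage ho hsrc
  have hΨ : ContDiffOn ℝ ∞ (fun x => χ (Φ x)) P :=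
    contMDiffOn_iff_contDiffOn.1 (hχ.comp (hΦ.mono Set.inter_subset_left) fun x hx => hx.2)
  have hN' : IsOpen (χ.target ∩ χ.symm ⁻¹' N) := hχs.continuousOn.isOpen_inter_preimage htgt hN
  have hcomp : ∀ {V : Type} [NormedAddCommGroup V] [NormedSpace ℝ V]
      {f : TangentBundle (𝓡 n) Q → V}, ContMDiffOn (𝓡 n).tangent 𝓘(ℝ, V) ∞ f N →
      ContDiffOn ℝ ∞ (fun q => f (χ.symm q)) (χ.target ∩ χ.symm ⁻¹' N) := fun hf =>
    contMDiffOn_iff_contDiffOn.1 (hf.comp (hχs.mono Set.inter_subset_left) fun x hx => hx.2)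
  have hsymm : ∀ p ∈ χ.source, χ.symm (χ p) = p := fun p hp => χ.left_inv hp
  have hev : ∀ p ∈ χ.source, ∀ᶠ s in 𝓝 (0 : ℝ), geodesicFlow g s p ∈ χ.source := fun p hp =>
    (continuous_geodesicFlow_left hg p).continuousAt.eventually_mem
      (hsrc.mem_nhds (by rwa [geodesicFlow_zero hg]))
  have hqP : ((0 : ℝ), χ p₀) ∈ P := by
    refine ⟨⟨trivial, χ.map_source hp₀s⟩, ?_⟩
    change geodesicFlow g 0 (χ.symm (χ p₀)) ∈ χ.source
    rwa [hsymm _ hp₀s, geodesicFlow_zero hg]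
  obtain ⟨V, T, hV, hqV, hT, hTV⟩ := exists_flowBox_solution (A := End)
    (Ψ := fun x => χ (Φ x)) (ρ := fun q => ρ (χ.symm q)) (C := fun q => C (χ.symm q))
    (K := fun q => K (χ.symm q)) (N := χ.target ∩ χ.symm ⁻¹' N) (q₀ := χ p₀) (c := c)
    hPo hqP hΨ
    (fun q hq => by
      change χ (geodesicFlow g 0 (χ.symm q)) = q
      rw [geodesicFlow_zero hg]
      exact χ.right_inv hq.1.2)
    (fun s s' q hs _ _ => by
      change χ (geodesicFlow g s' (χ.symm (χ (Φ (s, q))))) = χ (geodesicFlow g (s + s') (χ.symm q))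
      rw [hsymm _ hs.2, add_comm, geodesicFlow_add hg])
    hN' ⟨χ.map_source hp₀s, by rw [Set.mem_preimage, hsymm _ hp₀s]; exact hp₀⟩ (hcomp hρ)
    (by rw [hsymm _ hp₀s, hρ0]) hc
    (by
      refine hρd.congr_of_eventuallyEq ?_
      filter_upwards [hev p₀ hp₀s] with s hs
      change ρ (χ.symm (χ (geodesicFlow g s (χ.symm (χ p₀))))) = _
      rw [hsymm p₀ hp₀s, hsymm _ hs])
    (hcomp hC) (hcomp hK) (by simpa only [hsymm _ hp₀s] using hKu)
  refine ⟨χ.source ∩ χ ⁻¹' V, fun p => T (χ p), hχ.continuousOn.isOpen_inter_preimage hsrc hV,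
    ⟨hp₀s, hqV⟩, hT.contMDiffOn.comp (hχ.mono Set.inter_subset_left) fun p hp => hp.2,
    fun p hp => ?_⟩
  obtain ⟨h1, h2, h3⟩ := hTV (χ p) hp.2
  simp only [hsymm p hp.1] at h2 h3
  refine ⟨h1, h2, h3.congr_of_eventuallyEq (Filter.Eventually.of_forall fun s => ?_)⟩
  change T (χ (geodesicFlow g s p)) = T (χ (geodesicFlow g s (χ.symm (χ p))))
  rw [hsymm p hp.1]

/-- Existence of parallel frames with prescribed values on a hypersurface. -/
lemma exists_localFrame (mod : SmoothModel g Ω 𝓜) (hg : IsGeodesicallyComplete g)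
    (hΩ : IsObstacle n Ω) (hD₂ : SatisfiesBilliardLeibniz 𝓔 D)
    (e : Trivialization (Fin r → ℂ) (π (Fin r → ℂ) 𝓔.Fiber)) [MemTrivializationAtlas e]
    {z : PhaseSpace g Ω} (hz : z ∈ e.baseSet) {N : Set (TangentBundle (𝓡 n) Q)} (hN : IsOpen N)
    (hzN : incl g Ω z ∈ N) {ρ : TangentBundle (𝓡 n) Q → ℝ}
    (hρ : ContMDiffOn (𝓡 n).tangent 𝓘(ℝ, ℝ) ∞ ρ N) (hρ0 : ρ (incl g Ω z) = 0) {c : ℝ} (hc : c ≠ 0)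
    (hρd : HasDerivAt (fun s => ρ (geodesicFlow g s (incl g Ω z))) c 0)
    {K : TangentBundle (𝓡 n) Q → End} (hK : ContMDiffOn (𝓡 n).tangent 𝓘(ℝ, End) ∞ K N)
    (hKu : IsUnit (K (incl g Ω z))) :
    ∃ (W : Set (TangentBundle (𝓡 n) Q)) (map : ∀ z, 𝓔.Fiber z ≃ₗ[ℂ] (Fin r → ℂ)), IsOpen W ∧
      incl g Ω z ∈ W ∧ IsLocalFrame D W map ∧ ∀ w, incl g Ω w ∈ W → w ∈ e.baseSet ∧
        (ρ (incl g Ω w) = 0 → ∀ v, map w v = K (incl g Ω w) (e ⟨w, v⟩).2) := by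
  obtain ⟨W₁, C, hW₁, hzW₁, hC, hWe, hDC⟩ := exists_connectionForm mod hg hΩ hD₂ e hz
  obtain ⟨W₂, T, hW₂, hzW₂, hT, hTW⟩ := exists_flowBox_solution_geodesicFlow hg (hN.inter hW₁)
    ⟨hzN, hzW₁⟩ (hρ.mono Set.inter_subset_left) hρ0 hc hρd (hC.mono Set.inter_subset_right)
    (hK.mono Set.inter_subset_left) hKu
  -- The frame is `T` composed with the trivialization. Elsewhere an arbitrary isomorphism fills in,
  -- since the maps have to be defined on all fibers.
  have hmap : ∀ w, ∃ m : 𝓔.Fiber w ≃ₗ[ℂ] (Fin r → ℂ), incl g Ω w ∈ W₁ ∩ W₂ →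
      ∀ v, m v = T (incl g Ω w) (e ⟨w, v⟩).2 := by
    intro w
    by_cases hw : incl g Ω w ∈ W₁ ∩ W₂
    · obtain ⟨u, hu⟩ := (hTW _ hw.2).1
      refine ⟨(𝓔.fiberEquiv e (hWe w hw.1)).trans
        (ContinuousLinearEquiv.unitsEquiv ℂ (Fin r → ℂ) u).toLinearEquiv, fun _ v => ?_⟩
      rw [← hu]
      rfl
    · exact ⟨𝓔.fiberEquiv (trivializationAt (Fin r → ℂ) 𝓔.Fiber w)
        (mem_baseSet_trivializationAt _ _ _), fun h => absurd h hw⟩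
  choose map hm using hmap
  refine ⟨W₁ ∩ W₂, map, hW₁.inter hW₂, ⟨hzW₁, hzW₂⟩, ⟨fun e' _ y => ?_, fun w hw σ => ?_⟩,
    fun w hw => ⟨hWe w hw.1, fun h v => by rw [hm w hw, (hTW _ hw.2).2.1 h]⟩⟩
  · have h1 : SmoothOn (𝓡 n).tangent 𝓘(ℝ, End) (incl g Ω) (fun w => T (incl g Ω w))
        {w | incl g Ω w ∈ W₁ ∩ W₂ ∧ w ∈ e'.baseSet} :=
      SmoothOn.of_contMDiffOn hW₂ hT fun w hw => hw.1.2
    have h2 : SmoothOn (𝓡 n).tangent 𝓘(ℝ, End) (incl g Ω)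
        (fun w => (e'.coordChangeL ℂ e w : End)) {w | incl g Ω w ∈ W₁ ∩ W₂ ∧ w ∈ e'.baseSet} :=
      (𝓔.smooth_coordChange e' e).mono fun w hw => ⟨hw.2, hWe w hw.1.1⟩
    refine (h1.clm_apply (h2.clm_apply (SmoothOn.const y))).congr fun w hw => ?_
    rw [hm w hw.1]
    have h3 : (e'.coordChangeL ℂ e w : End) y = _ := 𝓔.coordChangeL_eq e' e hw.2 (hWe w hw.1.1) y
    rw [h3]
    rfl
  · obtain ⟨y, hy⟩ := (smoothOn_section e σ).exists_hasArcDeriv hg hW₁ hWe hw.1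
    -- With `T' = T C`, the product rule gives `T C σ + T σ'`, that is, `T` applied to the
    -- components of `D σ`: the equation for `T` says that the frame is parallel.
    have h1 : HasArcDeriv (fun w => T (incl g Ω w)) w (T (incl g Ω w) * C (incl g Ω w)) :=
      HasArcDeriv.of_hasDerivAt hg (F := T) isOpen_univ (Set.mem_univ _) (fun _ _ => rfl)
        (hTW _ hw.2).2.2
    have h2 := (h1.clm_apply hy).congr hg (hW₁.inter hW₂) hw
      (f' := fun z' => map z' (σ.1 z')) fun w' hw' => hm w' hw' _
    rw [hm w hw, hDC w hw.1 σ y hy, map_add, add_comm]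
    exact h2

end LocalFrame

/-! ### Frames compatible with the gluing, over open subsets of the model -/

section Frame

variable {n : ℕ} {Q : Type*} [TopologicalSpace Q] [ChartedSpace (EuclideanSpace ℝ (Fin n)) Q]
  [IsManifold (𝓡 n) ∞ Q] {g : Metric (n := n) Q} {Ω : Set Q}
  {𝓜 : Type*} [TopologicalSpace 𝓜]
  [ChartedSpace (EuclideanSpace ℝ (Fin (2 * n - 1))) 𝓜]
  {r : ℕ} {𝓔 : PhaseBundle g Ω r}

local notation "End" => (Fin r → ℂ) →L[ℂ] (Fin r → ℂ)

/-- A frame over the preimage of an open subset of the model, parallel along geodesics and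
compatible with the gluing. -/
structure Frame (mod : SmoothModel g Ω 𝓜) (D : 𝓔.sections →ₗ[ℂ] 𝓔.sections) (κ : Gluing 𝓔) where
  /-- The open subset of the model. -/
  U : Set 𝓜
  /-- The components with respect to the frame. -/
  map : ∀ z, 𝓔.Fiber z ≃ₗ[ℂ] (Fin r → ℂ)
  isOpen : IsOpen U
  smooth : ∀ (e : Trivialization (Fin r → ℂ) (π (Fin r → ℂ) 𝓔.Fiber)) [MemTrivializationAtlas e]
    (y : Fin r → ℂ), SmoothOn (𝓡 n).tangent 𝓘(ℝ, Fin r → ℂ) (incl g Ω)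
      (fun z => map z (e.symm z y)) {z | mod.proj z ∈ U ∧ z ∈ e.baseSet}
  parallel : ∀ z, mod.proj z ∈ U → ∀ σ : 𝓔.sections,
    HasArcDeriv (fun z' => map z' (σ.1 z')) z (map z ((D σ).1 z))
  glue : ∀ z : inwardBoundary g Ω, mod.proj z.1 ∈ U → ∀ v,
    map (reflection g Ω z.1) (κ.map z v) = map z.1 v

omit [IsManifold (𝓡 n) ∞ Q] in
-- A nonzero value would put the point into the interior of `Ω` or of its complement. Thus the zero
-- set of the defining function contains all nearby boundary points, and prescribing a frame on it
-- prescribes it on the boundary.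
lemma IsBoundaryDefiningAt.exists_eq_zero {x : Q} {ρ : Q → ℝ} (h : IsBoundaryDefiningAt n Ω x ρ) :
    ∃ U : Set Q, IsOpen U ∧ x ∈ U ∧ ContMDiffOn (𝓡 n) 𝓘(ℝ, ℝ) ∞ ρ U ∧
      ∀ y ∈ U, y ∈ frontier Ω → ρ y = 0 := by
  obtain ⟨-, -, U, hU, hxU, hs, hΩ⟩ := h
  refine ⟨U, hU, hxU, hs, fun y hy hyf => ?_⟩
  have hc : ContinuousAt ρ y := hs.continuousOn.continuousAt (hU.mem_nhds hy)
  rcases lt_trichotomy (ρ y) 0 with h | h | h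
  · have h1 : ∀ᶠ y' in 𝓝 y, y' ∈ Ωᶜ := by
      filter_upwards [hc.eventually (gt_mem_nhds h), hU.mem_nhds hy] with y' h1 h2 h3
      exact absurd ((hΩ y' h2).1 h3) (not_le.2 h1)
    rw [frontier_eq_closure_inter_closure] at hyf
    exact absurd hyf.1 (fun h2 => (mem_closure_iff_frequently.1 h2) h1)
  · exact h
  · have h1 : ∀ᶠ y' in 𝓝 y, y' ∈ Ω := by
      filter_upwards [hc.eventually (lt_mem_nhds h), hU.mem_nhds hy] with y' h1 h2
      exact (hΩ y' h2).2 h1.le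
    exact absurd (mem_interior_iff_mem_nhds.2 h1) hyf.2

variable {D : 𝓔.sections →ₗ[ℂ] 𝓔.sections} {κ : Gluing 𝓔}

/-- The matrix of the gluing extends to a smooth function. -/
lemma Gluing.exists_matrix (κ : Gluing 𝓔)
    (e e' : Trivialization (Fin r → ℂ) (π (Fin r → ℂ) 𝓔.Fiber)) [MemTrivializationAtlas e]
    [MemTrivializationAtlas e'] (z : inwardBoundary g Ω) (hz : z.1 ∈ e.baseSet)
    (hz' : reflection g Ω z.1 ∈ e'.baseSet) :
    ∃ (N : Set (TangentBundle (𝓡 n) Q)) (K : TangentBundle (𝓡 n) Q → End), IsOpen N ∧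
      incl g Ω z.1 ∈ N ∧ ContMDiffOn (𝓡 n).tangent 𝓘(ℝ, End) ∞ K N ∧ IsUnit (K (incl g Ω z.1)) ∧
      ∀ w : inwardBoundary g Ω, incl g Ω w.1 ∈ N → w.1 ∈ e.baseSet →
        reflection g Ω w.1 ∈ e'.baseSet → ∀ v,
        K (incl g Ω w.1) (e ⟨w.1, v⟩).2 = (e' ⟨reflection g Ω w.1, κ.map w v⟩).2 := by
  let s : Set (inwardBoundary g Ω) := {w | w.1 ∈ e.baseSet ∧ reflection g Ω w.1 ∈ e'.baseSet}
  have h1 : ∀ i : Fin r, SmoothOn (𝓡 n).tangent 𝓘(ℝ, Fin r → ℂ)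
      (fun w : inwardBoundary g Ω => incl g Ω w.1)
      (fun w => (e' ⟨reflection g Ω w.1, κ.map w (e.symm w.1 (Pi.single i 1))⟩).2) s := by
    intro i
    refine (κ.smooth e e').comp_param (c := fun w => (w, (Pi.single i 1 : Fin r → ℂ))) ?_
      fun w hw => ⟨hw.1, hw.2⟩
    exact SmoothOn.of_contMDiffOn
      (F := fun p : TangentBundle (𝓡 n) Q => (p, (Pi.single i 1 : Fin r → ℂ))) isOpen_univ
      (contMDiffOn_id.prodMk contMDiffOn_const) fun _ _ => Set.mem_univ _
  obtain ⟨N, hN, hzN, K, hK, hKs⟩ := SmoothOn.clm_of_columns h1 z ⟨hz, hz'⟩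
  have key : ∀ w : inwardBoundary g Ω, incl g Ω w.1 ∈ N → ∀ (hw : w.1 ∈ e.baseSet)
      (hw' : reflection g Ω w.1 ∈ e'.baseSet) (y : Fin r → ℂ), K (incl g Ω w.1) y
        = 𝓔.fiberEquiv e' hw' (κ.map w ((𝓔.fiberEquiv e hw).symm y)) := by
    intro w hwN hw hw' y
    rw [hKs w ⟨hw, hw'⟩ hwN]
    simp only [_root_.sum_apply, ContinuousLinearMap.smulRight_apply,
      ContinuousLinearMap.proj_apply]
    conv_rhs => rw [pi_eq_sum_univ' y, map_sum, map_sum, map_sum]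
    refine Finset.sum_congr rfl fun i _ => ?_
    rw [map_smul, map_smul, map_smul]
    rfl
  refine ⟨N, K, hN, hzN, hK, ?_, fun w hwN hw hw' v => ?_⟩
  · let m := ((𝓔.fiberEquiv e hz).symm.trans ((κ.map z).trans (𝓔.fiberEquiv e' hz'))).toContinuousLinearEquiv
    have : K (incl g Ω z.1) = (ContinuousLinearEquiv.unitsEquiv ℂ (Fin r → ℂ)).symm m :=
      ContinuousLinearMap.ext fun y => key z hzN hz hz' y
    rw [this]
    exact Units.isUnit _
  · rw [key w hwN hw hw', ← 𝓔.fiberEquiv_apply e hw, LinearEquiv.symm_apply_apply]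
    rfl

variable [T2Space Q] [T2Space 𝓜] [IsManifold (𝓡 (2 * n - 1)) ∞ 𝓜]

/-- Any hypersurface transversal to the geodesic will do. The slice used is the level set of the
pairing of the base coordinates with the velocity `v`, whose derivative along the geodesic at time 0
is `⟪v, v⟫`, nonzero for a unit vector. -/
lemma exists_localFrame_interior (mod : SmoothModel g Ω 𝓜) (hg : IsGeodesicallyComplete g)
    (hΩ : IsObstacle n Ω) (hD₂ : SatisfiesBilliardLeibniz 𝓔 D) (z : PhaseSpace g Ω) :
    ∃ (W : Set (TangentBundle (𝓡 n) Q)) (map : ∀ z, 𝓔.Fiber z ≃ₗ[ℂ] (Fin r → ℂ)), IsOpen W ∧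
      incl g Ω z ∈ W ∧ IsLocalFrame D W map := by
  set p := incl g Ω z with hp
  obtain ⟨v, hv⟩ : ∃ v : EuclideanSpace ℝ (Fin n), p.snd = v := ⟨p.snd, rfl⟩
  have hv0 : v ≠ 0 := by
    rintro rfl
    have h1 := z.2.1
    change g.inner p.proj p.snd p.snd = 1 at h1
    rw [hv] at h1
    have h2 : g.inner p.proj (0 : TangentSpace (𝓡 n) p.proj) = 0 := map_zero _
    have h3 : g.inner p.proj (0 : TangentSpace (𝓡 n) p.proj) (0 : TangentSpace (𝓡 n) p.proj) = 0 := by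
      rw [h2]; rfl
    exact zero_ne_one (h3.symm.trans h1)
  let χ := extChartAt (𝓡 n).tangent p
  let ℓ : EuclideanSpace ℝ (Fin n) × EuclideanSpace ℝ (Fin n) →L[ℝ] ℝ :=
    (innerSL ℝ v).comp (ContinuousLinearMap.fst ℝ _ _)
  have hχ : ContMDiffOn (𝓡 n).tangent
      𝓘(ℝ, EuclideanSpace ℝ (Fin n) × EuclideanSpace ℝ (Fin n)) ∞ χ χ.source := by
    rw [show χ.source = (chartAt (ModelProd (EuclideanSpace ℝ (Fin n)) (EuclideanSpace ℝ (Fin n))) p).source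
      from extChartAt_source _ _]
    exact contMDiffOn_extChartAt
  have hρ : ContMDiffOn (𝓡 n).tangent 𝓘(ℝ, ℝ) ∞ (fun q => ℓ (χ q) - ℓ (χ p)) χ.source :=
    ((ℓ.contDiff.sub contDiff_const).contMDiff (n := ∞)).comp_contMDiffOn
      (g := fun y => ℓ y - ℓ (χ p)) hχ
  have hp0 := geodesicFlow_zero hg p
  have hd := hasDerivAt_geodesicFlow_inChart hg (p := p) (p₀ := p) (t := 0)
    (by rw [hp0]; exact mem_extChartAt_source _)
  rw [hp0] at hd
  have hd' : HasDerivAt (fun s => ℓ (χ (geodesicFlow g s p)) - ℓ (χ p))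
      (ℓ (geodesicFieldInChart g p.proj (χ p))) 0 :=
    (ℓ.hasFDerivAt.comp_hasDerivAt (0 : ℝ) hd).sub_const _
  have hc : ℓ (geodesicFieldInChart g p.proj (χ p)) = inner ℝ v v := by
    have h1 : ((χ p).2 : EuclideanSpace ℝ (Fin n)) = v := by
      rw [← hv]
      exact tangentCoordChange_self (mem_extChartAt_source _)
    change inner ℝ v (χ p).2 = inner ℝ v v
    rw [h1]
  obtain ⟨W, map, hW, hzW, hmap, -⟩ := exists_localFrame mod hg hΩ hD₂
    (trivializationAt (Fin r → ℂ) 𝓔.Fiber z) (mem_baseSet_trivializationAt _ _ _)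
    (isOpen_extChartAt_source (I := (𝓡 n).tangent) p) (mem_extChartAt_source (I := (𝓡 n).tangent) p)
    hρ (sub_self _) (by rw [hc]; exact inner_self_ne_zero.2 hv0) hd'
    (K := fun _ => 1) contMDiffOn_const isUnit_one
  exact ⟨W, map, hW, hzW, hmap⟩

/-- At a non-grazing vector the boundary of `Ω` itself is the transversal hypersurface, so the
values of the frame on it can be prescribed. -/
lemma exists_localFrame_boundary (mod : SmoothModel g Ω 𝓜) (hg : IsGeodesicallyComplete g)
    (hΩ : IsObstacle n Ω) (hD₂ : SatisfiesBilliardLeibniz 𝓔 D)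
    (e : Trivialization (Fin r → ℂ) (π (Fin r → ℂ) 𝓔.Fiber)) [MemTrivializationAtlas e]
    {z : PhaseSpace g Ω} (hz : z ∈ e.baseSet) (hzN : normalPart g Ω (incl g Ω z) ≠ 0)
    {N : Set (TangentBundle (𝓡 n) Q)} (hN : IsOpen N) (hzN' : incl g Ω z ∈ N)
    {K : TangentBundle (𝓡 n) Q → End}
    (hK : ContMDiffOn (𝓡 n).tangent 𝓘(ℝ, End) ∞ K N) (hKu : IsUnit (K (incl g Ω z))) :
    ∃ (W : Set (TangentBundle (𝓡 n) Q)) (map : ∀ z, 𝓔.Fiber z ≃ₗ[ℂ] (Fin r → ℂ)), IsOpen W ∧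
      incl g Ω z ∈ W ∧ IsLocalFrame D W map ∧ ∀ w, incl g Ω w ∈ W → w ∈ e.baseSet ∧
        ((incl g Ω w).proj ∈ frontier Ω → ∀ v, map w v = K (incl g Ω w) (e ⟨w, v⟩).2) := by
  obtain ⟨ρ, c, hc, hρ, hd⟩ := exists_isBoundaryDefiningAt_inwardNormal (inwardNormal_ne_zero hzN)
  obtain ⟨U, hU, hxU, hρs, hρ0⟩ := hρ.exists_eq_zero
  have hp0 := geodesicFlow_zero hg (incl g Ω z)
  have hder := hasDerivAt_comp_proj_geodesicFlow hg (incl g Ω z) (ρ := ρ) (t := 0)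
    (by rw [hp0]; exact hρ.mdifferentiableAt)
  rw [hp0, hd] at hder
  have hproj : ContMDiff (𝓡 n).tangent (𝓡 n) ∞ (fun p : TangentBundle (𝓡 n) Q => p.proj) :=
    Bundle.contMDiff_proj _
  have hUo : IsOpen ((fun p : TangentBundle (𝓡 n) Q => p.proj) ⁻¹' U) := hU.preimage hproj.continuous
  obtain ⟨W, map, hW, hzW, hmap, hval⟩ := exists_localFrame mod hg hΩ hD₂ e hz (hN.inter hUo)
    ⟨hzN', hxU⟩ (ρ := fun p => ρ p.proj)
    (hρs.comp hproj.contMDiffOn fun p hp => hp.2) hρ.1 (mul_ne_zero hc.ne' hzN) hder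
    (hK.mono Set.inter_subset_left) hKu
  exact ⟨W ∩ _, map, hW.inter hUo, ⟨hzW, hxU⟩, hmap.mono Set.inter_subset_left,
    fun w hw => ⟨(hval w hw.1).1, fun hf => (hval w hw.1).2 (hρ0 _ hw.2 hf)⟩⟩

/-- Every point of the model lies in the domain of a frame. -/
theorem exists_frame (mod : SmoothModel g Ω 𝓜) (hg : IsGeodesicallyComplete g)
    (hΩ : IsObstacle n Ω) (hD₂ : SatisfiesBilliardLeibniz 𝓔 D) (κ : Gluing 𝓔) (p : 𝓜) :
    ∃ F : Frame mod D κ, p ∈ F.U := by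
  classical
  obtain ⟨z, rfl⟩ := mod.surjective_proj p
  have mk : ∀ (U : Set 𝓜) (W : Set (TangentBundle (𝓡 n) Q))
      (map : ∀ z, 𝓔.Fiber z ≃ₗ[ℂ] (Fin r → ℂ)), IsOpen U → mod.proj z ∈ U →
      (∀ w, mod.proj w ∈ U → incl g Ω w ∈ W) → IsLocalFrame D W map →
      (∀ z : inwardBoundary g Ω, mod.proj z.1 ∈ U → ∀ v,
        map (reflection g Ω z.1) (κ.map z v) = map z.1 v) → ∃ F : Frame mod D κ, mod.proj z ∈ F.U :=
    fun U W map hU hzU hUW h hglue => ⟨⟨U, map, hU,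
      fun e _ y => (h.smooth e y).mono fun w hw => ⟨hUW w hw.1, hw.2⟩,
      fun w hw => h.parallel w (hUW w hw), hglue⟩, hzU⟩
  by_cases hint : z ∈ interiorPart g Ω
  · obtain ⟨W, map, hW, hzW, hmap⟩ := exists_localFrame_interior mod hg hΩ hD₂ z
    obtain ⟨W', hW', hW'i⟩ := exists_isOpen_of_isOpen_phaseSpace (isOpen_interiorPart (g := g) hΩ)
    have hz' : incl g Ω z ∈ W ∩ W' := ⟨hzW, (hW'i z).2 hint⟩
    obtain ⟨U, hU, hzU, hUW⟩ := mod.exists_isOpen_preimage_subset hg hΩ z (hW.inter hW') hz'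
      (by rwa [reflection_of_mem_interiorPart hint])
    refine mk U _ map hU hzU hUW (hmap.mono Set.inter_subset_left) fun w hw => ?_
    exact absurd ((hW'i _).1 (hUW w.1 hw).2) fun h => notMem_boundary_of_interior hΩ h |>.1 w.2
  -- Both vectors have the same image in the model, so it suffices to treat the outward one.
  wlog hout : z ∈ outwardBoundary g Ω generalizing z
  · have hin : z ∈ inwardBoundary g Ω := by
      rcases mem_interiorPart_or z with h | h | h
      · exact absurd h hint
      · exact h
      · exact absurd h hout
    have hout' := reflection_mem_outwardBoundary hin
    have := this (reflection g Ω z) (by rwa [mod.proj_reflection hg hΩ])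
      (fun h => (notMem_boundary_of_interior hΩ h).2 hout') hout'
    rwa [mod.proj_reflection hg hΩ] at this
  set z' := reflection g Ω z with hz'def
  have hin : z' ∈ inwardBoundary g Ω := reflection_mem_inwardBoundary hout
  have hzz' : reflection g Ω z' = z := reflection_reflection z
  set e := trivializationAt (Fin r → ℂ) 𝓔.Fiber z with he
  set e' := trivializationAt (Fin r → ℂ) 𝓔.Fiber z' with he'
  have hze : z ∈ e.baseSet := mem_baseSet_trivializationAt _ _ _
  have hze' : z' ∈ e'.baseSet := mem_baseSet_trivializationAt _ _ _
  obtain ⟨N, K, hN, hzN, hK, hKu, hKκ⟩ := κ.exists_matrix e' e ⟨z', hin⟩ hze' (by rw [hzz']; exact hze)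
  -- On the boundary the frame near the outward vector has the identity as its matrix, the one near
  -- the inward vector the matrix of `κ`. This choice is the gluing condition.
  obtain ⟨W₁, map₁, hW₁, hzW₁, hmap₁, hval₁⟩ := exists_localFrame_boundary mod hg hΩ hD₂ e hze
    hout.2.ne isOpen_univ (Set.mem_univ _) (K := fun _ => 1) contMDiffOn_const isUnit_one
  obtain ⟨W₂, map₂, hW₂, hzW₂, hmap₂, hval₂⟩ := exists_localFrame_boundary mod hg hΩ hD₂ e' hze'
    hin.2.ne' hN hzN hK hKu
  have hne : incl g Ω z ≠ incl g Ω z' := fun h => by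
    have h1 := hout.2
    rw [h] at h1
    exact absurd h1 (not_lt.2 hin.2.le)
  obtain ⟨O₁, O₂, hO₁, hO₂, hzO₁, hzO₂, hO⟩ := t2_separation hne
  -- the domains
  obtain ⟨A₁, hA₁, hA₁o, hzA₁⟩ := eventually_nhds_iff.1 (eventually_reflectVector_mem (g := g) hΩ
    (p₁ := incl g Ω z) hout.2.ne (W := Set.univ) isOpen_univ (Set.mem_univ _))
  have hV₁ : IsOpen (W₁ ∩ O₁ ∩ A₁) := (hW₁.inter hO₁).inter hA₁o
  have hzV₁ : incl g Ω z ∈ W₁ ∩ O₁ ∩ A₁ := ⟨⟨hzW₁, hzO₁⟩, hzA₁⟩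
  obtain ⟨A₂, hA₂, hA₂o, hzA₂⟩ := eventually_nhds_iff.1 (eventually_reflectVector_mem (g := g) hΩ
    (p₁ := incl g Ω z') hin.2.ne' hV₁ (by rw [← incl_reflection, hzz']; exact hzV₁))
  -- The set is shrunk such that reflections of inward vectors in it lie in the domain of the first
  -- frame and such that the matrix of `κ` is available.
  have hV₂ : IsOpen (W₂ ∩ O₂ ∩ (A₂ ∩ N)) := (hW₂.inter hO₂).inter (hA₂o.inter hN)
  have hzV₂ : incl g Ω z' ∈ W₂ ∩ O₂ ∩ (A₂ ∩ N) := ⟨⟨hzW₂, hzO₂⟩, hzA₂, hzN⟩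
  have hdisj : Disjoint (W₁ ∩ O₁ ∩ A₁) (W₂ ∩ O₂ ∩ (A₂ ∩ N)) :=
    hO.mono (fun x hx => hx.1.2) (fun x hx => hx.1.2)
  obtain ⟨U, hU, hzU, hUW⟩ := mod.exists_isOpen_preimage_subset hg hΩ z (hV₁.union hV₂)
    (Or.inl hzV₁) (Or.inr hzV₂)
  refine mk U _ _ hU hzU hUW (IsLocalFrame.piecewise hg hV₁ hV₂ hdisj
    (hmap₁.mono fun x hx => hx.1.1) (hmap₂.mono fun x hx => hx.1.1)) fun w hw v => ?_
  have hwV₂ : incl g Ω w.1 ∈ W₂ ∩ O₂ ∩ (A₂ ∩ N) := by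
    -- In the first domain boundary vectors are outward like `z`, so an inward vector over `U` must
    -- be in the second.
    refine (hUW w.1 hw).resolve_left fun h => ?_
    have h1 := (hA₁ _ h.2 w.2.1 w.2.2.ne').2
    exact absurd h1 (not_lt.2 (mul_neg_of_pos_of_neg w.2.2 hout.2).le)
  have hRw : incl g Ω (reflection g Ω w.1) ∈ W₁ ∩ O₁ ∩ A₁ := by
    rw [incl_reflection]
    exact (hA₂ _ hwV₂.2.1 w.2.1 w.2.2.ne').1
  have hwn : incl g Ω w.1 ∉ W₁ ∩ O₁ ∩ A₁ := fun h => Set.disjoint_left.1 hdisj h hwV₂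
  have hRf : (incl g Ω (reflection g Ω w.1)).proj ∈ frontier Ω :=
    (reflection_mem_outwardBoundary w.2).1
  have h1 := (hval₁ _ hRw.1.1).2 hRf (κ.map w v)
  have h2 := (hval₂ _ hwV₂.1.1).2 w.2.1 v
  simp only [if_pos hRw, if_neg hwn]
  rw [h1, h2, hKκ w hwV₂.2.2 (hval₂ _ hwV₂.1.1).1 (hval₁ _ hRw.1.1).1]
  rfl

end Frame

/-! ### The model flow, and smoothness of functions that are constant along it -/

section ModelFlow

variable {n : ℕ} {Q : Type*} [TopologicalSpace Q] [ChartedSpace (EuclideanSpace ℝ (Fin n)) Q]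
  [IsManifold (𝓡 n) ∞ Q] {g : Metric (n := n) Q} {Ω : Set Q}
  {𝓜 : Type*} [TopologicalSpace 𝓜]
  [ChartedSpace (EuclideanSpace ℝ (Fin (2 * n - 1))) 𝓜]
  {mod : SmoothModel g Ω 𝓜}

namespace SmoothModel

lemma flow_flow {t : ℝ} {p : 𝓜} (h : (t, p) ∈ mod.domain) :
    ∀ᶠ s in 𝓝 (0 : ℝ), (s, mod.flow t p) ∈ mod.domain ∧
      mod.flow s (mod.flow t p) = mod.flow (t + s) p := by
  have h1 : ∀ᶠ s in 𝓝 (0 : ℝ), (s, mod.flow t p) ∈ mod.domain :=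
    ContinuousAt.eventually_mem (f := fun s : ℝ => (s, mod.flow t p)) (by fun_prop)
      (mod.isOpen_domain'.mem_nhds (mod.zero_mem_domain _))
  have h2 : ∀ᶠ s in 𝓝 (0 : ℝ), (t + s, p) ∈ mod.domain :=
    ContinuousAt.eventually_mem (f := fun s : ℝ => (t + s, p)) (by fun_prop)
      (mod.isOpen_domain'.mem_nhds (by simpa using h))
  filter_upwards [h1, h2] with s h1 h2
  exact ⟨h1, mod.flow_add t s p h h1 h2⟩

lemma hasDerivAt_flow {V : Type*} [NormedAddCommGroup V] [NormedSpace ℝ V] {f : 𝓜 → V} {y : V}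
    {t : ℝ} {p : 𝓜} (h : (t, p) ∈ mod.domain)
    (hf : HasDerivAt (fun s => f (mod.flow s (mod.flow t p))) y 0) :
    HasDerivAt (fun s => f (mod.flow s p)) y t := by
  have h1 : HasDerivAt (fun s => f (mod.flow (t + s) p)) y 0 :=
    hf.congr_of_eventuallyEq (by filter_upwards [mod.flow_flow h] with s hs using by rw [hs.2])
  have h2 : HasDerivAt (fun s => f (mod.flow (t + s) p)) y (t - t) := by rwa [sub_self]
  have h3 := h2.comp_sub_const t t
  simpa only [add_sub_cancel] using h3

lemma continuousAt_flow_time {t : ℝ} {p : 𝓜} (h : (t, p) ∈ mod.domain) :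
    ContinuousAt (fun s => mod.flow s p) t :=
  ContinuousAt.comp (f := fun s : ℝ => (s, p)) (mod.continuousAt_flow h) (by fun_prop)

lemma continuousAt_flow_point {t : ℝ} {p : 𝓜} (h : (t, p) ∈ mod.domain) :
    ContinuousAt (fun q => mod.flow t q) p :=
  ContinuousAt.comp (f := fun q : 𝓜 => (t, q)) (mod.continuousAt_flow h) (by fun_prop)

lemma contMDiffAt_flow_point {t : ℝ} {p : 𝓜} (h : (t, p) ∈ mod.domain) :
    ContMDiffAt (𝓡 (2 * n - 1)) (𝓡 (2 * n - 1)) ∞ (fun q => mod.flow t q) p :=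
  ContMDiffAt.comp (f := fun q : 𝓜 => (t, q)) p
    (mod.smooth_flow.contMDiffAt (mod.isOpen_domain'.mem_nhds h))
    (contMDiffAt_const.prodMk contMDiffAt_id)

variable [T2Space Q] (hg : IsGeodesicallyComplete g) (hΩ : IsObstacle n Ω)
include hg hΩ

/-- Trajectories can be cut off earlier, so the times at which the model flow is defined form an
interval around 0. -/
lemma mem_domain_of_mem_uIcc {t s : ℝ} {p : 𝓜} (h : (t, p) ∈ mod.domain) (hs : s ∈ Set.uIcc 0 t) :
    (s, p) ∈ mod.domain := by
  obtain ⟨z, rfl⟩ := mod.surjective_proj p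
  obtain ⟨w, hw⟩ := mod.exists_flowsTo hg hΩ h
  obtain ⟨d, hd, hdt⟩ := exists_direction_nonneg t
  have h1 : 0 ≤ d * s ∧ d * s ≤ d * t := by
    rcases hd with rfl | rfl
    · rw [Set.uIcc_of_le (by linarith)] at hs
      exact ⟨by linarith [hs.1], by linarith [hs.2]⟩
    · rw [Set.uIcc_of_ge (by linarith)] at hs
      exact ⟨by linarith [hs.2], by linarith [hs.1]⟩
  obtain ⟨w₀, hw₀⟩ := hw.exists_prefix hg hd h1.1 h1.2
  exact mod.mem_domain hw₀

/-- Over a short time, points near a given point are moved into the interior part of the model. -/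
lemma exists_short_time {U : Set 𝓜} (hU : IsOpen U) {q₀ : 𝓜} (hq₀ : q₀ ∈ U) {ε : ℝ} (hε : 0 < ε) :
    ∃ t : ℝ, 0 < t ∧ t < ε ∧ mod.flow t q₀ ∈ mod.proj '' interiorPart g Ω ∧
      ∀ᶠ q in 𝓝 q₀, (-t, mod.flow t q) ∈ mod.domain ∧
        ∀ s ∈ Set.Icc 0 t, (s, q) ∈ mod.domain ∧ mod.flow s q ∈ U := by
  have h1 : ∀ᶠ x in 𝓝 ((0 : ℝ), q₀), x ∈ mod.domain ∧ mod.flow x.1 x.2 ∈ U := by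
    refine Filter.Eventually.and (mod.isOpen_domain'.mem_nhds (mod.zero_mem_domain q₀))
      ((mod.continuousAt_flow (mod.zero_mem_domain q₀)).eventually_mem (hU.mem_nhds ?_))
    simpa only [mod.flow_zero] using hq₀
  rw [nhds_prod_eq] at h1
  obtain ⟨P, hP, R, hR, hPR⟩ := Filter.eventually_prod_iff.1 h1
  obtain ⟨δ, hδ, hP'⟩ := Metric.eventually_nhds_iff.1 hP
  have hR' : ∀ᶠ t in 𝓝 (0 : ℝ), ∀ᶠ q in 𝓝 (mod.flow t q₀), R q :=
    (mod.continuousAt_flow_left q₀).eventually (p := fun y => ∀ᶠ q in 𝓝 y, R q) (by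
      simp only [mod.flow_zero]; exact eventually_eventually_nhds.2 hR)
  obtain ⟨η, hη, hR''⟩ := Metric.eventually_nhds_iff.1 hR'
  obtain ⟨z, rfl⟩ := mod.surjective_proj q₀
  obtain ⟨ε', hε', harc⟩ := exists_short_arcs hg hΩ (Or.inl rfl : (1 : ℝ) = 1 ∨ (1 : ℝ) = -1) z
  have hpos : 0 < min (min ε η) (min δ ε') := lt_min (lt_min hε hη) (lt_min hδ hε')
  obtain ⟨t, ht, htm⟩ := exists_between hpos
  obtain ⟨⟨h2, h5⟩, h3, h4⟩ : (t < ε ∧ t < η) ∧ t < δ ∧ t < ε' := by simpa using htm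
  obtain ⟨w, hw, hwarc⟩ := harc t (by linarith) (by linarith)
  refine ⟨t, ht, h2, ?_, ?_⟩
  · rw [mod.flow_proj hg hΩ (FlowsTo.single (by rwa [launch_congr (d := 1) (by linarith)]) :
      FlowsTo g Ω t z w)]
    exact ⟨w, hw, rfl⟩
  · have htR := hR'' (y := t) (by rw [Real.dist_eq, sub_zero, abs_of_pos ht]; exact h5)
    have htd : (t, mod.proj z) ∈ mod.domain :=
      (hPR (hP' (by rw [Real.dist_eq, sub_zero, abs_of_pos ht]; exact h3)) hR.self_of_nhds).1
    filter_upwards [hR, (mod.continuousAt_flow_point htd).eventually htR] with q hq hq'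
    refine ⟨(hPR (hP' ?_) hq').1, fun s hs => hPR (hP' ?_) hq⟩
    · rw [Real.dist_eq, sub_zero, abs_neg, abs_of_pos ht]
      exact h3
    · rw [Real.dist_eq, sub_zero, abs_of_nonneg hs.1]
      linarith [hs.2]

end SmoothModel

variable [T2Space Q] [T2Space 𝓜]

omit [T2Space 𝓜] in
/-- The inverse of the projection on the interior part. -/
lemma SmoothModel.exists_inverse (mod : SmoothModel g Ω 𝓜) (hg : IsGeodesicallyComplete g)
    (hΩ : IsObstacle n Ω) : ∃ inv : 𝓜 → TangentBundle (𝓡 n) Q,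
    ContMDiffOn (𝓡 (2 * n - 1)) (𝓡 n).tangent ∞ inv (mod.proj '' interiorPart g Ω) ∧
    ∀ w, mod.proj w ∈ mod.proj '' interiorPart g Ω →
      w ∈ interiorPart g Ω ∧ inv (mod.proj w) = incl g Ω w := by
  obtain ⟨inv, hinvs, hinv⟩ := mod.diffeo_interior
  refine ⟨inv, hinvs, ?_⟩
  rintro w ⟨w', hw', hww⟩
  have h : w = w' := by
    rcases mod.eq_or_eq_reflection hg hΩ hww with h | h
    · exact h
    · rw [h, reflection_of_mem_interiorPart hw']
  subst h
  exact ⟨hw', hinv _ hw'⟩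

omit [T2Space 𝓜] in
/-- A function on the model is smooth near a point of the interior part if its pullback is. -/
lemma SmoothModel.contMDiffAt_of_smoothOn (mod : SmoothModel g Ω 𝓜) (hg : IsGeodesicallyComplete g)
    (hΩ : IsObstacle n Ω) {V : Type*} [NormedAddCommGroup V] [NormedSpace ℝ V] {f : 𝓜 → V}
    {s : Set (PhaseSpace g Ω)}
    (hf : SmoothOn (𝓡 n).tangent 𝓘(ℝ, V) (incl g Ω) (fun z => f (mod.proj z)) s) {p : 𝓜}
    (hp : p ∈ mod.proj '' interiorPart g Ω) (hs : ∀ᶠ q in 𝓝 p, ∀ z, mod.proj z = q → z ∈ s) :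
    ContMDiffAt (𝓡 (2 * n - 1)) 𝓘(ℝ, V) ∞ f p := by
  obtain ⟨inv, hinvs, hinv⟩ := mod.exists_inverse hg hΩ
  have hO := mod.isOpen_interior
  obtain ⟨z, hz, rfl⟩ := hp
  have hpO : mod.proj z ∈ mod.proj '' interiorPart g Ω := ⟨z, hz, rfl⟩
  obtain ⟨W, hW, hzW, G, hG, hGf⟩ := hf z (hs.self_of_nhds z rfl)
  have hinvz := (hinv z hpO).2
  have hinvAt : ContMDiffAt (𝓡 (2 * n - 1)) (𝓡 n).tangent ∞ inv (mod.proj z) :=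
    hinvs.contMDiffAt (hO.mem_nhds hpO)
  have h1 : ContMDiffAt (𝓡 (2 * n - 1)) 𝓘(ℝ, V) ∞ (fun q => G (inv q)) (mod.proj z) :=
    ContMDiffAt.comp (f := inv) _ (hG.contMDiffAt (hW.mem_nhds (by rwa [hinvz]))) hinvAt
  refine h1.congr_of_eventuallyEq ?_
  filter_upwards [hO.mem_nhds hpO, hs, hinvAt.continuousAt.eventually_mem
    (hW.mem_nhds (by rwa [hinvz]))] with q hq hqs hqW
  obtain ⟨w, hw, rfl⟩ := hq
  have h2 := (hinv w ⟨w, hw, rfl⟩).2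
  rw [h2] at hqW ⊢
  exact (hGf w (hqs w rfl) hqW).symm

omit [T2Space 𝓜] in
/-- Functions that are constant along the model flow are smooth if their pullback is. -/
lemma SmoothModel.contMDiffOn_of_constant (mod : SmoothModel g Ω 𝓜) (hg : IsGeodesicallyComplete g)
    (hΩ : IsObstacle n Ω) {V : Type*} [NormedAddCommGroup V] [NormedSpace ℝ V] {f : 𝓜 → V}
    {U : Set 𝓜} (hU : IsOpen U)
    (hf : SmoothOn (𝓡 n).tangent 𝓘(ℝ, V) (incl g Ω) (fun z => f (mod.proj z)) {z | mod.proj z ∈ U})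
    (hd : ∀ q ∈ U, HasDerivAt (fun t => f (mod.flow t q)) 0 0) :
    ContMDiffOn (𝓡 (2 * n - 1)) 𝓘(ℝ, V) ∞ f U := by
  intro q₀ hq₀
  -- Near `q₀` the function agrees with its composition with the flow by time `t`. That flow leads
  -- into the interior part, where smoothness can be tested on the phase space.
  obtain ⟨t, ht, -, htO, hev⟩ := SmoothModel.exists_short_time (mod := mod) hg hΩ hU hq₀ one_pos
  have h0 := hev.self_of_nhds.2 t ⟨ht.le, le_rfl⟩
  have h1 : ContMDiffAt (𝓡 (2 * n - 1)) 𝓘(ℝ, V) ∞ f (mod.flow t q₀) := by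
    refine mod.contMDiffAt_of_smoothOn hg hΩ hf htO ?_
    filter_upwards [hU.mem_nhds h0.2] with q hq z hz
    rwa [← hz] at hq
  have h2 : ContMDiffAt (𝓡 (2 * n - 1)) 𝓘(ℝ, V) ∞ (fun q => f (mod.flow t q)) q₀ :=
    ContMDiffAt.comp (f := fun q => mod.flow t q) q₀ h1 (mod.contMDiffAt_flow_point h0.1)
  refine (h2.congr_of_eventuallyEq ?_).contMDiffWithinAt
  filter_upwards [hev] with q hq
  have h3 : ∀ s ∈ Set.Icc 0 t, HasDerivAt (fun s => f (mod.flow s q)) 0 s := fun s hs =>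
    SmoothModel.hasDerivAt_flow (hq.2 s hs).1 (hd _ (hq.2 s hs).2)
  have h4 := constant_of_has_deriv_right_zero (f := fun s => f (mod.flow s q)) (a := 0) (b := t)
    (fun s hs => (h3 s hs).continuousAt.continuousWithinAt)
    (fun s hs => (h3 s ⟨hs.1, hs.2.le⟩).hasDerivWithinAt) t ⟨ht.le, le_rfl⟩
  simp only [mod.flow_zero] at h4
  exact h4.symm

end ModelFlow

/-! ### Smooth sections through a given vector -/

section Sections

variable {EN HN N : Type*} [NormedAddCommGroup EN] [NormedSpace ℝ EN] [FiniteDimensional ℝ EN]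
  [TopologicalSpace HN] [TopologicalSpace N] [T2Space N] [ChartedSpace HN N]
  {I : ModelWithCorners ℝ EN HN} [IsManifold I ∞ N]
  {B : Type*} [TopologicalSpace B] {ι : B → N} {r : ℕ} {𝓔 : SmoothBundle I ι r}

/-- Every vector is a value of a smooth section. -/
lemma exists_section_eq (hι : Topology.IsInducing ι) {b : B} (v : 𝓔.Fiber b) :
    ∃ σ : 𝓔.sections, σ.1 b = v := by
  let e := trivializationAt (Fin r → ℂ) 𝓔.Fiber b
  have hbe : b ∈ e.baseSet := mem_baseSet_trivializationAt _ _ _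
  obtain ⟨W, hW, hWe⟩ := hι.isOpen_iff.1 e.open_baseSet
  have hbW : ι b ∈ W := by
    change b ∈ ι ⁻¹' W
    rwa [hWe]
  obtain ⟨f, hf, hfs, hf1⟩ := exists_complex_cutoff I (hW.mem_nhds hbW)
  obtain ⟨s, hs⟩ := exists_section_cutoff e hf hW (fun w hw => hWe ▸ hw) hfs
    (SmoothOn.const (e ⟨b, v⟩).2)
  refine ⟨s, (𝓔.fiberEquiv e hbe).injective ?_⟩
  rw [𝓔.fiberEquiv_apply, hs b hbe, hf1.self_of_nhds]
  exact one_smul _ _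

end Sections

/-! ### Transition functions between frames and the bundle on the model -/

section ModelBundle

variable {n : ℕ} {Q : Type*} [TopologicalSpace Q] [ChartedSpace (EuclideanSpace ℝ (Fin n)) Q]
  [IsManifold (𝓡 n) ∞ Q] {g : Metric (n := n) Q} {Ω : Set Q}
  {𝓜 : Type*} [TopologicalSpace 𝓜]
  [ChartedSpace (EuclideanSpace ℝ (Fin (2 * n - 1))) 𝓜]
  {r : ℕ} {𝓔 : PhaseBundle g Ω r} {mod : SmoothModel g Ω 𝓜}
  {D : 𝓔.sections →ₗ[ℂ] 𝓔.sections} {κ : Gluing 𝓔}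

local notation "End" => (Fin r → ℂ) →L[ℂ] (Fin r → ℂ)

namespace Frame

/-- The coordinate change between two frames at a point of the phase space. -/
def change (F F' : Frame mod D κ) (z : PhaseSpace g Ω) : End :=
  (((F.map z).symm.trans (F'.map z)).toContinuousLinearEquiv : (Fin r → ℂ) →L[ℂ] (Fin r → ℂ))

lemma change_apply (F F' : Frame mod D κ) (z : PhaseSpace g Ω) (y : Fin r → ℂ) :
    F.change F' z y = F'.map z ((F.map z).symm y) := rfl

/-- Both frames absorb the same `κ`, which cancels in the coordinate change. -/
lemma change_reflection (F F' : Frame mod D κ) (z : inwardBoundary g Ω)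
    (h : mod.proj z.1 ∈ F.U) (h' : mod.proj z.1 ∈ F'.U) :
    F.change F' (reflection g Ω z.1) = F.change F' z.1 := by
  refine ContinuousLinearMap.ext fun y => ?_
  have h1 : (F.map (reflection g Ω z.1)).symm y = κ.map z ((F.map z.1).symm y) := by
    rw [LinearEquiv.symm_apply_eq, F.glue z h, LinearEquiv.apply_symm_apply]
  rw [change_apply, change_apply, h1, F'.glue z h']

variable [T2Space Q] [T2Space 𝓜] (hg : IsGeodesicallyComplete g) (hΩ : IsObstacle n Ω)

omit [T2Space 𝓜] in
include hg hΩ in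
/-- The coordinate change only depends on the point of the model. -/
lemma change_congr (F F' : Frame mod D κ) {z w : PhaseSpace g Ω} (hzw : mod.proj z = mod.proj w)
    (h : mod.proj z ∈ F.U) (h' : mod.proj z ∈ F'.U) : F.change F' z = F.change F' w := by
  rcases mod.eq_or_eq_reflection hg hΩ hzw with rfl | rfl
  · rfl
  rcases mem_interiorPart_or z with hz | hz | hz
  · rw [reflection_of_mem_interiorPart hz]
  · exact (change_reflection F F' ⟨z, hz⟩ h h').symm
  · have := change_reflection F F' ⟨_, reflection_mem_inwardBoundary hz⟩ (hzw ▸ h) (hzw ▸ h')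
    rwa [reflection_reflection] at this

omit [T2Space Q] [T2Space 𝓜] in
/-- The matrix of the frame with respect to a trivialization is smooth. -/
lemma smooth_matrix (F : Frame mod D κ)
    (e : Trivialization (Fin r → ℂ) (π (Fin r → ℂ) 𝓔.Fiber)) [MemTrivializationAtlas e] :
    ∃ M : PhaseSpace g Ω → End, SmoothOn (𝓡 n).tangent 𝓘(ℝ, End) (incl g Ω) M
      {z | mod.proj z ∈ F.U ∧ z ∈ e.baseSet} ∧ ∀ z ∈ e.baseSet, IsUnit (M z) ∧
        (∀ v, F.map z v = M z (e ⟨z, v⟩).2) ∧ ∀ y, (F.map z).symm y = e.symm z (Ring.inverse (M z) y) := by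
  classical
  let M : PhaseSpace g Ω → End := fun z => if hz : z ∈ e.baseSet then
    (((𝓔.fiberEquiv e hz).symm.trans (F.map z)).toContinuousLinearEquiv : End) else 0
  have hM : ∀ z (hz : z ∈ e.baseSet),
      M z = (((𝓔.fiberEquiv e hz).symm.trans (F.map z)).toContinuousLinearEquiv : End) :=
    fun z hz => dif_pos hz
  refine ⟨M, SmoothOn.clm_of_apply fun y => (F.smooth e y).congr fun z hz => ?_, fun z hz => ?_⟩
  · rw [hM z hz.2]
    rfl
  · set m := ((𝓔.fiberEquiv e hz).symm.trans (F.map z)).toContinuousLinearEquiv with hm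
    have h1 : M z = ((ContinuousLinearEquiv.unitsEquiv ℂ (Fin r → ℂ)).symm m : End) := hM z hz
    refine ⟨h1 ▸ Units.isUnit _, fun v => ?_, fun y => ?_⟩
    · rw [hM z hz, ← 𝓔.fiberEquiv_apply e hz]
      change _ = F.map z ((𝓔.fiberEquiv e hz).symm (𝓔.fiberEquiv e hz v))
      rw [LinearEquiv.symm_apply_apply]
    · rw [h1, Ring.inverse_unit]
      change _ = (𝓔.fiberEquiv e hz).symm (𝓔.fiberEquiv e hz ((F.map z).symm y))
      rw [LinearEquiv.symm_apply_apply]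

omit [T2Space Q] [T2Space 𝓜] in
lemma smoothOn_change (F F' : Frame mod D κ) :
    SmoothOn (𝓡 n).tangent 𝓘(ℝ, End) (incl g Ω) (F.change F')
      {z | mod.proj z ∈ F.U ∩ F'.U} := by
  refine SmoothOn.of_local fun z _ => ?_
  let e := trivializationAt (Fin r → ℂ) 𝓔.Fiber z
  obtain ⟨W, hW, hWe⟩ := exists_isOpen_of_isOpen_phaseSpace (g := g) (Ω := Ω) e.open_baseSet
  obtain ⟨M, hM, hMm⟩ := F.smooth_matrix e
  obtain ⟨M', hM', hMm'⟩ := F'.smooth_matrix e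
  refine ⟨W, hW, (hWe z).2 (mem_baseSet_trivializationAt _ _ _), ?_⟩
  refine (SmoothOn.clm_comp (hM'.mono fun w hw => ⟨hw.1.2, (hWe w).1 hw.2⟩)
    ((hM.mono fun w hw => ⟨hw.1.1, (hWe w).1 hw.2⟩).clm_inverse
      fun w hw => (hMm w ((hWe w).1 hw.2)).1)).congr fun w hw => ?_
  have hwe := (hWe w).1 hw.2
  refine ContinuousLinearMap.ext fun y => ?_
  rw [change_apply, (hMm w hwe).2.2, (hMm' w hwe).2.1, ← 𝓔.fiberEquiv_symm_apply e hwe,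
    ← 𝓔.fiberEquiv_apply e hwe, LinearEquiv.apply_symm_apply]
  rfl

omit [T2Space 𝓜] in
/-- Coordinate changes between frames are constant along geodesics. -/
lemma hasArcDeriv_change (hg : IsGeodesicallyComplete g) (F F' : Frame mod D κ)
    {z : PhaseSpace g Ω} (hΩ : IsObstacle n Ω) (hz : mod.proj z ∈ F.U ∩ F'.U) :
    HasArcDeriv (F.change F') z 0 := by
  obtain ⟨W, hW, hWe⟩ := exists_isOpen_of_isOpen_phaseSpace
    ((F.isOpen.inter F'.isOpen).preimage mod.continuous_proj)
  obtain ⟨A, hA⟩ := (F.smoothOn_change F').exists_hasArcDeriv hg hW (fun w => (hWe w).1)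
    ((hWe z).2 hz)
  suffices h : A = 0 by rwa [h] at hA
  refine ContinuousLinearMap.ext fun y => ?_
  -- Both frames differentiate a section through an arbitrary vector into the components of the same
  -- `D σ`. The product rule then leaves no room for a derivative of the coordinate change.
  obtain ⟨σ, hσ⟩ := exists_section_eq (𝓔 := 𝓔) Topology.IsInducing.subtypeVal ((F.map z).symm y)
  have h1 := hA.clm_apply (F.parallel z hz.1 σ)
  have h2 : (fun w => F.change F' w (F.map w (σ.1 w))) = fun w => F'.map w (σ.1 w) := by
    funext w
    rw [change_apply, LinearEquiv.symm_apply_apply]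
  rw [h2] at h1
  have h3 := h1.unique hg hΩ (F'.parallel z hz.2 σ)
  rw [change_apply, LinearEquiv.symm_apply_apply, hσ, LinearEquiv.apply_symm_apply] at h3
  exact add_eq_right.1 h3

/-- A point of the phase space over a given point of the model. -/
def _root_.Billiard.SmoothModel.lift (mod : SmoothModel g Ω 𝓜) (p : 𝓜) : PhaseSpace g Ω :=
  (mod.surjective_proj p).choose

omit [T2Space Q] [T2Space 𝓜] in
lemma _root_.Billiard.SmoothModel.proj_lift (mod : SmoothModel g Ω 𝓜) (p : 𝓜) :
    mod.proj (mod.lift p) = p :=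
  (mod.surjective_proj p).choose_spec

include hg hΩ in
omit [T2Space 𝓜] in
lemma change_lift (F F' : Frame mod D κ) {z : PhaseSpace g Ω} (hz : mod.proj z ∈ F.U ∩ F'.U) :
    F.change F' (mod.lift (mod.proj z)) = F.change F' z :=
  F.change_congr hg hΩ F' (mod.proj_lift _) (by rw [mod.proj_lift]; exact hz.1)
    (by rw [mod.proj_lift]; exact hz.2)

include hg hΩ in
lemma hasDerivAt_change (F F' : Frame mod D κ) {q : 𝓜} (hq : q ∈ F.U ∩ F'.U) :
    HasDerivAt (fun t => F.change F' (mod.lift (mod.flow t q))) 0 0 := by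
  refine mod.hasDerivAt_of_hasArcDeriv (F := fun p => F.change F' (mod.lift p)) hg hΩ fun z hz => ?_
  subst hz
  obtain ⟨W, hW, hWe⟩ := exists_isOpen_of_isOpen_phaseSpace
    ((F.isOpen.inter F'.isOpen).preimage mod.continuous_proj)
  exact (F.hasArcDeriv_change hg F' hΩ hq).congr hg hW ((hWe z).2 hq)
    fun w hw => F.change_lift hg hΩ F' ((hWe w).1 hw)

include hg hΩ in
-- At a boundary point the projection is no diffeomorphism, so smoothness does not descend directly;
-- constancy along the model flow reduces it to the interior part.
lemma contMDiffOn_change (F F' : Frame mod D κ) :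
    ContMDiffOn (𝓡 (2 * n - 1)) 𝓘(ℝ, End) ∞ (fun p => F.change F' (mod.lift p)) (F.U ∩ F'.U) :=
  mod.contMDiffOn_of_constant hg hΩ (F.isOpen.inter F'.isOpen)
    ((F.smoothOn_change F').congr fun _ hz => F.change_lift hg hΩ F' hz)
    fun _ hq => F.hasDerivAt_change hg hΩ F' hq

end Frame

variable (mod D κ) in
/-- A smooth vector bundle on the model in which the frames are trivializations. -/
structure ModelBundle where
  /-- The bundle. -/
  bundle : SmoothBundle.{0} (𝓡 (2 * n - 1)) (id : 𝓜 → 𝓜) r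
  /-- The projection of the bundle on the phase space. -/
  Φ : ∀ z : PhaseSpace g Ω, 𝓔.Fiber z ≃ₗ[ℂ] bundle.Fiber (mod.proj z)
  /-- The trivializations given by frames. -/
  triv : Frame mod D κ → Trivialization (Fin r → ℂ) (π (Fin r → ℂ) bundle.Fiber)
  memAtlas : ∀ F, MemTrivializationAtlas (triv F)
  exists_triv : ∀ (e : Trivialization (Fin r → ℂ) (π (Fin r → ℂ) bundle.Fiber))
    [MemTrivializationAtlas e], ∃ F, e = triv F
  baseSet_triv : ∀ F, (triv F).baseSet = F.U
  triv_Φ : ∀ F z, mod.proj z ∈ F.U → ∀ v, (triv F ⟨mod.proj z, Φ z v⟩).2 = F.map z v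

variable [T2Space Q] [T2Space 𝓜]

/-- The transition functions of the model bundle. -/
def modelCore (hg : IsGeodesicallyComplete g) (hΩ : IsObstacle n Ω)
    (hF : ∀ p, ∃ F : Frame mod D κ, p ∈ F.U) :
    VectorBundleCore ℂ 𝓜 (Fin r → ℂ) (Frame mod D κ) where
  baseSet F := F.U
  isOpen_baseSet F := F.isOpen
  indexAt p := (hF p).choose
  mem_baseSet_at p := (hF p).choose_spec
  coordChange F F' p := F.change F' (mod.lift p)
  coordChange_self F p _ v := by rw [Frame.change_apply, LinearEquiv.apply_symm_apply]
  continuousOn_coordChange F F' := (F.contMDiffOn_change hg hΩ F').continuousOn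
  coordChange_comp F F' F'' p _ v := by
    rw [Frame.change_apply, Frame.change_apply, Frame.change_apply, LinearEquiv.symm_apply_apply]

lemma nonempty_modelBundle (hg : IsGeodesicallyComplete g) (hΩ : IsObstacle n Ω)
    (hF : ∀ p, ∃ F : Frame mod D κ, p ∈ F.U) : Nonempty (ModelBundle mod D κ) := by
  -- Fibers of the core are copies of `ℂ ^ r`, with coordinates in the frame that `indexAt` selects
  -- at the point. The fiber isomorphism `Φ` takes components in this frame.
  let Z := modelCore hg hΩ hF
  refine ⟨{ bundle := { Fiber := Z.Fiber, smooth_coordChange := ?_ }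
            Φ := fun z => (Z.indexAt (mod.proj z)).map z
            triv := fun F => Z.localTriv F
            memAtlas := fun F => ⟨⟨F, rfl⟩⟩
            exists_triv := ?_
            baseSet_triv := fun F => rfl
            triv_Φ := ?_ }⟩
  · rintro _ _ ⟨⟨F, rfl⟩⟩ ⟨⟨F', rfl⟩⟩
    intro p hp
    refine ⟨F.U ∩ F'.U, F.isOpen.inter F'.isOpen, hp, fun p => F.change F' (mod.lift p),
      F.contMDiffOn_change hg hΩ F', fun q hq _ => ?_⟩
    exact ContinuousLinearMap.ext fun y => (Z.localTriv_coordChange_eq F F' hq y).symm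
  · rintro _ ⟨⟨F, rfl⟩⟩
    exact ⟨F, rfl⟩
  · intro F z hz v
    change (Z.indexAt (mod.proj z)).change F (mod.lift (mod.proj z))
      ((Z.indexAt (mod.proj z)).map z v) = F.map z v
    rw [Frame.change_congr hg hΩ _ F (mod.proj_lift (mod.proj z))
      (by rw [mod.proj_lift]; exact Z.mem_baseSet_at _) (by rw [mod.proj_lift]; exact hz),
      Frame.change_apply, LinearEquiv.symm_apply_apply]

end ModelBundle

/-! ### Locally constant quantities on intervals -/

section LocallyConstant

lemma eventually_eq_of_hasDerivAt_zero {V : Type*} [NormedAddCommGroup V] [NormedSpace ℝ V]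
    {f : ℝ → V} {t : ℝ} (h : ∀ᶠ s in 𝓝 t, HasDerivAt f 0 s) : ∀ᶠ s in 𝓝 t, f s = f t := by
  obtain ⟨ε, hε, hs⟩ := Metric.eventually_nhds_iff_ball.1 h
  filter_upwards [Metric.ball_mem_nhds t hε] with s hst
  exact Metric.isOpen_ball.is_const_of_deriv_eq_zero (convex_ball t ε).isPreconnected
    (fun x hx => (hs x hx).differentiableAt.differentiableWithinAt) (fun x hx => (hs x hx).deriv)
    hst (Metric.mem_ball_self hε)

/-- The predicate is read as a continuous map into the discrete space of truth values. This replaces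
separate open and closed arguments. -/
lemma IsPreconnected.of_eventually_iff {J : Set ℝ} (hJ : IsPreconnected J) {P : ℝ → Prop}
    (h : ∀ s ∈ J, ∀ᶠ s' in 𝓝[J] s, (P s' ↔ P s)) {s₀ s : ℝ} (hs₀ : s₀ ∈ J) (hs : s ∈ J)
    (hP : P s₀) : P s := by
  classical
  have hc : ContinuousOn (fun s => decide (P s)) J := fun s hs =>
    (continuousWithinAt_const (b := decide (P s))).congr_of_eventuallyEq
      (by filter_upwards [h s hs] with s' hs'; simp [hs']) rfl
  have := hJ.constant hc hs₀ hs
  simpa [hP] using this.symm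

end LocallyConstant

/-! ### Existence and uniqueness of curves with locally constant components -/

section FlatCurves

variable {n : ℕ} {Q : Type*} [TopologicalSpace Q] [ChartedSpace (EuclideanSpace ℝ (Fin n)) Q]
  [IsManifold (𝓡 n) ∞ Q] {g : Metric (n := n) Q} {Ω : Set Q}
  {𝓜 : Type*} [TopologicalSpace 𝓜]
  [ChartedSpace (EuclideanSpace ℝ (Fin (2 * n - 1))) 𝓜]
  {r : ℕ} {𝓔 : PhaseBundle g Ω r} {mod : SmoothModel g Ω 𝓜}
  {D : 𝓔.sections →ₗ[ℂ] 𝓔.sections} {κ : Gluing 𝓔} (B : ModelBundle mod D κ)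

namespace ModelBundle

/-- The components of a vector with respect to a frame. -/
def comp (F : Frame mod D κ) (x : B.bundle.Total) : Fin r → ℂ := (B.triv F x).2

/-- The projection as a map of total spaces. -/
def toModel (z : PhaseSpace g Ω) (v : 𝓔.Fiber z) : B.bundle.Total := ⟨mod.proj z, B.Φ z v⟩

lemma comp_toModel {F : Frame mod D κ} {z : PhaseSpace g Ω} (hz : mod.proj z ∈ F.U)
    (v : 𝓔.Fiber z) : B.comp F (B.toModel z v) = F.map z v := B.triv_Φ F z hz v

lemma exists_toModel (x : B.bundle.Total) {z : PhaseSpace g Ω} (hz : mod.proj z = x.proj) :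
    ∃ v, B.toModel z v = x := by
  obtain ⟨p, x⟩ := x
  obtain rfl : mod.proj z = p := hz
  exact ⟨(B.Φ z).symm x, by unfold toModel; rw [LinearEquiv.apply_symm_apply]⟩

/-- The isomorphism of a fiber with `ℂ ^ r` given by a frame. -/
def fiberEquiv (F : Frame mod D κ) {p : 𝓜} (hp : p ∈ F.U) : B.bundle.Fiber p ≃ₗ[ℂ] (Fin r → ℂ) :=
  haveI := B.memAtlas F
  B.bundle.fiberEquiv (B.triv F) ((B.baseSet_triv F).symm ▸ hp)

lemma fiberEquiv_apply (F : Frame mod D κ) {p : 𝓜} (hp : p ∈ F.U) (x : B.bundle.Fiber p) :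
    B.fiberEquiv F hp x = B.comp F ⟨p, x⟩ := rfl

lemma eq_of_comp_eq {F : Frame mod D κ} {x y : B.bundle.Total} (hxy : x.proj = y.proj)
    (hx : x.proj ∈ F.U) (h : B.comp F x = B.comp F y) : x = y := by
  obtain ⟨p, x⟩ := x
  obtain ⟨q, y⟩ := y
  obtain rfl : p = q := hxy
  rw [(B.fiberEquiv F hx).injective h]

lemma exists_comp_eq {F : Frame mod D κ} {p : 𝓜} (hp : p ∈ F.U) (y : Fin r → ℂ) :
    ∃ x : B.bundle.Total, x.proj = p ∧ B.comp F x = y :=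
  ⟨⟨p, (B.fiberEquiv F hp).symm y⟩, rfl, (B.fiberEquiv F hp).apply_symm_apply y⟩

lemma comp_change {F F' : Frame mod D κ} {x : B.bundle.Total} (hx : x.proj ∈ F.U ∩ F'.U) :
    B.comp F' x = F.change F' (mod.lift x.proj) (B.comp F x) := by
  obtain ⟨v, hv⟩ := B.exists_toModel x (mod.proj_lift x.proj)
  have h := mod.proj_lift x.proj
  have h1 : B.comp F' x = F'.map _ v := by
    rw [← B.comp_toModel (by rw [h]; exact hx.2), hv]
  have h2 : B.comp F x = F.map _ v := by
    rw [← B.comp_toModel (by rw [h]; exact hx.1), hv]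
  rw [h1, h2, Frame.change_apply, LinearEquiv.symm_apply_apply]

/-- Curves in the model along which the coordinate changes between frames are locally constant. -/
structure IsFlatBase (mod : SmoothModel g Ω 𝓜) (D : 𝓔.sections →ₗ[ℂ] 𝓔.sections) (κ : Gluing 𝓔)
    (c : ℝ → 𝓜) (J : Set ℝ) : Prop where
  continuousOn : ContinuousOn c J
  change_eq : ∀ (F F' : Frame mod D κ), ∀ s ∈ J, c s ∈ F.U ∩ F'.U →
    ∀ᶠ s' in 𝓝[J] s, F.change F' (mod.lift (c s')) = F.change F' (mod.lift (c s))

/-- Curves in the total space with locally constant components. -/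
def IsFlat (c : ℝ → 𝓜) (J : Set ℝ) (u : ℝ → B.bundle.Total) : Prop :=
  ∀ s ∈ J, (u s).proj = c s ∧ ∃ F : Frame mod D κ, c s ∈ F.U ∧
    ∀ᶠ s' in 𝓝[J] s, B.comp F (u s') = B.comp F (u s)

variable {B} {c : ℝ → 𝓜} {J J' : Set ℝ} {u u' : ℝ → B.bundle.Total}

lemma IsFlatBase.comp (h : IsFlatBase mod D κ c J) {τ : ℝ → ℝ} (hτ : Continuous τ)
    (hJ : Set.MapsTo τ J' J) : IsFlatBase mod D κ (fun s => c (τ s)) J' :=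
  ⟨h.continuousOn.comp hτ.continuousOn hJ, fun F F' s hs hF =>
    (hτ.continuousWithinAt.tendsto_nhdsWithin hJ).eventually (h.change_eq F F' (τ s) (hJ hs) hF)⟩

lemma IsFlatBase.mono (h : IsFlatBase mod D κ c J) (hJ : J' ⊆ J) : IsFlatBase mod D κ c J' :=
  h.comp continuous_id hJ

lemma IsFlat.comp (h : B.IsFlat c J u) {τ : ℝ → ℝ} (hτ : Continuous τ)
    (hJ : Set.MapsTo τ J' J) : B.IsFlat (fun s => c (τ s)) J' (fun s => u (τ s)) := fun s hs => by
  obtain ⟨h1, F, hF, h2⟩ := h (τ s) (hJ hs)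
  exact ⟨h1, F, hF, (hτ.continuousWithinAt.tendsto_nhdsWithin hJ).eventually h2⟩

lemma IsFlat.mono (h : B.IsFlat c J u) (hJ : J' ⊆ J) : B.IsFlat c J' u :=
  h.comp continuous_id hJ

/-- The frame in the definition of flatness is immaterial, because along the base curve coordinate
changes are locally constant too. -/
lemma IsFlat.eventually (h : B.IsFlat c J u) (hc : IsFlatBase mod D κ c J) {s : ℝ} (hs : s ∈ J)
    {F : Frame mod D κ} (hF : c s ∈ F.U) : ∀ᶠ s' in 𝓝[J] s, B.comp F (u s') = B.comp F (u s) := by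
  obtain ⟨h1, F₀, hF₀, h2⟩ := h s hs
  have h3 : ∀ᶠ s' in 𝓝[J] s, c s' ∈ F₀.U ∩ F.U :=
    (hc.continuousOn s hs).eventually_mem ((F₀.isOpen.inter F.isOpen).mem_nhds ⟨hF₀, hF⟩)
  filter_upwards [h2, h3, hc.change_eq F₀ F s hs ⟨hF₀, hF⟩, self_mem_nhdsWithin] with s' h4 h5 h6 h7
  have h8 := (h s' h7).1
  rw [B.comp_change (F := F₀) (x := u s') (h8 ▸ h5), B.comp_change (F := F₀) (x := u s)
    (h1 ▸ ⟨hF₀, hF⟩), h4, h8, h1, h6]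

/-- Near any time both curves have constant components in one frame, so agreement at that time is
equivalent to agreement nearby. -/
lemma IsFlat.eq_on (h : B.IsFlat c J u) (h' : B.IsFlat c J u') (hc : IsFlatBase mod D κ c J)
    (hJ : IsPreconnected J) {s₀ s : ℝ} (hs₀ : s₀ ∈ J) (hs : s ∈ J) (h0 : u s₀ = u' s₀) :
    u s = u' s := by
  refine IsPreconnected.of_eventually_iff hJ (P := fun s => u s = u' s) (fun s hs => ?_) hs₀ hs h0
  obtain ⟨h1, F, hF, h2⟩ := h s hs
  have h3 : ∀ᶠ s' in 𝓝[J] s, c s' ∈ F.U :=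
    (hc.continuousOn s hs).eventually_mem (F.isOpen.mem_nhds hF)
  filter_upwards [h2, h'.eventually hc hs hF, h3, self_mem_nhdsWithin] with s' h4 h5 h6 h7
  have h8 := (h s' h7).1
  have h9 := (h' s' h7).1
  have h10 := (h' s hs).1
  constructor
  · intro h11
    exact B.eq_of_comp_eq (h1.trans h10.symm) (h1 ▸ hF) (by rw [← h4, ← h5, h11])
  · intro h11
    exact B.eq_of_comp_eq (h8.trans h9.symm) (h8 ▸ h6) (by rw [h4, h5, h11])

lemma IsFlat.comp_eq (h : B.IsFlat c J u) (hc : IsFlatBase mod D κ c J) (hJ : IsPreconnected J)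
    {F : Frame mod D κ} (hF : ∀ s ∈ J, c s ∈ F.U) {s s' : ℝ} (hs : s ∈ J) (hs' : s' ∈ J) :
    B.comp F (u s') = B.comp F (u s) := by
  refine IsPreconnected.of_eventually_iff hJ (P := fun s' => B.comp F (u s') = B.comp F (u s))
    (fun s₁ hs₁ => ?_) hs hs' rfl
  filter_upwards [h.eventually hc hs₁ (hF s₁ hs₁)] with s₂ h2
  rw [h2]

/-- By compactness the interval is subdivided such that each piece runs in the domain of one frame.
The curve is continued over the next piece with constant components in its frame. -/
lemma exists_isFlat_Icc (hFr : ∀ p, ∃ F : Frame mod D κ, p ∈ F.U) {a b : ℝ} (hab : a ≤ b)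
    (hc : IsFlatBase mod D κ c (Set.Icc a b)) {x : B.bundle.Total} (hx : x.proj = c a) :
    ∃ u, B.IsFlat c (Set.Icc a b) u ∧ u a = x := by
  classical
  obtain ⟨t, ht0, htm, ⟨N, hN⟩, htc⟩ := exists_monotone_Icc_subset_open_cover_Icc hab
    (c := fun F : Frame mod D κ => {s : Set.Icc a b | c s ∈ F.U})
    (fun F => F.isOpen.preimage (continuousOn_iff_continuous_domRestrict.1 hc.continuousOn))
    (fun s _ => by
      obtain ⟨F, hF⟩ := hFr (c s)
      exact Set.mem_iUnion.2 ⟨F, hF⟩)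
  have key : ∀ k, ∃ u, B.IsFlat c (Set.Icc a (t k)) u ∧ u a = x := by
    intro k
    induction k with
    | zero =>
      refine ⟨fun _ => x, fun s hs => ?_, rfl⟩
      rw [ht0, Set.Icc_self] at hs
      obtain rfl : s = a := hs
      obtain ⟨F, hF⟩ := hFr (c s)
      exact ⟨hx, F, hF, Filter.Eventually.of_forall fun _ => rfl⟩
    | succ k ih =>
      obtain ⟨u, hu, hua⟩ := ih
      obtain ⟨F, hF⟩ := htc k
      have hF' : ∀ s, (t k : ℝ) ≤ s → s ≤ t (k + 1) → c s ∈ F.U := fun s h1 h2 =>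
        hF (a := ⟨s, (t k).2.1.trans h1, h2.trans (t (k + 1)).2.2⟩) ⟨h1, h2⟩
      have hle : (t k : ℝ) ≤ t (k + 1) := htm (Nat.le_succ k)
      have hex : ∀ s, ∃ y : B.bundle.Total, (t k : ℝ) ≤ s → s ≤ t (k + 1) →
          y.proj = c s ∧ B.comp F y = B.comp F (u (t k)) := by
        intro s
        by_cases hs : (t k : ℝ) ≤ s ∧ s ≤ t (k + 1)
        · obtain ⟨y, h1, h2⟩ := B.exists_comp_eq (hF' s hs.1 hs.2) (B.comp F (u (t k)))
          exact ⟨y, fun _ _ => ⟨h1, h2⟩⟩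
        · exact ⟨x, fun h1 h2 => absurd ⟨h1, h2⟩ hs⟩
      choose y hy using hex
      have hcs : IsFlatBase mod D κ c (Set.Icc a (t k)) :=
        hc.mono (Set.Icc_subset_Icc_right (t k).2.2)
      refine ⟨fun s => if s ≤ t k then u s else y s, fun s hs => ?_, ?_⟩
      · rcases lt_trichotomy s (t k) with hlt | heq | hgt
        · obtain ⟨h1, F₀, hF₀, h2⟩ := hu s ⟨hs.1, hlt.le⟩
          simp only [if_pos hlt.le]
          refine ⟨h1, F₀, hF₀, ?_⟩
          rw [eventually_nhdsWithin_iff] at h2 ⊢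
          filter_upwards [h2, gt_mem_nhds hlt] with s' h3 h4 h5
          rw [if_pos h4.le]
          exact h3 ⟨h5.1, h4.le⟩
        · subst heq
          simp only [if_pos le_rfl]
          refine ⟨(hu _ ⟨hs.1, le_rfl⟩).1, F, hF' _ le_rfl hle, ?_⟩
          have h2 := hu.eventually hcs ⟨hs.1, le_rfl⟩ (hF' _ le_rfl hle)
          rw [eventually_nhdsWithin_iff] at h2 ⊢
          filter_upwards [h2] with s' h3 h4
          split_ifs with h5
          · exact h3 ⟨h4.1, h5⟩
          · exact (hy s' (not_le.1 h5).le h4.2).2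
        · simp only [if_neg (not_le.2 hgt)]
          refine ⟨(hy s hgt.le hs.2).1, F, hF' s hgt.le hs.2, ?_⟩
          rw [eventually_nhdsWithin_iff]
          filter_upwards [lt_mem_nhds hgt] with s' h4 h5
          rw [if_neg (not_le.2 h4), (hy s hgt.le hs.2).2, (hy s' h4.le h5.2).2]
      · simp only [if_pos (t k).2.1]
        exact hua
  obtain ⟨u, hu, hua⟩ := key N
  rw [hN N le_rfl] at hu
  exact ⟨u, hu, hua⟩

/-- Reversing time carries the vector from `s₀` back to the left end; the flat curve starting there
passes through `x` at `s₀` by uniqueness. -/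
lemma exists_isFlat_Icc_of_mem (hFr : ∀ p, ∃ F : Frame mod D κ, p ∈ F.U) {a b s₀ : ℝ}
    (hs₀ : s₀ ∈ Set.Icc a b) (hc : IsFlatBase mod D κ c (Set.Icc a b)) {x : B.bundle.Total}
    (hx : x.proj = c s₀) : ∃ u, B.IsFlat c (Set.Icc a b) u ∧ u s₀ = x := by
  have hm : Set.MapsTo (fun s => -s) (Set.Icc (-s₀) (-a)) (Set.Icc a b) := fun s hs =>
    ⟨by linarith [hs.2], by linarith [hs.1, hs₀.2]⟩
  obtain ⟨v, hv, hv0⟩ := exists_isFlat_Icc hFr (neg_le_neg hs₀.1) (hc.comp continuous_neg hm)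
    (x := x) (by rw [neg_neg]; exact hx)
  have hm' : Set.MapsTo (fun s => -s) (Set.Icc a s₀) (Set.Icc (-s₀) (-a)) := fun s hs =>
    ⟨by linarith [hs.2], by linarith [hs.1]⟩
  have hv' := hv.comp continuous_neg hm'
  simp only [neg_neg] at hv'
  have hva : (v (-a)).proj = c a := (hv' a ⟨le_rfl, hs₀.1⟩).1
  obtain ⟨u, hu, hua⟩ := exists_isFlat_Icc hFr (hs₀.1.trans hs₀.2) hc hva
  refine ⟨u, hu, ?_⟩
  have hsub : Set.Icc a s₀ ⊆ Set.Icc a b := Set.Icc_subset_Icc_right hs₀.2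
  rw [(hu.mono hsub).eq_on hv' (hc.mono hsub) isPreconnected_Icc ⟨le_rfl, hs₀.1⟩ ⟨hs₀.1, le_rfl⟩ hua,
    hv0]

/-- Each time is interior to some compact interval that contains `s₀`. Uniqueness makes the curves
on these intervals coherent, so evaluating each one at its own time gives a flat curve. -/
lemma exists_isFlat (hFr : ∀ p, ∃ F : Frame mod D κ, p ∈ F.U) (hJ : IsOpen J)
    (hJc : J.OrdConnected) (hc : IsFlatBase mod D κ c J) {s₀ : ℝ} (hs₀ : s₀ ∈ J)
    {x : B.bundle.Total} (hx : x.proj = c s₀) : ∃ u, B.IsFlat c J u ∧ u s₀ = x := by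
  have hex : ∀ s, ∃ (a b : ℝ) (v : ℝ → B.bundle.Total), s ∈ J →
      Set.Icc a b ⊆ J ∧ s₀ ∈ Set.Icc a b ∧ s ∈ Set.Ioo a b ∧ B.IsFlat c (Set.Icc a b) v ∧
        v s₀ = x := by
    intro s
    by_cases hs : s ∈ J
    · have hm : min s s₀ ∈ J := by rcases min_choice s s₀ with h | h <;> rw [h] <;> assumption
      have hM : max s s₀ ∈ J := by rcases max_choice s s₀ with h | h <;> rw [h] <;> assumption
      obtain ⟨ε, hε, hεJ⟩ := Metric.isOpen_iff.1 hJ _ hm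
      obtain ⟨δ, hδ, hδJ⟩ := Metric.isOpen_iff.1 hJ _ hM
      have ha : min s s₀ - ε / 2 ∈ J := hεJ (by
        rw [Metric.mem_ball, Real.dist_eq, sub_sub_cancel_left, abs_neg, abs_of_pos] <;> linarith)
      have hb : max s s₀ + δ / 2 ∈ J := hδJ (by
        rw [Metric.mem_ball, Real.dist_eq, add_sub_cancel_left, abs_of_pos] <;> linarith)
      have hsub := hJc.out ha hb
      have h1 := min_le_left s s₀
      have h2 := min_le_right s s₀
      have h3 := le_max_left s s₀
      have h4 := le_max_right s s₀
      have h5 : s₀ ∈ Set.Icc (min s s₀ - ε / 2) (max s s₀ + δ / 2) :=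
        ⟨by linarith, by linarith⟩
      obtain ⟨v, hv, hv0⟩ := exists_isFlat_Icc_of_mem hFr h5 (hc.mono hsub) hx
      exact ⟨_, _, v, fun _ => ⟨hsub, h5, ⟨by linarith, by linarith⟩, hv, hv0⟩⟩
    · exact ⟨0, 0, fun _ => x, fun h => absurd h hs⟩
  choose a b v hv using hex
  refine ⟨fun s => v s s, fun s hs => ?_, (hv s₀ hs₀).2.2.2.2⟩
  obtain ⟨hsub, h0, hmem, hflat, hv0⟩ := hv s hs
  obtain ⟨h1, F, hF, h2⟩ := hflat s ⟨hmem.1.le, hmem.2.le⟩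
  refine ⟨h1, F, hF, ?_⟩
  rw [eventually_nhdsWithin_iff] at h2 ⊢
  filter_upwards [h2, isOpen_Ioo.mem_nhds hmem] with s' h3 h4 h5
  obtain ⟨hsub', h0', hmem', hflat', hv0'⟩ := hv s' h5
  have h6 : v s' s' = v s s' :=
    (hflat'.mono Set.inter_subset_left).eq_on (hflat.mono Set.inter_subset_right)
      (hc.mono (Set.inter_subset_left.trans hsub'))
      (Set.OrdConnected.isPreconnected (Set.ordConnected_Icc.inter Set.ordConnected_Icc))
      ⟨h0', h0⟩ ⟨⟨hmem'.1.le, hmem'.2.le⟩, h4.1.le, h4.2.le⟩ (hv0'.trans hv0.symm)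
  rw [h6]
  exact h3 ⟨h4.1.le, h4.2.le⟩

end ModelBundle

end FlatCurves

/-! ### Flat transport in the model bundle along the model flow -/

section FlatTransport

variable {n : ℕ} {Q : Type*} [TopologicalSpace Q] [ChartedSpace (EuclideanSpace ℝ (Fin n)) Q]
  [IsManifold (𝓡 n) ∞ Q] {g : Metric (n := n) Q} {Ω : Set Q}
  {𝓜 : Type*} [TopologicalSpace 𝓜]
  [ChartedSpace (EuclideanSpace ℝ (Fin (2 * n - 1))) 𝓜]
  {r : ℕ} {𝓔 : PhaseBundle g Ω r} {mod : SmoothModel g Ω 𝓜}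
  {D : 𝓔.sections →ₗ[ℂ] 𝓔.sections} {κ : Gluing 𝓔} (B : ModelBundle mod D κ)

local notation "End" => (Fin r → ℂ) →L[ℂ] (Fin r → ℂ)

/-- The times for which the flow of the model is defined at `p`. -/
def SmoothModel.times (mod : SmoothModel g Ω 𝓜) (p : 𝓜) : Set ℝ := {s | (s, p) ∈ mod.domain}

lemma SmoothModel.isOpen_times (p : 𝓜) : IsOpen (mod.times p) :=
  mod.isOpen_domain'.preimage (by fun_prop : Continuous fun s : ℝ => (s, p))

lemma SmoothModel.zero_mem_times (p : 𝓜) : (0 : ℝ) ∈ mod.times p := mod.zero_mem_domain p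

namespace ModelBundle

open Classical in
/-- The parallel transport in the model bundle along the model flow. -/
def trans (x : B.bundle.Total) : ℝ → B.bundle.Total :=
  if h : ∃ u, B.IsFlat (fun s => mod.flow s x.proj) (mod.times x.proj) u ∧ u 0 = x
  then h.choose else fun _ => x

variable [T2Space Q] [T2Space 𝓜] (hg : IsGeodesicallyComplete g) (hΩ : IsObstacle n Ω)

omit [T2Space 𝓜] in
include hg hΩ in
lemma _root_.Billiard.SmoothModel.uIcc_subset_times {p : 𝓜} {t : ℝ} (h : t ∈ mod.times p) :
    Set.uIcc 0 t ⊆ mod.times p := fun _ hs => mod.mem_domain_of_mem_uIcc hg hΩ h hs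

omit [T2Space 𝓜] in
include hg hΩ in
lemma _root_.Billiard.SmoothModel.ordConnected_times (p : 𝓜) : (mod.times p).OrdConnected :=
  Set.ordConnected_of_Ioo fun s hs t ht _ x hx => by
    rcases le_total 0 x with h | h
    · exact SmoothModel.uIcc_subset_times hg hΩ ht (Set.mem_uIcc_of_le h hx.2.le)
    · exact SmoothModel.uIcc_subset_times hg hΩ hs (Set.mem_uIcc_of_ge hx.1.le h)

include hg hΩ in
lemma isFlatBase_flow (p : 𝓜) :
    IsFlatBase mod D κ (fun s => mod.flow s p) (mod.times p) := by
  refine ⟨fun s hs => (SmoothModel.continuousAt_flow_time hs).continuousWithinAt,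
    fun F F' s hs hF => nhdsWithin_le_nhds ?_⟩
  refine eventually_eq_of_hasDerivAt_zero
    (f := fun s => F.change F' (mod.lift (mod.flow s p))) ?_
  filter_upwards [(SmoothModel.isOpen_times p).mem_nhds hs,
    (SmoothModel.continuousAt_flow_time hs).eventually_mem
      ((F.isOpen.inter F'.isOpen).mem_nhds hF)] with s' h1 h2
  exact SmoothModel.hasDerivAt_flow (f := fun p => F.change F' (mod.lift p)) h1
    (F.hasDerivAt_change hg hΩ F' h2)

variable (hFr : ∀ p, ∃ F : Frame mod D κ, p ∈ F.U)
include hg hΩ hFr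

lemma trans_spec (x : B.bundle.Total) :
    B.IsFlat (fun s => mod.flow s x.proj) (mod.times x.proj) (B.trans x) ∧ B.trans x 0 = x := by
  have h : ∃ u, B.IsFlat (fun s => mod.flow s x.proj) (mod.times x.proj) u ∧ u 0 = x :=
    exists_isFlat hFr (SmoothModel.isOpen_times _) (SmoothModel.ordConnected_times hg hΩ _)
      (isFlatBase_flow hg hΩ _) (SmoothModel.zero_mem_times _) (mod.flow_zero _).symm
  unfold trans
  rw [dif_pos h]
  exact h.choose_spec

lemma trans_proj {x : B.bundle.Total} {t : ℝ} (h : t ∈ mod.times x.proj) :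
    (B.trans x t).proj = mod.flow t x.proj := ((B.trans_spec hg hΩ hFr x).1 t h).1

/-- Flat curves starting at `x` are given by the parallel transport of `x`. -/
lemma trans_eq {x : B.bundle.Total} {J : Set ℝ} (hJ : IsPreconnected J) (h0 : (0 : ℝ) ∈ J)
    (hJt : J ⊆ mod.times x.proj) {u : ℝ → B.bundle.Total}
    (hu : B.IsFlat (fun s => mod.flow s x.proj) J u) (hu0 : u 0 = x) {t : ℝ} (ht : t ∈ J) :
    B.trans x t = u t :=
  ((B.trans_spec hg hΩ hFr x).1.mono hJt).eq_on hu ((isFlatBase_flow hg hΩ _).mono hJt) hJ h0 ht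
    ((B.trans_spec hg hΩ hFr x).2.trans hu0.symm)

lemma comp_trans_eq {x : B.bundle.Total} {J : Set ℝ} (hJ : IsPreconnected J)
    (hJt : J ⊆ mod.times x.proj) {F : Frame mod D κ} (hF : ∀ s ∈ J, mod.flow s x.proj ∈ F.U)
    {s s' : ℝ} (hs : s ∈ J) (hs' : s' ∈ J) :
    B.comp F (B.trans x s') = B.comp F (B.trans x s) :=
  ((B.trans_spec hg hΩ hFr x).1.mono hJt).comp_eq ((isFlatBase_flow hg hΩ _).mono hJt) hJ hF hs hs'

/-- The time-shifted flat curve is flat over the orbit of the shifted base point, and uniqueness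
identifies it. -/
lemma trans_trans {x : B.bundle.Total} {t s : ℝ} (ht : t ∈ mod.times x.proj)
    (hts : t + s ∈ mod.times x.proj) (hs : s ∈ mod.times (mod.flow t x.proj)) :
    B.trans (B.trans x t) s = B.trans x (t + s) := by
  have hp := B.trans_proj hg hΩ hFr ht
  have hsub : ∀ s' ∈ Set.uIcc 0 s, t + s' ∈ mod.times x.proj := by
    intro s' hs'
    have h1 : t + s' ∈ Set.uIcc t (t + s) := by
      have := Set.image_const_add_uIcc t 0 s
      rw [add_zero] at this
      rw [← this]
      exact ⟨s', hs', rfl⟩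
    exact (SmoothModel.ordConnected_times hg hΩ _).uIcc_subset ht hts h1
  have hflow : ∀ s' ∈ Set.uIcc 0 s, mod.flow (t + s') x.proj = mod.flow s' (B.trans x t).proj := by
    intro s' hs'
    rw [hp]
    exact (mod.flow_add t s' _ ht (SmoothModel.uIcc_subset_times hg hΩ hs hs') (hsub s' hs')).symm
  have hu := (B.trans_spec hg hΩ hFr x).1.comp (τ := fun s' => t + s') (J' := Set.uIcc 0 s)
    (by fun_prop) hsub
  refine B.trans_eq hg hΩ hFr isPreconnected_uIcc Set.left_mem_uIcc ?_
    (u := fun s' => B.trans x (t + s')) (fun s' hs' => ?_) (by rw [add_zero]) Set.right_mem_uIcc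
  · rw [hp]
    exact SmoothModel.uIcc_subset_times hg hΩ hs
  · obtain ⟨h1, F, hF, h2⟩ := hu s' hs'
    exact ⟨h1.trans (hflow s' hs'), F, (hflow s' hs' ▸ hF : mod.flow s' (B.trans x t).proj ∈ F.U), h2⟩

/-- One ball of times works for all base points near `q₀`: as long as the orbits stay in the domain
of `G`, components in `G` are constant in time. -/
lemma eventually_comp_trans_eq {t₀ : ℝ} {q₀ : 𝓜} (h : (t₀, q₀) ∈ mod.domain) {G : Frame mod D κ}
    (hG : mod.flow t₀ q₀ ∈ G.U) : ∃ δ > 0, ∀ᶠ q in 𝓝 q₀, ∀ s ∈ Metric.ball t₀ δ,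
      ∀ s' ∈ Metric.ball t₀ δ, (s, q) ∈ mod.domain ∧ mod.flow s q ∈ G.U ∧
        ∀ x : B.bundle.Total, x.proj = q → B.comp G (B.trans x s) = B.comp G (B.trans x s') := by
  have h1 : ∀ᶠ x in 𝓝 (t₀, q₀), x ∈ mod.domain ∧ mod.flow x.1 x.2 ∈ G.U :=
    Filter.Eventually.and (mod.isOpen_domain'.mem_nhds h)
      ((mod.continuousAt_flow h).eventually_mem (G.isOpen.mem_nhds hG))
  rw [nhds_prod_eq] at h1
  obtain ⟨P, hP, R, hR, hPR⟩ := Filter.eventually_prod_iff.1 h1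
  obtain ⟨δ, hδ, hP'⟩ := Metric.eventually_nhds_iff_ball.1 hP
  refine ⟨δ, hδ, ?_⟩
  filter_upwards [hR] with q hq s hs s' hs'
  refine ⟨(hPR (hP' s hs) hq).1, (hPR (hP' s hs) hq).2, ?_⟩
  rintro x rfl
  exact B.comp_trans_eq hg hΩ hFr (convex_ball t₀ δ).isPreconnected
    (fun s hs => (hPR (hP' s hs) hq).1) (fun s hs => (hPR (hP' s hs) hq).2) hs' hs

set_option maxHeartbeats 400000 in
/-- The parallel transport is locally given by a smooth matrix. -/
theorem exists_trans_matrix {t₀ : ℝ} {q₀ : 𝓜} (h : (t₀, q₀) ∈ mod.domain) {F : Frame mod D κ}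
    (hF : q₀ ∈ F.U) : ∃ (G : Frame mod D κ) (T : 𝓜 → End),
      ContMDiffAt (𝓡 (2 * n - 1)) 𝓘(ℝ, End) ∞ T q₀ ∧ ∀ᶠ y in 𝓝 (t₀, q₀), y ∈ mod.domain ∧
        mod.flow y.1 y.2 ∈ G.U ∧ IsUnit (T y.2) ∧ ∀ x : B.bundle.Total, x.proj = y.2 →
          B.comp G (B.trans x y.1) = T y.2 (B.comp F x) := by
  set P : ℝ → Prop := fun t => ∃ (G : Frame mod D κ) (T : 𝓜 → End),
      ContMDiffAt (𝓡 (2 * n - 1)) 𝓘(ℝ, End) ∞ T q₀ ∧ ∀ᶠ y in 𝓝 (t, q₀), y ∈ mod.domain ∧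
        mod.flow y.1 y.2 ∈ G.U ∧ IsUnit (T y.2) ∧ ∀ x : B.bundle.Total, x.proj = y.2 →
          B.comp G (B.trans x y.1) = T y.2 (B.comp F x) with hP
  have hP0 : P 0 := by
    obtain ⟨δ, hδ, hev⟩ := B.eventually_comp_trans_eq hg hΩ hFr (mod.zero_mem_domain q₀) (G := F)
      (by rwa [mod.flow_zero])
    refine ⟨F, fun _ => 1, contMDiffAt_const, ?_⟩
    rw [nhds_prod_eq]
    filter_upwards [(Metric.ball_mem_nhds (0 : ℝ) hδ |> Filter.Eventually.prod_inl <| 𝓝 q₀),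
      hev.prod_inr (𝓝 (0 : ℝ))] with y h1 h2
    obtain ⟨h3, h4, h5⟩ := h2 y.1 h1 0 (Metric.mem_ball_self hδ)
    refine ⟨h3, h4, isUnit_one, fun x hx => ?_⟩
    rw [h5 x hx, (B.trans_spec hg hΩ hFr x).2]
    rfl
  refine IsPreconnected.of_eventually_iff
    (SmoothModel.ordConnected_times hg hΩ q₀).isPreconnected (P := P) (fun τ hτ => ?_)
    (SmoothModel.zero_mem_times q₀) h hP0
  obtain ⟨G, hG⟩ := hFr (mod.flow τ q₀)
  obtain ⟨δ, hδ, hev⟩ := B.eventually_comp_trans_eq hg hΩ hFr hτ hG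
  have key : ∀ τ₁ ∈ Metric.ball τ δ, ∀ τ₂ ∈ Metric.ball τ δ, P τ₁ → P τ₂ := by
    rintro τ₁ h₁ τ₂ h₂ ⟨G₁, T₁, hT₁, hev₁⟩
    have hev₁' : ∀ᶠ q in 𝓝 q₀, (τ₁, q) ∈ mod.domain ∧ mod.flow τ₁ q ∈ G₁.U ∧ IsUnit (T₁ q) ∧
        ∀ x : B.bundle.Total, x.proj = q → B.comp G₁ (B.trans x τ₁) = T₁ q (B.comp F x) :=
      (show ContinuousAt (fun q : 𝓜 => (τ₁, q)) q₀ by fun_prop).eventually hev₁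
    have hτ₁ := hev₁'.self_of_nhds
    have hτ₁G := (hev.self_of_nhds τ₁ h₁ τ₁ h₁).2.1
    -- Only the frame at the end changes: the new matrix is the old one followed by the coordinate
    -- change at the point reached at time `τ₁`.
    refine ⟨G, fun q => (G₁.change G (mod.lift (mod.flow τ₁ q))).comp (T₁ q), ?_, ?_⟩
    · have e1 : ContMDiffAt (𝓡 (2 * n - 1)) 𝓘(ℝ, End) ∞
          (fun q => G₁.change G (mod.lift (mod.flow τ₁ q))) q₀ :=
        ContMDiffAt.comp (f := fun q => mod.flow τ₁ q) q₀
          ((G₁.contMDiffOn_change hg hΩ G).contMDiffAt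
            ((G₁.isOpen.inter G.isOpen).mem_nhds ⟨hτ₁.2.1, hτ₁G⟩))
          (SmoothModel.contMDiffAt_flow_point hτ₁.1)
      have e2 : ContDiff ℝ ∞ (fun q : End × End => q.1.comp q.2) :=
        (isBoundedBilinearMap_comp (𝕜 := ℂ) (E := Fin r → ℂ) (F := Fin r → ℂ)
          (G := Fin r → ℂ)).contDiff.restrict_scalars ℝ
      exact e2.contMDiff.contMDiffAt.comp q₀ (e1.prodMk_space hT₁)
    · rw [nhds_prod_eq]
      filter_upwards [(Metric.isOpen_ball.mem_nhds h₂ |> Filter.Eventually.prod_inl <| 𝓝 q₀),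
        hev.prod_inr (𝓝 τ₂), hev₁'.prod_inr (𝓝 τ₂)] with y e1 e2 e3
      obtain ⟨e4, e5, e6⟩ := e2 y.1 e1 τ₁ h₁
      have e7 := (e2 τ₁ h₁ τ₁ h₁).2.1
      refine ⟨e4, e5, ?_, fun x hx => ?_⟩
      · have e8 : IsUnit (G₁.change G (mod.lift (mod.flow τ₁ y.2))) :=
          Units.isUnit ((ContinuousLinearEquiv.unitsEquiv ℂ (Fin r → ℂ)).symm
            (((G₁.map _).symm.trans (G.map _)).toContinuousLinearEquiv))
        exact e8.mul e3.2.2.1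
      · have e8 := B.trans_proj hg hΩ hFr (x := x) (t := τ₁) (hx ▸ e3.1)
        have e9 : (B.trans x τ₁).proj ∈ G₁.U ∩ G.U := by
          rw [e8, hx]; exact ⟨e3.2.1, e7⟩
        rw [e6 x hx, B.comp_change e9, e3.2.2.2 x hx, e8, hx]
        rfl
  have hball : ∀ᶠ τ' in 𝓝[mod.times q₀] τ, τ' ∈ Metric.ball τ δ :=
    nhdsWithin_le_nhds (Metric.ball_mem_nhds τ hδ)
  filter_upwards [hball] with τ' hτ'
  exact ⟨key τ' hτ' τ (Metric.mem_ball_self hδ), key τ (Metric.mem_ball_self hδ) τ' hτ'⟩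

/-- The parallel transport as a linear isomorphism. -/
lemma exists_transEquiv {t : ℝ} {p q : 𝓜} (h : (t, p) ∈ mod.domain) (hq : mod.flow t p = q) :
    ∃ α : B.bundle.Fiber p ≃ₗ[ℂ] B.bundle.Fiber q, ∀ v, B.trans ⟨p, v⟩ t = ⟨q, α v⟩ := by
  subst hq
  obtain ⟨F, hF⟩ := hFr p
  obtain ⟨G, T, -, hev⟩ := B.exists_trans_matrix hg hΩ hFr h hF
  obtain ⟨-, hG, ⟨T', hT'⟩, hT⟩ := hev.self_of_nhds
  refine ⟨(B.fiberEquiv F hF).trans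
    ((ContinuousLinearEquiv.unitsEquiv ℂ (Fin r → ℂ) T').toLinearEquiv.trans
      (B.fiberEquiv G hG).symm), fun v => ?_⟩
  have h1 := B.trans_proj hg hΩ hFr (x := ⟨p, v⟩) (t := t) h
  refine B.eq_of_comp_eq h1 (h1 ▸ hG) ?_
  rw [hT _ rfl, ← B.fiberEquiv_apply G hG]
  change _ = B.fiberEquiv G hG ((B.fiberEquiv G hG).symm _)
  rw [LinearEquiv.apply_symm_apply]
  change T p _ = (T' : End) _
  rw [hT']
  rfl

end ModelBundle

end FlatTransport

/-! ### Two lemmas on derivatives of vector valued curves -/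

section RealCurves

/-- Parallelism is a condition at interior times only; continuity carries constancy to the end
points of the interval. -/
lemma eventually_eq_of_hasDerivAt_zero_uIoo {V : Type*} [NormedAddCommGroup V] [NormedSpace ℝ V]
    {f : ℝ → V} {a b s₁ : ℝ} (hs₁ : s₁ ∈ Set.uIcc a b)
    (hc : ∀ᶠ s in 𝓝[Set.uIcc a b] s₁, ContinuousWithinAt f (Set.uIcc a b) s)
    (hd : ∀ᶠ s in 𝓝 s₁, s ∈ Set.uIoo a b → HasDerivAt f 0 s) :
    ∀ᶠ s in 𝓝[Set.uIcc a b] s₁, f s = f s₁ := by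
  rw [eventually_nhdsWithin_iff] at hc ⊢
  obtain ⟨ε, hε, h⟩ := Metric.eventually_nhds_iff_ball.1 (hc.and hd)
  have key : ∀ p q, p < q → p ∈ Metric.ball s₁ ε → q ∈ Metric.ball s₁ ε → p ∈ Set.uIcc a b →
      q ∈ Set.uIcc a b → f p = f q := by
    intro p q hpq hp hq hpa hqa
    have hball : Set.Icc p q ⊆ Metric.ball s₁ ε := by
      rw [Real.ball_eq_Ioo] at *
      exact fun x hx => ⟨hp.1.trans_le hx.1, hx.2.trans_lt hq.2⟩
    have hI : Set.Icc p q ⊆ Set.uIcc a b := Set.ordConnected_uIcc.out hpa hqa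
    have hO : Set.Ioo p q ⊆ Set.uIoo a b := fun x hx => ⟨hpa.1.trans_lt hx.1, hx.2.trans_le hqa.2⟩
    have hcont : ContinuousOn f (Set.Icc p q) := fun x hx =>
      ((h x (hball hx)).1 (hI hx)).mono hI
    have hder : ∀ x ∈ Set.Ioo p q, HasDerivAt f 0 x := fun x hx =>
      (h x (hball (Set.Ioo_subset_Icc_self hx))).2 (hO hx)
    have hm : (p + q) / 2 ∈ Set.Ioo p q := ⟨by linarith, by linarith⟩
    have hEq : Set.EqOn f (fun _ => f ((p + q) / 2)) (Set.Ioo p q) := fun x hx =>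
      isOpen_Ioo.is_const_of_deriv_eq_zero isPreconnected_Ioo
        (fun x hx => (hder x hx).differentiableAt.differentiableWithinAt)
        (fun x hx => (hder x hx).deriv) hx hm
    have hEq' := hEq.of_subset_closure hcont continuousOn_const Set.Ioo_subset_Icc_self
      (by rw [closure_Ioo hpq.ne])
    exact (hEq' ⟨le_rfl, hpq.le⟩).trans (hEq' ⟨hpq.le, le_rfl⟩).symm
  filter_upwards [Metric.ball_mem_nhds s₁ hε] with s hs hsa
  rcases lt_trichotomy s s₁ with hlt | heq | hgt
  · exact key s s₁ hlt hs (Metric.mem_ball_self hε) hsa hs₁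
  · rw [heq]
  · exact (key s₁ s hgt (Metric.mem_ball_self hε) hs hs₁ hsa).symm

/-- At time `s` the difference of `a` and `c` vanishes, so the term with `M'` drops out of the
product rule. In the application `M` passes from a trivialization to a frame, `a` belongs to a
section and `c` to the curve being tested. -/
lemma hasDerivAt_sub_iff {r : ℕ} {M : ℝ → (Fin r → ℂ) →L[ℂ] (Fin r → ℂ)}
    {M' : (Fin r → ℂ) →L[ℂ] (Fin r → ℂ)} {a c : ℝ → Fin r → ℂ} {d : Fin r → ℂ} {s : ℝ}
    (hM : HasDerivAt M M' s) (hu : IsUnit (M s)) (hd : HasDerivAt (fun t => M t (a t)) (M s d) s)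
    (h0 : a s = c s) :
    HasDerivAt (fun t => a t - c t) d s ↔ HasDerivAt (fun t => M t (c t)) 0 s := by
  constructor
  · intro h
    have h1 := hasDerivWithinAt_univ.1 (hasDerivWithinAt_clm_apply hM.hasDerivWithinAt
      (h.hasDerivWithinAt (s := Set.univ)))
    have h2 := hd.sub h1
    simp only [h0, sub_self, map_zero, zero_add] at h2
    refine h2.congr_of_eventuallyEq (Filter.Eventually.of_forall fun t => ?_)
    simp only [Pi.sub_apply, map_sub]
    abel
  · intro h
    obtain ⟨U, hU⟩ := hu
    have h1 : HasDerivAt (fun t => M t (a t - c t)) (M s d) s := by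
      have := hd.sub h
      rw [sub_zero] at this
      refine this.congr_of_eventuallyEq (Filter.Eventually.of_forall fun t => ?_)
      simp only [Pi.sub_apply, map_sub]
    have hI := ((contDiffAt_ringInverse ℝ U (n := 1)).differentiableAt
      one_ne_zero).hasFDerivAt
    rw [hU] at hI
    have hI' := hI.comp_hasDerivAt s hM
    have h2 := hasDerivWithinAt_univ.1 (hasDerivWithinAt_clm_apply hI'.hasDerivWithinAt
      (h1.hasDerivWithinAt (s := Set.univ)))
    have hcan : ∀ A : (Fin r → ℂ) →L[ℂ] (Fin r → ℂ), IsUnit A → ∀ y, Ring.inverse A (A y) = y :=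
      fun A hA y => congrArg (fun T : (Fin r → ℂ) →L[ℂ] (Fin r → ℂ) => T y)
        (Ring.inverse_mul_cancel A hA)
    simp only [Function.comp_apply, h0, sub_self, map_zero, zero_add,
      hcan _ ⟨U, hU⟩] at h2
    refine h2.congr_of_eventuallyEq ?_
    have hev : ∀ᶠ t in 𝓝 s, IsUnit (M t) :=
      hM.continuousAt.eventually_mem (Units.isOpen.mem_nhds ⟨U, hU⟩)
    filter_upwards [hev] with t ht
    exact (hcan _ ht _).symm

end RealCurves

/-! ### Parallel curves along arcs and flat curves in the model -/

section Parallel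

variable {n : ℕ} {Q : Type*} [TopologicalSpace Q] [ChartedSpace (EuclideanSpace ℝ (Fin n)) Q]
  [IsManifold (𝓡 n) ∞ Q] {g : Metric (n := n) Q} {Ω : Set Q}
  {𝓜 : Type*} [TopologicalSpace 𝓜]
  [ChartedSpace (EuclideanSpace ℝ (Fin (2 * n - 1))) 𝓜]
  {r : ℕ} {𝓔 : PhaseBundle g Ω r} {mod : SmoothModel g Ω 𝓜}
  {D : 𝓔.sections →ₗ[ℂ] 𝓔.sections} {κ : Gluing 𝓔} (B : ModelBundle mod D κ)

local notation "End" => (Fin r → ℂ) →L[ℂ] (Fin r → ℂ)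

lemma HasArcDeriv.hasDerivAt_curve [T2Space Q] (hg : IsGeodesicallyComplete g) {V : Type*}
    [NormedAddCommGroup V] [NormedSpace ℝ V] {f : PhaseSpace g Ω → V} {b : ℝ → PhaseSpace g Ω}
    {p : TangentBundle (𝓡 n) Q} {s : ℝ} {y : V} (h : HasArcDeriv f (b s) y)
    (hb : ∀ᶠ t in 𝓝 s, incl g Ω (b t) = geodesicFlow g t p) :
    HasDerivAt (fun t => f (b t)) y s := by
  have hJ : {t | incl g Ω (b (s + t)) = geodesicFlow g (s + t) p} ∈ 𝓝 (0 : ℝ) := by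
    have h1 : Filter.Tendsto (fun t => s + t) (𝓝 0) (𝓝 s) := by
      have : ContinuousAt (fun t => s + t) 0 := by fun_prop
      simpa [ContinuousAt] using this
    exact h1.eventually hb
  have h1 := (h _ (fun t => b (s + t)) (by rw [add_zero]) fun t ht => by
    have h2 := hb.self_of_nhds
    have h3 : incl g Ω (b (s + t)) = geodesicFlow g (s + t) p := ht
    rw [h3, h2, ← geodesicFlow_add hg, add_comm]).hasDerivAt hJ
  have h2 := HasDerivAt.comp_sub_const s s (f := fun t => f (b (s + t))) (f' := y)
    (by rwa [sub_self])
  simpa using h2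

variable [T2Space Q] (hg : IsGeodesicallyComplete g) (hΩ : IsObstacle n Ω)

include hg in
-- The frame differentiates the section into the components of `D σ`. Passing from the
-- trivialization to the frame by `hasDerivAt_sub_iff`, the parallel condition becomes vanishing of
-- the derivative of the components, independently of the test section.
lemma Frame.hasDerivAt_iff (F : Frame mod D κ) {u : ℝ → 𝓔.Total} {p : TangentBundle (𝓡 n) Q}
    {s : ℝ} (hb : ∀ᶠ t in 𝓝 s, incl g Ω (u t).proj = geodesicFlow g t p)
    (hF : mod.proj (u s).proj ∈ F.U) (σ : 𝓔.sections) (hσ : σ.1 (u s).proj = (u s).snd) :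
    HasDerivAt
      (fun s' => (trivializationAt (Fin r → ℂ) 𝓔.Fiber (u s).proj
          ⟨(u s').proj, σ.1 (u s').proj⟩).2
        - (trivializationAt (Fin r → ℂ) 𝓔.Fiber (u s).proj (u s')).2)
      (trivializationAt (Fin r → ℂ) 𝓔.Fiber (u s).proj ⟨(u s).proj, (D σ).1 (u s).proj⟩).2 s ↔
    HasDerivAt (fun s' => F.map (u s').proj (u s').snd) 0 s := by
  set e := trivializationAt (Fin r → ℂ) 𝓔.Fiber (u s).proj with he
  have hbe : (u s).proj ∈ e.baseSet := mem_baseSet_trivializationAt _ _ _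
  obtain ⟨M, hM, hMe⟩ := F.smooth_matrix e
  obtain ⟨W, hW, hWe⟩ := exists_isOpen_of_isOpen_phaseSpace
    (((F.isOpen.preimage mod.continuous_proj)).inter e.open_baseSet)
  have hzW : incl g Ω (u s).proj ∈ W := (hWe _).2 ⟨hF, hbe⟩
  obtain ⟨M', hM'⟩ := hM.exists_hasArcDeriv hg hW (fun w hw => (hWe w).1 hw) hzW
  have hev : ∀ᶠ t in 𝓝 s, (u t).proj ∈ e.baseSet := by
    have h1 : ∀ᶠ t in 𝓝 s, geodesicFlow g t p ∈ W :=
      (continuous_geodesicFlow_left hg p).continuousAt.eventually_mem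
        (hW.mem_nhds (hb.self_of_nhds ▸ hzW))
    filter_upwards [h1, hb] with t h2 h3
    exact ((hWe _).1 (h3 ▸ h2)).2
  have hderM := hM'.hasDerivAt_curve hg (b := fun t => (u t).proj) hb
  have hd := (F.parallel _ hF σ).hasDerivAt_curve hg (b := fun t => (u t).proj) hb
  rw [(hMe _ hbe).2.1] at hd
  have hd' := hd.congr_of_eventuallyEq (f₁ := fun t => M (u t).proj
    (e ⟨(u t).proj, σ.1 (u t).proj⟩).2) (by
      filter_upwards [hev] with t ht
      exact ((hMe _ ht).2.1 _).symm)
  rw [hasDerivAt_sub_iff (c := fun t => (e (u t)).2) hderM (hMe _ hbe).1 hd' (by rw [hσ])]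
  refine Filter.EventuallyEq.hasDerivAt_iff ?_
  filter_upwards [hev] with t ht
  exact ((hMe _ ht).2.1 _).symm

omit [T2Space Q] in
lemma Frame.continuousWithinAt_map (F : Frame mod D κ) {u : ℝ → 𝓔.Total} {J : Set ℝ} {s : ℝ}
    (hu : ContinuousWithinAt u J s) (hF : mod.proj (u s).proj ∈ F.U) :
    ContinuousWithinAt (fun t => F.map (u t).proj (u t).snd) J s := by
  set e := trivializationAt (Fin r → ℂ) 𝓔.Fiber (u s).proj with he
  have hbe : (u s).proj ∈ e.baseSet := mem_baseSet_trivializationAt _ _ _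
  obtain ⟨M, hM, hMe⟩ := F.smooth_matrix e
  obtain ⟨h1, h2⟩ := (FiberBundle.continuousWithinAt_totalSpace (F := Fin r → ℂ) u).1 hu
  have hO : IsOpen {z | mod.proj z ∈ F.U ∧ z ∈ e.baseSet} :=
    (F.isOpen.preimage mod.continuous_proj).inter e.open_baseSet
  have h3 : ContinuousAt M (u s).proj :=
    ((hM.continuous continuous_incl) _ ⟨hF, hbe⟩).continuousAt (hO.mem_nhds ⟨hF, hbe⟩)
  have h4 : ContinuousWithinAt (fun t => M (u t).proj (e (u t)).2) J s :=
    (h3.comp_continuousWithinAt (f := fun t => (u t).proj) h1).clm_apply h2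
  refine h4.congr_of_eventuallyEq ?_ ((hMe _ hbe).2.1 _)
  filter_upwards [h1.eventually_mem (e.open_baseSet.mem_nhds hbe)] with t ht
  exact (hMe _ ht).2.1 _

omit [T2Space Q] in
/-- A curve over a continuous curve is continuous if its components in a frame are. -/
lemma Frame.continuousWithinAt_of_map (F : Frame mod D κ) {u : ℝ → 𝓔.Total} {J : Set ℝ} {s : ℝ}
    (h1 : ContinuousWithinAt (fun t => (u t).proj) J s) (hF : mod.proj (u s).proj ∈ F.U)
    (hu : ContinuousWithinAt (fun t => F.map (u t).proj (u t).snd) J s) :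
    ContinuousWithinAt u J s := by
  refine (FiberBundle.continuousWithinAt_totalSpace (F := Fin r → ℂ) u).2 ⟨h1, ?_⟩
  set e := trivializationAt (Fin r → ℂ) 𝓔.Fiber (u s).proj with he
  have hbe : (u s).proj ∈ e.baseSet := mem_baseSet_trivializationAt _ _ _
  obtain ⟨M, hM, hMe⟩ := F.smooth_matrix e
  have hM' := hM.clm_inverse fun z hz => (hMe z hz.2).1
  have hO : IsOpen {z | mod.proj z ∈ F.U ∧ z ∈ e.baseSet} :=
    (F.isOpen.preimage mod.continuous_proj).inter e.open_baseSet
  have h3 : ContinuousAt (fun z => Ring.inverse (M z)) (u s).proj :=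
    ((hM'.continuous continuous_incl) _ ⟨hF, hbe⟩).continuousAt (hO.mem_nhds ⟨hF, hbe⟩)
  have h4 : ContinuousWithinAt
      (fun t => Ring.inverse (M (u t).proj) (F.map (u t).proj (u t).snd)) J s :=
    (h3.comp_continuousWithinAt (f := fun t => (u t).proj) h1).clm_apply hu
  have hcan : ∀ t, (u t).proj ∈ e.baseSet →
      (e (u t)).2 = Ring.inverse (M (u t).proj) (F.map (u t).proj (u t).snd) := fun t ht => by
    rw [(hMe _ ht).2.1]
    exact (congrArg (fun T : End => T (e (u t)).2)
      (Ring.inverse_mul_cancel _ (hMe _ ht).1)).symm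
  refine h4.congr_of_eventuallyEq ?_ (hcan s hbe)
  filter_upwards [h1.eventually_mem (e.open_baseSet.mem_nhds hbe)] with t ht
  exact hcan t ht

omit [T2Space Q] in
include hg in
/-- The points of an arc are points of the trajectory. -/
lemma IsArc.flowsTo {s t : ℝ} {w₀ w' b : PhaseSpace g Ω} (harc : IsArc g Ω s w₀ w')
    (hl : launch g Ω s w₀ = w₀) (ht : t ∈ Set.uIcc 0 s)
    (hb : incl g Ω b = geodesicFlow g t (incl g Ω w₀)) : FlowsTo g Ω t w₀ b := by
  obtain ⟨d, hd, hds⟩ := exists_direction harc.1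
  rcases eq_or_ne t 0 with rfl | h0
  · rw [geodesicFlow_zero hg] at hb
    rw [incl_injective hb]
    exact FlowsTo.refl _
  have hdt : 0 < d * t ∧ d * t ≤ d * s := by
    rcases hd with rfl | rfl
    · rw [Set.uIcc_of_le (by linarith)] at ht
      exact ⟨by simpa using lt_of_le_of_ne ht.1 h0.symm, by simpa using ht.2⟩
    · rw [Set.uIcc_of_ge (by linarith)] at ht
      exact ⟨by simpa using lt_of_le_of_ne ht.2 h0, by simpa using ht.1⟩
  refine FlowsTo.single ⟨h0, ?_, fun τ hτ => ?_⟩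
  · rw [launch_congr hdt.1, ← launch_congr hds, hl, hb]
  · rw [launch_congr hdt.1, ← launch_congr hds, hl]
    rw [mem_uIoo_iff_of_mul_pos hd hdt.1] at hτ
    exact harc.2.2 τ ((mem_uIoo_iff_of_mul_pos hd hds τ).2 ⟨hτ.1, hτ.2.trans_le hdt.2⟩)

omit [T2Space Q] in
include hg in
lemma IsArc.exists_point {s t : ℝ} {w₀ w' : PhaseSpace g Ω} (harc : IsArc g Ω s w₀ w')
    (ht : t ∈ Set.uIcc 0 s) : ∃ b, incl g Ω b = geodesicFlow g t (incl g Ω w₀) := by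
  rcases eq_or_ne t 0 with rfl | h0
  · exact ⟨w₀, (geodesicFlow_zero hg _).symm⟩
  rcases eq_or_ne t s with rfl | h1
  · exact ⟨w', harc.2.1.symm⟩
  have hm : t ∈ Set.uIoo 0 s := by
    refine ⟨lt_of_le_of_ne ht.1 fun h => ?_, lt_of_le_of_ne ht.2 fun h => ?_⟩
    · rcases min_choice 0 s with h2 | h2
      · exact h0 (h.symm.trans h2)
      · exact h1 (h.symm.trans h2)
    · rcases max_choice 0 s with h2 | h2
      · exact h0 (h.trans h2)
      · exact h1 (h.trans h2)
  obtain ⟨b, -, hb⟩ := exists_phasePoint hg w₀ (harc.2.2 t hm)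
  exact ⟨b, hb.symm⟩

namespace ModelBundle

omit [T2Space Q] in
lemma toModel_injective {x y : 𝓔.Total} (h : x.proj = y.proj)
    (h' : B.toModel x.proj x.snd = B.toModel y.proj y.snd) : x = y := by
  obtain ⟨z, v⟩ := x
  obtain ⟨w, v'⟩ := y
  obtain rfl : z = w := h
  have h1 : B.Φ z v = B.Φ z v' := by
    simpa [toModel] using h'
  rw [(B.Φ z).injective h1]

variable [T2Space 𝓜] (hFr : ∀ p, ∃ F : Frame mod D κ, p ∈ F.U)
include hg hΩ hFr

omit [T2Space 𝓜] in
-- Through any vector of the curve there is a smooth test section, so at intermediate times the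
-- components in a frame have derivative 0; continuity covers the ends. The condition on `launch`
-- says that the arc already starts at the reflected vector.
lemma isFlat_of_isParallel {s : ℝ} {w₀ w' : PhaseSpace g Ω} (harc : IsArc g Ω s w₀ w')
    (hl : launch g Ω s w₀ = w₀) {u : ℝ → 𝓔.Total} (hu : 𝓔.IsParallel D u s)
    (hb : ∀ t ∈ Set.uIcc 0 s, incl g Ω (u t).proj = geodesicFlow g t (incl g Ω w₀)) :
    B.IsFlat (fun t => mod.flow t (mod.proj w₀)) (Set.uIcc 0 s)
      (fun t => B.toModel (u t).proj (u t).snd) := by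
  have hproj : ∀ t ∈ Set.uIcc 0 s, mod.proj (u t).proj = mod.flow t (mod.proj w₀) := fun t ht =>
    (mod.flow_proj hg hΩ (harc.flowsTo hg hl ht (hb t ht))).symm
  intro s₁ hs₁
  refine ⟨hproj s₁ hs₁, ?_⟩
  obtain ⟨F, hF⟩ := hFr (mod.flow s₁ (mod.proj w₀))
  refine ⟨F, hF, ?_⟩
  have hdom : s₁ ∈ mod.times (mod.proj w₀) :=
    mod.mem_domain (harc.flowsTo hg hl hs₁ (hb s₁ hs₁))
  have hFev : ∀ᶠ t in 𝓝 s₁, mod.flow t (mod.proj w₀) ∈ F.U :=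
    (SmoothModel.continuousAt_flow_time hdom).eventually_mem (F.isOpen.mem_nhds hF)
  have key := eventually_eq_of_hasDerivAt_zero_uIoo
    (f := fun t => F.map (u t).proj (u t).snd) hs₁ (by
      filter_upwards [nhdsWithin_le_nhds hFev, self_mem_nhdsWithin] with t h1 h2
      exact F.continuousWithinAt_map (hu.1 t h2) (hproj t h2 ▸ h1)) (by
      filter_upwards [hFev] with t h1 h2
      have h3 := hproj t (Set.uIoo_subset_uIcc_self h2)
      obtain ⟨σ, hσ⟩ := exists_section_eq (𝓔 := 𝓔) Topology.IsInducing.subtypeVal (u t).snd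
      refine (F.hasDerivAt_iff hg (p := incl g Ω w₀) ?_ (h3 ▸ h1) σ hσ).1 (hu.2 t h2 σ hσ)
      filter_upwards [isOpen_Ioo.mem_nhds h2] with t' ht'
      exact hb t' (Set.uIoo_subset_uIcc_self ht'))
  filter_upwards [key, nhdsWithin_le_nhds hFev, self_mem_nhdsWithin] with t h1 h2 h3
  rw [B.comp_toModel (by rw [hproj t h3]; exact h2), B.comp_toModel (by rw [hproj s₁ hs₁]; exact hF)]
  exact h1

/-- The flat curve in the model bundle is lifted, vector by vector, to the points of the arc through
the fiber isomorphisms. Its components are locally constant, hence it is continuous and parallel. -/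
lemma exists_isParallel {s : ℝ} {w₀ w' : PhaseSpace g Ω} (harc : IsArc g Ω s w₀ w')
    (hl : launch g Ω s w₀ = w₀) (v : 𝓔.Fiber w₀) : ∃ u : ℝ → 𝓔.Total, 𝓔.IsParallel D u s ∧
      ∀ t ∈ Set.uIcc 0 s, incl g Ω (u t).proj = geodesicFlow g t (incl g Ω w₀) ∧
        B.toModel (u t).proj (u t).snd = B.trans (B.toModel w₀ v) t := by
  have hdom : s ∈ mod.times (mod.proj w₀) :=
    mod.mem_domain (harc.flowsTo hg hl Set.right_mem_uIcc harc.2.1.symm)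
  have hsub := SmoothModel.uIcc_subset_times hg hΩ hdom
  have hex : ∀ t, ∃ x : 𝓔.Total, t ∈ Set.uIcc 0 s →
      incl g Ω x.proj = geodesicFlow g t (incl g Ω w₀) ∧
        B.toModel x.proj x.snd = B.trans (B.toModel w₀ v) t := by
    intro t
    by_cases ht : t ∈ Set.uIcc 0 s
    · obtain ⟨b, hb⟩ := harc.exists_point hg ht
      have h1 := mod.flow_proj hg hΩ (harc.flowsTo hg hl ht hb)
      obtain ⟨v', hv'⟩ := B.exists_toModel (B.trans (B.toModel w₀ v) t) (z := b)
        (by rw [B.trans_proj hg hΩ hFr (by exact hsub ht), ← h1]; rfl)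
      exact ⟨⟨b, v'⟩, fun _ => ⟨hb, hv'⟩⟩
    · exact ⟨⟨w₀, v⟩, fun h => absurd h ht⟩
  choose u hu using hex
  have hproj : ∀ t ∈ Set.uIcc 0 s, mod.proj (u t).proj = mod.flow t (mod.proj w₀) := fun t ht =>
    (mod.flow_proj hg hΩ (harc.flowsTo hg hl ht (hu t ht).1)).symm
  have hflat := (B.trans_spec hg hΩ hFr (B.toModel w₀ v)).1.mono hsub
  have hloc : ∀ s₁ ∈ Set.uIcc 0 s, ∃ F : Frame mod D κ, mod.proj (u s₁).proj ∈ F.U ∧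
      ∀ᶠ t in 𝓝[Set.uIcc 0 s] s₁,
        F.map (u t).proj (u t).snd = F.map (u s₁).proj (u s₁).snd := by
    intro s₁ hs₁
    obtain ⟨-, F, hF, hev⟩ := hflat s₁ hs₁
    refine ⟨F, by rw [hproj s₁ hs₁]; exact hF, ?_⟩
    have hFev : ∀ᶠ t in 𝓝[Set.uIcc 0 s] s₁, mod.flow t (mod.proj w₀) ∈ F.U :=
      nhdsWithin_le_nhds ((SmoothModel.continuousAt_flow_time (hsub hs₁)).eventually_mem
        (F.isOpen.mem_nhds hF))
    filter_upwards [hev, hFev, self_mem_nhdsWithin] with t h1 h2 h3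
    rw [← B.comp_toModel (by rw [hproj t h3]; exact h2),
      ← B.comp_toModel (by rw [hproj s₁ hs₁]; exact hF), (hu t h3).2, (hu s₁ hs₁).2, h1]
  refine ⟨u, ⟨fun s₁ hs₁ => ?_, fun s₁ hs₁ σ hσ => ?_⟩, hu⟩
  · obtain ⟨F, hF, hev⟩ := hloc s₁ hs₁
    refine F.continuousWithinAt_of_map ?_ hF (continuousWithinAt_const.congr_of_eventuallyEq hev rfl)
    have hind : Topology.IsInducing (incl g Ω) := Topology.IsInducing.subtypeVal
    refine hind.tendsto_nhds_iff.2 ?_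
    refine ((continuous_geodesicFlow_left hg (incl g Ω w₀)).continuousWithinAt (s := Set.uIcc 0 s)
      (x := s₁)).congr (fun t ht => (hu t ht).1) (hu s₁ hs₁).1
  · have hs₁' := Set.uIoo_subset_uIcc_self hs₁
    have hn : Set.uIoo 0 s ∈ 𝓝 s₁ := isOpen_Ioo.mem_nhds hs₁
    obtain ⟨F, hF, hev⟩ := hloc s₁ hs₁'
    rw [nhdsWithin_eq_nhds.2 (Filter.mem_of_superset hn Set.uIoo_subset_uIcc_self)] at hev
    refine (F.hasDerivAt_iff hg (p := incl g Ω w₀) ?_ hF σ hσ).2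
      ((hasDerivAt_const s₁ (F.map (u s₁).proj (u s₁).snd)).congr_of_eventuallyEq hev)
    filter_upwards [hn] with t ht
    exact (hu t (Set.uIoo_subset_uIcc_self ht)).1

end ModelBundle

end Parallel

/-! ### Billiard parallel transport and flat transport -/

section Transport

variable {n : ℕ} {Q : Type*} [TopologicalSpace Q] [ChartedSpace (EuclideanSpace ℝ (Fin n)) Q]
  [IsManifold (𝓡 n) ∞ Q] {g : Metric (n := n) Q} {Ω : Set Q}
  {𝓜 : Type*} [TopologicalSpace 𝓜]
  [ChartedSpace (EuclideanSpace ℝ (Fin (2 * n - 1))) 𝓜]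
  {r : ℕ} {𝓔 : PhaseBundle g Ω r} {mod : SmoothModel g Ω 𝓜}
  {D : 𝓔.sections →ₗ[ℂ] 𝓔.sections} {κ : Gluing 𝓔} (B : ModelBundle mod D κ)

local notation "End" => (Fin r → ℂ) →L[ℂ] (Fin r → ℂ)

lemma IsLaunch.eq_launch {s : ℝ} {w w₀ : PhaseSpace g Ω} {K : 𝓔.Fiber w ≃ₗ[ℂ] 𝓔.Fiber w₀}
    (h : IsLaunch κ s w w₀ K) : w₀ = launch g Ω s w := by
  cases h with
  | stay _ h h' =>
    unfold launch
    rw [if_neg]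
    rintro (h1 | h1)
    · exact h h1.1 h1.2
    · exact h' h1.1 h1.2
  | forward w h => exact (launch_of_inward w.2 h).symm
  | backward w h =>
    rw [launch_of_outward (reflection_mem_outwardBoundary w.2) h, reflection_reflection]

variable (κ) in
lemma exists_isLaunch (s : ℝ) (w : PhaseSpace g Ω) :
    ∃ (w₀ : PhaseSpace g Ω) (K : 𝓔.Fiber w ≃ₗ[ℂ] 𝓔.Fiber w₀), IsLaunch κ s w w₀ K := by
  by_cases h1 : 0 < s ∧ w ∈ inwardBoundary g Ω
  · exact ⟨_, _, IsLaunch.forward ⟨w, h1.2⟩ h1.1⟩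
  by_cases h2 : s < 0 ∧ w ∈ outwardBoundary g Ω
  · obtain ⟨w', hw', rfl⟩ : ∃ w' ∈ inwardBoundary g Ω, reflection g Ω w' = w :=
      ⟨_, reflection_mem_inwardBoundary h2.2, reflection_reflection w⟩
    exact ⟨_, _, IsLaunch.backward ⟨w', hw'⟩ h2.1⟩
  · exact ⟨_, _, IsLaunch.stay w (fun h h' => h1 ⟨h, h'⟩) (fun h h' => h2 ⟨h, h'⟩)⟩

variable [T2Space Q] [T2Space 𝓜] (hg : IsGeodesicallyComplete g) (hΩ : IsObstacle n Ω)
  (hFr : ∀ p, ∃ F : Frame mod D κ, p ∈ F.U)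

namespace ModelBundle

include B hg hΩ hFr

/-- Frames take the same values on a vector and on its image under `κ`, so in the model the gluing
is invisible. -/
lemma toModel_glue (z : inwardBoundary g Ω) (v : 𝓔.Fiber z.1) :
    B.toModel (reflection g Ω z.1) (κ.map z v) = B.toModel z.1 v := by
  have hp := mod.proj_reflection hg hΩ z.1
  obtain ⟨F, hF⟩ := hFr (mod.proj z.1)
  have hF' : mod.proj (reflection g Ω z.1) ∈ F.U := hp.symm ▸ hF
  refine B.eq_of_comp_eq (F := F) hp hF' ?_
  rw [B.comp_toModel hF', B.comp_toModel hF, F.glue z hF v]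

lemma toModel_launch {s : ℝ} {w w₀ : PhaseSpace g Ω} {K : 𝓔.Fiber w ≃ₗ[ℂ] 𝓔.Fiber w₀}
    (h : IsLaunch κ s w w₀ K) (v : 𝓔.Fiber w) : B.toModel w₀ (K v) = B.toModel w v := by
  cases h with
  | stay => rfl
  | forward w h => exact B.toModel_glue hg hΩ hFr w v
  | backward w h =>
    rw [← B.toModel_glue hg hΩ hFr w, LinearEquiv.apply_symm_apply]

lemma trans_of_isParallelTransport {s : ℝ} {w₀ w' : PhaseSpace g Ω} (harc : IsArc g Ω s w₀ w')
    (hl : launch g Ω s w₀ = w₀) {T : 𝓔.Fiber w₀ ≃ₗ[ℂ] 𝓔.Fiber w'}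
    (hT : 𝓔.IsParallelTransport D (fun r => geodesicFlow g r (incl g Ω w₀)) s w₀ w' T)
    (v : 𝓔.Fiber w₀) : B.trans (B.toModel w₀ v) s = B.toModel w' (T v) := by
  obtain ⟨u, hu, hb, hu0, hus⟩ := hT v
  have hdom : s ∈ mod.times (mod.proj w₀) :=
    mod.mem_domain (harc.flowsTo hg hl Set.right_mem_uIcc harc.2.1.symm)
  rw [B.trans_eq hg hΩ hFr isPreconnected_uIcc Set.left_mem_uIcc
    (SmoothModel.uIcc_subset_times hg hΩ hdom) (B.isFlat_of_isParallel hg hΩ hFr harc hl hu hb)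
    (by rw [hu0]) Set.right_mem_uIcc, hus]

lemma exists_isParallelTransport {s : ℝ} {w₀ w' : PhaseSpace g Ω} (harc : IsArc g Ω s w₀ w')
    (hl : launch g Ω s w₀ = w₀) : ∃ T : 𝓔.Fiber w₀ ≃ₗ[ℂ] 𝓔.Fiber w',
      𝓔.IsParallelTransport D (fun r => geodesicFlow g r (incl g Ω w₀)) s w₀ w' T := by
  have hfl := harc.flowsTo hg hl Set.right_mem_uIcc harc.2.1.symm
  obtain ⟨α, hα⟩ := B.exists_transEquiv hg hΩ hFr (mod.mem_domain hfl) (mod.flow_proj hg hΩ hfl)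
  refine ⟨(B.Φ w₀).trans (α.trans (B.Φ w').symm), fun v => ?_⟩
  obtain ⟨u, hu, hb⟩ := B.exists_isParallel hg hΩ hFr harc hl v
  refine ⟨u, hu, fun t ht => (hb t ht).1, ?_, ?_⟩
  · obtain ⟨h1, h2⟩ := hb 0 Set.left_mem_uIcc
    rw [geodesicFlow_zero hg] at h1
    exact B.toModel_injective (y := ⟨w₀, v⟩) (incl_injective h1)
      (h2.trans (B.trans_spec hg hΩ hFr _).2)
  · obtain ⟨h1, h2⟩ := hb s Set.right_mem_uIcc
    rw [harc.2.1] at h1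
    refine B.toModel_injective (y := ⟨w', _⟩) (incl_injective h1) (h2.trans ?_)
    change B.trans ⟨_, B.Φ w₀ v⟩ s = ⟨_, B.Φ w' ((B.Φ w').symm (α (B.Φ w₀ v)))⟩
    rw [LinearEquiv.apply_symm_apply, hα]

/-- Induction over the arcs: gluing does not change the image in the model, transport along an arc
maps to flat transport, and `trans_trans` composes the pieces. -/
lemma trans_of_billiardTransport {t : ℝ} {z w : PhaseSpace g Ω}
    {A : 𝓔.Fiber z ≃ₗ[ℂ] 𝓔.Fiber w} (h : BilliardTransport D κ t z w A) :
    FlowsTo g Ω t z w ∧ ∀ v, B.trans (B.toModel z v) t = B.toModel w (A v) := by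
  induction h with
  | refl z => exact ⟨FlowsTo.refl z, fun v => (B.trans_spec hg hΩ hFr _).2⟩
  | @step t s z w w₀ w' A K T h hs hK harc hT ih =>
    obtain ⟨ih1, ih2⟩ := ih
    have hw₀ := hK.eq_launch
    have hl : launch g Ω s w₀ = w₀ := by rw [hw₀, launch_launch]
    have hfl : FlowsTo g Ω (t + s) z w' := FlowsTo.step ih1 hs (hw₀ ▸ harc)
    refine ⟨hfl, fun v => ?_⟩
    have hlast := mod.mem_domain (FlowsTo.single (hw₀ ▸ harc) : FlowsTo g Ω s w w')
    rw [← B.trans_trans hg hΩ hFr (x := B.toModel z v) (mod.mem_domain ih1) (mod.mem_domain hfl)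
      (by rw [show (B.toModel z v).proj = mod.proj z from rfl, mod.flow_proj hg hΩ ih1]
          exact hlast), ih2, ← B.toModel_launch hg hΩ hFr hK,
      B.trans_of_isParallelTransport hg hΩ hFr harc hl hT]
    rfl

lemma exists_billiardTransport {t : ℝ} {z w : PhaseSpace g Ω} (h : FlowsTo g Ω t z w) :
    ∃ A : 𝓔.Fiber z ≃ₗ[ℂ] 𝓔.Fiber w, BilliardTransport D κ t z w A := by
  induction h with
  | refl z => exact ⟨_, BilliardTransport.refl z⟩
  | @step t s z w w' h hs harc ih =>
    obtain ⟨A, hA⟩ := ih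
    obtain ⟨w₀, K, hK⟩ := exists_isLaunch κ s w
    have hw₀ := hK.eq_launch
    rw [← hw₀] at harc
    obtain ⟨T, hT⟩ := B.exists_isParallelTransport hg hΩ hFr harc (by rw [hw₀, launch_launch])
    exact ⟨_, BilliardTransport.step hA hs hK harc hT⟩

/-- The decomposition of a trajectory into arcs is not unique, but every choice induces the same
flat transport in the model, and fibers embed into the model bundle. -/
theorem existsUnique_billiardTransport {t : ℝ} {z w : PhaseSpace g Ω} (h : FlowsTo g Ω t z w) :
    ∃! A : 𝓔.Fiber z ≃ₗ[ℂ] 𝓔.Fiber w, BilliardTransport D κ t z w A := by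
  obtain ⟨A, hA⟩ := B.exists_billiardTransport hg hΩ hFr h
  refine ⟨A, hA, fun A' hA' => LinearEquiv.ext fun v => ?_⟩
  have h1 := (B.trans_of_billiardTransport hg hΩ hFr hA').2 v
  rw [(B.trans_of_billiardTransport hg hΩ hFr hA).2 v] at h1
  have h2 := B.toModel_injective (x := ⟨w, A v⟩) (y := ⟨w, A' v⟩) rfl h1
  simpa using h2.symm

end ModelBundle

/-! ### Parallel transport for the induced operator, and equality of traces -/

section ModelParallel

variable {B} {X : B.bundle.sections →ₗ[ℂ] B.bundle.sections}

/-- The operator `X` differentiates the components with respect to frames along the flow. -/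
def ModelBundle.IsFlowDerivative (B : ModelBundle mod D κ)
    (X : B.bundle.sections →ₗ[ℂ] B.bundle.sections) : Prop :=
  ∀ (F : Frame mod D κ) (σ : B.bundle.sections) (p : 𝓜), p ∈ F.U →
    HasDerivAt (fun t => B.comp F ⟨mod.flow t p, σ.1 (mod.flow t p)⟩) (B.comp F ⟨p, (X σ).1 p⟩) 0

omit [T2Space Q] [T2Space 𝓜] in
lemma Frame.isUnit_change (F F' : Frame mod D κ) (z : PhaseSpace g Ω) :
    IsUnit (F.change F' z) :=
  Units.isUnit ((ContinuousLinearEquiv.unitsEquiv ℂ (Fin r → ℂ)).symm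
    (((F.map _).symm.trans (F'.map _)).toContinuousLinearEquiv))

namespace ModelBundle.IsFlowDerivative

include hg hΩ

/-- Every trivialization in the atlas comes from a frame, and the coordinate change between two
frames has derivative 0 along the flow. As on the phase space, the parallel condition becomes
constancy of components. -/
lemma hasDerivAt_iff (hX : B.IsFlowDerivative X) (F : Frame mod D κ) {u : ℝ → B.bundle.Total}
    {p : 𝓜} {s : ℝ} (hs : s ∈ mod.times p) (hb : ∀ᶠ t in 𝓝 s, (u t).proj = mod.flow t p)
    (hF : mod.flow s p ∈ F.U) (σ : B.bundle.sections) (hσ : σ.1 (u s).proj = (u s).snd) :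
    HasDerivAt
      (fun s' => (trivializationAt (Fin r → ℂ) B.bundle.Fiber (u s).proj
          ⟨(u s').proj, σ.1 (u s').proj⟩).2
        - (trivializationAt (Fin r → ℂ) B.bundle.Fiber (u s).proj (u s')).2)
      (trivializationAt (Fin r → ℂ) B.bundle.Fiber (u s).proj
        ⟨(u s).proj, (X σ).1 (u s).proj⟩).2 s ↔
    HasDerivAt (fun s' => B.comp F (u s')) 0 s := by
  have hus := hb.self_of_nhds
  obtain ⟨F', hF'⟩ := B.exists_triv (trivializationAt (Fin r → ℂ) B.bundle.Fiber (u s).proj)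
  have hsF' : mod.flow s p ∈ F'.U := by
    rw [← hus, ← B.baseSet_triv, ← hF']
    exact mem_baseSet_trivializationAt _ _ _
  rw [hF']
  have hev : ∀ᶠ t in 𝓝 s, mod.flow t p ∈ F'.U ∩ F.U :=
    (SmoothModel.continuousAt_flow_time hs).eventually_mem
      ((F'.isOpen.inter F.isOpen).mem_nhds ⟨hsF', hF⟩)
  have hM : HasDerivAt (fun t => F'.change F (mod.lift (mod.flow t p))) 0 s :=
    SmoothModel.hasDerivAt_flow (f := fun q => F'.change F (mod.lift q)) hs
      (F'.hasDerivAt_change hg hΩ F ⟨hsF', hF⟩)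
  have hd : HasDerivAt (fun t => F'.change F (mod.lift (mod.flow t p))
      (B.comp F' ⟨(u t).proj, σ.1 (u t).proj⟩)) (F'.change F (mod.lift (mod.flow s p))
        (B.comp F' ⟨(u s).proj, (X σ).1 (u s).proj⟩)) s := by
    have h1 : HasDerivAt (fun t => B.comp F ⟨mod.flow t p, σ.1 (mod.flow t p)⟩)
        (B.comp F ⟨mod.flow s p, (X σ).1 (mod.flow s p)⟩) s :=
      SmoothModel.hasDerivAt_flow (f := fun q => B.comp F ⟨q, σ.1 q⟩) hs (hX F σ _ hF)
    rw [hus]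
    rw [B.comp_change (F := F') (F' := F) (x := ⟨mod.flow s p, _⟩) ⟨hsF', hF⟩] at h1
    refine h1.congr_of_eventuallyEq ?_
    filter_upwards [hev, hb] with t h2 h3
    rw [h3, B.comp_change (F := F') (F' := F) (x := ⟨mod.flow t p, _⟩) h2]
  refine (hasDerivAt_sub_iff hM (F'.isUnit_change F _) hd
    (c := fun t => B.comp F' (u t)) (by rw [hσ])).trans (Filter.EventuallyEq.hasDerivAt_iff ?_)
  filter_upwards [hev, hb] with t h2 h3
  rw [B.comp_change (F := F') (F' := F) (x := u t) (by rw [h3]; exact h2), h3]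

omit hg hΩ [T2Space Q] [T2Space 𝓜] in
lemma continuousWithinAt_comp {u : ℝ → B.bundle.Total} {J : Set ℝ} {s : ℝ}
    (hu : ContinuousWithinAt u J s) (F : Frame mod D κ) (hF : (u s).proj ∈ F.U) :
    ContinuousWithinAt (fun t => B.comp F (u t)) J s := by
  have h1 : ContinuousAt (B.triv F) (u s) := (B.triv F).continuousAt
    ((B.triv F).mem_source.2 ((B.baseSet_triv F).symm ▸ hF))
  exact continuousWithinAt_snd.comp (t := Set.univ) (f := fun t => B.triv F (u t))
    (h1.comp_continuousWithinAt hu) (Set.mapsTo_univ _ _)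

variable [IsManifold (𝓡 (2 * n - 1)) ∞ 𝓜]

include hFr in
lemma trans_eq (hX : B.IsFlowDerivative X) {t : ℝ} {p q : 𝓜} (ht : (t, p) ∈ mod.domain)
    {T : B.bundle.Fiber p ≃ₗ[ℂ] B.bundle.Fiber q}
    (hT : B.bundle.IsParallelTransport X (fun s => mod.flow s p) t p q T) (v : B.bundle.Fiber p) :
    B.trans ⟨p, v⟩ t = ⟨q, T v⟩ := by
  obtain ⟨u, hu, hb, hu0, hut⟩ := hT v
  have hsub := SmoothModel.uIcc_subset_times hg hΩ ht
  have hb' : ∀ s ∈ Set.uIcc 0 t, (u s).proj = mod.flow s p := hb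
  rw [← hut]
  refine B.trans_eq hg hΩ hFr isPreconnected_uIcc Set.left_mem_uIcc hsub (fun s₁ hs₁ => ?_) hu0
    Set.right_mem_uIcc
  refine ⟨hb' s₁ hs₁, ?_⟩
  obtain ⟨F, hF⟩ := hFr (mod.flow s₁ p)
  refine ⟨F, hF, ?_⟩
  have hFev : ∀ᶠ t in 𝓝 s₁, mod.flow t p ∈ F.U :=
    (SmoothModel.continuousAt_flow_time (hsub hs₁)).eventually_mem (F.isOpen.mem_nhds hF)
  refine eventually_eq_of_hasDerivAt_zero_uIoo hs₁ ?_ ?_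
  · filter_upwards [nhdsWithin_le_nhds hFev, self_mem_nhdsWithin] with s h1 h2
    exact continuousWithinAt_comp (hu.1 s h2) F (by rw [hb' s h2]; exact h1)
  · filter_upwards [hFev] with s h1 h2
    have h3 := Set.uIoo_subset_uIcc_self h2
    obtain ⟨σ, hσ⟩ := exists_section_eq (𝓔 := B.bundle) Topology.IsInducing.id (u s).snd
    refine (hX.hasDerivAt_iff hg hΩ F (p := p) (hsub h3) ?_ h1 σ hσ).1 (hu.2 s h2 σ hσ)
    filter_upwards [isOpen_Ioo.mem_nhds h2] with t' ht'
    exact hb' t' (Set.uIoo_subset_uIcc_self ht')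

include hFr in
-- Flat transport is a parallel transport for `X`, and `trans_eq` shows that every other one
-- coincides with it.
theorem existsUnique_isParallelTransport (hX : B.IsFlowDerivative X) {t : ℝ} {p : 𝓜}
    (ht : (t, p) ∈ mod.domain) : ∃! T : B.bundle.Fiber p ≃ₗ[ℂ] B.bundle.Fiber (mod.flow t p),
      B.bundle.IsParallelTransport X (fun s => mod.flow s p) t p (mod.flow t p) T := by
  obtain ⟨α, hα⟩ := B.exists_transEquiv hg hΩ hFr ht rfl
  have hsub := SmoothModel.uIcc_subset_times hg hΩ ht
  refine ⟨α, fun v => ?_, fun T hT => LinearEquiv.ext fun v => ?_⟩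
  · have hp := fun s (hs : s ∈ mod.times p) => B.trans_proj hg hΩ hFr (x := ⟨p, v⟩) hs
    have hflat := (B.trans_spec hg hΩ hFr ⟨p, v⟩).1
    have hpe : ∀ s ∈ mod.times p, ∀ᶠ s' in 𝓝 s, (B.trans ⟨p, v⟩ s').proj = mod.flow s' p :=
      fun s hs => by
        filter_upwards [(SmoothModel.isOpen_times p).mem_nhds hs] with s' hs' using hp s' hs'
    refine ⟨B.trans ⟨p, v⟩, ⟨fun s hs => ?_, fun s hs σ hσ => ?_⟩, fun s hs => hp s (hsub hs),
      (B.trans_spec hg hΩ hFr _).2, hα v⟩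
    · have hs' := hsub hs
      refine ContinuousAt.continuousWithinAt ?_
      have h1 : ContinuousAt (fun s' => (B.trans ⟨p, v⟩ s').proj) s :=
        (SmoothModel.continuousAt_flow_time hs').congr
          (by filter_upwards [hpe s hs'] with s' h using h.symm)
      refine (FiberBundle.continuousAt_totalSpace (F := Fin r → ℂ) _).2 ⟨h1, ?_⟩
      obtain ⟨F, hF⟩ := B.exists_triv
        (trivializationAt (Fin r → ℂ) B.bundle.Fiber (B.trans ⟨p, v⟩ s).proj)
      have hsF : mod.flow s p ∈ F.U := by
        rw [← hp s hs', ← B.baseSet_triv, ← hF]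
        exact mem_baseSet_trivializationAt _ _ _
      rw [hF]
      have h2 := hflat.eventually (isFlatBase_flow hg hΩ p) hs' hsF
      rw [nhdsWithin_eq_nhds.2 ((SmoothModel.isOpen_times p).mem_nhds hs')] at h2
      exact continuousAt_const.congr (by filter_upwards [h2] with s' h using h.symm)
    · have hs' := hsub (Set.uIoo_subset_uIcc_self hs)
      obtain ⟨F, hF⟩ := hFr (mod.flow s p)
      refine (hX.hasDerivAt_iff hg hΩ F hs' (hpe s hs') hF σ hσ).2 ?_
      have h2 := hflat.eventually (isFlatBase_flow hg hΩ p) hs' hF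
      rw [nhdsWithin_eq_nhds.2 ((SmoothModel.isOpen_times p).mem_nhds hs')] at h2
      exact (hasDerivAt_const s _).congr_of_eventuallyEq h2
  · have h1 := hX.trans_eq hg hΩ hFr ht hT v
    rw [hα] at h1
    simpa using h1.symm

include hFr in
-- Both transports induce the flat transport, so the fiber isomorphism at `z` conjugates one into
-- the other.
theorem trace_eq (hX : B.IsFlowDerivative X) {t : ℝ} {z : PhaseSpace g Ω}
    {T : B.bundle.Fiber (mod.proj z) ≃ₗ[ℂ] B.bundle.Fiber (mod.proj z)}
    {A : 𝓔.Fiber z ≃ₗ[ℂ] 𝓔.Fiber z}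
    (hT : B.bundle.IsParallelTransport X (fun s => mod.flow s (mod.proj z)) t
      (mod.proj z) (mod.proj z) T) (hA : BilliardTransport D κ t z z A) :
    LinearMap.trace ℂ (B.bundle.Fiber (mod.proj z)) T.toLinearMap
      = LinearMap.trace ℂ (𝓔.Fiber z) A.toLinearMap := by
  obtain ⟨h1, h2⟩ := B.trans_of_billiardTransport hg hΩ hFr hA
  have h3 : ∀ v, T (B.Φ z v) = B.Φ z (A v) := fun v => by
    have h4 := hX.trans_eq hg hΩ hFr (mod.mem_domain h1) hT (B.Φ z v)
    have h5 := h2 v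
    unfold toModel at h5
    rw [h4] at h5
    simpa using h5
  have h6 : T.toLinearMap = (B.Φ z).conj A.toLinearMap := by
    refine LinearMap.ext fun x => ?_
    rw [LinearEquiv.conj_apply_apply]
    change T x = B.Φ z (A ((B.Φ z).symm x))
    rw [← h3, LinearEquiv.apply_symm_apply]
  rw [h6, LinearMap.trace_conj']

end ModelBundle.IsFlowDerivative

end ModelParallel

include hg hΩ in
/-- Periodic points of the model flow come from periodic points of the billiard flow. -/
lemma SmoothModel.exists_periodic {t : ℝ} {p : 𝓜} (h : (t, p) ∈ mod.domain)
    (hp : mod.flow t p = p) : ∃ z, mod.proj z = p ∧ FlowsTo g Ω t z z := by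
  obtain ⟨z, rfl⟩ := mod.surjective_proj p
  obtain ⟨w, hw⟩ := mod.exists_flowsTo hg hΩ h
  have h1 := mod.flow_proj hg hΩ hw
  rw [hp] at h1
  rcases mod.eq_or_eq_reflection hg hΩ h1 with rfl | rfl
  · exact ⟨_, rfl, hw⟩
  · rcases eq_or_ne t 0 with rfl | ht
    · exact ⟨z, rfl, FlowsTo.refl z⟩
    · refine ⟨_, mod.proj_reflection hg hΩ z, ?_⟩
      exact (hw.reflection ht)

end Transport

/-! ### Billiard sections descend to smooth sections on the model -/

section Sections

variable {n : ℕ} {Q : Type*} [TopologicalSpace Q] [ChartedSpace (EuclideanSpace ℝ (Fin n)) Q]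
  [IsManifold (𝓡 n) ∞ Q] {g : Metric (n := n) Q} {Ω : Set Q}
  {𝓜 : Type*} [TopologicalSpace 𝓜]
  [ChartedSpace (EuclideanSpace ℝ (Fin (2 * n - 1))) 𝓜]
  {r : ℕ} {𝓔 : PhaseBundle g Ω r} {mod : SmoothModel g Ω 𝓜}
  {D : 𝓔.sections →ₗ[ℂ] 𝓔.sections} {κ : Gluing 𝓔} (B : ModelBundle mod D κ)

local notation "End" => (Fin r → ℂ) →L[ℂ] (Fin r → ℂ)

section FlowDerivative

variable {V : Type*} [NormedAddCommGroup V] [NormedSpace ℝ V]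

lemma SmoothModel.contMDiffAt_flow {x : ℝ × 𝓜} (h : x ∈ mod.domain) :
    ContMDiffAt (𝓘(ℝ, ℝ).prod (𝓡 (2 * n - 1))) (𝓡 (2 * n - 1)) ∞
      (fun x : ℝ × 𝓜 => mod.flow x.1 x.2) x :=
  mod.smooth_flow.contMDiffAt (mod.isOpen_domain'.mem_nhds h)

lemma SmoothModel.hasDerivAt_deriv_flow {f : 𝓜 → V} {p : 𝓜}
    (hf : ContMDiffAt (𝓡 (2 * n - 1)) 𝓘(ℝ, V) ∞ f p) :
    HasDerivAt (fun t => f (mod.flow t p)) (deriv (fun t => f (mod.flow t p)) 0) 0 := by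
  have h1 : ContMDiffAt 𝓘(ℝ, ℝ) (𝓡 (2 * n - 1)) ∞ (fun t : ℝ => mod.flow t p) 0 :=
    ContMDiffAt.comp (f := fun t : ℝ => (t, p)) 0
      (SmoothModel.contMDiffAt_flow (mod.zero_mem_domain p))
      (contMDiffAt_id.prodMk contMDiffAt_const)
  have h2 : ContMDiffAt 𝓘(ℝ, ℝ) 𝓘(ℝ, V) ∞ (fun t : ℝ => f (mod.flow t p)) 0 :=
    ContMDiffAt.comp (f := fun t : ℝ => mod.flow t p) 0 (by rwa [mod.flow_zero]) h1
  exact (h2.contDiffAt.differentiableAt (by simp)).hasDerivAt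

lemma SmoothModel.contMDiffAt_deriv_flow [IsManifold (𝓡 (2 * n - 1)) ∞ 𝓜] {f : 𝓜 → V} {p : 𝓜}
    (hf : ContMDiffAt (𝓡 (2 * n - 1)) 𝓘(ℝ, V) ∞ f p) :
    ContMDiffAt (𝓡 (2 * n - 1)) 𝓘(ℝ, V) ∞ (fun q => deriv (fun t => f (mod.flow t q)) 0) p := by
  have h0 : ContMDiffAt ((𝓡 (2 * n - 1)).prod 𝓘(ℝ, ℝ)) (𝓡 (2 * n - 1)) ∞
      (fun x : 𝓜 × ℝ => mod.flow x.2 x.1) (p, 0) :=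
    ContMDiffAt.comp (f := fun x : 𝓜 × ℝ => (x.2, x.1)) (p, 0)
      (SmoothModel.contMDiffAt_flow (mod.zero_mem_domain p))
      (contMDiffAt_snd.prodMk contMDiffAt_fst)
  have h1 : ContMDiffAt ((𝓡 (2 * n - 1)).prod 𝓘(ℝ, ℝ)) 𝓘(ℝ, V) ∞
      (Function.uncurry fun q t => f (mod.flow t q)) (p, 0) :=
    ContMDiffAt.comp (f := fun x : 𝓜 × ℝ => mod.flow x.2 x.1) (p, 0)
      (by simpa only [mod.flow_zero] using hf) h0
  have h2 := ContMDiffAt.mfderiv (m := ∞) (fun q t => f (mod.flow t q)) (fun _ => (0 : ℝ)) h1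
    contMDiffAt_const (by simp)
  have h3 : ContMDiffAt (𝓡 (2 * n - 1)) 𝓘(ℝ, ℝ →L[ℝ] V) ∞
      (fun q => fderiv ℝ (fun t => f (mod.flow t q)) 0) p := by
    have e := inTangentCoordinates_model_space (I := 𝓘(ℝ, ℝ)) (I' := 𝓘(ℝ, V))
      (fun _ : 𝓜 => (0 : ℝ)) (fun q => f (mod.flow 0 q))
      (fun q => fderiv ℝ (fun t => f (mod.flow t q)) 0) p
    rw [← e]
    simp only [mfderiv_eq_fderiv] at h2
    exact h2
  exact h3.clm_apply (contMDiffAt_const (c := (1 : ℝ)))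

end FlowDerivative

variable [T2Space Q] [T2Space 𝓜] (hg : IsGeodesicallyComplete g) (hΩ : IsObstacle n Ω)
  (hFr : ∀ p, ∃ F : Frame mod D κ, p ∈ F.U)

namespace ModelBundle

omit [T2Space Q] [T2Space 𝓜] in
lemma mem_sections {η : ∀ p, B.bundle.Fiber p} : η ∈ B.bundle.sections ↔
    ∀ (F : Frame mod D κ), ∀ q ∈ F.U,
      ContMDiffAt (𝓡 (2 * n - 1)) 𝓘(ℝ, Fin r → ℂ) ∞ (fun q => B.comp F ⟨q, η q⟩) q := by
  constructor
  · intro h F q hq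
    have := B.memAtlas F
    have hb : q ∈ (B.triv F).baseSet := (B.baseSet_triv F).symm ▸ hq
    obtain ⟨U, hU, hqU, G, hG, hGf⟩ := h (B.triv F) q ⟨Set.mem_univ _, hb⟩
    refine (hG.contMDiffAt (hU.mem_nhds hqU)).congr_of_eventuallyEq ?_
    filter_upwards [hU.mem_nhds hqU, (B.triv F).open_baseSet.mem_nhds hb] with q' h1 h2
    exact (hGf q' ⟨Set.mem_univ _, h2⟩ h1).symm
  · intro h e _
    obtain ⟨F, rfl⟩ := B.exists_triv e
    exact SmoothOn.of_contMDiffOn (ι := (id : 𝓜 → 𝓜)) F.isOpen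
      (fun q hq => (h F q hq).contMDiffWithinAt) fun b hb => B.baseSet_triv F ▸ hb.2

omit [T2Space Q] [T2Space 𝓜] in
lemma toModel_eq_iff {z : PhaseSpace g Ω} {v : 𝓔.Fiber z} {x : B.bundle.Fiber (mod.proj z)} :
    B.toModel z v = ⟨mod.proj z, x⟩ ↔ B.Φ z v = x := by simp [toModel]

include hg hΩ hFr

lemma trans_injective {t : ℝ} {x y : B.bundle.Total} (ht : (t, x.proj) ∈ mod.domain)
    (hxy : x.proj = y.proj) (h : B.trans x t = B.trans y t) : x = y := by
  obtain ⟨p, x⟩ := x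
  obtain ⟨q, y⟩ := y
  obtain rfl : p = q := hxy
  obtain ⟨α, hα⟩ := B.exists_transEquiv hg hΩ hFr ht rfl
  rw [hα, hα] at h
  have h1 : α x = α y := by simpa using h
  rw [α.injective h1]

/-- This characterizes the transferred vector by flat transport and thereby removes the choice in
the definition of the transfer operator. -/
lemma trans_transferOperator {t : ℝ} {z w : PhaseSpace g Ω} (h : FlowsTo g Ω (-t) z w)
    (σ : ∀ z, 𝓔.Fiber z) :
    B.trans (B.toModel z (transferOperator D κ t σ z)) (-t) = B.toModel w (σ w) := by
  obtain rfl := flow_eq hg hΩ h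
  have h1 := B.exists_billiardTransport hg hΩ hFr h
  unfold transferOperator
  rw [dif_pos h1, (B.trans_of_billiardTransport hg hΩ hFr h1.choose_spec).2,
    LinearEquiv.apply_symm_apply]

include B in
lemma transferOperator_zero (σ : ∀ z, 𝓔.Fiber z) (z : PhaseSpace g Ω) :
    transferOperator D κ 0 σ z = σ z := by
  have h1 := B.trans_transferOperator hg hΩ hFr (t := 0) (by rw [neg_zero]; exact FlowsTo.refl z) σ
  rw [neg_zero, (B.trans_spec hg hΩ hFr _).2] at h1
  have h2 := B.toModel_injective (x := ⟨z, transferOperator D κ 0 σ z⟩)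
    (y := ⟨z, σ z⟩) rfl h1
  simpa using h2

/-- At nonzero times the two points have the same trajectory. The two vectors are transported to the
same one, and transport is injective. -/
lemma toModel_transferOperator_reflection {t : ℝ} (ht : t ≠ 0) {z : PhaseSpace g Ω}
    (h : (-t, mod.proj z) ∈ mod.domain) (σ : ∀ z, 𝓔.Fiber z) :
    B.toModel (reflection g Ω z) (transferOperator D κ t σ (reflection g Ω z))
      = B.toModel z (transferOperator D κ t σ z) := by
  obtain ⟨w, hw⟩ := mod.exists_flowsTo hg hΩ h
  refine (B.trans_injective hg hΩ hFr (t := -t) h (mod.proj_reflection hg hΩ z).symm ?_).symm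
  rw [B.trans_transferOperator hg hΩ hFr hw,
    B.trans_transferOperator hg hΩ hFr (hw.reflection (neg_ne_zero.2 ht))]

omit hFr [T2Space 𝓜] in
lemma continuousAt_transferOperator {σ : 𝓔.sections} (hσ : σ ∈ billiardSections D κ)
    (F : Frame mod D κ) (z : PhaseSpace g Ω) :
    ContinuousAt (fun t => F.map z (transferOperator D κ t σ.1 z)) 0 := by
  set e := trivializationAt (Fin r → ℂ) 𝓔.Fiber z
  have hze : z ∈ e.baseSet := mem_baseSet_trivializationAt _ _ _
  obtain ⟨M, -, hMe⟩ := F.smooth_matrix e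
  simp only [(hMe z hze).2.1]
  refine (M z).continuous.continuousAt.comp (f := fun t => (e ⟨z, _⟩).2) ?_
  have h1 := (hσ e).continuous (ι := Prod.map id (incl g Ω))
    (continuous_id.prodMap continuous_incl)
  have hdom : ∀ᶠ t in 𝓝 (0 : ℝ), (-t, z) ∈ flowDomain g Ω := by
    have h2 : ContinuousAt (fun t : ℝ => (-t, mod.proj z)) 0 := by fun_prop
    filter_upwards [h2.eventually_mem (mod.isOpen_domain'.mem_nhds
      (by rw [neg_zero]; exact mod.zero_mem_domain _))] with t ht
    exact mod.exists_flowsTo hg hΩ ht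
  have h3 : ContinuousWithinAt (fun t : ℝ => ((t, z) : ℝ × PhaseSpace g Ω))
      {t | (-t, z) ∈ flowDomain g Ω} 0 := by fun_prop
  have h4 := (h1 (0, z) ⟨hdom.self_of_nhds, hze⟩).comp (x := (0 : ℝ))
    (f := fun t : ℝ => ((t, z) : ℝ × PhaseSpace g Ω)) h3 (fun t ht => ⟨ht, hze⟩)
  exact h4.continuousAt hdom

/-- Smooth billiard sections are compatible with the reflection. -/
lemma toModel_reflection {σ : 𝓔.sections} (hσ : σ ∈ billiardSections D κ) (z : PhaseSpace g Ω) :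
    B.toModel (reflection g Ω z) (σ.1 (reflection g Ω z)) = B.toModel z (σ.1 z) := by
  have hp := mod.proj_reflection hg hΩ z
  obtain ⟨F, hF⟩ := hFr (mod.proj z)
  have hF' : mod.proj (reflection g Ω z) ∈ F.U := hp.symm ▸ hF
  refine B.eq_of_comp_eq (F := F) hp hF' ?_
  rw [B.comp_toModel hF', B.comp_toModel hF]
  have h1 := continuousAt_transferOperator hg hΩ hσ F z
  have h2 := continuousAt_transferOperator hg hΩ hσ F (reflection g Ω z)
  rw [ContinuousAt, B.transferOperator_zero hg hΩ hFr] at h1 h2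
  -- At `t = 0` itself the two transferred vectors are the values of `σ` and need not be related a
  -- priori; the limit through `t ≠ 0` relates them.
  refine tendsto_nhds_unique (h2.mono_left nhdsWithin_le_nhds)
    (Filter.Tendsto.congr' ?_ (h1.mono_left (nhdsWithin_le_nhds (s := {0}ᶜ))))
  have h3 : ContinuousAt (fun t : ℝ => (-t, mod.proj z)) 0 := by fun_prop
  filter_upwards [nhdsWithin_le_nhds (h3.eventually_mem (mod.isOpen_domain'.mem_nhds
    (by rw [neg_zero]; exact mod.zero_mem_domain _))), self_mem_nhdsWithin] with t ht h0
  rw [← B.comp_toModel hF', ← B.comp_toModel hF,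
    B.toModel_transferOperator_reflection hg hΩ hFr h0 ht]

omit hFr [T2Space 𝓜] in
lemma exists_modelSection {s : ∀ z, 𝓔.Fiber z}
    (h : ∀ z, B.toModel (reflection g Ω z) (s (reflection g Ω z)) = B.toModel z (s z)) :
    ∃ η : ∀ p, B.bundle.Fiber p, ∀ z, B.Φ z (s z) = η (mod.proj z) := by
  have hex : ∀ p, ∃ y : B.bundle.Fiber p,
      B.toModel (mod.lift p) (s (mod.lift p)) = (⟨p, y⟩ : B.bundle.Total) := fun p => by
    have hp : (B.toModel (mod.lift p) (s (mod.lift p))).proj = p := mod.proj_lift p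
    -- The projection of this vector equals `p` only up to a proof; generalizing allows the fiber
    -- over `p` to be substituted.
    generalize B.toModel (mod.lift p) (s (mod.lift p)) = x at hp
    obtain ⟨q, x⟩ := x
    obtain rfl : q = p := hp
    exact ⟨x, rfl⟩
  choose η hη using hex
  refine ⟨η, fun z => B.toModel_eq_iff.1 ?_⟩
  rw [← hη]
  rcases mod.eq_or_eq_reflection hg hΩ (mod.proj_lift (mod.proj z)).symm with h1 | h1
  · rw [h1]
  · rw [h1, h]

/-- The transferred section at `z` is the parallel transport of the value of the model section. -/
lemma trans_transferOperator_eq {s : ∀ z, 𝓔.Fiber z} {η : ∀ p, B.bundle.Fiber p}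
    (hη : ∀ z, B.Φ z (s z) = η (mod.proj z)) {t : ℝ} {z : PhaseSpace g Ω}
    (h : (-t, mod.proj z) ∈ mod.domain) :
    B.trans (B.toModel z (transferOperator D κ t s z)) (-t)
      = ⟨mod.flow (-t) (mod.proj z), η (mod.flow (-t) (mod.proj z))⟩ := by
  obtain ⟨w, hw⟩ := mod.exists_flowsTo hg hΩ h
  rw [B.trans_transferOperator hg hΩ hFr hw, mod.flow_proj hg hΩ hw]
  exact B.toModel_eq_iff.2 (hη w)

/-- Near `q₀`, a short flow by time `t` leads to interior points. The value of `η` at `q` is the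
flat transport over time `-t` of the transferred section at the flowed point. The orbit stays in one
frame domain, so the components agree. At interior points the transferred section is smooth by the
definition of billiard sections, and there smoothness descends. -/
theorem modelSection_mem_sections {σ : 𝓔.sections} (hσ : σ ∈ billiardSections D κ)
    {η : ∀ p, B.bundle.Fiber p} (hη : ∀ z, B.Φ z (σ.1 z) = η (mod.proj z)) :
    η ∈ B.bundle.sections := by
  refine B.mem_sections.2 fun F q₀ hq₀ => ?_
  obtain ⟨t, ht, -, hint, hev⟩ := mod.exists_short_time hg hΩ F.isOpen hq₀ one_pos
  obtain ⟨h0, h0'⟩ := hev.self_of_nhds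
  have h1 : ContMDiffAt (𝓡 (2 * n - 1)) 𝓘(ℝ, Fin r → ℂ) ∞
      (fun p => F.map (mod.lift p) (transferOperator D κ t σ.1 (mod.lift p)))
      (mod.flow t q₀) := by
    have hO : IsOpen {p | (-t, p) ∈ mod.domain ∧ p ∈ F.U ∧ p ∈ mod.proj '' interiorPart g Ω} :=
      (mod.isOpen_domain'.preimage (by fun_prop : Continuous fun p : 𝓜 => (-t, p))).inter
        (F.isOpen.inter mod.isOpen_interior)
    refine mod.contMDiffAt_of_smoothOn hg hΩ
      (s := {z | (-t, mod.proj z) ∈ mod.domain ∧ mod.proj z ∈ F.U ∧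
        mod.proj z ∈ mod.proj '' interiorPart g Ω}) ?_ hint ?_
    · refine SmoothOn.congr (f := fun z => F.map z (transferOperator D κ t σ.1 z)) ?_ ?_
      · refine SmoothOn.of_local fun z hz => ?_
        set e := trivializationAt (Fin r → ℂ) 𝓔.Fiber z
        have hze : z ∈ e.baseSet := mem_baseSet_trivializationAt _ _ _
        obtain ⟨M, hM, hMe⟩ := F.smooth_matrix e
        obtain ⟨W, hW, hWe⟩ := exists_isOpen_of_isOpen_phaseSpace e.open_baseSet
        refine ⟨W, hW, (hWe z).2 hze, ?_⟩
        have h2 := (hσ e).comp_param (j := incl g Ω) (J := (𝓡 n).tangent)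
          (s' := {z | (-t, mod.proj z) ∈ mod.domain ∧ mod.proj z ∈ F.U ∧
            mod.proj z ∈ mod.proj '' interiorPart g Ω} ∩ incl g Ω ⁻¹' W)
          (c := fun z => (t, z))
          (SmoothOn.of_contMDiffOn (F := fun x : TangentBundle (𝓡 n) Q => (t, x)) isOpen_univ
            (contMDiff_const.prodMk contMDiff_id).contMDiffOn (fun _ _ => Set.mem_univ _))
          (fun w hw => ⟨mod.exists_flowsTo hg hΩ hw.1.1, (hWe w).1 hw.2⟩)
        refine ((hM.mono fun w hw => ⟨hw.1.2.1, (hWe w).1 hw.2⟩).clm_apply h2).congr fun w hw => ?_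
        exact (hMe w ((hWe w).1 hw.2)).2.1 _
      · rintro z ⟨h2, h3, z', hz', h4⟩
        have h5 : mod.lift (mod.proj z) = z := by
          rcases mod.eq_or_eq_reflection hg hΩ h4 with h6 | h6
          · rcases mod.eq_or_eq_reflection hg hΩ (mod.proj_lift (mod.proj z)).symm with h7 | h7
            · exact h7
            · rw [h7, h6, reflection_of_mem_interiorPart hz']
          · rw [reflection_of_mem_interiorPart hz'] at h6
            rcases mod.eq_or_eq_reflection hg hΩ (mod.proj_lift (mod.proj z)).symm with h7 | h7
            · exact h7
            · rw [h7, h6, reflection_of_mem_interiorPart hz']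
        rw [h5]
    · filter_upwards [hO.mem_nhds ⟨h0, (h0' t ⟨ht.le, le_rfl⟩).2, hint⟩] with q hq z hz
      subst hz
      exact hq
  have h2 := ContMDiffAt.comp (f := fun q => mod.flow t q) q₀ h1
    (SmoothModel.contMDiffAt_flow_point (h0' t ⟨ht.le, le_rfl⟩).1)
  refine h2.congr_of_eventuallyEq ?_
  filter_upwards [hev] with q hq
  obtain ⟨h3, h4⟩ := hq
  have h5 : mod.proj (mod.lift (mod.flow t q)) = mod.flow t q := mod.proj_lift _
  have h6 : mod.flow (-t) (mod.flow t q) = q := by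
    rw [mod.flow_add t (-t) q (h4 t ⟨ht.le, le_rfl⟩).1 h3
      (by rw [add_neg_cancel]; exact mod.zero_mem_domain _), add_neg_cancel, mod.flow_zero]
  have h7 := B.trans_transferOperator_eq hg hΩ hFr hη (t := t)
    (z := mod.lift (mod.flow t q)) (by rw [h5]; exact h3)
  rw [h5, h6] at h7
  have h8 := (h4 t ⟨ht.le, le_rfl⟩).2
  have hsub : Set.uIcc 0 (-t) ⊆ mod.times (mod.flow t q) :=
    SmoothModel.uIcc_subset_times hg hΩ h3
  have h9 := B.comp_trans_eq hg hΩ hFr (x := B.toModel (mod.lift (mod.flow t q))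
    (transferOperator D κ t σ.1 (mod.lift (mod.flow t q)))) (J := Set.uIcc 0 (-t)) (F := F)
    isPreconnected_uIcc (by change _ ⊆ mod.times (mod.proj _); rw [h5]; exact hsub)
    (fun s hs => by
      change mod.flow s (mod.proj _) ∈ F.U
      rw [h5]
      have hs' : t + s ∈ Set.Icc 0 t := by
        rw [Set.uIcc_of_ge (by linarith)] at hs
        exact ⟨by linarith [hs.1], by linarith [hs.2]⟩
      rw [mod.flow_add t s q (h4 t ⟨ht.le, le_rfl⟩).1 (hsub hs) (h4 _ hs').1]
      exact (h4 _ hs').2) Set.left_mem_uIcc Set.right_mem_uIcc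
  rw [h7, (B.trans_spec hg hΩ hFr _).2, B.comp_toModel (by rw [h5]; exact h8)] at h9
  exact h9

end ModelBundle

end Sections

/-! ### Smooth sections on the model are the billiard sections -/

section SectionEquiv

variable {n : ℕ} {Q : Type*} [TopologicalSpace Q] [ChartedSpace (EuclideanSpace ℝ (Fin n)) Q]
  [IsManifold (𝓡 n) ∞ Q] {g : Metric (n := n) Q} {Ω : Set Q}
  {𝓜 : Type*} [TopologicalSpace 𝓜]
  [ChartedSpace (EuclideanSpace ℝ (Fin (2 * n - 1))) 𝓜]
  {r : ℕ} {𝓔 : PhaseBundle g Ω r} {mod : SmoothModel g Ω 𝓜}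
  {D : 𝓔.sections →ₗ[ℂ] 𝓔.sections} {κ : Gluing 𝓔} (B : ModelBundle mod D κ)

local notation "End" => (Fin r → ℂ) →L[ℂ] (Fin r → ℂ)

lemma uniqueDiffWithinAt_halfLine {d : ℝ} (hd : d = 1 ∨ d = -1) :
    UniqueDiffWithinAt ℝ {s : ℝ | 0 ≤ d * s} 0 := by
  rcases hd with rfl | rfl
  · rw [show {s : ℝ | 0 ≤ 1 * s} = Set.Ici 0 by ext; simp]
    exact uniqueDiffWithinAt_Ici (0 : ℝ)
  · rw [show {s : ℝ | 0 ≤ -1 * s} = Set.Iic 0 by ext; simp]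
    exact uniqueDiffWithinAt_Iic (0 : ℝ)

lemma contMDiffAt_ringInverse_apply {EN HN N : Type*} [NormedAddCommGroup EN] [NormedSpace ℝ EN]
    [TopologicalSpace HN] [TopologicalSpace N] [ChartedSpace HN N] {I : ModelWithCorners ℝ EN HN}
    {T : N → End} {f : N → Fin r → ℂ} {x : N} (hT : ContMDiffAt I 𝓘(ℝ, End) ∞ T x)
    (hu : IsUnit (T x)) (hf : ContMDiffAt I 𝓘(ℝ, Fin r → ℂ) ∞ f x) :
    ContMDiffAt I 𝓘(ℝ, Fin r → ℂ) ∞ (fun y => Ring.inverse (T y) (f y)) x := by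
  obtain ⟨u, hu⟩ := hu
  have h1 : ContDiffAt ℝ ∞ (Ring.inverse : End → End) (T x) :=
    hu ▸ (contDiffAt_ringInverse ℂ u).restrict_scalars ℝ
  have h2 : ContMDiffAt I 𝓘(ℝ, End) ∞ (fun y => Ring.inverse (T y)) x :=
    ContMDiffAt.comp x h1.contMDiffAt hT
  have h3 : ContDiff ℝ ∞ (fun q : End × (Fin r → ℂ) => q.1 q.2) :=
    (isBoundedBilinearMap_apply (𝕜 := ℂ) (E := Fin r → ℂ)
      (F := Fin r → ℂ)).contDiff.restrict_scalars ℝ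
  exact h3.contMDiff.contMDiffAt.comp x (h2.prodMk_space hf)

lemma ringInverse_apply {T : End} (h : IsUnit T) (y : Fin r → ℂ) : Ring.inverse T (T y) = y :=
  congrArg (fun A : End => A y) (Ring.inverse_mul_cancel T h)

variable [T2Space Q] [T2Space 𝓜] (hg : IsGeodesicallyComplete g) (hΩ : IsObstacle n Ω)
  (hFr : ∀ p, ∃ F : Frame mod D κ, p ∈ F.U)

namespace ModelBundle

omit [T2Space Q] [T2Space 𝓜] in
lemma map_eq {s : ∀ z, 𝓔.Fiber z} {η : ∀ p, B.bundle.Fiber p}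
    (hη : ∀ z, B.Φ z (s z) = η (mod.proj z)) (F : Frame mod D κ) {z : PhaseSpace g Ω}
    (hz : mod.proj z ∈ F.U) : F.map z (s z) = B.comp F ⟨mod.proj z, η (mod.proj z)⟩ := by
  rw [← B.comp_toModel hz, B.toModel_eq_iff.2 (hη z)]

omit [T2Space Q] [T2Space 𝓜] in
include hFr in
lemma mem_sections_of_model {s : ∀ z, 𝓔.Fiber z} {η : ∀ p, B.bundle.Fiber p}
    (hη : ∀ z, B.Φ z (s z) = η (mod.proj z)) (hηs : η ∈ B.bundle.sections) : s ∈ 𝓔.sections := by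
  intro e _
  refine SmoothOn.of_local fun z hz => ?_
  obtain ⟨F, hF⟩ := hFr (mod.proj z)
  obtain ⟨M, hM, hMe⟩ := F.smooth_matrix e
  obtain ⟨W, hW, hWe⟩ := exists_isOpen_of_isOpen_phaseSpace
    ((F.isOpen.preimage mod.continuous_proj).inter e.open_baseSet)
  refine ⟨W, hW, (hWe z).2 ⟨hF, hz.2⟩, ?_⟩
  have h1 := ((hM.clm_inverse fun w hw => (hMe w hw.2).1).mono
    (s' := {a ∈ Set.univ | a ∈ e.baseSet} ∩ incl g Ω ⁻¹' W) fun w hw => (hWe w).1 hw.2).clm_apply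
      (((mod.smooth_proj.mono' (Set.subset_univ _)).comp_contMDiffOn F.isOpen
        (G := fun q => B.comp F ⟨q, η q⟩)
        (fun q hq => (B.mem_sections.1 hηs F q hq).contMDiffWithinAt)
        fun w hw => ((hWe w).1 hw.2).1))
  refine h1.congr fun w hw => ?_
  have h2 := (hWe w).1 hw.2
  rw [← B.map_eq hη F h2.1, (hMe w h2.2).2.1, ringInverse_apply (hMe w h2.2).1]

include hg hΩ hFr

lemma map_transferOperator {s : ∀ z, 𝓔.Fiber z} {η : ∀ p, B.bundle.Fiber p}
    (hη : ∀ z, B.Φ z (s z) = η (mod.proj z)) (F : Frame mod D κ) {t : ℝ} {z : PhaseSpace g Ω}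
    (h : (-t, mod.proj z) ∈ mod.domain) (hF : mod.proj z ∈ F.U) :
    F.map z (transferOperator D κ t s z) = F.map (mod.lift (mod.proj z))
      (transferOperator D κ t s (mod.lift (mod.proj z))) := by
  have hp := mod.proj_lift (mod.proj z)
  rw [← B.comp_toModel hF, ← B.comp_toModel (by rwa [hp])]
  have h1 := B.trans_transferOperator_eq hg hΩ hFr hη h
  have h2 := B.trans_transferOperator_eq hg hΩ hFr hη (t := t) (z := mod.lift (mod.proj z))
    (by rwa [hp])
  rw [hp] at h2
  rw [B.trans_injective hg hΩ hFr h hp.symm (h1.trans h2.symm)]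

/-- Smoothness of the transferred section in terms of the model. -/
lemma contMDiffAt_transferOperator {s : ∀ z, 𝓔.Fiber z} {η : ∀ p, B.bundle.Fiber p}
    (hη : ∀ z, B.Φ z (s z) = η (mod.proj z)) (hηs : η ∈ B.bundle.sections) (F : Frame mod D κ)
    {t₀ : ℝ} {q₀ : 𝓜} (h : (-t₀, q₀) ∈ mod.domain) (hF : q₀ ∈ F.U) :
    ContMDiffAt (𝓘(ℝ, ℝ).prod (𝓡 (2 * n - 1))) 𝓘(ℝ, Fin r → ℂ) ∞
      (fun y : ℝ × 𝓜 => F.map (mod.lift y.2) (transferOperator D κ y.1 s (mod.lift y.2)))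
      (t₀, q₀) := by
  obtain ⟨G, T, hT, hev⟩ := B.exists_trans_matrix hg hΩ hFr h hF
  have hneg : ContMDiff (𝓘(ℝ, ℝ).prod (𝓡 (2 * n - 1))) (𝓘(ℝ, ℝ).prod (𝓡 (2 * n - 1))) ∞
      (fun y : ℝ × 𝓜 => (-y.1, y.2)) :=
    (contDiff_neg.contMDiff.comp contMDiff_fst).prodMk contMDiff_snd
  have hev' : ∀ᶠ y in 𝓝 (t₀, q₀), (-y.1, y.2) ∈ mod.domain ∧ mod.flow (-y.1) y.2 ∈ G.U ∧
      IsUnit (T y.2) ∧ ∀ x : B.bundle.Total, x.proj = y.2 →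
        B.comp G (B.trans x (-y.1)) = T y.2 (B.comp F x) :=
    (hneg.continuous.continuousAt (x := (t₀, q₀))).eventually hev
  obtain ⟨h0, hG, hu, -⟩ := hev'.self_of_nhds
  have h1 : ContMDiffAt (𝓘(ℝ, ℝ).prod (𝓡 (2 * n - 1))) (𝓡 (2 * n - 1)) ∞
      (fun y : ℝ × 𝓜 => mod.flow (-y.1) y.2) (t₀, q₀) :=
    ContMDiffAt.comp (f := fun y : ℝ × 𝓜 => (-y.1, y.2)) (t₀, q₀)
      (SmoothModel.contMDiffAt_flow h) hneg.contMDiffAt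
  have h2 : ContMDiffAt (𝓘(ℝ, ℝ).prod (𝓡 (2 * n - 1))) 𝓘(ℝ, Fin r → ℂ) ∞
      (fun y : ℝ × 𝓜 => B.comp G ⟨mod.flow (-y.1) y.2, η (mod.flow (-y.1) y.2)⟩) (t₀, q₀) :=
    ContMDiffAt.comp (f := fun y : ℝ × 𝓜 => mod.flow (-y.1) y.2) (t₀, q₀)
      (B.mem_sections.1 hηs G _ hG) h1
  have h3 : ContMDiffAt (𝓘(ℝ, ℝ).prod (𝓡 (2 * n - 1))) 𝓘(ℝ, End) ∞
      (fun y : ℝ × 𝓜 => T y.2) (t₀, q₀) :=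
    ContMDiffAt.comp (f := fun y : ℝ × 𝓜 => y.2) (t₀, q₀) hT contMDiffAt_snd
  -- The components of the transferred section are those of `η` at the point flowed to over time
  -- `-t`, multiplied by the inverse of the transport matrix.
  refine (contMDiffAt_ringInverse_apply h3 hu h2).congr_of_eventuallyEq ?_
  have hFev : ∀ᶠ y in 𝓝 (t₀, q₀), y.2 ∈ F.U :=
    continuousAt_snd.eventually_mem (F.isOpen.mem_nhds hF)
  filter_upwards [hev', hFev] with y hy hyF
  have hp := mod.proj_lift y.2
  have h4 := B.trans_transferOperator_eq hg hΩ hFr hη (t := y.1) (z := mod.lift y.2)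
    (by rw [hp]; exact hy.1)
  have h5 := hy.2.2.2 (B.toModel (mod.lift y.2) (transferOperator D κ y.1 s (mod.lift y.2))) hp
  rw [h4, hp, B.comp_toModel (by rwa [hp])] at h5
  rw [h5, ringInverse_apply hy.2.2.1]

/-- In a frame the transferred section is a function of the time and the image in the model, smooth
by `contMDiffAt_transferOperator`. The smooth matrix of the frame converts it back to
trivializations of `𝓔`. -/
theorem mem_billiardSections_of_model {σ : 𝓔.sections} {η : ∀ p, B.bundle.Fiber p}
    (hη : ∀ z, B.Φ z (σ.1 z) = η (mod.proj z)) (hηs : η ∈ B.bundle.sections) :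
    σ ∈ billiardSections D κ := by
  intro e _
  refine SmoothOn.of_local fun x hx => ?_
  obtain ⟨F, hF⟩ := hFr (mod.proj x.2)
  obtain ⟨M, hM, hMe⟩ := F.smooth_matrix e
  obtain ⟨W, hW, hWe⟩ := exists_isOpen_of_isOpen_phaseSpace
    ((F.isOpen.preimage mod.continuous_proj).inter e.open_baseSet)
  refine ⟨Prod.snd ⁻¹' W, hW.preimage continuous_snd, (hWe x.2).2 ⟨hF, hx.2⟩, ?_⟩
  set S := {a : ℝ × PhaseSpace g Ω | a ∈ {x : ℝ × PhaseSpace g Ω | (-x.1, x.2) ∈ flowDomain g Ω} ∧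
    a.2 ∈ e.baseSet} ∩ Prod.map (id : ℝ → ℝ) (incl g Ω) ⁻¹' (Prod.snd ⁻¹' W) with hS
  have hSe : ∀ a ∈ S, mod.proj a.2 ∈ F.U ∧ a.2 ∈ e.baseSet := fun a ha => (hWe a.2).1 ha.2
  have hSd : ∀ a ∈ S, (-a.1, mod.proj a.2) ∈ mod.domain := fun a ha => by
    obtain ⟨w, hw⟩ := ha.1.1
    exact mod.mem_domain hw
  have hsnd : SmoothOn (𝓘(ℝ, ℝ).prod (𝓡 n).tangent) (𝓡 n).tangent (Prod.map (id : ℝ → ℝ) (incl g Ω))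
      (fun a => incl g Ω a.2) S :=
    SmoothOn.of_contMDiffOn (F := Prod.snd) isOpen_univ contMDiff_snd.contMDiffOn
      (fun _ _ => Set.mem_univ _)
  have hfst : SmoothOn (𝓘(ℝ, ℝ).prod (𝓡 n).tangent) 𝓘(ℝ, ℝ) (Prod.map (id : ℝ → ℝ) (incl g Ω))
      (fun a => a.1) S :=
    SmoothOn.of_contMDiffOn (F := Prod.fst) isOpen_univ contMDiff_fst.contMDiffOn
      (fun _ _ => Set.mem_univ _)
  have hO : IsOpen {y : ℝ × 𝓜 | (-y.1, y.2) ∈ mod.domain ∧ y.2 ∈ F.U} :=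
    (mod.isOpen_domain'.preimage (by fun_prop : Continuous fun y : ℝ × 𝓜 => (-y.1, y.2))).inter
      (F.isOpen.preimage continuous_snd)
  have h1 := (hfst.prodMk (mod.smooth_proj.comp_param hsnd fun _ _ => Set.mem_univ _)).comp_contMDiffOn
    hO (fun y hy => (B.contMDiffAt_transferOperator hg hΩ hFr hη hηs F hy.1 hy.2).contMDiffWithinAt)
    (fun a ha => ⟨hSd a ha, (hSe a ha).1⟩)
  have h2 := ((hM.clm_inverse fun w hw => (hMe w hw.2).1).comp_param hsnd hSe).clm_apply h1
  refine h2.congr fun a ha => ?_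
  obtain ⟨h3, h4⟩ := hSe a ha
  rw [← B.map_transferOperator hg hΩ hFr hη F (hSd a ha) h3, (hMe a.2 h4).2.1,
    ringInverse_apply (hMe a.2 h4).1]

omit hFr [T2Space 𝓜] in
/-- In a frame the operator becomes the derivative along the model flow. -/
lemma map_operator {σ : 𝓔.sections} {η : ∀ p, B.bundle.Fiber p}
    (hη : ∀ z, B.Φ z (σ.1 z) = η (mod.proj z)) (hηs : η ∈ B.bundle.sections) (F : Frame mod D κ)
    {z : PhaseSpace g Ω} (hF : mod.proj z ∈ F.U) : F.map z ((D σ).1 z) =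
      deriv (fun t => B.comp F ⟨mod.flow t (mod.proj z), η (mod.flow t (mod.proj z))⟩) 0 := by
  -- In the direction without reflection, model flow and geodesic correspond, and a one-sided
  -- derivative already determines the value.
  obtain ⟨d, hd, hl⟩ := exists_direction_launch hΩ z
  obtain ⟨ε, hε, w, hw0, hw⟩ := exists_arc_family hg hΩ hd hl
  have h1 := (F.parallel z hF σ).hasDerivWithinAt_family hε hw0 fun s hs hs' => (hw s hs hs').1
  have h2 := (SmoothModel.hasDerivAt_deriv_flow (mod := mod) (B.mem_sections.1 hηs F _ hF)).hasDerivWithinAt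
    (s := {s : ℝ | 0 ≤ d * s})
  refine (uniqueDiffWithinAt_halfLine hd).eq_deriv _ h1 (h2.congr_of_eventuallyEq ?_ ?_)
  · have h3 : ∀ᶠ t in 𝓝 (0 : ℝ), mod.flow t (mod.proj z) ∈ F.U :=
      (SmoothModel.continuousAt_flow_time (mod.zero_mem_domain _)).eventually_mem
        (F.isOpen.mem_nhds (by rwa [mod.flow_zero]))
    filter_upwards [halfInterval_mem_nhdsWithin hε, nhdsWithin_le_nhds h3] with s hs hsF
    have h4 := mod.flow_proj hg hΩ (hw s hs.1 hs.2).2.1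
    rw [h4] at hsF ⊢
    exact B.map_eq hη F hsF
  · rw [hw0, mod.flow_zero]
    exact B.map_eq hη F hF

variable [IsManifold (𝓡 (2 * n - 1)) ∞ 𝓜]

/-- By `map_operator`, in a frame `D σ` is a derivative along the model flow: it depends on the
image in the model only, and smoothly. -/
lemma exists_model_of_operator {σ : 𝓔.sections} {η : ∀ p, B.bundle.Fiber p}
    (hη : ∀ z, B.Φ z (σ.1 z) = η (mod.proj z)) (hηs : η ∈ B.bundle.sections) :
    ∃ η' ∈ B.bundle.sections, ∀ z, B.Φ z ((D σ).1 z) = η' (mod.proj z) := by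
  obtain ⟨η', hη'⟩ := B.exists_modelSection hg hΩ (s := (D σ).1) fun z => by
    have hp := mod.proj_reflection hg hΩ z
    obtain ⟨F, hF⟩ := hFr (mod.proj z)
    have hF' : mod.proj (reflection g Ω z) ∈ F.U := hp.symm ▸ hF
    refine B.eq_of_comp_eq (F := F) hp hF' ?_
    rw [B.comp_toModel hF', B.comp_toModel hF, B.map_operator hg hΩ hη hηs F hF',
      B.map_operator hg hΩ hη hηs F hF, hp]
  refine ⟨η', B.mem_sections.2 fun F q hq => ?_, hη'⟩
  refine (SmoothModel.contMDiffAt_deriv_flow (mod := mod) (B.mem_sections.1 hηs F q hq)).congr_of_eventuallyEq ?_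
  filter_upwards [F.isOpen.mem_nhds hq] with p hp
  obtain ⟨z, rfl⟩ := mod.surjective_proj p
  rw [← B.map_eq hη' F hp, B.map_operator hg hΩ hη hηs F hp]

omit hg hΩ hFr [T2Space Q] [T2Space 𝓜] [IsManifold (𝓡 (2 * n - 1)) ∞ 𝓜] in
lemma sections_ext {η η' : B.bundle.sections}
    (h : ∀ z, η.1 (mod.proj z) = η'.1 (mod.proj z)) : η = η' :=
  Subtype.ext (funext fun p => by
    obtain ⟨z, rfl⟩ := mod.surjective_proj p
    exact h z)

omit [IsManifold (𝓡 (2 * n - 1)) ∞ 𝓜] in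
/-- Smooth billiard sections are the smooth sections of the model bundle. -/
theorem exists_sectionEquiv : ∃ S : billiardSections D κ ≃ₗ[ℂ] B.bundle.sections,
    ∀ (σ : billiardSections D κ) (z : PhaseSpace g Ω), (S σ).1 (mod.proj z) = B.Φ z (σ.1.1 z) := by
  have hex : ∀ σ : billiardSections D κ, ∃ η : B.bundle.sections,
      ∀ z, η.1 (mod.proj z) = B.Φ z (σ.1.1 z) := fun σ => by
    obtain ⟨η, hη⟩ := B.exists_modelSection hg hΩ (s := σ.1.1)
      (B.toModel_reflection hg hΩ hFr σ.2)
    exact ⟨⟨η, B.modelSection_mem_sections hg hΩ hFr σ.2 hη⟩, fun z => (hη z).symm⟩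
  choose S hS using hex
  let L : billiardSections D κ →ₗ[ℂ] B.bundle.sections :=
    { toFun := S
      map_add' := fun σ τ => B.sections_ext fun z => by
        refine (hS _ z).trans ?_
        change B.Φ z (σ.1.1 z + τ.1.1 z) = (S σ).1 (mod.proj z) + (S τ).1 (mod.proj z)
        rw [map_add, hS, hS]
      map_smul' := fun c σ => B.sections_ext fun z => by
        refine (hS _ z).trans ?_
        change B.Φ z (c • σ.1.1 z) = c • (S σ).1 (mod.proj z)
        rw [map_smul, hS] }
  refine ⟨LinearEquiv.ofBijective L ⟨fun σ τ h => ?_, fun η => ?_⟩, hS⟩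
  · refine Subtype.ext (Subtype.ext (funext fun z => (B.Φ z).injective ?_))
    rw [← hS, ← hS]
    exact congrArg (fun η : B.bundle.sections => η.1 (mod.proj z)) h
  -- The preimage of a section on the model is obtained by applying the inverse fiber isomorphisms
  -- pointwise.
  · have h1 : ∀ z, B.Φ z ((B.Φ z).symm (η.1 (mod.proj z))) = η.1 (mod.proj z) := fun z =>
      LinearEquiv.apply_symm_apply _ _
    let σ : 𝓔.sections := ⟨_, B.mem_sections_of_model hFr h1 η.2⟩
    refine ⟨⟨σ, B.mem_billiardSections_of_model hg hΩ hFr h1 η.2⟩, B.sections_ext fun z => ?_⟩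
    exact (hS _ z).trans (h1 z)

end ModelBundle

end SectionEquiv

/-! ### The induced operator and the assembly of the theorem -/

section ModelOperator

variable {n : ℕ} {Q : Type*} [TopologicalSpace Q] [ChartedSpace (EuclideanSpace ℝ (Fin n)) Q]
  [IsManifold (𝓡 n) ∞ Q] {g : Metric (n := n) Q} {Ω : Set Q}
  {𝓜 : Type*} [TopologicalSpace 𝓜]
  [ChartedSpace (EuclideanSpace ℝ (Fin (2 * n - 1))) 𝓜]
  {r : ℕ} {𝓔 : PhaseBundle g Ω r} {mod : SmoothModel g Ω 𝓜}
  {D : 𝓔.sections →ₗ[ℂ] 𝓔.sections} {κ : Gluing 𝓔} {B : ModelBundle mod D κ}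

/-- The trivializations on the model side are frames, so in coordinates the bundle map is the smooth
matrix of a frame. -/
lemma ModelBundle.isSmoothBundleMap (B : ModelBundle mod D κ) :
    𝓔.IsSmoothBundleMap B.bundle (𝓡 n).tangent (incl g Ω) (fun z => z) mod.proj B.Φ := by
  intro e _ e' _
  obtain ⟨F, rfl⟩ := B.exists_triv e'
  obtain ⟨M, hM, hMe⟩ := F.smooth_matrix e
  set S := {a : PhaseSpace g Ω × (Fin r → ℂ) | a ∈ {x : PhaseSpace g Ω × (Fin r → ℂ) |
    x.1 ∈ e.baseSet} ∧ mod.proj a.1 ∈ (B.triv F).baseSet} with hS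
  have hSF : ∀ a ∈ S, mod.proj a.1 ∈ F.U ∧ a.1 ∈ e.baseSet := fun a ha =>
    ⟨B.baseSet_triv F ▸ ha.2, ha.1⟩
  have hfst : SmoothOn ((𝓡 n).tangent.prod 𝓘(ℝ, Fin r → ℂ)) (𝓡 n).tangent
      (Prod.map (incl g Ω) (id : (Fin r → ℂ) → (Fin r → ℂ))) (fun a => incl g Ω a.1) S :=
    SmoothOn.of_contMDiffOn (F := Prod.fst) isOpen_univ contMDiff_fst.contMDiffOn
      (fun _ _ => Set.mem_univ _)
  have hsnd : SmoothOn ((𝓡 n).tangent.prod 𝓘(ℝ, Fin r → ℂ)) 𝓘(ℝ, Fin r → ℂ)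
      (Prod.map (incl g Ω) (id : (Fin r → ℂ) → (Fin r → ℂ))) (fun a => a.2) S :=
    SmoothOn.of_contMDiffOn (F := Prod.snd) isOpen_univ contMDiff_snd.contMDiffOn
      (fun _ _ => Set.mem_univ _)
  refine ((hM.comp_param hfst hSF).clm_apply hsnd).congr fun a ha => ?_
  obtain ⟨h1, h2⟩ := hSF a ha
  rw [B.triv_Φ F a.1 h1, (hMe a.1 h2).2.1]
  congr 1
  exact congrArg Prod.snd (e.apply_mk_symm h2 a.2)

lemma ModelBundle.surjective_toModel (B : ModelBundle mod D κ) : Function.Surjective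
    (fun x : 𝓔.Total => (⟨mod.proj x.proj, B.Φ x.proj x.snd⟩ : B.bundle.Total)) := fun x => by
  obtain ⟨v, hv⟩ := B.exists_toModel x (mod.proj_lift x.proj)
  exact ⟨⟨_, v⟩, hv⟩

lemma SmoothFun.contMDiffAt (f : SmoothFun (𝓡 (2 * n - 1)) (id : 𝓜 → 𝓜)) (p : 𝓜) :
    ContMDiffAt (𝓡 (2 * n - 1)) 𝓘(ℝ, ℂ) ∞ f.1 p := by
  obtain ⟨U, hU, hpU, G, hG, hGf⟩ := f.2 p (Set.mem_univ _)
  refine (hG.contMDiffAt (hU.mem_nhds hpU)).congr_of_eventuallyEq ?_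
  filter_upwards [hU.mem_nhds hpU] with q hq
  exact (hGf q (Set.mem_univ _) hq).symm

/-- Operators satisfying a Leibniz rule are differential operators of order at most one. -/
lemma SmoothBundle.isFirstOrder_of_leibniz {EN HN N : Type*} [NormedAddCommGroup EN]
    [NormedSpace ℝ EN] [TopologicalSpace HN] [TopologicalSpace N] [ChartedSpace HN N]
    {I : ModelWithCorners ℝ EN HN} {B' : Type*} [TopologicalSpace B'] {ι : B' → N}
    {𝓕 : SmoothBundle I ι r} {X : 𝓕.sections →ₗ[ℂ] 𝓕.sections} (Y : SmoothFun I ι → B' → ℂ)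
    (h : ∀ f σ p, (X (𝓕.fmul f σ)).1 p = Y f p • σ.1 p + f.1 p • (X σ).1 p) :
    𝓕.IsFirstOrder X := by
  intro f f' σ
  refine Subtype.ext (funext fun p => ?_)
  have e1 := h f (𝓕.fmul f' σ) p
  have e2 := h f σ p
  change (X (𝓕.fmul f (𝓕.fmul f' σ))).1 p - f.1 p • (X (𝓕.fmul f' σ)).1 p
    - f'.1 p • (X (𝓕.fmul f σ)).1 p + f'.1 p • f.1 p • (X σ).1 p = 0
  rw [e1, e2]
  change Y f p • f'.1 p • σ.1 p + _ - _ - _ + _ = 0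
  module

/-- In a frame this is the product rule for the derivative along the flow at time 0. -/
lemma ModelBundle.IsFlowDerivative.leibniz {X : B.bundle.sections →ₗ[ℂ] B.bundle.sections}
    (hX : B.IsFlowDerivative X) (hFr : ∀ p, ∃ F : Frame mod D κ, p ∈ F.U)
    (f : SmoothFun (𝓡 (2 * n - 1)) (id : 𝓜 → 𝓜)) (η : B.bundle.sections) (p : 𝓜) :
    (X (B.bundle.fmul f η)).1 p
      = deriv (fun t : ℝ => f.1 (mod.flow t p)) 0 • η.1 p + f.1 p • (X η).1 p := by
  obtain ⟨F, hF⟩ := hFr p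
  refine (B.fiberEquiv F hF).injective ?_
  rw [map_add, map_smul, map_smul]
  simp only [B.fiberEquiv_apply]
  have h1 := hX F (B.bundle.fmul f η) p hF
  have h2 := (SmoothModel.hasDerivAt_deriv_flow (mod := mod) (f.contMDiffAt p)).smul (hX F η p hF)
  have hev : ∀ᶠ t in 𝓝 (0 : ℝ), mod.flow t p ∈ F.U :=
    (SmoothModel.continuousAt_flow_time (mod.zero_mem_domain p)).eventually_mem
      (F.isOpen.mem_nhds (by rwa [mod.flow_zero]))
  have h3 := h1.unique (h2.congr_of_eventuallyEq (by
    filter_upwards [hev] with t ht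
    change B.fiberEquiv F ht (f.1 (mod.flow t p) • η.1 (mod.flow t p)) = _
    rw [map_smul]
    rfl))
  rw [h3, mod.flow_zero, add_comm]

variable [T2Space Q] (hg : IsGeodesicallyComplete g) (hΩ : IsObstacle n Ω)

include hg hΩ in
-- Components of a section on the model are those of the corresponding billiard section, on which
-- `map_operator` computes `D`.
lemma ModelBundle.isFlowDerivative_inducedOperator
    {S : billiardSections D κ ≃ₗ[ℂ] B.bundle.sections}
    (hS : ∀ (σ : billiardSections D κ) (z : PhaseSpace g Ω),
      (S σ).1 (mod.proj z) = B.Φ z (σ.1.1 z))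
    (hD : ∀ σ ∈ billiardSections D κ, D σ ∈ billiardSections D κ) :
    B.IsFlowDerivative (inducedOperator S hD) := by
  intro F η p hp
  obtain ⟨σ, rfl⟩ := S.surjective η
  obtain ⟨z, rfl⟩ := mod.surjective_proj p
  have h1 : (inducedOperator S hD (S σ)).1 (mod.proj z) = B.Φ z ((D σ.1).1 z) := by
    have h2 : inducedOperator S hD (S σ) = S (D.restrict hD σ) :=
      congrArg (fun τ => S (D.restrict hD τ)) (S.symm_apply_apply σ)
    rw [h2, hS]
    rfl
  have h2 : B.comp F ⟨mod.proj z, (inducedOperator S hD (S σ)).1 (mod.proj z)⟩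
      = F.map z ((D σ.1).1 z) := by
    rw [h1]
    exact B.comp_toModel hp _
  rw [h2, B.map_operator hg hΩ (fun z => (hS σ z).symm) (S σ).2 F hp]
  exact SmoothModel.hasDerivAt_deriv_flow (B.mem_sections.1 (S σ).2 F _ hp)

end ModelOperator

end Billiard

end

/-! ### The main theorem -/

open scoped Manifold ContDiff in
open Billiard in
theorem mainTheorem12 {n : ℕ} (hn : 1 ≤ n)
    {Q : Type*} [TopologicalSpace Q] [T2Space Q] [SecondCountableTopology Q] [ConnectedSpace Q]
    [ChartedSpace (EuclideanSpace ℝ (Fin n)) Q] [IsManifold (𝓡 n) ∞ Q]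
    (g : Metric (n := n) Q) (hg : IsGeodesicallyComplete g)
    (Ω : Set Q) (hΩ : IsObstacle n Ω)
    {𝓜 : Type*} [TopologicalSpace 𝓜] [T2Space 𝓜] [SecondCountableTopology 𝓜]
    [ChartedSpace (EuclideanSpace ℝ (Fin (2 * n - 1))) 𝓜] [IsManifold (𝓡 (2 * n - 1)) ∞ 𝓜]
    (mod : SmoothModel g Ω 𝓜)
    {r : ℕ} (𝓔 : PhaseBundle g Ω r) (D : 𝓔.sections →ₗ[ℂ] 𝓔.sections)
    (hD₁ : 𝓔.IsFirstOrder D) (hD₂ : SatisfiesBilliardLeibniz 𝓔 D) (κ : Gluing 𝓔) :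
    ∃ (𝓕 : SmoothBundle.{0} (𝓡 (2 * n - 1)) (id : 𝓜 → 𝓜) r)
      (Φ : ∀ z : PhaseSpace g Ω, 𝓔.Fiber z ≃ₗ[ℂ] 𝓕.Fiber (mod.proj z)),
      𝓔.IsSmoothBundleMap 𝓕 (𝓡 n).tangent (incl g Ω) (fun z => z) mod.proj Φ ∧
      Function.Surjective
        (fun x : 𝓔.Total => (⟨mod.proj x.proj, Φ x.proj x.snd⟩ : 𝓕.Total)) ∧
      ∃ S : billiardSections D κ ≃ₗ[ℂ] 𝓕.sections,
        (∀ (σ : billiardSections D κ) (z : PhaseSpace g Ω),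
          (S σ).1 (mod.proj z) = Φ z (σ.1.1 z)) ∧
        (∀ S' : billiardSections D κ → 𝓕.sections,
          (∀ (σ : billiardSections D κ) (z : PhaseSpace g Ω),
            (S' σ).1 (mod.proj z) = Φ z (σ.1.1 z)) → ∀ σ, S' σ = S σ) ∧
        ∃ hD : ∀ σ ∈ billiardSections D κ, D σ ∈ billiardSections D κ,
          𝓕.IsFirstOrder (inducedOperator S hD) ∧
          (∀ (f : SmoothFun (𝓡 (2 * n - 1)) (id : 𝓜 → 𝓜)) (σ : 𝓕.sections) (p : 𝓜),
            (inducedOperator S hD (𝓕.fmul f σ)).1 p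
              = deriv (fun t : ℝ => f.1 (mod.flow t p)) 0 • σ.1 p + f.1 p • (inducedOperator S hD σ).1 p) ∧
          (∀ (t : ℝ) (p : 𝓜), (t, p) ∈ mod.domain →
            ∃! T : 𝓕.Fiber p ≃ₗ[ℂ] 𝓕.Fiber (mod.flow t p),
              𝓕.IsParallelTransport (inducedOperator S hD) (fun s => mod.flow s p) t p (mod.flow t p) T) ∧
          (∀ (t : ℝ) (z w : PhaseSpace g Ω), FlowsTo g Ω t z w →
            ∃! A : 𝓔.Fiber z ≃ₗ[ℂ] 𝓔.Fiber w, BilliardTransport D κ t z w A) ∧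
          (∀ (t : ℝ) (p : 𝓜), (t, p) ∈ mod.domain → mod.flow t p = p →
            ∃ z : PhaseSpace g Ω, mod.proj z = p ∧ FlowsTo g Ω t z z) ∧
          (∀ (t : ℝ) (z : PhaseSpace g Ω), FlowsTo g Ω t z z →
            ∀ (T : 𝓕.Fiber (mod.proj z) ≃ₗ[ℂ] 𝓕.Fiber (mod.proj z))
              (A : 𝓔.Fiber z ≃ₗ[ℂ] 𝓔.Fiber z),
              𝓕.IsParallelTransport (inducedOperator S hD) (fun s => mod.flow s (mod.proj z)) t
                (mod.proj z) (mod.proj z) T →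
              BilliardTransport D κ t z z A →
              LinearMap.trace ℂ (𝓕.Fiber (mod.proj z)) T.toLinearMap
                = LinearMap.trace ℂ (𝓔.Fiber z) A.toLinearMap) := by
  have hFr : ∀ p, ∃ F : Frame mod D κ, p ∈ F.U := exists_frame mod hg hΩ hD₂ κ
  obtain ⟨B⟩ := nonempty_modelBundle hg hΩ hFr
  refine (B.exists_sectionEquiv hg hΩ hFr).elim fun S hS => ?_
  have hD : ∀ σ ∈ billiardSections D κ, D σ ∈ billiardSections D κ := fun σ hσ => by
    obtain ⟨η, hη, hη'⟩ := B.exists_model_of_operator hg hΩ hFr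
      (fun z => (hS ⟨σ, hσ⟩ z).symm) (S ⟨σ, hσ⟩).2
    exact B.mem_billiardSections_of_model hg hΩ hFr hη' hη
  have hX : B.IsFlowDerivative (inducedOperator S hD) :=
    ModelBundle.isFlowDerivative_inducedOperator hg hΩ hS hD
  have hL := hX.leibniz hFr
  have hO : B.bundle.IsFirstOrder (inducedOperator S hD) :=
    SmoothBundle.isFirstOrder_of_leibniz
      (fun f p => deriv (fun t : ℝ => f.1 (mod.flow t p)) 0) hL
  refine ⟨B.bundle, B.Φ, ?_⟩
  refine ⟨B.isSmoothBundleMap, ?_⟩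
  refine ⟨B.surjective_toModel, ?_⟩
  refine ⟨S, hS, ?_⟩
  -- The projection is surjective, so the values at projected points determine the section.
  refine ⟨fun S' hS' σ => B.sections_ext fun z => (hS' σ z).trans (hS σ z).symm, ?_⟩
  refine ⟨hD, ?_⟩
  refine ⟨hO, ?_⟩
  refine ⟨hL, ?_⟩
  refine ⟨fun t p h => hX.existsUnique_isParallelTransport hg hΩ hFr h, ?_⟩
  refine ⟨fun t z w h => B.existsUnique_billiardTransport hg hΩ hFr h, ?_⟩
  refine ⟨fun t p h hp => mod.exists_periodic hg hΩ h hp, ?_⟩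
  exact fun t z _ T A hT hA => hX.trace_eq hg hΩ hFr hT hA
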